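/- Let $T$ be one of the Dynkin types $A_r$ ($r\ge 1$), $D_r$ ($r\ge 4$), $E_6,E_7,E_8$, with Coxeter number $h$ and exponents $m_1,\dots,m_r$ (with multiplicity), and let $(a,b)$ be $(2,h)$, $(4,2(r-2))$, $(6,8)$, $(8,12)$, $(12,20)$ respectively, so that $h=a+b-2$. Let $p$ be a prime with $p>h$, let $\mathbb F$ be a field of characteristic $p$, and let $A$ be the graded Poisson algebra of functions on a Kleinian singularity of type $T$ over $\mathbb F$, i.e. one of the following. (1) $A=\mathbb F[x,y,z]/(Q)$, where $\deg x=a$, $\deg y=b$, $\deg z=h$, the polynomial $Q$ is quasihomogeneous of degree $2h$, the surface $Q=0$ has an isolated singularity at $0$ (over $\overline{\mathbb F}$), and $\{x,y\}=Q_z$, $\{y,z\}=Q_x$, $\{z,x\}=Q_y$. (2) $A=\mathbb F[u,v]^{\Gamma}$, where $\Gamma\subset SL_2(\mathbb F)$ is a finite subgroup of type $T$ under the McKay correspondence (cyclic of order $r+1$ for $A_r$; binary dihedral of order $4(r-2)$ for $D_r$; binary tetrahedral, octahedral, icosahedral for $E_6,E_7,E_8$), $\deg u=\deg v=1$, and the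 bracket is induced by $\{u,v\}=1$. Let $HP_0(A)=A/\{A,A\}$, where $\{A,A\}$ is the linear span of all brackets, and let $H(t)=\sum_{m\ge 0}\dim HP_0(A)[m]\,t^m$ be its Hilbert series (all graded components being finite dimensional). Then, with $c=h$ and $d=2h$, $$H(t)=\frac{(1-t^{d-a})(1-t^{d-b})(1-t^{d-c})}{(1-t^a)(1-t^b)(1-t^c)}+t^{d-a-b-c}f(t^p),\qquad f(z)=g(z)-g_-(z)+g_-(z^{-1})-g_0,$$ where $g(z)=z^{a+b+c-d}\dfrac{1-z^d}{(1-z^a)(1-z^b)(1-z^c)}$, and $g_-$ and $g_0$ are the sum of the terms of negative degree and the constant term of the Laurent expansion of $g$ at $0$. Explicitly, $$H(t)=\sum_{i=1}^r t^{2(m_i-1)}+t^{2p-2}\,\frac{1+t^{ph}}{(1-t^{pa})(1-t^{pb})}.$$ -/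

import Mathlib

open scoped PowerSeries LaurentSeries

namespace KleinianHP

/-! ### Hilbert series and zeroth Poisson homology -/

/-- The Hilbert series `∑ m, (dim V m) t ^ m` of a family of (finite-dimensional) subspaces. -/
noncomputable def hilbertSeries (F : Type*) [Field F] {W : Type*} [AddCommGroup W] [Module F W]
    (V : ℕ → Submodule F W) : ℚ⟦X⟧ :=
  PowerSeries.mk fun m => (Module.finrank F (V m) : ℚ)

/-- The linear span `{A, A}` of all brackets. -/
def bracketSpan (F : Type*) {A : Type*} [Field F] [CommRing A] [Algebra F A]
    (br : A → A → A) : Submodule F A :=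
  Submodule.span F {a | ∃ f g : A, a = br f g}

/-- The zeroth Poisson homology `HP₀(A) = A / {A, A}`. -/
abbrev HP0 (F : Type*) {A : Type*} [Field F] [CommRing A] [Algebra F A]
    (br : A → A → A) : Type _ :=
  A ⧸ bracketSpan F br

/-- The `m`-th graded component of `HP₀(A)`: the image of the `m`-th graded component of `A`. -/
def HP0Component (F : Type*) {A : Type*} [Field F] [CommRing A] [Algebra F A]
    (br : A → A → A) (grading : ℕ → Submodule F A) (m : ℕ) : Submodule F (HP0 F br) :=
  (grading m).map (bracketSpan F br).mkQ

/-! ### Surfaces `Q = 0` in affine three-space -/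

section Surface

open MvPolynomial

variable {F : Type*} [Field F]

/-- The bracket `{f, g} = det (∂(f, g, Q) / ∂(x, y, z))` on `F[x, y, z]`; it is the biderivation
with `{x, y} = Q_z`, `{y, z} = Q_x`, `{z, x} = Q_y`. -/
noncomputable def jacobianBracket (Q f g : MvPolynomial (Fin 3) F) : MvPolynomial (Fin 3) F :=
  pderiv 0 Q * (pderiv 1 f * pderiv 2 g - pderiv 2 f * pderiv 1 g) +
  pderiv 1 Q * (pderiv 2 f * pderiv 0 g - pderiv 0 f * pderiv 2 g) +
  pderiv 2 Q * (pderiv 0 f * pderiv 1 g - pderiv 1 f * pderiv 0 g)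

theorem jacobianBracket_generators (Q : MvPolynomial (Fin 3) F) :
    jacobianBracket Q (X 0) (X 1) = pderiv 2 Q ∧
    jacobianBracket Q (X 1) (X 2) = pderiv 0 Q ∧
    jacobianBracket Q (X 2) (X 0) = pderiv 1 Q := by
  simp [jacobianBracket, pderiv_X]

/-- The coordinate ring `A = F[x, y, z] / (Q)` of the surface `Q = 0`. -/
abbrev SurfaceRing (Q : MvPolynomial (Fin 3) F) : Type _ :=
  MvPolynomial (Fin 3) F ⧸ Ideal.span {Q}

theorem jacobianBracket_congr (Q f f' g g' : MvPolynomial (Fin 3) F)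
    (hf : f - f' ∈ Ideal.span {Q}) (hg : g - g' ∈ Ideal.span {Q}) :
    jacobianBracket Q f g - jacobianBracket Q f' g' ∈ Ideal.span {Q} := by
  obtain ⟨u, hu⟩ := Ideal.mem_span_singleton'.1 hf
  obtain ⟨v, hv⟩ := Ideal.mem_span_singleton'.1 hg
  obtain rfl : f = f' + u * Q := by rw [hu]; ring
  obtain rfl : g = g' + v * Q := by rw [hv]; ring
  refine Ideal.mem_span_singleton'.2
    ⟨jacobianBracket Q u g' + jacobianBracket Q f' v + Q * jacobianBracket Q u v, ?_⟩
  simp only [jacobianBracket, map_add, pderiv_mul]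
  ring

/-- The Poisson bracket on `A = F[x, y, z] / (Q)` induced by `jacobianBracket Q`. -/
noncomputable def surfaceBracket (Q : MvPolynomial (Fin 3) F) :
    SurfaceRing Q → SurfaceRing Q → SurfaceRing Q :=
  Quotient.map₂ (jacobianBracket Q) fun f f' hf g g' hg =>
    (Submodule.quotientRel_def _).2 (jacobianBracket_congr Q f f' g g'
      ((Submodule.quotientRel_def _).1 hf) ((Submodule.quotientRel_def _).1 hg))

theorem surfaceBracket_mk (Q f g : MvPolynomial (Fin 3) F) :
    surfaceBracket Q (Ideal.Quotient.mk _ f) (Ideal.Quotient.mk _ g) =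
      Ideal.Quotient.mk _ (jacobianBracket Q f g) := rfl

/-- The grading on `A = F[x, y, z] / (Q)` given by `deg x = w 0`, `deg y = w 1`, `deg z = w 2`
(for quasihomogeneous `Q`). -/
noncomputable def surfaceGrading (Q : MvPolynomial (Fin 3) F) (w : Fin 3 → ℕ) (m : ℕ) :
    Submodule F (SurfaceRing Q) :=
  (weightedHomogeneousSubmodule F w m).map (Ideal.Quotient.mkₐ F (Ideal.span {Q})).toLinearMap

/-- The origin is the one and only singular geometric point of the surface `Q = 0`. For a
quasihomogeneous `Q` with positive weights this says that `0` is an isolated singular point. -/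
def IsIsolatedSingularity (Q : MvPolynomial (Fin 3) F) : Prop :=
  ∀ v : Fin 3 → AlgebraicClosure F,
    (aeval v Q = 0 ∧ ∀ i, aeval v (pderiv i Q) = 0) ↔ v = 0

end Surface

/-! ### Quotients `L / Γ` with `L` a symplectic plane and `Γ ⊆ SL(L)` -/

section Quotient

open MvPolynomial Matrix

variable {F : Type*} [Field F]

/-- The pullback `f ↦ f ∘ γ` of polynomial functions on `L = F²` under `γ ∈ SL(2, F)`. -/
noncomputable def pullback (γ : SpecialLinearGroup (Fin 2) F) :
    MvPolynomial (Fin 2) F →ₐ[F] MvPolynomial (Fin 2) F :=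
  aeval fun i => ∑ j, C (γ.1 i j) * X j

/-- The algebra `A = F[L]^Γ` of invariant polynomials, i.e. of regular functions on `L / Γ`. -/
noncomputable def invariants (Γ : Subgroup (SpecialLinearGroup (Fin 2) F)) :
    Subalgebra F (MvPolynomial (Fin 2) F) where
  carrier := {f | ∀ γ ∈ Γ, pullback γ f = f}
  mul_mem' hf hg γ hγ := by rw [map_mul, hf γ hγ, hg γ hγ]
  add_mem' hf hg γ hγ := by rw [map_add, hf γ hγ, hg γ hγ]
  algebraMap_mem' r γ _ := (pullback γ).commutes r

/-- The standard Poisson bracket `{f, g} = f_u g_v - f_v g_u` on `F[u, v]`. -/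
noncomputable def planeBracket (f g : MvPolynomial (Fin 2) F) : MvPolynomial (Fin 2) F :=
  pderiv 0 f * pderiv 1 g - pderiv 1 f * pderiv 0 g

theorem pderiv_pullback (γ : SpecialLinearGroup (Fin 2) F) (j : Fin 2)
    (f : MvPolynomial (Fin 2) F) :
    pderiv j (pullback γ f) = ∑ i, C (γ.1 i j) * pullback γ (pderiv i f) := by
  induction f using MvPolynomial.induction_on with
  | C a => simp [pullback]
  | add f g hf hg => simp only [map_add, hf, hg, mul_add, Finset.sum_add_distrib]
  | mul_X f k hf =>
    simp only [map_mul, pderiv_mul, hf, map_add, Fin.sum_univ_two]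
    fin_cases j <;> fin_cases k <;>
      simp [pullback, pderiv_X, Fin.sum_univ_two] <;> ring

theorem planeBracket_pullback (γ : SpecialLinearGroup (Fin 2) F) (f g : MvPolynomial (Fin 2) F) :
    planeBracket (pullback γ f) (pullback γ g) = pullback γ (planeBracket f g) := by
  have h : (C (γ.1 0 0) * C (γ.1 1 1) - C (γ.1 0 1) * C (γ.1 1 0) : MvPolynomial (Fin 2) F) = 1 := by
    rw [← C_mul, ← C_mul, ← C_sub, ← det_fin_two, γ.2, C_1]
  simp only [planeBracket, pderiv_pullback, Fin.sum_univ_two, map_sub, map_mul]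
  linear_combination (pullback γ (pderiv 0 f) * pullback γ (pderiv 1 g) -
    pullback γ (pderiv 1 f) * pullback γ (pderiv 0 g)) * h

/-- The Poisson bracket on `F[L]^Γ`, the restriction of the one on `F[L]`. -/
noncomputable def invariantBracket (Γ : Subgroup (SpecialLinearGroup (Fin 2) F))
    (f g : invariants Γ) : invariants Γ :=
  ⟨planeBracket f.1 g.1, fun γ hγ => by
    rw [← planeBracket_pullback, f.2 γ hγ, g.2 γ hγ]⟩

/-- The grading on `F[L]^Γ` by the usual degree of polynomials. -/
noncomputable def invariantGrading (Γ : Subgroup (SpecialLinearGroup (Fin 2) F)) (m : ℕ) :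
    Submodule F (invariants Γ) :=
  (homogeneousSubmodule (Fin 2) F m).comap (invariants Γ).val.toLinearMap

end Quotient

/-! ### The types of Kleinian singularities -/

/-- The simply laced irreducible root systems. -/
inductive ADEType : Type
  | A (r : ℕ) (hr : 1 ≤ r)
  | D (r : ℕ) (hr : 4 ≤ r)
  | E6
  | E7
  | E8

namespace ADEType

/-- The Coxeter number `h`. -/
def coxeterNumber : ADEType → ℕ
  | A r _ => r + 1
  | D r _ => 2 * (r - 1)
  | E6 => 12
  | E7 => 18
  | E8 => 30

/-- The exponents `m₁, …, m_r` of the root system, with multiplicity. -/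
def exponents : ADEType → Multiset ℕ
  | A r _ => (Multiset.range r).map (· + 1)
  | D r _ => (r - 1) ::ₘ (Multiset.range (r - 1)).map (2 * · + 1)
  | E6 => {1, 4, 5, 7, 8, 11}
  | E7 => {1, 5, 7, 9, 11, 13, 17}
  | E8 => {1, 7, 11, 13, 17, 19, 23, 29}

/-- The degree `a` of the first primary invariant of the corresponding group. -/
def degA : ADEType → ℕ
  | A _ _ => 2
  | D _ _ => 4
  | E6 => 6
  | E7 => 8
  | E8 => 12

/-- The degree `b` of the second primary invariant of the corresponding group. -/
def degB : ADEType → ℕ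
  | A r _ => r + 1
  | D r _ => 2 * (r - 2)
  | E6 => 8
  | E7 => 12
  | E8 => 20

/-- The weights `(a, b, h)` of the variables `x, y, z`; the third generating invariant has
degree `h = a + b - 2`, and the equation `Q` of the singularity has degree `2 h`. -/
def weights (T : ADEType) : Fin 3 → ℕ := ![T.degA, T.degB, T.coxeterNumber]

end ADEType

/-- `G` is the binary polyhedral group `⟨l, m, n⟩`: it is generated by elements `r, s, t` with
`r ^ l = s ^ m = t ^ n = r s t` and has the order `N` of the group with this presentation. -/
def IsBinaryPolyhedral (G : Type*) [Group G] (l m n N : ℕ) : Prop :=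
  Nat.card G = N ∧ ∃ r s t : G, Subgroup.closure {r, s, t} = ⊤ ∧
    r ^ l = r * s * t ∧ s ^ m = r * s * t ∧ t ^ n = r * s * t

/-- The McKay correspondence: `G` is the cyclic group of order `r + 1` (type `A_r`), the binary
dihedral group of order `4 (r - 2)` (type `D_r`), or the binary tetrahedral (`E₆`), octahedral
(`E₇`) or icosahedral (`E₈`) group. -/
def IsMcKayGroup (G : Type*) [Group G] : ADEType → Prop
  | .A r _ => IsCyclic G ∧ Nat.card G = r + 1
  | .D r _ => IsBinaryPolyhedral G 2 2 (r - 2) (4 * (r - 2))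
  | .E6 => IsBinaryPolyhedral G 2 3 3 24
  | .E7 => IsBinaryPolyhedral G 2 3 4 48
  | .E8 => IsBinaryPolyhedral G 2 3 5 120

/-! ### The right-hand sides -/

/-- The Laurent expansion at `0` of
`g(z) = z ^ (a + b + c - d) (1 - z ^ d) / ((1 - z ^ a) (1 - z ^ b) (1 - z ^ c))`. -/
noncomputable def gSeries (a b c d : ℕ) : ℚ⸨X⸩ :=
  HahnSeries.single ((a : ℤ) + b + c - d) 1 *
    HahnSeries.ofPowerSeries ℤ ℚ
      ((1 - PowerSeries.X ^ d) *
        ((1 - PowerSeries.X ^ a) * (1 - PowerSeries.X ^ b) * (1 - PowerSeries.X ^ c))⁻¹)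

/-- `φ₊(z) = φ(z) - φ₋(z) - φ₀`, the sum of the terms of positive degree. -/
noncomputable def posPart (φ : ℚ⸨X⸩) : ℚ⟦X⟧ :=
  PowerSeries.mk fun k => if 0 < k then φ.coeff (k : ℤ) else 0

/-- `φ₋(z⁻¹)`, where `φ₋(z)` is the sum of the terms of negative degree. -/
noncomputable def negPartInv (φ : ℚ⸨X⸩) : ℚ⟦X⟧ :=
  PowerSeries.mk fun k => if 0 < k then φ.coeff (-(k : ℤ)) else 0

/-- `f(z) = g(z) - g₋(z) + g₋(z⁻¹) - g₀`. -/
noncomputable def fSeries (a b c d : ℕ) : ℚ⟦X⟧ :=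
  posPart (gSeries a b c d) + negPartInv (gSeries a b c d)

/-- The right-hand side
`(1 - t ^ (d - a)) (1 - t ^ (d - b)) (1 - t ^ (d - c)) / ((1 - t ^ a) (1 - t ^ b) (1 - t ^ c))
  + t ^ (d - a - b - c) f(t ^ p)`
of the main formula for a quasihomogeneous surface of degree `d` and weights `a, b, c ≤ d`. -/
noncomputable def mainFormula (a b c d p : ℕ) (hp : p ≠ 0) : ℚ⸨X⸩ :=
  HahnSeries.ofPowerSeries ℤ ℚ
      ((1 - PowerSeries.X ^ (d - a)) * (1 - PowerSeries.X ^ (d - b)) *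
          (1 - PowerSeries.X ^ (d - c)) *
        ((1 - PowerSeries.X ^ a) * (1 - PowerSeries.X ^ b) * (1 - PowerSeries.X ^ c))⁻¹) +
    HahnSeries.single ((d : ℤ) - a - b - c) 1 *
      HahnSeries.ofPowerSeries ℤ ℚ (PowerSeries.expand p hp (fSeries a b c d))

/-- `∑ i, t ^ (2 (m_i - 1)) + t ^ (2 p - 2) (1 + t ^ (p h)) / ((1 - t ^ (p a)) (1 - t ^ (p b)))`. -/
noncomputable def explicitFormula (T : ADEType) (p : ℕ) : ℚ⟦X⟧ :=
  (T.exponents.map fun m => (PowerSeries.X : ℚ⟦X⟧) ^ (2 * (m - 1))).sum +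
    PowerSeries.X ^ (2 * p - 2) * (1 + PowerSeries.X ^ (p * T.coxeterNumber)) *
      ((1 - PowerSeries.X ^ (p * T.degA)) * (1 - PowerSeries.X ^ (p * T.degB)))⁻¹

/-- The graded components `V m` are finite-dimensional, and their Hilbert series is given by the
main formula (for weights `a, b, h` and degree `2 h`) and, explicitly, by `explicitFormula`. -/
def HasKleinianHilbertSeries (F : Type*) [Field F] {W : Type*} [AddCommGroup W] [Module F W]
    (V : ℕ → Submodule F W) (T : ADEType) (p : ℕ) (hp : p ≠ 0) : Prop :=
  (∀ m, Module.Finite F (V m)) ∧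
  HahnSeries.ofPowerSeries ℤ ℚ (hilbertSeries F V) =
    mainFormula T.degA T.degB T.coxeterNumber (2 * T.coxeterNumber) p hp ∧
  hilbertSeries F V = explicitFormula T p

end KleinianHP

/-! Both kinds of algebra are double planes: `A` is free over `F[x, y]` with basis `1, z`, where `z²
= P(x, y)`, `P` is weighted homogeneous of degree `2h` for the weights `a, b`, the partial
derivatives of `P` are coprime, and the bracket is a nonzero multiple of the one with `{x, y} = 2z`.
For this model the theorem is a count of monomials in two variables.

The span of the brackets splits along `1, z` (`span_doublePlaneBracket`). Its `z`-part consists of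
the coefficients of the exact 2-forms in the plane, so exactly the monomials `x^i y^j` with `p ∣ i +
1` and `p ∣ j + 1` survive. Its `z`-free part consists of the coefficients of `2P dω + dP ∧ ω = 2z
d(zω)` for polynomial 1-forms `ω` (`twistedCurl`). In degree `m` the form `zω` has weight `m + 2`
for the Euler field `E`, and Cartan's formula for `E` leads to two cases.

If `m + 2 ≠ 0` in `F`, the image is the degree `m` part of the Jacobian ideal `(P_x, P_y)`. The
Koszul relation gives its dimension, and the quotient, the Jacobian ring, has the Hilbert series `∑
t^(2(m_i - 1))`.

If `m + 2 = pk`, contraction with `E` is injective and carries the image onto the image of `f ↦ 2z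
d(zf)` in weight `pk - h` (`twistedGrad`). The kernel of that map is `P^((p-1)/2)` times the
polynomials in `x^p, y^p`, so the dimension is `w(pk - h) - w(k - h)`, where `w(j)` counts monomials
of weight `j`. The result matches the formula because `w(pk - 2) - w(pk - h) = w(k - 2) - w(k - h)`:
the series `(t² - t^h) / ((1 - t^a)(1 - t^b))` is a combination of series `1 / (1 - t^d)` with `0 <
d < p`, whose coefficients only see which `d` divide the index.

A surface `Q = 0` is a double plane because `Q` has degree at most 2 in `z`. Isolatedness makes the
coefficient of `z²` nonzero after a graded shear, one completes the square, and a common factor of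
`P_x, P_y` would produce a singular point other than the origin.

For invariants one first passes to the algebraic closure, which preserves dimensions since the order
of `Γ` is invertible. It remains to exhibit Klein's generators with `z² = P(x, y)` and `{x, y} = c
z`. Cyclic and binary dihedral groups are put in normal form and treated by monomials. In the
polyhedral cases one uses the semi-invariant forms vanishing on the orbits of the eigenlines of the
generators. The eigenvalues on the line stabilizers determine the degrees of these forms and force
orders of vanishing, and two semi-invariants of equal degree, one dividing the other, are
proportional. This yields all relations and the generation statement. -/

namespace KleinianHP

/-! ### Counting monomials of given weight, and geometric series. -/

section Numerics

open PowerSeries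

/-- The weights `(a, b)` of two variables. -/
abbrev planeWeights (a b : ℕ) : Fin 2 → ℤ := ![(a : ℤ), (b : ℤ)]

theorem weight_planeWeights (a b : ℕ) (d : Fin 2 →₀ ℕ) :
    Finsupp.weight (planeWeights a b) d = a * d 0 + b * d 1 := by
  simp [Finsupp.weight_apply, Finsupp.sum_fintype, mul_comm]

/-- The number of monomials of weight `j` in two variables of weights `a` and `b`. -/
noncomputable def weightCount (a b : ℕ) (j : ℤ) : ℕ :=
  Nat.card {d : Fin 2 →₀ ℕ | Finsupp.weight (planeWeights a b) d = j}

theorem weightCount_of_neg {a b : ℕ} {j : ℤ} (hj : j < 0) : weightCount a b j = 0 := by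
  have : IsEmpty {d : Fin 2 →₀ ℕ | Finsupp.weight (planeWeights a b) d = j} := by
    refine ⟨fun ⟨d, hd⟩ => ?_⟩
    simp only [Set.mem_ofPred_eq, weight_planeWeights] at hd
    have : (0 : ℤ) ≤ a * d 0 + b * d 1 := by positivity
    omega
  exact Nat.card_of_isEmpty

theorem finite_weight_eq {a b : ℕ} (ha : 0 < a) (hb : 0 < b) (j : ℤ) :
    {d : Fin 2 →₀ ℕ | Finsupp.weight (planeWeights a b) d = j}.Finite := by
  refine Set.Finite.subset (Set.finite_Iic (Finsupp.equivFunOnFinite.symm fun _ => j.toNat)) ?_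
  intro d hd i
  simp only [Set.mem_ofPred_eq, weight_planeWeights] at hd
  have h0 : (d 0 : ℤ) ≤ a * d 0 := by nlinarith
  have h1 : (d 1 : ℤ) ≤ b * d 1 := by nlinarith
  have h2 : (0 : ℤ) ≤ d 0 := by positivity
  have h3 : (0 : ℤ) ≤ d 1 := by positivity
  fin_cases i <;> simp <;> omega

/-- The series `1 / (1 - X ^ d)`. -/
noncomputable def geomSeries (d : ℕ) : ℚ⟦X⟧ := PowerSeries.mk fun n => if d ∣ n then 1 else 0

theorem coeff_geomSeries (d n : ℕ) : coeff n (geomSeries d) = if d ∣ n then 1 else 0 := by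
  simp [geomSeries]

theorem geomSeries_mul {d : ℕ} (hd : 0 < d) : geomSeries d * (1 - X ^ d) = 1 := by
  ext n
  rw [mul_sub, mul_one, map_sub, mul_comm, coeff_X_pow_mul', coeff_geomSeries, coeff_geomSeries,
    coeff_one]
  rcases Nat.eq_zero_or_pos n with rfl | hn
  · simp [hd.ne']
  · by_cases hdn : d ≤ n
    · simp [hdn, Nat.dvd_sub_iff_left hdn (dvd_refl d), hn.ne']
    · have h : ¬ d ∣ n := fun h => hdn (Nat.le_of_dvd hn h)
      simp [hdn, hn.ne', h]

/-- Brings several series `1 / (1 - X ^ d)` to a common denominator, so that identities between them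
become polynomial identities. -/
theorem geomSeries_eq_sum_mul {d k : ℕ} (hd : 0 < d) (hk : 0 < k) :
    geomSeries d = (∑ i ∈ Finset.range k, X ^ (d * i)) * geomSeries (d * k) := by
  have h1 := geomSeries_mul hd
  have h2 := geomSeries_mul (Nat.mul_pos hd hk)
  have h3 := geom_sum_mul_neg ((X : ℚ⟦X⟧) ^ d) k
  simp only [← pow_mul] at h3
  linear_combination (-geomSeries d) * h2 + geomSeries d * geomSeries (d * k) * (-h3) +
    (∑ i ∈ Finset.range k, X ^ (d * i)) * geomSeries (d * k) * h1

theorem constantCoeff_one_sub_X_pow {d : ℕ} (hd : 0 < d) :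
    constantCoeff (1 - (X : ℚ⟦X⟧) ^ d) = 1 := by
  simp [hd.ne']

theorem inv_one_sub_X_pow {d : ℕ} (hd : 0 < d) : (1 - (X : ℚ⟦X⟧) ^ d)⁻¹ = geomSeries d := by
  rw [PowerSeries.inv_eq_iff_mul_eq_one (by simp [constantCoeff_one_sub_X_pow hd]),
    geomSeries_mul hd]

theorem expand_geomSeries {p : ℕ} (hp : p ≠ 0) (d : ℕ) :
    expand p hp (geomSeries d) = geomSeries (p * d) := by
  ext n
  rw [coeff_expand, coeff_geomSeries, coeff_geomSeries]
  split_ifs with h1 h2 h3 h4 h5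
  · rfl
  · obtain ⟨k, rfl⟩ := h1
    rw [Nat.mul_div_cancel_left _ (Nat.pos_of_ne_zero hp)] at h2
    exact absurd (Nat.mul_dvd_mul_left p h2) h3
  · obtain ⟨k, rfl⟩ := h1
    rw [Nat.mul_div_cancel_left _ (Nat.pos_of_ne_zero hp)] at h2
    exact absurd (Nat.dvd_of_mul_dvd_mul_left (Nat.pos_of_ne_zero hp) h4) h2
  · rfl
  · exact absurd (dvd_of_mul_right_dvd h5) h1
  · rfl

theorem coeff_geomSeries_mul_geomSeries {a b : ℕ} (ha : 0 < a) (hb : 0 < b) (n : ℕ) :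
    coeff n (geomSeries a * geomSeries b) = weightCount a b n := by
  classical
  have h1 : coeff n (geomSeries a * geomSeries b) =
      ((Finset.HasAntidiagonal.antidiagonal n).filter fun x => a ∣ x.1 ∧ b ∣ x.2).card := by
    rw [coeff_mul, Finset.card_filter, Nat.cast_sum]
    refine Finset.sum_congr rfl fun x _ => ?_
    rw [coeff_geomSeries, coeff_geomSeries]
    split_ifs <;> simp_all
  rw [h1, weightCount, Nat.cast_inj, ← Set.ncard_coe_finset, ← Nat.card_coe_set_eq, eq_comm]
  refine Nat.card_eq_of_bijective (fun d => ⟨(a * d.1 0, b * d.1 1), ?_⟩) ⟨?_, ?_⟩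
  · have := d.2
    simp only [Set.mem_ofPred_eq, weight_planeWeights] at this
    simp only [Finset.coe_filter, Finset.HasAntidiagonal.mem_antidiagonal, Set.mem_ofPred_eq]
    exact ⟨by exact_mod_cast this, ⟨_, rfl⟩, ⟨_, rfl⟩⟩
  · rintro ⟨d, hd⟩ ⟨e, he⟩ h
    simp only [Subtype.mk.injEq, Prod.mk.injEq] at h
    ext i
    fin_cases i
    · exact Nat.eq_of_mul_eq_mul_left ha h.1
    · exact Nat.eq_of_mul_eq_mul_left hb h.2
  · rintro ⟨⟨x, y⟩, h⟩
    simp only [Finset.coe_filter, Finset.HasAntidiagonal.mem_antidiagonal, Set.mem_ofPred_eq] at h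
    obtain ⟨h1, ⟨i, rfl⟩, ⟨j, rfl⟩⟩ := h
    refine ⟨⟨Finsupp.equivFunOnFinite.symm ![i, j], ?_⟩, ?_⟩
    · simp only [Set.mem_ofPred_eq, weight_planeWeights]
      simpa using by exact_mod_cast h1
    · simp

/-- The count is indexed by integers and vanishes in negative weight, so the shift by `c` needs no
case distinction. -/
theorem coeff_X_pow_mul_geomSeries {a b : ℕ} (ha : 0 < a) (hb : 0 < b) (c n : ℕ) :
    coeff n ((X : ℚ⟦X⟧) ^ c * (geomSeries a * geomSeries b)) = (weightCount a b (n - c) : ℚ) := by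
  rw [coeff_X_pow_mul']
  split_ifs with h
  · rw [coeff_geomSeries_mul_geomSeries ha hb, Nat.cast_sub h]
  · rw [weightCount_of_neg (by omega), Nat.cast_zero]

end Numerics

/-! ### Generating functions attached to the Dynkin types. -/

namespace ADEType

open PowerSeries

variable (T : ADEType)

theorem degA_pos : 0 < T.degA := by cases T <;> simp [degA]

theorem degB_pos : 0 < T.degB := by cases T <;> simp [degB]; omega

theorem coxeterNumber_add_two : T.coxeterNumber + 2 = T.degA + T.degB := by
  cases T <;> simp only [degA, degB, coxeterNumber] <;> omega

theorem two_le_degA : 2 ≤ T.degA := by cases T <;> simp [degA]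

theorem two_le_degB : 2 ≤ T.degB := by cases T <;> simp [degB] <;> omega

theorem degA_le : T.degA ≤ T.coxeterNumber := by
  have := T.coxeterNumber_add_two; have := T.two_le_degB; omega

theorem degB_le : T.degB ≤ T.coxeterNumber := by
  have := T.coxeterNumber_add_two; have := T.two_le_degA; omega

theorem exponents_pos : ∀ m ∈ T.exponents, 0 < m := by
  cases T <;> simp [exponents]; omega

theorem exponents_lt : ∀ m ∈ T.exponents, m < T.coxeterNumber := by
  cases T with
  | D r hr =>
    simp only [exponents, coxeterNumber, Multiset.mem_cons, Multiset.mem_map, Multiset.mem_range]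
    rintro m (rfl | ⟨k, hk, rfl⟩) <;> omega
  | _ => simp [exponents, coxeterNumber]

theorem sum_geom_X_pow (k n : ℕ) :
    (((Multiset.range n).map fun i => (X : ℚ⟦X⟧) ^ (k * i)).sum) * (1 - X ^ k) =
      1 - X ^ (k * n) := by
  have := geom_sum_mul_neg ((X : ℚ⟦X⟧) ^ k) n
  rw [← pow_mul] at this
  rw [← this]
  congr 1
  simp only [← pow_mul]
  rfl

/-- The quotient of the right side by `(1 - X ^ a) * (1 - X ^ b)` is the Hilbert series of the
Jacobian ring of a polynomial `P` of weight `2h` with coprime partial derivatives. That its degrees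
are `2(m_i - 1)` is checked type by type; for `A` and `D` the sum is a geometric progression, with
one extra term for `D`. -/
theorem sum_X_pow_exponents :
    (T.exponents.map fun m => (X : ℚ⟦X⟧) ^ (2 * (m - 1))).sum *
        ((1 - X ^ T.degA) * (1 - X ^ T.degB)) =
      (1 - X ^ (2 * T.coxeterNumber - T.degA)) * (1 - X ^ (2 * T.coxeterNumber - T.degB)) := by
  cases T with
  | A r hr =>
    have h := sum_geom_X_pow 2 r
    simp only [exponents, degA, degB, coxeterNumber, Multiset.map_map, Function.comp_def,
      Nat.add_sub_cancel]
    rw [← mul_assoc, h]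
    congr 3
    omega
  | D r hr =>
    obtain ⟨n, rfl⟩ : ∃ n, r = n + 2 := ⟨r - 2, by omega⟩
    have h := sum_geom_X_pow 4 (n + 1)
    simp only [exponents, degA, degB, coxeterNumber, Multiset.map_cons, Multiset.sum_cons,
      Multiset.map_map, Function.comp_def, Nat.add_sub_cancel]
    have e1 : n + 2 - 1 = n + 1 := by omega
    have e2 : 2 * (2 * (n + 1)) - 4 = 4 * n := by omega
    have e3 : 2 * (2 * (n + 1)) - 2 * n = 2 * n + 4 := by omega
    have e4 : ∀ x : ℕ, 2 * (2 * x) = 4 * x := by intro x; omega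
    rw [e1, e2, e3, Nat.add_sub_cancel]
    simp only [e4]
    linear_combination (1 - X ^ (2 * n)) * h
  | E6 => simp [exponents, degA, degB, coxeterNumber]; ring
  | E7 => simp [exponents, degA, degB, coxeterNumber]; ring
  | E8 => simp [exponents, degA, degB, coxeterNumber]; ring

theorem sum_X_pow_exponents_eq :
    (T.exponents.map fun m => (X : ℚ⟦X⟧) ^ (2 * (m - 1))).sum =
      (1 - X ^ (2 * T.coxeterNumber - T.degA)) * (1 - X ^ (2 * T.coxeterNumber - T.degB)) *
        (geomSeries T.degA * geomSeries T.degB) := by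
  rw [← sum_X_pow_exponents]
  linear_combination (-(T.exponents.map fun m => (X : ℚ⟦X⟧) ^ (2 * (m - 1))).sum) *
    ((1 - X ^ T.degB) * geomSeries T.degB * geomSeries_mul T.degA_pos +
      geomSeries_mul T.degB_pos)

theorem coeff_sum_X_pow_exponents (m : ℕ) :
    coeff m ((T.exponents.map fun m => (X : ℚ⟦X⟧) ^ (2 * (m - 1))).sum) =
      (weightCount T.degA T.degB m : ℚ) -
        weightCount T.degA T.degB (m - (2 * T.coxeterNumber - T.degA)) -
        weightCount T.degA T.degB (m - (2 * T.coxeterNumber - T.degB)) +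
        weightCount T.degA T.degB (m - (4 * T.coxeterNumber - T.degA - T.degB)) := by
  have h1 := T.degA_le
  have h2 := T.degB_le
  have h : (1 - (X : ℚ⟦X⟧) ^ (2 * T.coxeterNumber - T.degA)) *
      (1 - X ^ (2 * T.coxeterNumber - T.degB)) * (geomSeries T.degA * geomSeries T.degB) =
      X ^ 0 * (geomSeries T.degA * geomSeries T.degB)
      - X ^ (2 * T.coxeterNumber - T.degA) * (geomSeries T.degA * geomSeries T.degB)
      - X ^ (2 * T.coxeterNumber - T.degB) * (geomSeries T.degA * geomSeries T.degB)
      + X ^ (2 * T.coxeterNumber - T.degA + (2 * T.coxeterNumber - T.degB)) *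
        (geomSeries T.degA * geomSeries T.degB) := by ring
  rw [sum_X_pow_exponents_eq, h]
  simp only [map_add, map_sub, coeff_X_pow_mul_geomSeries T.degA_pos T.degB_pos]
  have e1 : ((2 * T.coxeterNumber - T.degA : ℕ) : ℤ) = 2 * T.coxeterNumber - T.degA := by omega
  have e2 : ((2 * T.coxeterNumber - T.degB : ℕ) : ℤ) = 2 * T.coxeterNumber - T.degB := by omega
  have e3 : (2 * (T.coxeterNumber : ℤ) - T.degA + (2 * T.coxeterNumber - T.degB)) =
      4 * T.coxeterNumber - T.degA - T.degB := by ring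
  rw [Nat.cast_add, e1, e2, e3, Nat.cast_zero, sub_zero]

/-- If `m = 2(m_i - 1)`, then `m + 2 = 2 m_i`, which is prime to `p` because `0 < m_i < h < p` and
`p > 2`. -/
theorem coeff_sum_X_pow_exponents_of_dvd {p : ℕ} (hp : p.Prime) (hT : T.coxeterNumber < p)
    {m : ℕ} (hm : p ∣ m + 2) :
    coeff m ((T.exponents.map fun m => (X : ℚ⟦X⟧) ^ (2 * (m - 1))).sum) = 0 := by
  rw [← AddMonoidHom.coe_coe, AddMonoidHom.map_multiset_sum, Multiset.map_map]
  refine Multiset.sum_eq_zero fun x hx => ?_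
  obtain ⟨k, hk, rfl⟩ := Multiset.mem_map.1 hx
  have h1 := T.exponents_pos k hk
  have h2 := T.exponents_lt k hk
  have h3 := T.coxeterNumber_add_two
  have h4 := T.two_le_degA
  have h5 := T.two_le_degB
  simp only [Function.comp_apply, AddMonoidHom.coe_coe, coeff_X_pow]
  rw [if_neg]
  rintro rfl
  rw [show 2 * (k - 1) + 2 = 2 * k by omega] at hm
  rcases hp.dvd_mul.1 hm with h | h
  · have := Nat.le_of_dvd (by norm_num) h; omega
  · have := Nat.le_of_dvd h1 h; omega

/-- The series `(X ^ 2 - X ^ h) / ((1 - X ^ a) (1 - X ^ b))` is a combination of series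
`1 / (1 - X ^ d)` with `d` prime to `p`. -/
theorem exists_sum_geomSeries {p : ℕ} (hT : T.coxeterNumber < p) :
    ∃ s : Multiset (ℚ × ℕ), (∀ x ∈ s, 0 < x.2 ∧ x.2 < p) ∧
      (X ^ 2 - X ^ T.coxeterNumber) * (geomSeries T.degA * geomSeries T.degB) =
        (s.map fun x => PowerSeries.C x.1 * geomSeries x.2).sum := by
  have key : ∀ d : ℕ, 0 < d → d < p → 0 < d ∧ d < p := fun d h1 h2 => ⟨h1, h2⟩
  cases T with
  | A r hr =>
    simp only [coxeterNumber] at hT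
    -- A pair `(c, d)` stands for the partial fraction `c / (1 - X ^ d)`.
    refine ⟨{(1, 2), (-1, r + 1)}, ?_, ?_⟩
    · simp only [Multiset.insert_eq_cons, Multiset.mem_cons, Multiset.mem_singleton]
      rintro x (rfl | rfl) <;> exact key _ (by simp) (by simp; omega)
    · simp [degA, degB, coxeterNumber]
      linear_combination (-geomSeries (r + 1)) * geomSeries_mul (d := 2) (by simp) +
        geomSeries 2 * geomSeries_mul (d := r + 1) (by simp)
  | D r hr =>
    simp only [coxeterNumber] at hT
    refine ⟨{(1, 2), (-1, 4)}, ?_, ?_⟩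
    · simp only [Multiset.insert_eq_cons, Multiset.mem_cons, Multiset.mem_singleton]
      rintro x (rfl | rfl) <;> exact key _ (by simp) (by simp; omega)
    · obtain ⟨n, rfl⟩ : ∃ n, r = n + 2 := ⟨r - 2, by omega⟩
      simp [degA, degB, coxeterNumber]
      rw [geomSeries_eq_sum_mul (d := 2) (k := 2) (by simp) (by simp)]
      norm_num [Finset.sum_range_succ]
      linear_combination X ^ 2 * geomSeries 4 * geomSeries_mul (d := 2 * n) (by omega)
  | E6 =>
    simp only [coxeterNumber] at hT
    refine ⟨{(1, 2), (-1, 4), (-1, 6), (1, 8)}, ?_, ?_⟩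
    · simp only [Multiset.insert_eq_cons, Multiset.mem_cons, Multiset.mem_singleton]
      rintro x (rfl | rfl | rfl | rfl) <;> exact key _ (by simp) (by simp; omega)
    · simp [degA, degB, coxeterNumber]
      -- Everything goes over the common denominator `1 - X ^ 24`, as 24 is the least common
      -- multiple of the periods. The product of two series on the left has its square as
      -- denominator, and the relation cancels one factor.
      rw [geomSeries_eq_sum_mul (d := 2) (k := 12) (by simp) (by simp), geomSeries_eq_sum_mul (d := 4) (k := 6) (by simp) (by simp), geomSeries_eq_sum_mul (d := 6) (k := 4) (by simp) (by simp), geomSeries_eq_sum_mul (d := 8) (k := 3) (by simp) (by simp)]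
      norm_num [Finset.sum_range_succ]
      linear_combination (1 * X ^ 2 + 1 * X ^ 8 + 1 * X ^ 10 - 1 * X ^ 12 + 1 * X ^ 14 + 1 * X ^ 16 + 1 * X ^ 22) * geomSeries 24 * geomSeries_mul (d := 24) (by simp)
  | E7 =>
    simp only [coxeterNumber] at hT
    refine ⟨{(1, 2), (-1, 4), (-1, 6), (1, 12)}, ?_, ?_⟩
    · simp only [Multiset.insert_eq_cons, Multiset.mem_cons, Multiset.mem_singleton]
      rintro x (rfl | rfl | rfl | rfl) <;> exact key _ (by simp) (by simp; omega)
    · simp [degA, degB, coxeterNumber]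
      rw [geomSeries_eq_sum_mul (d := 2) (k := 12) (by simp) (by simp), geomSeries_eq_sum_mul (d := 4) (k := 6) (by simp) (by simp), geomSeries_eq_sum_mul (d := 6) (k := 4) (by simp) (by simp), geomSeries_eq_sum_mul (d := 8) (k := 3) (by simp) (by simp), geomSeries_eq_sum_mul (d := 12) (k := 2) (by simp) (by simp)]
      norm_num [Finset.sum_range_succ]
      linear_combination (1 * X ^ 2 + 1 * X ^ 10 + 1 * X ^ 14 + 1 * X ^ 22) * geomSeries 24 * geomSeries_mul (d := 24) (by simp)
  | E8 =>
    simp only [coxeterNumber] at hT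
    refine ⟨{(1, 2), (-1, 4), (-1, 6), (-1, 10), (1, 12), (1, 20)}, ?_, ?_⟩
    · simp only [Multiset.insert_eq_cons, Multiset.mem_cons, Multiset.mem_singleton]
      rintro x (rfl | rfl | rfl | rfl | rfl | rfl) <;> exact key _ (by simp) (by simp; omega)
    · simp [degA, degB, coxeterNumber]
      rw [geomSeries_eq_sum_mul (d := 2) (k := 30) (by simp) (by simp), geomSeries_eq_sum_mul (d := 4) (k := 15) (by simp) (by simp), geomSeries_eq_sum_mul (d := 6) (k := 10) (by simp) (by simp), geomSeries_eq_sum_mul (d := 10) (k := 6) (by simp) (by simp), geomSeries_eq_sum_mul (d := 12) (k := 5) (by simp) (by simp), geomSeries_eq_sum_mul (d := 20) (k := 3) (by simp) (by simp)]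
      norm_num [Finset.sum_range_succ]
      linear_combination (1 * X ^ 2 + 1 * X ^ 14 + 1 * X ^ 22 + 1 * X ^ 26 - 1 * X ^ 30 + 1 * X ^ 34 + 1 * X ^ 38 + 1 * X ^ 46 + 1 * X ^ 58) * geomSeries 60 * geomSeries_mul (d := 60) (by simp)

/-- By `exists_sum_geomSeries` the `n`-th difference depends only on which of finitely many `d < p`
divide `n`. All these `d` are prime to `p`, so passing from `k` to `p * k` changes nothing. -/
theorem weightCount_mul_sub {p : ℕ} (hp : p.Prime) (hT : T.coxeterNumber < p) (k : ℕ) :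
    (weightCount T.degA T.degB (p * k - 2) : ℚ) -
        weightCount T.degA T.degB (p * k - T.coxeterNumber) =
      weightCount T.degA T.degB (k - 2) - weightCount T.degA T.degB (k - T.coxeterNumber) := by
  obtain ⟨s, hs, h⟩ := T.exists_sum_geomSeries hT
  have h1 : ∀ n : ℕ, (weightCount T.degA T.degB (n - 2) : ℚ) -
      weightCount T.degA T.degB (n - T.coxeterNumber) =
      (s.map fun x => x.1 * if x.2 ∣ n then 1 else 0).sum := by
    intro n
    have := congrArg (coeff n) h
    rw [sub_mul, map_sub, coeff_X_pow_mul_geomSeries T.degA_pos T.degB_pos,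
      coeff_X_pow_mul_geomSeries T.degA_pos T.degB_pos, map_multiset_sum, Multiset.map_map] at this
    simpa [coeff_geomSeries] using this
  have h2 := h1 (p * k)
  push_cast at h2
  rw [h2, h1 k]
  congr 1
  refine Multiset.map_congr rfl fun x hx => ?_
  have : x.2.Coprime p :=
    ((Nat.Prime.coprime_iff_not_dvd hp).2 fun hd =>
      absurd (Nat.le_of_dvd (hs x hx).1 hd) (not_le.2 (hs x hx).2)).symm
  simp only [this.dvd_mul_left]

theorem explicitFormula_eq {p : ℕ} (hp : p ≠ 0) :
    explicitFormula T p = (T.exponents.map fun m => (X : ℚ⟦X⟧) ^ (2 * (m - 1))).sum +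
      X ^ (2 * p - 2) * expand p hp
        ((1 + X ^ T.coxeterNumber) * (geomSeries T.degA * geomSeries T.degB)) := by
  have hA := T.degA_pos
  have hB := T.degB_pos
  have hp' := Nat.pos_of_ne_zero hp
  rw [explicitFormula, PowerSeries.mul_inv_rev, inv_one_sub_X_pow (Nat.mul_pos hp' hA),
    inv_one_sub_X_pow (Nat.mul_pos hp' hB)]
  simp only [map_mul, map_add, map_one, map_pow, expand_X, expand_geomSeries, ← pow_mul]
  ring

/-- In these degrees the exponents contribute nothing. What is left is `X ^ (2p - 2)` times a series
in `X ^ p`, and `m - (2p - 2) = p (k - 2)`; for `k < 2` both sides are zero. -/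
theorem coeff_explicitFormula_of_dvd {p : ℕ} (hp : p.Prime) (hT : T.coxeterNumber < p)
    {m k : ℕ} (hm : m + 2 = p * k) :
    coeff m (explicitFormula T p) =
      (weightCount T.degA T.degB (k - 2) : ℚ) +
        weightCount T.degA T.degB (k - 2 - T.coxeterNumber) := by
  have hp2 := hp.two_le
  rw [T.explicitFormula_eq hp.ne_zero, map_add,
    T.coeff_sum_X_pow_exponents_of_dvd hp hT ⟨k, hm⟩, zero_add, coeff_X_pow_mul']
  split_ifs with h
  · obtain ⟨l, rfl⟩ : ∃ l, k = l + 2 := by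
      refine ⟨k - 2, ?_⟩
      have : p * 2 ≤ p * k := by omega
      have := Nat.le_of_mul_le_mul_left this hp.pos
      omega
    have h1 : m - (2 * p - 2) = p * l := by
      have : p * (l + 2) = p * l + 2 * p := by ring
      omega
    have h2 : (1 + X ^ T.coxeterNumber) * (geomSeries T.degA * geomSeries T.degB) =
      X ^ 0 * (geomSeries T.degA * geomSeries T.degB) +
        X ^ T.coxeterNumber * (geomSeries T.degA * geomSeries T.degB) := by ring
    rw [h1, coeff_expand_mul, h2, map_add, coeff_X_pow_mul_geomSeries T.degA_pos T.degB_pos,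
      coeff_X_pow_mul_geomSeries T.degA_pos T.degB_pos]
    rw [Nat.cast_zero, sub_zero, show ((l + 2 : ℕ) : ℤ) - 2 = l by push_cast; ring]
  · have : k < 2 := by
      by_contra hk
      have := Nat.mul_le_mul_left p (not_lt.1 hk)
      omega
    rw [weightCount_of_neg (by omega), weightCount_of_neg (by omega)]
    simp

/-- The second summand of the formula lives in degrees congruent to `-2` modulo `p`, so only the
Jacobian ring is seen here. -/
theorem coeff_explicitFormula_of_not_dvd {p : ℕ} (hp : p.Prime) {m : ℕ} (hm : ¬ p ∣ m + 2) :
    coeff m (explicitFormula T p) =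
      (weightCount T.degA T.degB m : ℚ) -
        weightCount T.degA T.degB (m - (2 * T.coxeterNumber - T.degA)) -
        weightCount T.degA T.degB (m - (2 * T.coxeterNumber - T.degB)) +
        weightCount T.degA T.degB (m - (4 * T.coxeterNumber - T.degA - T.degB)) := by
  have hp2 := hp.two_le
  rw [T.explicitFormula_eq hp.ne_zero, map_add, coeff_sum_X_pow_exponents, coeff_X_pow_mul']
  split_ifs with h
  · rw [coeff_expand_of_not_dvd, add_zero]
    rintro ⟨l, hl⟩
    exact hm ⟨l + 2, by rw [mul_add]; omega⟩
  · rw [add_zero]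

/-- For `c = h` and `d = 2h` the factor `1 - X ^ c` of the denominators cancels. Since `a + b + c -
d = 2`, the expansion of `g` has only positive degrees, so `f = g`. The prefactor `t ^ (-2)` and the
term `t ^ (2p)` coming from `z ^ 2` combine to `t ^ (2p - 2)`. -/
theorem mainFormula_eq {p : ℕ} (hp : p ≠ 0) :
    mainFormula T.degA T.degB T.coxeterNumber (2 * T.coxeterNumber) p hp =
      HahnSeries.ofPowerSeries ℤ ℚ (explicitFormula T p) := by
  have hA := T.degA_pos
  have hB := T.degB_pos
  have h2 := T.coxeterNumber_add_two
  have hH : 0 < T.coxeterNumber := by have := T.degA_le; omega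
  have hp' := Nat.pos_of_ne_zero hp
  have hinv : ((1 - (X : ℚ⟦X⟧) ^ T.degA) * (1 - X ^ T.degB) * (1 - X ^ T.coxeterNumber))⁻¹ =
      geomSeries T.degA * geomSeries T.degB * geomSeries T.coxeterNumber := by
    rw [PowerSeries.mul_inv_rev, PowerSeries.mul_inv_rev, inv_one_sub_X_pow hA,
      inv_one_sub_X_pow hB, inv_one_sub_X_pow hH]
    ring
  have hg : gSeries T.degA T.degB T.coxeterNumber (2 * T.coxeterNumber) =
      HahnSeries.ofPowerSeries ℤ ℚ (X ^ 2 * ((1 + X ^ T.coxeterNumber) *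
        (geomSeries T.degA * geomSeries T.degB))) := by
    have h3 : ((T.degA : ℤ) + T.degB + T.coxeterNumber - (2 * T.coxeterNumber : ℕ)) = (2 : ℕ) := by
      push_cast; omega
    rw [gSeries, hinv, h3, ← HahnSeries.ofPowerSeries_X_pow, ← map_mul]
    congr 2
    linear_combination (1 + X ^ T.coxeterNumber) * (geomSeries T.degA * geomSeries T.degB) *
      geomSeries_mul hH
  have hf : fSeries T.degA T.degB T.coxeterNumber (2 * T.coxeterNumber) =
      X ^ 2 * ((1 + X ^ T.coxeterNumber) * (geomSeries T.degA * geomSeries T.degB)) := by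
    rw [fSeries, hg]
    ext n
    simp only [posPart, negPartInv, map_add, coeff_mk]
    rcases Nat.eq_zero_or_pos n with rfl | hn
    · simp
    · rw [if_pos hn, if_pos hn, LaurentSeries.coeff_coe_powerSeries, PowerSeries.coeff_coe,
        if_pos (by omega), add_zero]
  have h4 : ((2 * T.coxeterNumber : ℕ) : ℤ) - T.degA - T.degB - T.coxeterNumber = -2 := by
    push_cast; omega
  rw [mainFormula, hf, hinv, h4, T.explicitFormula_eq hp, map_add, sum_X_pow_exponents_eq]
  congr 1
  · congr 1
    rw [show 2 * T.coxeterNumber - T.coxeterNumber = T.coxeterNumber by omega]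
    linear_combination (1 - X ^ (2 * T.coxeterNumber - T.degA)) *
      (1 - X ^ (2 * T.coxeterNumber - T.degB)) * (geomSeries T.degA * geomSeries T.degB) *
      geomSeries_mul hH
  · rw [map_mul (expand p hp) (X ^ 2), map_pow, expand_X, map_mul, map_mul _ (X ^ (2 * p - 2)),
      ← mul_assoc]
    congr 1
    rw [← pow_mul, HahnSeries.ofPowerSeries_X_pow, HahnSeries.ofPowerSeries_X_pow,
      HahnSeries.single_mul_single, mul_one]
    congr 1
    push_cast [Nat.cast_sub (show 2 ≤ 2 * p by omega)]
    ring_nf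

end ADEType

/-! ### Twisted differential forms in the weighted plane, away from weights divisible by the
characteristic. -/

section Plane

open MvPolynomial

variable {F : Type*} [Field F]

/-- The weighted homogeneous polynomials of degree `j` in two variables of weights `a`, `b`. -/
abbrev planeGrading (F : Type*) [Field F] (a b : ℕ) (j : ℤ) :
    Submodule F (MvPolynomial (Fin 2) F) :=
  weightedHomogeneousSubmodule F (planeWeights a b) j

theorem planeGrading_eq_restrictSupport (a b : ℕ) (j : ℤ) :
    planeGrading F a b j =
      restrictSupport F {d | Finsupp.weight (planeWeights a b) d = j} := by
  ext f
  simp [IsWeightedHomogeneous, mem_restrictSupport_iff, Set.subset_def]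

theorem finrank_restrictSupport {σ : Type*} (s : Set (σ →₀ ℕ)) :
    Module.finrank F (restrictSupport F s) = Nat.card s :=
  Module.finrank_eq_nat_card_basis (basisRestrictSupport F s)

theorem finrank_planeGrading (a b : ℕ) (j : ℤ) :
    Module.finrank F (planeGrading F a b j) = weightCount a b j := by
  rw [planeGrading_eq_restrictSupport, finrank_restrictSupport, weightCount]

theorem finite_planeGrading {a b : ℕ} (ha : 0 < a) (hb : 0 < b) (j : ℤ) :
    Module.Finite F (planeGrading F a b j) := by
  rw [planeGrading_eq_restrictSupport]
  have := (finite_weight_eq ha hb j).to_subtype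
  exact Module.Finite.of_basis (basisRestrictSupport F _)

variable {a b : ℕ} {i j : ℤ} {f g P : MvPolynomial (Fin 2) F}

theorem euler_planeGrading (hf : f ∈ planeGrading F a b j) :
    (a : MvPolynomial (Fin 2) F) * (X 0 * pderiv 0 f) + (b : MvPolynomial (Fin 2) F) *
      (X 1 * pderiv 1 f) = (j : MvPolynomial (Fin 2) F) * f := by
  have hf' : IsWeightedHomogeneous (planeWeights a b) f j := hf
  induction hf' using IsWeightedHomogeneous.induction_on with
  | zero => simp
  | add p q hp hq h1 h2 =>
    simp only [map_add, mul_add] at *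
    linear_combination h1 hp + h2 hq
  | monomial d r hr =>
    rw [X_mul_pderiv_monomial, X_mul_pderiv_monomial, ← hr, weight_planeWeights]
    push_cast
    simp only [nsmul_eq_mul]
    ring

theorem pderiv_zero_mem (hf : f ∈ planeGrading F a b j) : pderiv 0 f ∈ planeGrading F a b (j - a) :=
  IsWeightedHomogeneous.pderiv hf (by simp)

theorem pderiv_one_mem (hf : f ∈ planeGrading F a b j) : pderiv 1 f ∈ planeGrading F a b (j - b) :=
  IsWeightedHomogeneous.pderiv hf (by simp)

theorem mul_mem_planeGrading (hf : f ∈ planeGrading F a b i) (hg : g ∈ planeGrading F a b j) :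
    f * g ∈ planeGrading F a b (i + j) :=
  IsWeightedHomogeneous.mul hf hg

theorem X_zero_mem : (X 0 : MvPolynomial (Fin 2) F) ∈ planeGrading F a b a :=
  isWeightedHomogeneous_X _ _ _

theorem X_one_mem : (X 1 : MvPolynomial (Fin 2) F) ∈ planeGrading F a b b :=
  isWeightedHomogeneous_X _ _ _

theorem natCast_mul_mem (n : ℕ) (hf : f ∈ planeGrading F a b i) :
    (n : MvPolynomial (Fin 2) F) * f ∈ planeGrading F a b i := by
  rw [← nsmul_eq_mul]
  exact nsmul_mem hf n

theorem component_mul (w : Fin 2 → ℤ) (f : MvPolynomial (Fin 2) F)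
    (hg : IsWeightedHomogeneous w g j) (n : ℤ) :
    weightedHomogeneousComponent w n (f * g) = weightedHomogeneousComponent w (n - j) f * g := by
  induction f using MvPolynomial.induction_on' with
  | add p q hp hq => simp only [add_mul, map_add, hp, hq]
  | monomial d r =>
    have h := isWeightedHomogeneous_monomial w d r rfl
    by_cases hd : Finsupp.weight w d = n - j
    · rw [hd] at h
      rw [weightedHomogeneousComponent_eq_self h]
      exact weightedHomogeneousComponent_eq_self (by simpa using h.mul hg)
    · rw [h.weightedHomogeneousComponent_ne _ (Ne.symm hd), zero_mul]
      exact (h.mul hg).weightedHomogeneousComponent_ne _ (by intro h; apply hd; omega)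

theorem component_pderiv (w : Fin 2 → ℤ) (f : MvPolynomial (Fin 2) F) (i : Fin 2) (n : ℤ) :
    weightedHomogeneousComponent w n (pderiv i f) =
      pderiv i (weightedHomogeneousComponent w (n + w i) f) := by
  induction f using MvPolynomial.induction_on' with
  | add p q hp hq => simp only [map_add, hp, hq]
  | monomial d r =>
    have h := isWeightedHomogeneous_monomial w d r rfl
    have h' : IsWeightedHomogeneous w (pderiv i (monomial d r)) (Finsupp.weight w d - w i) :=
      h.pderiv (by simp)
    by_cases hd : Finsupp.weight w d = n + w i
    · rw [hd] at h
      rw [weightedHomogeneousComponent_eq_self h]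
      exact weightedHomogeneousComponent_eq_self (by simpa [hd] using h')
    · rw [h.weightedHomogeneousComponent_ne _ (Ne.symm hd), map_zero]
      exact h'.weightedHomogeneousComponent_ne _ (by intro h; apply hd; omega)

theorem mem_planeGrading_of_mul_mem (hg : g ∈ planeGrading F a b j) (hg0 : g ≠ 0)
    (h : f * g ∈ planeGrading F a b i) : f ∈ planeGrading F a b (i - j) := by
  have h1 := weightedHomogeneousComponent_eq_self h
  rw [component_mul _ _ hg] at h1
  rw [← mul_right_cancel₀ hg0 h1]
  exact weightedHomogeneousComponent_mem _ _ _

/-- Coprimality to `0` would make `q` a unit, hence a nonzero constant, which has degree `0` and not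
`j`. -/
theorem pderiv_ne_zero_of_isRelPrime (hj : j ≠ 0) {q : MvPolynomial (Fin 2) F}
    (hq : q ∈ planeGrading F a b j) {p : MvPolynomial (Fin 2) F} (h : IsRelPrime p q) : p ≠ 0 := by
  rintro rfl
  rw [isRelPrime_zero_left] at h
  obtain ⟨c, hc, rfl⟩ := (MvPolynomial.isUnit_iff_eq_C_of_isReduced).1 h
  exact hj (IsWeightedHomogeneous.inj_right (by simpa using hc.ne_zero) hq
    (isWeightedHomogeneous_C _ _))

/-- The operator `α dX + β dY ↦ 2 P dω + dP ∧ ω`. -/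
noncomputable def twistedCurl (P : MvPolynomial (Fin 2) F) :
    MvPolynomial (Fin 2) F × MvPolynomial (Fin 2) F →ₗ[F] MvPolynomial (Fin 2) F where
  toFun ω := 2 * P * (pderiv 0 ω.2 - pderiv 1 ω.1) + (pderiv 0 P * ω.2 - pderiv 1 P * ω.1)
  map_add' ω η := by simp only [Prod.fst_add, Prod.snd_add, map_add]; ring
  map_smul' c ω := by
    simp only [Prod.smul_fst, Prod.smul_snd, smul_eq_C_mul, pderiv_C_mul, RingHom.id_apply]
    ring

theorem twistedCurl_apply (P α β : MvPolynomial (Fin 2) F) : twistedCurl P (α, β) =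
    2 * P * (pderiv 0 β - pderiv 1 α) + (pderiv 0 P * β - pderiv 1 P * α) := rfl

/-- The operator `f ↦ 2 P df + f dP`. -/
noncomputable def twistedGrad (P : MvPolynomial (Fin 2) F) :
    MvPolynomial (Fin 2) F →ₗ[F] MvPolynomial (Fin 2) F × MvPolynomial (Fin 2) F where
  toFun f := (2 * P * pderiv 0 f + f * pderiv 0 P, 2 * P * pderiv 1 f + f * pderiv 1 P)
  map_add' f g := by ext1 <;> simp only [Prod.fst_add, Prod.snd_add, map_add] <;> ring
  map_smul' c f := by
    ext1 <;> simp only [Prod.smul_fst, Prod.smul_snd, smul_eq_C_mul, pderiv_C_mul,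
      RingHom.id_apply] <;> ring

theorem twistedGrad_apply (P f : MvPolynomial (Fin 2) F) : twistedGrad P f =
    (2 * P * pderiv 0 f + f * pderiv 0 P, 2 * P * pderiv 1 f + f * pderiv 1 P) := rfl

theorem pderiv_comm' (f : MvPolynomial (Fin 2) F) :
    pderiv 1 (pderiv 0 f) = pderiv 0 (pderiv 1 f) := by
  induction f using MvPolynomial.induction_on' with
  | add p q hp hq => simp only [map_add, hp, hq]
  | monomial d r =>
    simp only [pderiv_monomial]
    rw [tsub_right_comm]
    simp only [Finsupp.tsub_apply]
    congr 1
    simp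
    ring

/-- The contraction of `g dX ∧ dY` with the Euler field. -/
noncomputable def eulerContraction (F : Type*) [Field F] (a b : ℕ) :
    MvPolynomial (Fin 2) F →ₗ[F] MvPolynomial (Fin 2) F × MvPolynomial (Fin 2) F where
  toFun g := (-((b : MvPolynomial (Fin 2) F) * (X 1 * g)), (a : MvPolynomial (Fin 2) F) * (X 0 * g))
  map_add' f g := by ext1 <;> simp only [Prod.fst_add, Prod.snd_add] <;> ring
  map_smul' c f := by
    ext1 <;> simp only [Prod.smul_fst, Prod.smul_snd, smul_eq_C_mul,
      RingHom.id_apply] <;> ring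

theorem eulerContraction_apply (g : MvPolynomial (Fin 2) F) : eulerContraction F a b g =
    (-((b : MvPolynomial (Fin 2) F) * (X 1 * g)), (a : MvPolynomial (Fin 2) F) * (X 0 * g)) := rfl

/-- `P` is weighted homogeneous of degree `2 h`, where `h = a + b - 2`, and its partial
derivatives have no common factor. -/
structure IsBranchPolynomial (a b h : ℕ) (P : MvPolynomial (Fin 2) F) : Prop where
  add_two : h + 2 = a + b
  two_le_left : 2 ≤ a
  two_le_right : 2 ≤ b
  mem : P ∈ planeGrading F a b (2 * h)
  isRelPrime : IsRelPrime (pderiv 0 P) (pderiv 1 P)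

variable {n : ℤ} {α β : MvPolynomial (Fin 2) F} {h : ℕ}

/-- Cartan's formula. Let `ω = α dX + β dY`, of weight `n`, and `z² = P`. The Lie derivative along
the Euler field multiplies `zω` by its weight `n + h`, which is zero in `F`. Hence `i_E d(zω) = -d(z
i_E ω)`, and multiplication by `2z` gives the claim. -/
theorem eulerContraction_twistedCurl (hP : P ∈ planeGrading F a b (2 * h))
    (hα : α ∈ planeGrading F a b (n - a)) (hβ : β ∈ planeGrading F a b (n - b))
    (hn : ((n + h : ℤ) : F) = 0) :
    eulerContraction F a b (twistedCurl P (α, β)) =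
      -twistedGrad P ((a : MvPolynomial (Fin 2) F) * (X 0 * α) + (b : MvPolynomial (Fin 2) F) * (X 1 * β)) := by
  have e1 := euler_planeGrading hP
  have e2 := euler_planeGrading hα
  have e3 := euler_planeGrading hβ
  have e4 : ((n : MvPolynomial (Fin 2) F) + h) = 0 := by
    have := congrArg (C : F →+* MvPolynomial (Fin 2) F) hn
    simpa using this
  push_cast at e1 e2 e3
  rw [eulerContraction_apply, twistedCurl_apply, twistedGrad_apply]
  ext1
  · simp only [map_add, pderiv_mul, Derivation.map_natCast, pderiv_X_self, Prod.fst_neg,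
      pderiv_X_of_ne (show (1 : Fin 2) ≠ 0 by simp)]
    linear_combination α * e1 + 2 * P * e2 + 2 * P * α * e4
  · simp only [map_add, pderiv_mul, Derivation.map_natCast, pderiv_X_self, Prod.snd_neg,
      pderiv_X_of_ne (show (0 : Fin 2) ≠ 1 by simp)]
    linear_combination β * e1 + 2 * P * e3 + 2 * P * β * e4

/-- The argument is `hω + d(i_E ω)`. Since a 3-form in the plane vanishes, `0 = i_E(dP ∧ dω) = 2hP
dω - dP ∧ i_E dω`, and `i_E dω = nω - d(i_E ω)`. Substituting this for `2hP dω` leaves `(n + h) dP ∧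
ω`. -/
theorem twistedCurl_eq (hP : P ∈ planeGrading F a b (2 * h))
    (hα : α ∈ planeGrading F a b (n - a)) (hβ : β ∈ planeGrading F a b (n - b)) :
    twistedCurl P ((h : MvPolynomial (Fin 2) F) * α +
          pderiv 0 ((a : MvPolynomial (Fin 2) F) * (X 0 * α) + (b : MvPolynomial (Fin 2) F) * (X 1 * β)),
        (h : MvPolynomial (Fin 2) F) * β +
          pderiv 1 ((a : MvPolynomial (Fin 2) F) * (X 0 * α) + (b : MvPolynomial (Fin 2) F) * (X 1 * β))) =
      ((n + h : ℤ) : MvPolynomial (Fin 2) F) * (pderiv 0 P * β - pderiv 1 P * α) := by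
  have e1 := euler_planeGrading hP
  have e2 := euler_planeGrading hα
  have e3 := euler_planeGrading hβ
  push_cast at e1 e2 e3
  rw [twistedCurl_apply]
  simp only [map_add, pderiv_mul, Derivation.map_natCast, pderiv_X_self,
      pderiv_X_of_ne (show (0 : Fin 2) ≠ 1 by simp), pderiv_X_of_ne (show (1 : Fin 2) ≠ 0 by simp),
      pderiv_comm', pderiv_one, map_zero]
  push_cast
  linear_combination (pderiv 1 α - pderiv 0 β) * e1 + (-pderiv 1 P) * e2 + pderiv 0 P * e3

/-- A 2-form of weight `n + 2h` has a coefficient of weight `n + 2h - (a + b) = n + h - 2`. -/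
theorem twistedCurl_mem (hab : h + 2 = a + b) (hP : P ∈ planeGrading F a b (2 * h))
    (hα : α ∈ planeGrading F a b (n - a)) (hβ : β ∈ planeGrading F a b (n - b)) :
    twistedCurl P (α, β) ∈ planeGrading F a b (n + h - 2) := by
  have hab' : (h : ℤ) = a + b - 2 := by omega
  rw [twistedCurl_apply, two_mul, add_mul]
  have h1 : P * (pderiv 0 β - pderiv 1 α) ∈ planeGrading F a b (n + h - 2) := by
    have h2 : pderiv 0 β - pderiv 1 α ∈ planeGrading F a b (n - b - a) := by
      refine sub_mem (pderiv_zero_mem hβ) ?_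
      have := pderiv_one_mem hα
      rwa [sub_right_comm] at this
    have := mul_mem_planeGrading hP h2
    rwa [show 2 * (h : ℤ) + (n - b - a) = n + h - 2 by omega] at this
  refine add_mem (add_mem h1 h1) (sub_mem ?_ ?_)
  · have := mul_mem_planeGrading (pderiv_zero_mem hP) hβ
    rwa [show 2 * (h : ℤ) - a + (n - b) = n + h - 2 by omega] at this
  · have := mul_mem_planeGrading (pderiv_one_mem hP) hα
    rwa [show 2 * (h : ℤ) - b + (n - a) = n + h - 2 by omega] at this

theorem component_twistedCurl (hab : h + 2 = a + b) (hP : P ∈ planeGrading F a b (2 * h))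
    (n : ℤ) (α β : MvPolynomial (Fin 2) F) :
    weightedHomogeneousComponent (planeWeights a b) (n + h - 2) (twistedCurl P (α, β)) =
      twistedCurl P (weightedHomogeneousComponent (planeWeights a b) (n - a) α,
        weightedHomogeneousComponent (planeWeights a b) (n - b) β) := by
  have hab' : (h : ℤ) = a + b - 2 := by omega
  have e : twistedCurl P (α, β) = (pderiv 0 β - pderiv 1 α) * P + (pderiv 0 β - pderiv 1 α) * P +
      β * pderiv 0 P - α * pderiv 1 P := by rw [twistedCurl_apply]; ring
  rw [e]
  simp only [map_add, map_sub, component_mul _ _ hP, component_mul _ _ (pderiv_zero_mem hP),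
    component_mul _ _ (pderiv_one_mem hP), component_pderiv]
  rw [twistedCurl_apply]
  simp only [Matrix.cons_val_zero, Matrix.cons_val_one]
  rw [show n + (h : ℤ) - 2 - 2 * h + a = n - b by omega,
    show n + (h : ℤ) - 2 - 2 * h + b = n - a by omega,
    show n + (h : ℤ) - 2 - (2 * h - a) = n - b by omega,
    show n + (h : ℤ) - 2 - (2 * h - b) = n - a by omega]
  ring

/-- The operator is homogeneous, so a preimage may be replaced by its component of the right weight.
-/
theorem exists_homogeneous_of_mem_range (hab : h + 2 = a + b)
    (hP : P ∈ planeGrading F a b (2 * h)) (hf : f ∈ planeGrading F a b (n + h - 2))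
    (hr : f ∈ LinearMap.range (twistedCurl P)) :
    ∃ α ∈ planeGrading F a b (n - a), ∃ β ∈ planeGrading F a b (n - b),
      f = twistedCurl P (α, β) := by
  obtain ⟨⟨α, β⟩, rfl⟩ := hr
  refine ⟨_, weightedHomogeneousComponent_mem _ α _, _, weightedHomogeneousComponent_mem _ β _, ?_⟩
  rw [← component_twistedCurl hab hP, weightedHomogeneousComponent_eq_self hf]

/-- The map `(u, v) ↦ u P_X + v P_Y`. -/
noncomputable def gradPairing (P : MvPolynomial (Fin 2) F) :
    MvPolynomial (Fin 2) F × MvPolynomial (Fin 2) F →ₗ[F] MvPolynomial (Fin 2) F :=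
  ((LinearMap.mulRight F (pderiv 0 P)).comp (LinearMap.fst F _ _)) +
    ((LinearMap.mulRight F (pderiv 1 P)).comp (LinearMap.snd F _ _))

theorem gradPairing_apply (P u v : MvPolynomial (Fin 2) F) :
    gradPairing P (u, v) = u * pderiv 0 P + v * pderiv 1 P := rfl

theorem finrank_map_add_finrank_inf_ker {V W : Type*} [AddCommGroup V] [Module F V]
    [AddCommGroup W] [Module F W] (φ : V →ₗ[F] W) (p : Submodule F V) [Module.Finite F p] :
    Module.finrank F (p.map φ) + Module.finrank F (p ⊓ LinearMap.ker φ : Submodule F V) =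
      Module.finrank F p := by
  have h1 := LinearMap.finrank_range_add_finrank_ker (φ.domRestrict p)
  rw [LinearMap.range_domRestrict] at h1
  rw [← h1, LinearMap.ker_domRestrict, ← Submodule.finrank_map_subtype_eq p,
    Submodule.map_comap_subtype]

/-- A product of subspaces is the product of the underlying spaces. -/
def prodSubmoduleEquiv {V W : Type*} [AddCommGroup V] [Module F V]
    [AddCommGroup W] [Module F W] (p : Submodule F V) (q : Submodule F W) :
    (p.prod q) ≃ₗ[F] p × q where
  toFun x := (⟨x.1.1, x.2.1⟩, ⟨x.1.2, x.2.2⟩)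
  invFun x := ⟨(x.1.1, x.2.1), x.1.2, x.2.2⟩
  map_add' _ _ := rfl
  map_smul' _ _ := rfl

theorem finrank_prod_submodule {V W : Type*} [AddCommGroup V] [Module F V]
    [AddCommGroup W] [Module F W] (p : Submodule F V) (q : Submodule F W)
    [Module.Finite F p] [Module.Finite F q] :
    Module.finrank F (p.prod q) = Module.finrank F p + Module.finrank F q := by
  rw [LinearEquiv.finrank_eq (prodSubmoduleEquiv p q), Module.finrank_prod]

namespace IsBranchPolynomial

theorem pderiv_zero_ne_zero (hP : IsBranchPolynomial a b h P) : pderiv 0 P ≠ 0 :=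
  pderiv_ne_zero_of_isRelPrime (by have := hP.add_two; have := hP.two_le_left; have := hP.two_le_right; omega)
    (pderiv_one_mem hP.mem) hP.isRelPrime

theorem pderiv_one_ne_zero (hP : IsBranchPolynomial a b h P) : pderiv 1 P ≠ 0 :=
  pderiv_ne_zero_of_isRelPrime (by have := hP.add_two; have := hP.two_le_left; have := hP.two_le_right; omega)
    (pderiv_zero_mem hP.mem) hP.isRelPrime.symm

theorem left_pos (hP : IsBranchPolynomial a b h P) : 0 < a := by have := hP.two_le_left; omega

theorem right_pos (hP : IsBranchPolynomial a b h P) : 0 < b := by have := hP.two_le_right; omega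

theorem ne_zero (hP : IsBranchPolynomial a b h P) : P ≠ 0 := by
  rintro rfl
  exact hP.pderiv_zero_ne_zero (map_zero _)

/-- This is the degree `m` part of the Jacobian ideal. Because `P_X` and `P_Y` are coprime, their
only relations are the multiples of the Koszul relation, which are parametrized by polynomials of
weight `m - (4h - a - b)`. -/
theorem finrank_map_gradPairing (hP : IsBranchPolynomial a b h P) (m : ℤ) :
    Module.finrank F (((planeGrading F a b (m - (2 * h - a))).prod
        (planeGrading F a b (m - (2 * h - b)))).map (gradPairing P)) +
        weightCount a b (m - (4 * h - a - b)) =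
      weightCount a b (m - (2 * h - a)) + weightCount a b (m - (2 * h - b)) := by
  have h0 := hP.pderiv_zero_ne_zero
  have h1 := hP.pderiv_one_ne_zero
  have f1 := finite_planeGrading (F := F) hP.left_pos hP.right_pos (m - (2 * h - a))
  have f2 := finite_planeGrading (F := F) hP.left_pos hP.right_pos (m - (2 * h - b))
  have f3 : Module.Finite F ((planeGrading F a b (m - (2 * h - a))).prod
      (planeGrading F a b (m - (2 * h - b)))) :=
    Module.Finite.equiv (prodSubmoduleEquiv _ _).symm
  rw [← finrank_planeGrading (F := F) a b (m - (2 * h - a)),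
    ← finrank_planeGrading (F := F) a b (m - (2 * h - b)), ← finrank_prod_submodule,
    ← finrank_map_add_finrank_inf_ker (gradPairing P), add_right_inj,
    ← finrank_planeGrading (F := F)]
  -- The Koszul map onto the relations `u P_X + v P_Y = 0`.
  obtain ⟨ψ, hψ⟩ : ∃ ψ : MvPolynomial (Fin 2) F →ₗ[F] MvPolynomial (Fin 2) F × MvPolynomial (Fin 2) F,
      ∀ t, ψ t = (-(t * pderiv 1 P), t * pderiv 0 P) :=
    ⟨(-LinearMap.mulRight F (pderiv 1 P)).prod (LinearMap.mulRight F (pderiv 0 P)), fun t => rfl⟩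
  have hinj : Function.Injective ψ := by
    intro s t hst
    rw [hψ, hψ, Prod.mk.injEq] at hst
    exact mul_right_cancel₀ h0 hst.2
  rw [LinearEquiv.finrank_eq (Submodule.equivMapOfInjective ψ hinj (planeGrading F a b _))]
  refine congrArg (fun q : Submodule F (MvPolynomial (Fin 2) F × MvPolynomial (Fin 2) F) =>
    Module.finrank F q) ?_
  ext ⟨u, v⟩
  simp only [Submodule.mem_map, Submodule.mem_inf, Submodule.mem_prod, LinearMap.mem_ker, hψ,
    gradPairing_apply, Prod.mk.injEq]
  constructor
  · rintro ⟨t, ht, rfl, rfl⟩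
    refine ⟨⟨?_, ?_⟩, by ring⟩
    · have := neg_mem (mul_mem_planeGrading ht (pderiv_one_mem hP.mem))
      rwa [show m - (4 * (h : ℤ) - a - b) + (2 * h - b) = m - (2 * h - a) by ring] at this
    · have := mul_mem_planeGrading ht (pderiv_zero_mem hP.mem)
      rwa [show m - (4 * (h : ℤ) - a - b) + (2 * h - a) = m - (2 * h - b) by ring] at this
  · rintro ⟨⟨hu, hv⟩, huv⟩
    have hd : pderiv 0 P ∣ v := by
      refine hP.isRelPrime.dvd_of_dvd_mul_right ⟨-u, ?_⟩
      linear_combination huv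
    obtain ⟨t, rfl⟩ := hd
    refine ⟨t, ?_, ?_, mul_comm _ _⟩
    · rw [mul_comm (pderiv 0 P) t] at hv
      have := mem_planeGrading_of_mul_mem (pderiv_zero_mem hP.mem) h0 hv
      rwa [show m - (2 * (h : ℤ) - b) - (2 * h - a) = m - (4 * h - a - b) by ring] at this
    · refine mul_right_cancel₀ h0 ?_
      linear_combination -huv

/-- `P` divides `gcd (f P_X) (f P_Y)`, which is associated to `f * gcd P_X P_Y`, that is, to `f`. -/
theorem dvd_of_dvd_mul_pderiv (hP : IsBranchPolynomial a b h P)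
    (h0 : P ∣ f * pderiv 0 P) (h1 : P ∣ f * pderiv 1 P) : P ∣ f := by
  let d : NormalizedGCDMonoid (MvPolynomial (Fin 2) F) := Classical.arbitrary _
  have h2 := dvd_gcd h0 h1
  have h3 : IsUnit (gcd (pderiv 0 P) (pderiv 1 P)) :=
    hP.isRelPrime (gcd_dvd_left _ _) (gcd_dvd_right _ _)
  exact (h2.trans (gcd_mul_left' f _ _).dvd).trans ((associated_mul_unit_left _ _ h3).dvd)

/-- The image of the twisted curl lies in the Jacobian ideal because `P` does, by Euler's identity.
Conversely `twistedCurl_eq` writes `(n + h)` times any element of the ideal as a twisted curl, and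
`n + h = m + 2` is invertible. -/
theorem map_twistedCurl_inf (hP : IsBranchPolynomial a b h P) (hph : (h : F) ≠ 0) {m : ℤ} (hm : ((m + 2 : ℤ) : F) ≠ 0) :
    planeGrading F a b m ⊓ LinearMap.range (twistedCurl P) =
      ((planeGrading F a b (m - (2 * h - a))).prod
        (planeGrading F a b (m - (2 * h - b)))).map (gradPairing P) := by
  have hab := hP.add_two
  ext f
  simp only [Submodule.mem_inf, Submodule.mem_map, Submodule.mem_prod]
  constructor
  · rintro ⟨hf, hr⟩
    obtain ⟨n, rfl⟩ : ∃ n : ℤ, m = n + h - 2 := ⟨m + 2 - h, by ring⟩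
    obtain ⟨α, hα, β, hβ, rfl⟩ := exists_homogeneous_of_mem_range hab hP.mem hf hr
    have e := euler_planeGrading hP.mem
    have e0 : C (h : F)⁻¹ * (h : MvPolynomial (Fin 2) F) = 1 := by
      rw [← map_natCast (C (σ := Fin 2) (R := F)), ← C_mul, inv_mul_cancel₀ hph, C_1]
    set c := C (σ := Fin 2) (h : F)⁻¹ with hc
    set γ := pderiv 0 β - pderiv 1 α with hγ
    have hγm : c * γ ∈ planeGrading F a b (n - b - a) := by
      refine IsWeightedHomogeneous.C_mul (sub_mem (pderiv_zero_mem hβ) ?_) _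
      have := pderiv_one_mem hα
      rwa [sub_right_comm] at this
    -- By Euler's identity the term `2Pγ` equals `h⁻¹ γ (a X P_X + b Y P_Y)`.
    refine ⟨((a : MvPolynomial (Fin 2) F) * (X 0 * (c * γ)) + β,
      (b : MvPolynomial (Fin 2) F) * (X 1 * (c * γ)) - α), ⟨?_, ?_⟩, ?_⟩
    · rw [show n + (h : ℤ) - 2 - (2 * h - a) = n - b by omega]
      refine add_mem (natCast_mul_mem _ ?_) hβ
      have := mul_mem_planeGrading X_zero_mem hγm
      rwa [show (a : ℤ) + (n - b - a) = n - b by ring] at this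
    · rw [show n + (h : ℤ) - 2 - (2 * h - b) = n - a by omega]
      refine sub_mem (natCast_mul_mem _ ?_) hα
      have := mul_mem_planeGrading X_one_mem hγm
      rwa [show (b : ℤ) + (n - b - a) = n - a by ring] at this
    · rw [gradPairing_apply, twistedCurl_apply]
      push_cast at e
      linear_combination c * γ * e + 2 * P * γ * e0
  · rintro ⟨⟨u, v⟩, ⟨hu, hv⟩, rfl⟩
    rw [gradPairing_apply]
    refine ⟨add_mem ?_ ?_, ?_⟩
    · have := mul_mem_planeGrading hu (pderiv_zero_mem hP.mem)
      rwa [sub_add_cancel] at this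
    · have := mul_mem_planeGrading hv (pderiv_one_mem hP.mem)
      rwa [sub_add_cancel] at this
    · obtain ⟨n, rfl⟩ : ∃ n : ℤ, m = n + h - 2 := ⟨m + 2 - h, by ring⟩
      have h3 := twistedCurl_eq (n := n) (α := -v) (β := u) hP.mem (neg_mem ?_) ?_
      · rw [show n + (h : ℤ) - 2 + 2 = n + h by ring] at hm
        have e0 : C ((n + h : ℤ) : F)⁻¹ * ((n + h : ℤ) : MvPolynomial (Fin 2) F) = 1 := by
          rw [← map_intCast (C (σ := Fin 2) (R := F)), ← C_mul, inv_mul_cancel₀ hm, C_1]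
        have h4 : u * pderiv 0 P + v * pderiv 1 P = ((n + h : ℤ) : F)⁻¹ •
            (((n + h : ℤ) : MvPolynomial (Fin 2) F) * (pderiv 0 P * u - pderiv 1 P * -v)) := by
          rw [smul_eq_C_mul]
          linear_combination (-(u * pderiv 0 P + v * pderiv 1 P)) * e0
        rw [h4, ← h3]
        exact Submodule.smul_mem _ _ ⟨_, rfl⟩
      · rwa [show n + (h : ℤ) - 2 - (2 * h - b) = n - a by omega] at hv
      · rwa [show n + (h : ℤ) - 2 - (2 * h - a) = n - b by omega] at hu

theorem finrank_inf_range_of_ne (hP : IsBranchPolynomial a b h P) (hph : (h : F) ≠ 0) {m : ℤ} (hm : ((m + 2 : ℤ) : F) ≠ 0) :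
    Module.finrank F (planeGrading F a b m ⊓ LinearMap.range (twistedCurl P) : Submodule F _) +
        weightCount a b (m - (4 * h - a - b)) =
      weightCount a b (m - (2 * h - a)) + weightCount a b (m - (2 * h - b)) := by
  rw [hP.map_twistedCurl_inf hph hm, hP.finrank_map_gradPairing]

end IsBranchPolynomial

end Plane

/-! ### The plane in characteristic `p`: weights divisible by `p`, and exact 2-forms. -/

section PlaneCharP

open MvPolynomial

variable {F : Type*} [Field F] {a b h : ℕ} {f g P : MvPolynomial (Fin 2) F}
  {p : ℕ} [CharP F p]

theorem pderiv_eq_zero_iff {σ : Type*} (i : σ) (f : MvPolynomial σ F) :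
    pderiv i f = 0 ↔ ∀ d, coeff d f ≠ 0 → p ∣ d i := by
  classical
  constructor
  · intro hf d hd
    by_contra hpd
    have h0 : d i ≠ 0 := by rintro h; simp [h] at hpd
    have h1 := coeff_pderiv (i := i) f (d - Finsupp.single i 1)
    rw [hf, coeff_zero, Finsupp.sub_add_single_one_cancel h0] at h1
    have h2 : (((d - Finsupp.single i 1 : σ →₀ ℕ) i : ℕ) : F) + 1 = (d i : ℕ) := by
      rw [← Nat.cast_add_one]; congr 1; simp; omega
    rw [h2] at h1
    rcases mul_eq_zero.1 h1.symm with h3 | h3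
    · exact hd h3
    · exact hpd ((CharP.cast_eq_zero_iff F p _).1 h3)
  · intro hf
    ext d
    rw [coeff_pderiv, coeff_zero]
    by_cases hd : coeff (d + Finsupp.single i 1) f = 0
    · rw [hd, zero_mul]
    · have := (CharP.cast_eq_zero_iff F p _).2 (hf _ hd)
      simp at this
      rw [this, mul_zero]

/-- The weighted homogeneous polynomials with vanishing differential. -/
noncomputable def pthPowers (F : Type*) [Field F] (a b : ℕ) (j : ℤ) :
    Submodule F (MvPolynomial (Fin 2) F) :=
  planeGrading F a b j ⊓
    (LinearMap.ker (pderiv (R := F) (0 : Fin 2)).toLinearMap ⊓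
      LinearMap.ker (pderiv (R := F) (1 : Fin 2)).toLinearMap)

theorem mem_pthPowers {j : ℤ} : f ∈ pthPowers F a b j ↔
    f ∈ planeGrading F a b j ∧ pderiv 0 f = 0 ∧ pderiv 1 f = 0 := Iff.rfl

/-- A polynomial with vanishing differential is a polynomial in `X ^ p` and `Y ^ p`. Its
coefficients are arbitrary, so `F` need not be perfect, and dividing the exponents by `p` divides
the weight by `p`. -/
theorem finrank_pthPowers (hp : p.Prime) (k : ℤ) :
    Module.finrank F (pthPowers F a b (p * k)) = weightCount a b k := by
  have h1 : pthPowers F a b (p * k) = restrictSupport F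
      {d | Finsupp.weight (planeWeights a b) d = p * k ∧ p ∣ d 0 ∧ p ∣ d 1} := by
    ext f
    rw [mem_pthPowers, pderiv_eq_zero_iff (p := p), pderiv_eq_zero_iff (p := p),
      mem_restrictSupport_iff]
    simp only [mem_weightedHomogeneousSubmodule, IsWeightedHomogeneous, Set.subset_def,
      Finset.mem_coe, mem_support_iff, Set.mem_ofPred_eq]
    exact ⟨fun h d hd => ⟨h.1 hd, h.2.1 d hd, h.2.2 d hd⟩,
      fun h => ⟨fun d hd => (h d hd).1, fun d hd => (h d hd).2.1, fun d hd => (h d hd).2.2⟩⟩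
  rw [h1, finrank_restrictSupport, weightCount]
  symm
  have hp0 : (p : ℤ) ≠ 0 := by exact_mod_cast hp.ne_zero
  refine Nat.card_eq_of_bijective (fun d => ⟨p • d.1, ?_⟩) ⟨?_, ?_⟩
  · refine ⟨?_, by simp, by simp⟩
    have := d.2
    simp only [Set.mem_ofPred_eq] at this
    rw [map_nsmul, this, nsmul_eq_mul]
  · rintro ⟨d, hd⟩ ⟨e, he⟩ hde
    simp only [Subtype.mk.injEq] at hde ⊢
    ext i
    have := DFunLike.congr_fun hde i
    simpa [hp.ne_zero] using this
  · rintro ⟨d, hd, ⟨x, hx⟩, ⟨y, hy⟩⟩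
    have hd' : d = p • (Finsupp.equivFunOnFinite.symm ![x, y] : Fin 2 →₀ ℕ) := by
      ext i
      fin_cases i
      · simpa using hx
      · simpa using hy
    refine ⟨⟨Finsupp.equivFunOnFinite.symm ![x, y], ?_⟩, ?_⟩
    · rw [hd', map_nsmul, nsmul_eq_mul] at hd
      exact mul_left_cancel₀ hp0 hd
    · simp only [Subtype.mk.injEq]
      exact hd'.symm

namespace IsBranchPolynomial

/-- If `2P dg + (2i + 1) g dP = 0` with `2i + 1` invertible, then `P` divides `g dP` and hence `g`.
Writing `g = P q` and cancelling `P` gives the same equation with `2i + 3`, so the descent continues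
while the odd coefficient stays below `p`. -/
theorem exists_pow_mul_of_twistedGrad_eq_zero (hP : IsBranchPolynomial a b h P)
    (hf : twistedGrad P f = 0) (i : ℕ) (hi : 2 * i < p) :
    ∃ g, f = P ^ i * g ∧ 2 * P * pderiv 0 g + ((2 * i + 1 : ℕ) : MvPolynomial (Fin 2) F) *
      (g * pderiv 0 P) = 0 ∧ 2 * P * pderiv 1 g + ((2 * i + 1 : ℕ) : MvPolynomial (Fin 2) F) *
      (g * pderiv 1 P) = 0 := by
  induction i with
  | zero =>
    rw [twistedGrad_apply, Prod.mk_eq_zero] at hf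
    exact ⟨f, by simp, by simpa using hf.1, by simpa using hf.2⟩
  | succ i ih =>
    obtain ⟨g, rfl, h0, h1⟩ := ih (by omega)
    have hc : ((2 * i + 1 : ℕ) : F) ≠ 0 := by
      rw [Ne, CharP.cast_eq_zero_iff F p]
      intro hd
      have := Nat.le_of_dvd (by omega) hd
      omega
    have e0 : C ((2 * i + 1 : ℕ) : F)⁻¹ * ((2 * i + 1 : ℕ) : MvPolynomial (Fin 2) F) = 1 := by
      rw [← map_natCast (C (σ := Fin 2) (R := F)), ← C_mul, inv_mul_cancel₀ hc, C_1]
    obtain ⟨q, rfl⟩ : P ∣ g := by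
      refine hP.dvd_of_dvd_mul_pderiv ⟨-C ((2 * i + 1 : ℕ) : F)⁻¹ * 2 * pderiv 0 g, ?_⟩
        ⟨-C ((2 * i + 1 : ℕ) : F)⁻¹ * 2 * pderiv 1 g, ?_⟩
      · linear_combination (-(g * pderiv 0 P)) * e0 + C ((2 * i + 1 : ℕ) : F)⁻¹ * h0
      · linear_combination (-(g * pderiv 1 P)) * e0 + C ((2 * i + 1 : ℕ) : F)⁻¹ * h1
    refine ⟨q, by ring, mul_left_cancel₀ hP.ne_zero ?_, mul_left_cancel₀ hP.ne_zero ?_⟩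
    · rw [pderiv_mul] at h0
      push_cast at h0 ⊢
      linear_combination h0
    · rw [pderiv_mul] at h1
      push_cast at h1 ⊢
      linear_combination h1

/-- After `N = (p - 1) / 2` divisions by `P` the coefficient becomes `2N + 1 = p = 0` and the
equation reads `2P dg = 0`. Thus the kernel is `P ^ N` times the polynomials in `X ^ p, Y ^ p`, and
removing `P ^ N` lowers the weight `pk - h` to `p (k - h)`. -/
theorem finrank_ker_twistedGrad (hp : p.Prime) (hp2 : p ≠ 2) (hP : IsBranchPolynomial a b h P)
    (k : ℤ) :
    Module.finrank F (planeGrading F a b (p * k - h) ⊓ LinearMap.ker (twistedGrad P) :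
      Submodule F _) = weightCount a b (k - h) := by
  obtain ⟨N, hN⟩ : ∃ N, p = 2 * N + 1 := hp.odd_of_ne_two hp2
  have h2 : (2 : MvPolynomial (Fin 2) F) ≠ 0 := by
    intro h2
    have : ((2 : ℕ) : F) = 0 := by
      refine C_injective (Fin 2) F ?_
      rw [map_natCast, C_0]
      exact_mod_cast h2
    rw [CharP.cast_eq_zero_iff F p] at this
    exact hp2 ((Nat.prime_dvd_prime_iff_eq hp Nat.prime_two).1 this)
  have hp0 : (p : MvPolynomial (Fin 2) F) = 0 := by
    rw [← map_natCast (C (σ := Fin 2) (R := F)), CharP.cast_eq_zero, C_0]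
  have hPN : P ^ N ≠ 0 := pow_ne_zero _ hP.ne_zero
  have hPNm : P ^ N ∈ planeGrading F a b (h * (p - 1)) := by
    have := IsWeightedHomogeneous.pow hP.mem N
    rw [show N • (2 * (h : ℤ)) = h * (p - 1) by rw [hN]; push_cast; simp; ring] at this
    exact this
  have hinj : Function.Injective (LinearMap.mulRight F (P ^ N)) :=
    fun x y hxy => mul_right_cancel₀ hPN hxy
  rw [← finrank_pthPowers (F := F) hp, LinearEquiv.finrank_eq
    (Submodule.equivMapOfInjective _ hinj (pthPowers F a b (p * (k - h))))]
  refine congrArg (fun q : Submodule F (MvPolynomial (Fin 2) F) => Module.finrank F q) ?_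
  ext f
  simp only [Submodule.mem_inf, LinearMap.mem_ker, Submodule.mem_map, LinearMap.mulRight_apply,
    mem_pthPowers]
  constructor
  · rintro ⟨hf, hker⟩
    obtain ⟨g, rfl, h0, h1⟩ := hP.exists_pow_mul_of_twistedGrad_eq_zero hker N (by omega)
    rw [← hN, hp0, zero_mul, add_zero] at h0 h1
    refine ⟨g, ⟨?_, ?_, ?_⟩, mul_comm _ _⟩
    · rw [mul_comm (P ^ N) g] at hf
      have := mem_planeGrading_of_mul_mem hPNm hPN hf
      rwa [show (p : ℤ) * k - h - h * (p - 1) = p * (k - h) by ring] at this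
    · exact (mul_eq_zero.1 h0).resolve_left (mul_ne_zero h2 hP.ne_zero)
    · exact (mul_eq_zero.1 h1).resolve_left (mul_ne_zero h2 hP.ne_zero)
  · rintro ⟨g, ⟨hg, h0, h1⟩, rfl⟩
    refine ⟨?_, ?_⟩
    · have := mul_mem_planeGrading hg hPNm
      rwa [show (p : ℤ) * (k - h) + h * (p - 1) = p * k - h by ring] at this
    · have h3 : P * (N * P ^ (N - 1)) = (N : MvPolynomial (Fin 2) F) * P ^ N := by
        rcases N with _ | N
        · simp
        · simp [pow_succ]; ring
      have h4 : 2 * (N : MvPolynomial (Fin 2) F) + 1 = 0 := by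
        rw [← hp0, hN]; push_cast; ring
      rw [twistedGrad_apply, pderiv_mul, pderiv_mul, pderiv_pow, pderiv_pow, h0, h1, Prod.mk_eq_zero]
      constructor
      · linear_combination 2 * g * pderiv 0 P * h3 + g * P ^ N * pderiv 0 P * h4
      · linear_combination 2 * g * pderiv 1 P * h3 + g * P ^ N * pderiv 1 P * h4

/-- By `eulerContraction_twistedCurl` contraction turns the curl of `ω` into minus the gradient of
`i_E ω`. Every `f` of weight `n` is of the form `i_E ω`, with `ω = n⁻¹ df`, because `n ≠ 0` in `F`.
-/
theorem map_eulerContraction (hP : IsBranchPolynomial a b h P) {n : ℤ}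
    (hn : ((n + h : ℤ) : F) = 0) (hn0 : (n : F) ≠ 0) :
    (planeGrading F a b (n + h - 2) ⊓ LinearMap.range (twistedCurl P)).map
        (eulerContraction F a b) = (planeGrading F a b n).map (twistedGrad P) := by
  ext x
  simp only [Submodule.mem_map, Submodule.mem_inf]
  constructor
  · rintro ⟨f, ⟨hf, hr⟩, rfl⟩
    obtain ⟨α, hα, β, hβ, rfl⟩ := exists_homogeneous_of_mem_range hP.add_two hP.mem hf hr
    refine ⟨-((a : MvPolynomial (Fin 2) F) * (X 0 * α) + (b : MvPolynomial (Fin 2) F) * (X 1 * β)),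
      ?_, ?_⟩
    rotate_left
    · rw [eulerContraction_twistedCurl hP.mem hα hβ hn, ← map_neg]
    · refine neg_mem (add_mem (natCast_mul_mem _ ?_) (natCast_mul_mem _ ?_))
      · simpa using mul_mem_planeGrading X_zero_mem hα
      · simpa using mul_mem_planeGrading X_one_mem hβ
  · rintro ⟨f, hf, rfl⟩
    have hα : -((n : F)⁻¹ • pderiv 0 f) ∈ planeGrading F a b (n - a) :=
      neg_mem (Submodule.smul_mem _ _ (pderiv_zero_mem hf))
    have hβ : -((n : F)⁻¹ • pderiv 1 f) ∈ planeGrading F a b (n - b) :=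
      neg_mem (Submodule.smul_mem _ _ (pderiv_one_mem hf))
    refine ⟨_, ⟨twistedCurl_mem hP.add_two hP.mem hα hβ, ⟨_, rfl⟩⟩, ?_⟩
    rw [eulerContraction_twistedCurl hP.mem hα hβ hn, ← map_neg]
    congr 1
    have e := euler_planeGrading hf
    have e0 : C (n : F)⁻¹ * (n : MvPolynomial (Fin 2) F) = 1 := by
      rw [← map_intCast (C (σ := Fin 2) (R := F)), ← C_mul, inv_mul_cancel₀ hn0, C_1]
    simp only [smul_eq_C_mul]
    linear_combination C (n : F)⁻¹ * e + f * e0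

/-- Rank-nullity for the twisted gradient in weight `n = pk - h`. Here `n + h` is zero and `n = -h`
is nonzero in `F`. Contraction with the Euler field is injective because `0 < a ≤ h < p`. -/
theorem finrank_inf_range_of_eq (hp : p.Prime) (hph : h < p) (hP : IsBranchPolynomial a b h P)
    {m k : ℤ} (hm : m + 2 = p * k) :
    Module.finrank F (planeGrading F a b m ⊓ LinearMap.range (twistedCurl P) : Submodule F _) +
        weightCount a b (k - h) = weightCount a b (p * k - h) := by
  have hab := hP.add_two
  have ha2 := hP.two_le_left
  have hb2 := hP.two_le_right
  have hf := finite_planeGrading (F := F) hP.left_pos hP.right_pos (p * k - h)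
  have hpa : (a : F) ≠ 0 := by
    rw [Ne, CharP.cast_eq_zero_iff F p]
    intro hd
    have := Nat.le_of_dvd (by omega) hd
    omega
  have hph' : (h : F) ≠ 0 := by
    rw [Ne, CharP.cast_eq_zero_iff F p]
    intro hd
    have := Nat.le_of_dvd (by omega) hd
    omega
  have hinj : Function.Injective (eulerContraction F a b) := by
    intro x y hxy
    rw [eulerContraction_apply, eulerContraction_apply, Prod.mk.injEq] at hxy
    have h3 : (a : MvPolynomial (Fin 2) F) ≠ 0 := by
      rw [← map_natCast (C (σ := Fin 2) (R := F))]
      exact fun h => hpa (C_injective _ _ (by simpa using h))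
    exact mul_left_cancel₀ (X_ne_zero 0) (mul_left_cancel₀ h3 hxy.2)
  rw [← finrank_planeGrading (F := F) a b (p * k - h),
    ← finrank_map_add_finrank_inf_ker (twistedGrad P) (planeGrading F a b (p * k - h)),
    hP.finrank_ker_twistedGrad hp (by omega), add_left_inj,
    ← hP.map_eulerContraction (n := p * k - h), show (p : ℤ) * k - h + h - 2 = m by omega]
  · exact LinearEquiv.finrank_eq (Submodule.equivMapOfInjective _ hinj
      (planeGrading F a b m ⊓ LinearMap.range (twistedCurl P)))
  · simp
  · simpa using hph'

end IsBranchPolynomial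

/-- The span of all brackets `{f, g}` in two variables. -/
noncomputable def planeBracketSpan (F : Type*) [Field F] : Submodule F (MvPolynomial (Fin 2) F) :=
  Submodule.span F {q | ∃ f g : MvPolynomial (Fin 2) F, q = planeBracket f g}

theorem planeBracket_eq (f g : MvPolynomial (Fin 2) F) :
    planeBracket f g = pderiv 0 (f * pderiv 1 g) - pderiv 1 (f * pderiv 0 g) := by
  rw [pderiv_mul, pderiv_mul, pderiv_comm', planeBracket]
  ring

/-- Brackets are the coefficients of exact forms `df ∧ dg = d(f dg)`, and a derivative with respect
to `X` has no term whose `X`-exponent is `-1` modulo `p`. If one exponent of a monomial is not `-1`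
modulo `p`, the monomial can be integrated in that variable and becomes a bracket with the other
variable. -/
theorem planeBracketSpan_eq : planeBracketSpan F =
    restrictSupport F {d : Fin 2 →₀ ℕ | ¬ (p ∣ d 0 + 1 ∧ p ∣ d 1 + 1)} := by
  apply le_antisymm
  · refine Submodule.span_le.2 ?_
    rintro _ ⟨f, g, rfl⟩ d hd
    replace hd : coeff d (planeBracket f g) ≠ 0 := mem_support_iff.1 hd
    rintro ⟨h0, h1⟩
    apply hd
    have h0' := (CharP.cast_eq_zero_iff F p _).2 h0
    have h1' := (CharP.cast_eq_zero_iff F p _).2 h1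
    push_cast at h0' h1'
    rw [planeBracket_eq, coeff_sub, coeff_pderiv, coeff_pderiv, h0', h1']
    simp
  · rw [restrictSupport_eq_span, Submodule.span_le]
    rintro _ ⟨d, hd, rfl⟩
    have key : ∀ i : Fin 2, ¬ p ∣ d i + 1 →
        (monomial d (1 : F)) = ((d i + 1 : ℕ) : F)⁻¹ • pderiv i (monomial (d + Finsupp.single i 1) 1) := by
      intro i hi
      rw [pderiv_monomial, add_tsub_cancel_right, smul_monomial]
      congr 1
      have : ((d i + 1 : ℕ) : F) ≠ 0 := by rwa [Ne, CharP.cast_eq_zero_iff F p]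
      simp only [Finsupp.add_apply, Finsupp.single_eq_same, one_mul, smul_eq_mul]
      rw [inv_mul_cancel₀ this]
    simp only [Set.mem_ofPred_eq, not_and_or] at hd
    rcases hd with hd | hd
    · change monomial d (1 : F) ∈ _
      rw [key 0 hd]
      refine Submodule.smul_mem _ _ (Submodule.subset_span
        ⟨monomial (d + Finsupp.single 0 1) 1, X 1, ?_⟩)
      simp [planeBracket, pderiv_X]
    · change monomial d (1 : F) ∈ _
      rw [key 1 hd]
      refine Submodule.smul_mem _ _ (Submodule.subset_span
        ⟨X 0, monomial (d + Finsupp.single 1 1) 1, ?_⟩)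
      simp [planeBracket, pderiv_X]

theorem finrank_inf_planeBracketSpan (ha : 0 < a) (hb : 0 < b) (j : ℤ) :
    Module.finrank F (planeGrading F a b j ⊓ planeBracketSpan F : Submodule F _) +
      Nat.card {d : Fin 2 →₀ ℕ | Finsupp.weight (planeWeights a b) d = j ∧
        p ∣ d 0 + 1 ∧ p ∣ d 1 + 1} = weightCount a b j := by
  have h1 : planeGrading F a b j ⊓ planeBracketSpan F = restrictSupport F
      ({d | Finsupp.weight (planeWeights a b) d = j} \
        {d | Finsupp.weight (planeWeights a b) d = j ∧ p ∣ d 0 + 1 ∧ p ∣ d 1 + 1}) := by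
    rw [planeBracketSpan_eq (p := p), planeGrading_eq_restrictSupport]
    ext f
    simp only [Submodule.mem_inf, mem_restrictSupport_iff, Set.subset_def, Finset.mem_coe,
      mem_support_iff, Set.mem_ofPred_eq, Set.mem_sdiff]
    exact ⟨fun h d hd => ⟨h.1 d hd, fun h' => h.2 d hd h'.2⟩,
      fun h => ⟨fun d hd => (h d hd).1, fun d hd h' => (h d hd).2 ⟨(h d hd).1, h'⟩⟩⟩
  rw [h1, finrank_restrictSupport, weightCount, Nat.card_coe_set_eq, Nat.card_coe_set_eq,
    Nat.card_coe_set_eq]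
  exact Set.ncard_sdiff_add_ncard_of_subset (fun d hd => hd.1) (finite_weight_eq ha hb j)

/-- The exponents in question are `p e + (p - 1, p - 1)`. If `e` has weight `j`, this has weight `p
j + (p - 1)(h + 2)`, which equals `pk - 2 - h` exactly for `j = k - 2 - h`. -/
theorem card_weight_eq_of_dvd (hp : p.Prime) (hab : h + 2 = a + b) {m k : ℤ}
    (hm : m + 2 = p * k) :
    Nat.card {d : Fin 2 →₀ ℕ | Finsupp.weight (planeWeights a b) d = m - h ∧
        p ∣ d 0 + 1 ∧ p ∣ d 1 + 1} = weightCount a b (k - 2 - h) := by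
  symm
  have hp0 : (p : ℤ) ≠ 0 := by exact_mod_cast hp.ne_zero
  have hp1 : ((p - 1 : ℕ) : ℤ) = p - 1 := by have := hp.one_le; omega
  have hab' : (h : ℤ) = a + b - 2 := by omega
  have hp1' := hp.one_le
  refine Nat.card_eq_of_bijective (fun d => ⟨p • d.1 +
    Finsupp.equivFunOnFinite.symm (fun _ => p - 1), ?_⟩) ⟨?_, ?_⟩
  · refine ⟨?_, ?_, ?_⟩
    · have := d.2
      simp only [Set.mem_ofPred_eq, weight_planeWeights] at this ⊢
      simp only [Finsupp.add_apply, Finsupp.smul_apply, smul_eq_mul,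
        Finsupp.equivFunOnFinite_symm_apply_apply]
      push_cast [hp1]
      linear_combination (p : ℤ) * this - hm + (1 - p) * hab'
    · exact ⟨d.1 0 + 1, by simp; rw [mul_add]; omega⟩
    · exact ⟨d.1 1 + 1, by simp; rw [mul_add]; omega⟩
  · rintro ⟨d, hd⟩ ⟨e, he⟩ hde
    simp only [Subtype.mk.injEq, add_left_inj] at hde ⊢
    ext i
    have := DFunLike.congr_fun hde i
    simpa [hp.ne_zero] using this
  · rintro ⟨d, hd, ⟨x, hx⟩, ⟨y, hy⟩⟩
    obtain ⟨x, rfl⟩ : ∃ x', x = x' + 1 := Nat.exists_eq_succ_of_ne_zero (by rintro rfl; omega)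
    obtain ⟨y, rfl⟩ : ∃ x', y = x' + 1 := Nat.exists_eq_succ_of_ne_zero (by rintro rfl; omega)
    rw [mul_add] at hx hy
    refine ⟨⟨Finsupp.equivFunOnFinite.symm ![x, y], ?_⟩, ?_⟩
    · simp only [Set.mem_ofPred_eq, weight_planeWeights] at hd ⊢
      simp only [Finsupp.equivFunOnFinite_symm_apply_apply, Matrix.cons_val_zero,
        Matrix.cons_val_one]
      refine mul_left_cancel₀ hp0 ?_
      have hx' : (d 0 : ℤ) = p * x + p - 1 := by zify at hx; linarith
      have hy' : (d 1 : ℤ) = p * y + p - 1 := by zify at hy; linarith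
      rw [hx', hy'] at hd
      linear_combination hd + hm + (p - 1) * hab'
    · simp only [Subtype.mk.injEq]
      ext i
      fin_cases i
      · simp; omega
      · simp; omega

/-- Exponents congruent to `-1` have weight congruent to `-(a + b) = -(h + 2)` modulo `p`. -/
theorem card_weight_eq_of_not_dvd (hab : h + 2 = a + b) {m : ℤ}
    (hm : ¬ (p : ℤ) ∣ m + 2) :
    Nat.card {d : Fin 2 →₀ ℕ | Finsupp.weight (planeWeights a b) d = m - h ∧
        p ∣ d 0 + 1 ∧ p ∣ d 1 + 1} = 0 := by
  have hab' : (h : ℤ) = a + b - 2 := by omega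
  have : IsEmpty {d : Fin 2 →₀ ℕ | Finsupp.weight (planeWeights a b) d = m - h ∧
        p ∣ d 0 + 1 ∧ p ∣ d 1 + 1} := by
    refine ⟨?_⟩
    rintro ⟨d, hd, ⟨x, hx⟩, ⟨y, hy⟩⟩
    refine hm ⟨a * x + b * y, ?_⟩
    rw [weight_planeWeights] at hd
    have hx' : (d 0 : ℤ) + 1 = p * x := by exact_mod_cast hx
    have hy' : (d 1 : ℤ) + 1 = p * y := by exact_mod_cast hy
    linear_combination -hd + (a : ℤ) * hx' + (b : ℤ) * hy' + hab'
  exact Nat.card_of_isEmpty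

end PlaneCharP

/-! ### The Hilbert series of a double plane. -/

section Model

open MvPolynomial

variable {F : Type*} [Field F] {a b h : ℕ} {P : MvPolynomial (Fin 2) F}

/-- The Poisson bracket of the double plane `z ^ 2 = P (x, y)`, where `(f, g)` stands for
`f + g z`. -/
noncomputable def doublePlaneBracket (P : MvPolynomial (Fin 2) F)
    (u v : MvPolynomial (Fin 2) F × MvPolynomial (Fin 2) F) :
    MvPolynomial (Fin 2) F × MvPolynomial (Fin 2) F :=
  (2 * P * planeBracket u.1 v.2 + v.2 * planeBracket u.1 P -
      (2 * P * planeBracket v.1 u.2 + u.2 * planeBracket v.1 P),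
    2 * planeBracket u.1 v.1 + planeBracket (P * u.2) v.2 + planeBracket u.2 (P * v.2))

theorem planeBracket_mem_span (f g : MvPolynomial (Fin 2) F) :
    planeBracket f g ∈ planeBracketSpan F := Submodule.subset_span ⟨f, g, rfl⟩

/-- The `z`-free part of `{f, g z}` is the twisted curl of `-g df`, and the `z`-parts are sums of
plane brackets. Conversely `-{x, α z} - {y, β z}` realizes the curl of `α dX + β dY` with no
`z`-part, and for `f, g` in `F[x, y]` the bracket of the double plane is `2z` times the plane
bracket. -/
theorem span_doublePlaneBracket (h2 : (2 : F) ≠ 0) (P : MvPolynomial (Fin 2) F) :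
    Submodule.span F {u | ∃ f g, u = doublePlaneBracket P f g} =
      (LinearMap.range (twistedCurl P)).prod (planeBracketSpan F) := by
  have hc : ∀ f g, 2 * P * planeBracket f g + g * planeBracket f P =
      twistedCurl P (-(g * pderiv 0 f), -(g * pderiv 1 f)) := by
    intro f g
    rw [twistedCurl_apply, planeBracket, planeBracket]
    simp only [map_neg, pderiv_mul, pderiv_comm']
    ring
  apply le_antisymm
  · refine Submodule.span_le.2 ?_
    rintro _ ⟨u, v, rfl⟩
    refine ⟨?_, ?_⟩
    · simp only [doublePlaneBracket, hc]
      exact sub_mem ⟨_, rfl⟩ ⟨_, rfl⟩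
    · simp only [doublePlaneBracket, two_mul]
      exact add_mem (add_mem (add_mem (planeBracket_mem_span _ _) (planeBracket_mem_span _ _))
        (planeBracket_mem_span _ _)) (planeBracket_mem_span _ _)
  · rintro ⟨u, v⟩ ⟨⟨⟨α, β⟩, hu⟩, hv⟩
    rw [show (u, v) = ((u, 0) : _ × _) + (0, v) by simp]
    refine add_mem ?_ ?_
    · simp only at hu
      have h3 : (u, (0 : MvPolynomial (Fin 2) F)) =
          -(doublePlaneBracket P (X 0, 0) (0, α) + doublePlaneBracket P (X 1, 0) (0, β)) := by
        rw [← hu, twistedCurl_apply]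
        ext1
        · simp [doublePlaneBracket, planeBracket, pderiv_X]
          ring
        · simp [doublePlaneBracket, planeBracket]
      rw [h3]
      exact neg_mem (add_mem (Submodule.subset_span ⟨_, _, rfl⟩) (Submodule.subset_span ⟨_, _, rfl⟩))
    · have hle : planeBracketSpan F ≤ (Submodule.span F {u | ∃ f g, u = doublePlaneBracket P f g}).comap
          (LinearMap.inr F (MvPolynomial (Fin 2) F) (MvPolynomial (Fin 2) F)) := by
        refine Submodule.span_le.2 ?_
        rintro _ ⟨f, g, rfl⟩
        have h3 : ((0 : MvPolynomial (Fin 2) F), planeBracket f g) =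
            (2 : F)⁻¹ • doublePlaneBracket P (f, 0) (g, 0) := by
          ext1
          · simp [doublePlaneBracket, planeBracket]
          · have e0 : C (σ := Fin 2) (2 : F)⁻¹ * 2 = 1 := by
              rw [← map_ofNat (C (σ := Fin 2) (R := F)) 2, ← C_mul, inv_mul_cancel₀ h2, C_1]
            simp [doublePlaneBracket, planeBracket, smul_eq_C_mul]
            linear_combination (-(pderiv 0 f * pderiv 1 g - pderiv 1 f * pderiv 0 g)) * e0
        refine Submodule.mem_comap.2 ?_
        rw [LinearMap.inr_apply, h3]
        exact Submodule.smul_mem _ _ (Submodule.subset_span ⟨_, _, rfl⟩)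
      exact hle hv

/-- The elements `f + g z` of degree `j`, where `z` has degree `h`. -/
noncomputable abbrev doublePlaneGrading (F : Type*) [Field F] (a b h : ℕ) (j : ℤ) :
    Submodule F (MvPolynomial (Fin 2) F × MvPolynomial (Fin 2) F) :=
  (planeGrading F a b j).prod (planeGrading F a b (j - h))

theorem finite_doublePlaneGrading (ha : 0 < a) (hb : 0 < b) (h : ℕ) (j : ℤ) :
    Module.Finite F (doublePlaneGrading F a b h j) :=
  have := finite_planeGrading (F := F) ha hb j
  have := finite_planeGrading (F := F) ha hb (j - h)
  Module.Finite.equiv (prodSubmoduleEquiv _ _).symm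

/-- The left side is the dimension of `HP₀` in degree `m`. Write `w` for the monomial count. If `m +
2 = pk`, it equals `w(pk - 2) - w(pk - h) + w(k - h) + w(k - 2 - h)`, and `weightCount_mul_sub`
turns the first two terms into `w(k - 2) - w(k - h)`. Otherwise the `z`-part contributes nothing and
the Jacobian ring remains. -/
theorem finrank_doublePlaneGrading_sub (T : ADEType) {p : ℕ} [CharP F p] (hp : p.Prime)
    (hT : T.coxeterNumber < p) (hP : IsBranchPolynomial T.degA T.degB T.coxeterNumber P) (m : ℕ) :
    (Module.finrank F (doublePlaneGrading F T.degA T.degB T.coxeterNumber m) : ℚ) -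
      Module.finrank F (doublePlaneGrading F T.degA T.degB T.coxeterNumber m ⊓
        (LinearMap.range (twistedCurl P)).prod (planeBracketSpan F) : Submodule F _) =
      PowerSeries.coeff m (explicitFormula T p) := by
  have ha := hP.left_pos
  have hb := hP.right_pos
  have hab := hP.add_two
  have := finite_planeGrading (F := F) ha hb m
  have := finite_planeGrading (F := F) ha hb (m - T.coxeterNumber)
  have : Module.Finite F (planeGrading F T.degA T.degB m ⊓ LinearMap.range (twistedCurl P) :
    Submodule F _) := Submodule.finiteDimensional_inf_left _ _
  have : Module.Finite F (planeGrading F T.degA T.degB (m - T.coxeterNumber) ⊓ planeBracketSpan F :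
    Submodule F _) := Submodule.finiteDimensional_inf_left _ _
  rw [Submodule.prod_inf_prod, finrank_prod_submodule, finrank_prod_submodule,
    finrank_planeGrading, finrank_planeGrading]
  have h1 := finrank_inf_planeBracketSpan (F := F) (p := p) ha hb (m - T.coxeterNumber)
  by_cases hd : p ∣ m + 2
  · obtain ⟨k, hk⟩ := hd
    have hk' : (m : ℤ) + 2 = p * (k : ℤ) := by exact_mod_cast hk
    have h2 := hP.finrank_inf_range_of_eq hp hT hk'
    rw [card_weight_eq_of_dvd hp hab hk'] at h1
    have h3 := T.weightCount_mul_sub hp hT k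
    rw [T.coeff_explicitFormula_of_dvd hp hT hk, show (m : ℤ) = p * k - 2 by omega] at *
    have h1' := congrArg (Nat.cast (R := ℚ)) h1
    have h2' := congrArg (Nat.cast (R := ℚ)) h2
    push_cast at h1' h2' ⊢
    linear_combination h3 - h1' - h2'
  · have hd' : ¬ (p : ℤ) ∣ m + 2 := by exact_mod_cast hd
    have hm : (((m : ℤ) + 2 : ℤ) : F) ≠ 0 := by
      rwa [Ne, CharP.intCast_eq_zero_iff F p]
    have hph : (T.coxeterNumber : F) ≠ 0 := by
      rw [Ne, CharP.cast_eq_zero_iff F p]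
      intro hd
      have := Nat.le_of_dvd (by have := hP.two_le_left; have := hP.two_le_right; omega) hd
      omega
    have h2 := hP.finrank_inf_range_of_ne hph hm
    rw [card_weight_eq_of_not_dvd hab hd'] at h1
    rw [T.coeff_explicitFormula_of_not_dvd hp hd]
    have h1' := congrArg (Nat.cast (R := ℚ)) h1
    have h2' := congrArg (Nat.cast (R := ℚ)) h2
    push_cast at h1' h2' ⊢
    linear_combination - h1' - h2'

theorem hasKleinianHilbertSeries_of_coeff (T : ADEType) {p : ℕ} (hp : p ≠ 0) {W : Type*}
    [AddCommGroup W] [Module F W] (V : ℕ → Submodule F W) (hfin : ∀ m, Module.Finite F (V m))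
    (hV : ∀ m, (Module.finrank F (V m) : ℚ) = PowerSeries.coeff m (explicitFormula T p)) :
    HasKleinianHilbertSeries F V T p hp := by
  have h1 : hilbertSeries F V = explicitFormula T p := by
    ext m
    rw [hilbertSeries, PowerSeries.coeff_mk, hV]
  exact ⟨hfin, by rw [h1, T.mainFormula_eq], h1⟩

/-- An algebra isomorphic to the coordinate ring of a double plane, with its grading and, up to a
constant factor, its bracket. -/
structure IsDoublePlane {A : Type*} [CommRing A] [Algebra F A] (br : A → A → A)
    (grading : ℕ → Submodule F A) (a b h : ℕ) (P : MvPolynomial (Fin 2) F)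
    (e : (MvPolynomial (Fin 2) F × MvPolynomial (Fin 2) F) ≃ₗ[F] A) (c : F) : Prop where
  branch : IsBranchPolynomial a b h P
  ne_zero : c ≠ 0
  bracket : ∀ u v, br (e u) (e v) = c • e (doublePlaneBracket P u v)
  grading : ∀ m : ℕ, grading m = (doublePlaneGrading F a b h m).map e.toLinearMap

/-- A nonzero constant factor of the bracket does not affect the span of brackets, so the count in
the model carries over. -/
theorem IsDoublePlane.hasKleinianHilbertSeries {A : Type*} [CommRing A] [Algebra F A]
    {br : A → A → A} {grading : ℕ → Submodule F A} {T : ADEType}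
    {e : (MvPolynomial (Fin 2) F × MvPolynomial (Fin 2) F) ≃ₗ[F] A} {c : F}
    (he : IsDoublePlane br grading T.degA T.degB T.coxeterNumber P e c)
    {p : ℕ} [CharP F p] (hp : p.Prime) (hT : T.coxeterNumber < p) :
    HasKleinianHilbertSeries F (HP0Component F br grading) T p hp.ne_zero := by
  have h2 : (2 : F) ≠ 0 := by
    have h3 : ((2 : ℕ) : F) ≠ 0 := by
      rw [Ne, CharP.cast_eq_zero_iff F p]
      intro hd
      have := Nat.le_of_dvd (by norm_num) hd
      have := T.coxeterNumber_add_two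
      have := T.two_le_degA
      have := T.two_le_degB
      omega
    simpa using h3
  have hspan : bracketSpan F br =
      ((LinearMap.range (twistedCurl P)).prod (planeBracketSpan F)).map e.toLinearMap := by
    rw [← span_doublePlaneBracket h2, Submodule.map_span, bracketSpan]
    apply le_antisymm
    · refine Submodule.span_le.2 ?_
      rintro _ ⟨x, y, rfl⟩
      have h3 := he.bracket (e.symm x) (e.symm y)
      rw [e.apply_symm_apply, e.apply_symm_apply] at h3
      rw [h3]
      exact Submodule.smul_mem _ _ (Submodule.subset_span ⟨_, ⟨_, _, rfl⟩, rfl⟩)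
    · refine Submodule.span_le.2 ?_
      rintro _ ⟨_, ⟨u, v, rfl⟩, rfl⟩
      have h3 : e.toLinearMap (doublePlaneBracket P u v) = c⁻¹ • br (e u) (e v) := by
        rw [he.bracket, smul_smul, inv_mul_cancel₀ he.ne_zero, one_smul]
        rfl
      rw [h3]
      exact Submodule.smul_mem _ _ (Submodule.subset_span ⟨_, _, rfl⟩)
  have hfin : ∀ m, Module.Finite F (grading m) := by
    intro m
    have := finite_doublePlaneGrading (F := F) he.branch.left_pos he.branch.right_pos
      T.coxeterNumber m
    rw [he.grading]
    exact Module.Finite.map _ _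
  refine hasKleinianHilbertSeries_of_coeff T hp.ne_zero _ (fun m => ?_) fun m => ?_
  · have := hfin m
    exact Module.Finite.map _ _
  · have := hfin m
    have h3 := finrank_map_add_finrank_inf_ker (bracketSpan F br).mkQ (grading m)
    rw [Submodule.ker_mkQ] at h3
    have h4 : Module.finrank F (grading m ⊓ bracketSpan F br : Submodule F A) =
        Module.finrank F (doublePlaneGrading F T.degA T.degB T.coxeterNumber m ⊓
          (LinearMap.range (twistedCurl P)).prod (planeBracketSpan F) : Submodule F _) := by
      rw [hspan, he.grading, ← Submodule.map_inf _ e.injective]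
      exact LinearEquiv.finrank_map_eq e _
    have h5 : Module.finrank F (grading m) =
        Module.finrank F (doublePlaneGrading F T.degA T.degB T.coxeterNumber m) := by
      rw [he.grading]
      exact LinearEquiv.finrank_map_eq e _
    rw [← finrank_doublePlaneGrading_sub T hp hT he.branch m, ← h4, ← h5, ← h3, HP0Component]
    push_cast
    ring

end Model

/-! ### Coordinate changes of surfaces and the double plane `z ^ 2 = P (x, y)`. -/

section Surfaces

open MvPolynomial

variable {F : Type*} [Field F] {a b h : ℕ} {P : MvPolynomial (Fin 2) F}

theorem aeval_isWeightedHomogeneous {w : Fin 3 → ℕ} {g : Fin 3 → MvPolynomial (Fin 3) F}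
    (hg : ∀ i, IsWeightedHomogeneous w (g i) (w i)) {m : ℕ} {f : MvPolynomial (Fin 3) F}
    (hf : IsWeightedHomogeneous w f m) : IsWeightedHomogeneous w (aeval g f) m := by
  rw [aeval_def, eval₂_eq']
  rw [algebraMap_eq]
  refine IsWeightedHomogeneous.sum _ _ _ fun d hd => ?_
  refine IsWeightedHomogeneous.C_mul ?_ _
  have h1 : ∑ i, d i • w i = m := by
    rw [← hf (mem_support_iff.1 hd), Finsupp.weight_apply, Finsupp.sum_fintype _ _ (by simp)]
  rw [← h1]
  exact IsWeightedHomogeneous.prod _ _ _ fun i _ => (hg i).pow _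

theorem pderiv_aeval (g : Fin 3 → MvPolynomial (Fin 3) F) (i : Fin 3) (f : MvPolynomial (Fin 3) F) :
    pderiv i (aeval g f) = ∑ j, aeval g (pderiv j f) * pderiv i (g j) := by
  induction f using MvPolynomial.induction_on with
  | C a => simp [algebraMap_eq]
  | add f g hf hg => simp only [map_add, hf, hg, add_mul, Finset.sum_add_distrib]
  | mul_X f k hf =>
    simp only [map_mul, pderiv_mul, hf, map_add, Fin.sum_univ_three, aeval_X]
    fin_cases k <;> simp [pderiv_X] <;> ring

/-- The bracket is a Jacobian determinant, so this is the chain rule. The factor `jacobianBracket (g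
2) (g 0) (g 1)` is the Jacobian of the substitution, up to a cyclic permutation of rows. -/
theorem jacobianBracket_aeval (g : Fin 3 → MvPolynomial (Fin 3) F)
    (Q u v : MvPolynomial (Fin 3) F) :
    jacobianBracket (aeval g Q) (aeval g u) (aeval g v) =
      jacobianBracket (g 2) (g 0) (g 1) * aeval g (jacobianBracket Q u v) := by
  simp only [jacobianBracket, pderiv_aeval, Fin.sum_univ_three, map_add, map_mul, map_sub]
  ring

/-- An automorphism of `F[x, y, z]` which preserves the grading and the Poisson brackets. -/
structure IsGradedUnimodular (w : Fin 3 → ℕ)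
    (φ : MvPolynomial (Fin 3) F ≃ₐ[F] MvPolynomial (Fin 3) F) : Prop where
  map_mem : ∀ {m f}, IsWeightedHomogeneous w f m → IsWeightedHomogeneous w (φ f) m
  symm_mem : ∀ {m f}, IsWeightedHomogeneous w f m → IsWeightedHomogeneous w (φ.symm f) m
  bracket : ∀ Q u v, jacobianBracket (φ Q) (φ u) (φ v) = φ (jacobianBracket Q u v)

theorem IsGradedUnimodular.trans {w : Fin 3 → ℕ}
    {φ ψ : MvPolynomial (Fin 3) F ≃ₐ[F] MvPolynomial (Fin 3) F}
    (hφ : IsGradedUnimodular w φ) (hψ : IsGradedUnimodular w ψ) :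
    IsGradedUnimodular w (φ.trans ψ) where
  map_mem hf := hψ.map_mem (hφ.map_mem hf)
  symm_mem hf := hφ.symm_mem (hψ.symm_mem hf)
  bracket Q u v := by simp [hψ.bracket, hφ.bracket]

theorem exists_isGradedUnimodular {w : Fin 3 → ℕ} (g g' : Fin 3 → MvPolynomial (Fin 3) F)
    (hg : ∀ i, IsWeightedHomogeneous w (g i) (w i))
    (hg' : ∀ i, IsWeightedHomogeneous w (g' i) (w i))
    (h1 : ∀ i, aeval g (g' i) = X i) (h2 : ∀ i, aeval g' (g i) = X i)
    (hj : jacobianBracket (g 2) (g 0) (g 1) = 1) :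
    ∃ φ : MvPolynomial (Fin 3) F ≃ₐ[F] MvPolynomial (Fin 3) F,
      IsGradedUnimodular w φ ∧ ∀ f, φ f = aeval g f := by
  refine ⟨AlgEquiv.ofAlgHom (aeval g) (aeval g') ?_ ?_, ⟨?_, ?_, ?_⟩, fun _ => rfl⟩
  · ext1 i
    simpa using h1 i
  · ext1 i
    simpa using h2 i
  · exact fun hf => aeval_isWeightedHomogeneous hg hf
  · exact fun hf => aeval_isWeightedHomogeneous hg' hf
  · intro Q u v
    simp only [AlgEquiv.ofAlgHom_apply]
    rw [jacobianBracket_aeval, hj, one_mul]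

/-- The inclusion `F[x, y] → F[x, y, z]`. -/
noncomputable def planeInclusion (F : Type*) [Field F] :
    MvPolynomial (Fin 2) F →ₐ[F] MvPolynomial (Fin 3) F := rename Fin.castSucc

theorem pderiv_castSucc_planeInclusion (i : Fin 2) (f : MvPolynomial (Fin 2) F) :
    pderiv i.castSucc (planeInclusion F f) = planeInclusion F (pderiv i f) :=
  pderiv_rename (Fin.castSucc_injective 2) _ _

@[simp] theorem pderiv_zero_planeInclusion (f : MvPolynomial (Fin 2) F) :
    pderiv 0 (planeInclusion F f) = planeInclusion F (pderiv 0 f) :=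
  pderiv_castSucc_planeInclusion 0 f

@[simp] theorem pderiv_one_planeInclusion (f : MvPolynomial (Fin 2) F) :
    pderiv 1 (planeInclusion F f) = planeInclusion F (pderiv 1 f) :=
  pderiv_castSucc_planeInclusion 1 f

@[simp] theorem pderiv_two_planeInclusion (f : MvPolynomial (Fin 2) F) :
    pderiv 2 (planeInclusion F f) = 0 := by
  classical
  refine pderiv_eq_zero_of_notMem_vars fun hm => ?_
  obtain ⟨i, -, hi⟩ := Finset.mem_image.1 (vars_rename _ _ hm)
  fin_cases i <;> simp [Fin.ext_iff] at hi

@[simp] theorem planeInclusion_X (i : Fin 2) : planeInclusion F (X i) = X i.castSucc :=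
  rename_X _ _

theorem planeInclusion_mem {j : ℤ} {m : ℕ} {f : MvPolynomial (Fin 2) F}
    (hf : f ∈ planeGrading F a b j) (hj : j = m) :
    IsWeightedHomogeneous ![a, b, h] (planeInclusion F f) m := by
  intro d hd
  obtain ⟨e, rfl, he⟩ := coeff_rename_ne_zero _ _ _ hd
  have h1 := hf he
  rw [weight_planeWeights, hj] at h1
  have h2 : Finsupp.weight ![a, b, h] (e.mapDomain Fin.castSucc) = a * e 0 + b * e 1 := by
    rw [Finsupp.weight_apply, Finsupp.sum_mapDomain_index (by simp) (by simp [add_mul]),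
      Finsupp.sum_fintype _ _ (by simp)]
    simp [mul_comm]
  rw [h2]
  exact_mod_cast h1

theorem weightedHomogeneous_induction {m : ℕ} {motive : MvPolynomial (Fin 3) F → Prop}
    (zero : motive 0) (add : ∀ f g, motive f → motive g → motive (f + g))
    (mul : ∀ (k : ℕ) (q : MvPolynomial (Fin 2) F), q ∈ planeGrading F a b (m - h * k) →
      motive (planeInclusion F q * X 2 ^ k)) {f : MvPolynomial (Fin 3) F}
    (hf : IsWeightedHomogeneous ![a, b, h] f m) : motive f := by
  rw [← support_sum_monomial_coeff f]
  refine Finset.sum_induction _ motive add zero fun d hd => ?_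
  have h1 : monomial d (coeff d f) = planeInclusion F (C (coeff d f) * (X 0 ^ d 0 * X 1 ^ d 1)) *
      X 2 ^ d 2 := by
    rw [monomial_eq, Finsupp.prod_fintype _ _ (by simp), Fin.prod_univ_three]
    simp only [map_mul, map_pow, planeInclusion_X]
    simp [planeInclusion]
    ring
  rw [h1]
  refine mul _ _ ?_
  have h2 := hf (mem_support_iff.1 hd)
  rw [Finsupp.weight_apply, Finsupp.sum_fintype _ _ (by simp), Fin.sum_univ_three] at h2
  simp only [smul_eq_mul, Matrix.cons_val] at h2
  have h3 : (X 0 ^ d 0 * X 1 ^ d 1 : MvPolynomial (Fin 2) F) =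
      monomial (Finsupp.single 0 (d 0) + Finsupp.single 1 (d 1)) 1 := by
    rw [X_pow_eq_monomial, X_pow_eq_monomial, monomial_mul, one_mul]
  rw [h3, C_mul_monomial]
  refine isWeightedHomogeneous_monomial _ _ _ ?_
  rw [weight_planeWeights, ← h2]
  push_cast
  simp
  ring

/-- `f + g z` in `F[x, y, z]`. -/
noncomputable def doublePlaneInclusion (F : Type*) [Field F] :
    (MvPolynomial (Fin 2) F × MvPolynomial (Fin 2) F) →ₗ[F] MvPolynomial (Fin 3) F :=
  (planeInclusion F).toLinearMap.coprod
    ((LinearMap.mulRight F (X 2)).comp (planeInclusion F).toLinearMap)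

theorem doublePlaneInclusion_apply (u : MvPolynomial (Fin 2) F × MvPolynomial (Fin 2) F) :
    doublePlaneInclusion F u = planeInclusion F u.1 + planeInclusion F u.2 * X 2 := rfl

/-- The equation `z ^ 2 - P (x, y)`. -/
noncomputable def doublePlaneEquation (P : MvPolynomial (Fin 2) F) : MvPolynomial (Fin 3) F :=
  X 2 ^ 2 - planeInclusion F P

theorem jacobianBracket_doublePlane (P : MvPolynomial (Fin 2) F)
    (u v : MvPolynomial (Fin 2) F × MvPolynomial (Fin 2) F) :
    jacobianBracket (doublePlaneEquation P) (doublePlaneInclusion F u) (doublePlaneInclusion F v) -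
      doublePlaneInclusion F (doublePlaneBracket P u v) ∈ Ideal.span {doublePlaneEquation P} := by
  -- The quotient collects the terms of the bracket of degree 2 and 3 in `z`, in which `z ^ 2` gets
  -- replaced by `P`.
  refine Ideal.mem_span_singleton'.2 ⟨2 * planeInclusion F (planeBracket u.1 v.2 +
    planeBracket u.2 v.1) + 2 * planeInclusion F (planeBracket u.2 v.2) * X 2, ?_⟩
  simp only [jacobianBracket, doublePlaneEquation, doublePlaneInclusion_apply, doublePlaneBracket,
    planeBracket, map_add, map_sub, pderiv_mul, map_mul, pderiv_zero_planeInclusion,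
    pderiv_one_planeInclusion, pderiv_two_planeInclusion, pderiv_X, Pi.single_apply, pderiv_pow,
    map_ofNat]
  simp
  ring

open QuadraticAlgebra in
-- Sending `z` to a formal square root of `P` kills the equation, and the two coordinates in the
-- quadratic algebra over `F[x, y]` recover `f` and `g` from `f + g z`.
theorem eq_zero_of_doublePlaneInclusion_mem (P : MvPolynomial (Fin 2) F)
    {u : MvPolynomial (Fin 2) F × MvPolynomial (Fin 2) F}
    (hu : doublePlaneInclusion F u ∈ Ideal.span {doublePlaneEquation P}) : u = 0 := by
  let ev : MvPolynomial (Fin 3) F →ₐ[F] QuadraticAlgebra (MvPolynomial (Fin 2) F) P 0 :=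
    aeval ![⟨X 0, 0⟩, ⟨X 1, 0⟩, ⟨0, 1⟩]
  have h1 : ∀ f, ev (planeInclusion F f) = ⟨f, 0⟩ := by
    intro f
    induction f using MvPolynomial.induction_on with
    | C a => 
      rw [← algebraMap_eq, AlgHom.commutes, AlgHom.commutes]
      rfl
    | add f g hf hg =>
      rw [map_add, map_add, hf, hg]
      ext <;> simp
    | mul_X f k hf =>
      rw [map_mul, map_mul, hf]
      fin_cases k <;> simp [ev]
  have h2 : ev (doublePlaneEquation P) = 0 := by
    rw [doublePlaneEquation, map_sub, h1, map_pow]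
    ext <;> simp [ev, pow_two]
  have h3 : ev (doublePlaneInclusion F u) = ⟨u.1, u.2⟩ := by
    rw [doublePlaneInclusion_apply, map_add, map_mul, h1, h1]
    ext <;> simp [ev]
  obtain ⟨q, hq⟩ := Ideal.mem_span_singleton'.1 hu
  rw [← hq, map_mul, h2, mul_zero] at h3
  have h4 := congrArg QuadraticAlgebra.re h3
  have h5 := congrArg QuadraticAlgebra.im h3
  ext1
  · simpa using h4.symm
  · simpa using h5.symm

theorem exists_sub_doublePlaneInclusion_mem (P : MvPolynomial (Fin 2) F)
    (f : MvPolynomial (Fin 3) F) :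
    ∃ u, f - doublePlaneInclusion F u ∈ Ideal.span {doublePlaneEquation P} := by
  induction f using MvPolynomial.induction_on with
  | C a => exact ⟨(C a, 0), by simp [doublePlaneInclusion_apply, planeInclusion]⟩
  | add f g hf hg =>
    obtain ⟨u, hu⟩ := hf
    obtain ⟨v, hv⟩ := hg
    refine ⟨u + v, ?_⟩
    rw [map_add, add_sub_add_comm]
    exact add_mem hu hv
  | mul_X f k hf =>
    obtain ⟨u, hu⟩ := hf
    have key : ∀ v, doublePlaneInclusion F u * X k - doublePlaneInclusion F v ∈
        Ideal.span {doublePlaneEquation P} →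
        ∃ u, f * X k - doublePlaneInclusion F u ∈ Ideal.span {doublePlaneEquation P} := by
      intro v hv
      refine ⟨v, ?_⟩
      have h1 := add_mem (Ideal.mul_mem_right (X k) _ hu) hv
      rwa [show (f - doublePlaneInclusion F u) * X k + (doublePlaneInclusion F u * X k -
        doublePlaneInclusion F v) = f * X k - doublePlaneInclusion F v by ring] at h1
    fin_cases k
    · refine key (u.1 * X 0, u.2 * X 0) ?_
      convert Ideal.zero_mem _
      simp [doublePlaneInclusion_apply]
      ring
    · refine key (u.1 * X 1, u.2 * X 1) ?_
      convert Ideal.zero_mem _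
      simp [doublePlaneInclusion_apply]
      ring
    · refine key (u.2 * P, u.1) ?_
      refine Ideal.mem_span_singleton'.2 ⟨planeInclusion F u.2, ?_⟩
      simp [doublePlaneInclusion_apply, doublePlaneEquation]
      ring

theorem planeGrading_of_neg {j : ℤ} (hj : j < 0) {q : MvPolynomial (Fin 2) F}
    (hq : q ∈ planeGrading F a b j) : q = 0 := by
  by_contra hq0
  obtain ⟨d, hd⟩ := exists_coeff_ne_zero hq0
  have h1 := hq hd
  rw [weight_planeWeights] at h1
  have : (0 : ℤ) ≤ a * d 0 + b * d 1 := by positivity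
  omega

theorem doublePlaneInclusion_mem {m : ℕ} {u : MvPolynomial (Fin 2) F × MvPolynomial (Fin 2) F}
    (hu : u ∈ doublePlaneGrading F a b h m) :
    IsWeightedHomogeneous ![a, b, h] (doublePlaneInclusion F u) m := by
  rw [doublePlaneInclusion_apply]
  refine (planeInclusion_mem hu.1 rfl).add ?_
  rcases lt_or_ge m h with hm | hm
  · rw [planeGrading_of_neg (by omega) hu.2]
    simpa using isWeightedHomogeneous_zero F _ m
  · have h1 := (planeInclusion_mem (h := h) (m := m - h) hu.2 (by omega)).mul
      (isWeightedHomogeneous_X F ![a, b, h] 2)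
    simpa [Nat.sub_add_cancel hm] using h1

/-- Replacing `z ^ 2` by `P` preserves the weight and lowers the power of `z` by two. -/
theorem exists_mem_doublePlaneGrading (hP : P ∈ planeGrading F a b (2 * h)) {m : ℕ}
    {f : MvPolynomial (Fin 3) F} (hf : IsWeightedHomogeneous ![a, b, h] f m) :
    ∃ u ∈ doublePlaneGrading F a b h m,
      f - doublePlaneInclusion F u ∈ Ideal.span {doublePlaneEquation P} := by
  refine weightedHomogeneous_induction (motive := fun f => ∃ u ∈ doublePlaneGrading F a b h m,
      f - doublePlaneInclusion F u ∈ Ideal.span {doublePlaneEquation P}) ?_ ?_ ?_ hf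
  · exact ⟨0, zero_mem _, by simp⟩
  · rintro f g ⟨u, hu, hfu⟩ ⟨v, hv, hgv⟩
    refine ⟨u + v, add_mem hu hv, ?_⟩
    rw [map_add, add_sub_add_comm]
    exact add_mem hfu hgv
  · intro k
    induction k using Nat.strong_induction_on with
    | _ k ih =>
      intro q hq
      match k with
      | 0 =>
        refine ⟨(q, 0), ⟨by simpa using hq, zero_mem _⟩, ?_⟩
        simp [doublePlaneInclusion_apply]
      | 1 =>
        refine ⟨(0, q), ⟨zero_mem _, by simpa using hq⟩, ?_⟩
        simp [doublePlaneInclusion_apply]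
      | k + 2 =>
        obtain ⟨u, hu, h1⟩ := ih k (by omega) (q * P) (by
          have := mul_mem_planeGrading hq hP
          rwa [show (m : ℤ) - h * (k + 2 : ℕ) + 2 * h = m - h * k by push_cast; ring] at this)
        refine ⟨u, hu, ?_⟩
        have h2 : planeInclusion F q * X 2 ^ (k + 2) - planeInclusion F (q * P) * X 2 ^ k ∈
            Ideal.span {doublePlaneEquation P} := by
          refine Ideal.mem_span_singleton'.2 ⟨planeInclusion F q * X 2 ^ k, ?_⟩
          rw [doublePlaneEquation, map_mul]
          ring
        have := add_mem h2 h1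
        rwa [sub_add_sub_cancel] at this

/-- A graded coordinate change reducing the equation of a surface to `z ^ 2 = P (x, y)` identifies
the coordinate ring with that of a double plane. -/
theorem isDoublePlane_of_isGradedUnimodular {Q : MvPolynomial (Fin 3) F}
    (hP : IsBranchPolynomial a b h P) {w : Fin 3 → ℕ} (hw : w = ![a, b, h])
    {φ : MvPolynomial (Fin 3) F ≃ₐ[F] MvPolynomial (Fin 3) F} (hφ : IsGradedUnimodular w φ)
    {c : F} (hc : c ≠ 0) (hQ : φ Q = C c * doublePlaneEquation P) :
    ∃ e, IsDoublePlane (surfaceBracket Q) (surfaceGrading Q w) a b h P e c := by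
  subst hw
  have hmem : ∀ f, f ∈ Ideal.span {Q} ↔ φ f ∈ Ideal.span {doublePlaneEquation P} := by
    intro f
    rw [Ideal.mem_span_singleton, Ideal.mem_span_singleton, ← map_dvd_iff φ, hQ]
    have hu : IsUnit (C c : MvPolynomial (Fin 3) F) := (isUnit_iff_ne_zero.2 hc).map C
    exact (associated_unit_mul_left _ _ hu).dvd_iff_dvd_left
  let e₀ : (MvPolynomial (Fin 2) F × MvPolynomial (Fin 2) F) →ₗ[F] SurfaceRing Q :=
    (Ideal.Quotient.mkₐ F (Ideal.span {Q})).toLinearMap ∘ₗ φ.symm.toLinearMap ∘ₗ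
      doublePlaneInclusion F
  have he₀ : ∀ u, e₀ u = Ideal.Quotient.mk _ (φ.symm (doublePlaneInclusion F u)) := fun _ => rfl
  have heq : ∀ f u, f - doublePlaneInclusion F u ∈ Ideal.span {doublePlaneEquation P} →
      Ideal.Quotient.mk (Ideal.span {Q}) (φ.symm f) = e₀ u := by
    intro f u hf
    rw [he₀, Ideal.Quotient.eq, hmem, map_sub, φ.apply_symm_apply, φ.apply_symm_apply]
    exact hf
  have hbij : Function.Bijective e₀ := by
    constructor
    · rw [← LinearMap.ker_eq_bot, LinearMap.ker_eq_bot']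
      intro u hu
      rw [he₀, Ideal.Quotient.eq_zero_iff_mem, hmem, φ.apply_symm_apply] at hu
      exact eq_zero_of_doublePlaneInclusion_mem P hu
    · intro y
      obtain ⟨f, rfl⟩ := Ideal.Quotient.mk_surjective y
      obtain ⟨u, hu⟩ := exists_sub_doublePlaneInclusion_mem P (φ f)
      exact ⟨u, by rw [← heq _ _ hu, φ.symm_apply_apply]⟩
  refine ⟨LinearEquiv.ofBijective e₀ hbij, hP, hc, ?_, ?_⟩
  · intro u v
    simp only [LinearEquiv.ofBijective_apply]
    rw [he₀ u, he₀ v, surfaceBracket_mk, ← heq _ _ (jacobianBracket_doublePlane P u v)]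
    change _ = c • (Ideal.Quotient.mkₐ F (Ideal.span {Q})) _
    rw [← map_smul, ← map_smul, Ideal.Quotient.mkₐ_eq_mk]
    congr 1
    apply φ.injective
    rw [← hφ.bracket, hQ, φ.apply_symm_apply, φ.apply_symm_apply, φ.apply_symm_apply,
      smul_eq_C_mul]
    simp only [jacobianBracket, pderiv_C_mul]
    ring
  · intro m
    apply le_antisymm
    · rintro _ ⟨f, hf, rfl⟩
      obtain ⟨u, hu, h1⟩ := exists_mem_doublePlaneGrading hP.mem (hφ.map_mem hf)
      refine ⟨u, hu, ?_⟩
      have := heq _ _ h1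
      rw [φ.symm_apply_apply] at this
      exact this.symm
    · rintro _ ⟨u, hu, rfl⟩
      exact ⟨_, hφ.symm_mem (doublePlaneInclusion_mem hu), rfl⟩

end Surfaces

/-! ### Reduction of an isolated quasihomogeneous singularity to a double plane. -/

section Singularities

open MvPolynomial

variable {F : Type*} [Field F] {a b h : ℕ} {P : MvPolynomial (Fin 2) F}

/-- A nonconstant plane curve has a point other than the origin. -/
theorem exists_zero_ne_zero {K : Type*} [Field K] [Algebra F K] [IsAlgClosed K]
    {g : MvPolynomial (Fin 2) F} (hg : ¬ IsUnit g) : ∃ v : Fin 2 → K, v ≠ 0 ∧ aeval v g = 0 := by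
  by_contra! hv
  -- If every zero of `g` is the origin, the Nullstellensatz makes `g` divide powers of both
  -- variables. These are coprime, so `g` is a unit.
  have h1 : ∀ i, ∃ n, g ∣ X i ^ n := by
    intro i
    have h2 : (X i : MvPolynomial (Fin 2) F) ∈ (Ideal.span {g}).radical := by
      rw [← vanishingIdeal_zeroLocus_eq_radical (K := K)]
      intro v hv'
      have h3 : v = 0 := by
        by_contra h0
        exact hv v h0 (hv' g (Ideal.mem_span_singleton_self g))
      simp [h3]
    obtain ⟨n, hn⟩ := h2
    exact ⟨n, Ideal.mem_span_singleton.1 hn⟩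
  obtain ⟨m, hm⟩ := h1 0
  obtain ⟨n, hn⟩ := h1 1
  have h2 : IsRelPrime (X 0 : MvPolynomial (Fin 2) F) (X 1) :=
    ((X_prime (i := 0)).irreducible.isRelPrime_iff_not_dvd).2 (by simp [X_dvd_X])
  exact hg ((h2.pow (m := m) (n := n)) hm hn)

/-- The automorphism moves `v` to the point with coordinates `φ (X i)` evaluated at `v`. That point
is not the origin because the polynomials `φ.symm (X i)` have positive weight, hence no constant
term. -/
theorem singular_of_isGradedUnimodular {K : Type*} [Field K] [Algebra F K]
    {w : Fin 3 → ℕ} (hw : ∀ i, 0 < w i) {φ : MvPolynomial (Fin 3) F ≃ₐ[F] MvPolynomial (Fin 3) F}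
    (hφ : IsGradedUnimodular w φ) {Q : MvPolynomial (Fin 3) F} {v : Fin 3 → K} (hv : v ≠ 0)
    (hQ : aeval v (φ Q) = 0) (hdQ : ∀ i, aeval v (pderiv i (φ Q)) = 0) :
    ∃ u : Fin 3 → K, u ≠ 0 ∧ aeval u Q = 0 ∧ ∀ i, aeval u (pderiv i Q) = 0 := by
  have h1 : ∀ f, aeval (fun i => aeval v (φ (X i))) f = aeval v (φ f) := by
    intro f
    have : (aeval (fun i => aeval v (φ (X i))) : MvPolynomial (Fin 3) F →ₐ[F] K) =
        (aeval v).comp φ.toAlgHom := by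
      ext1 i
      simp
    rw [this]
    rfl
  refine ⟨fun i => aeval v (φ (X i)), ?_, by rw [h1, hQ], ?_⟩
  · intro h0
    apply hv
    funext i
    have h2 := h1 (φ.symm (X i))
    rw [φ.apply_symm_apply, aeval_X, h0, aeval_zero] at h2
    rw [← h2, Pi.zero_apply]
    have h3 := (hφ.symm_mem (isWeightedHomogeneous_X F w i)).coeff_eq_zero 0 (by
      rw [map_zero]
      exact (hw i).ne)
    rw [constantCoeff_eq, h3, map_zero]
  · intro i
    rw [h1]
    -- The conjugate of `∂ᵢ` by `φ` is again a derivation, hence a combination of partial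
    -- derivatives, all of which kill `φ Q` at `v`.
    let D : Derivation F (MvPolynomial (Fin 3) F) (MvPolynomial (Fin 3) F) :=
      { toLinearMap := φ.toLinearMap ∘ₗ (pderiv i).toLinearMap ∘ₗ φ.symm.toLinearMap
        map_one_eq_zero' := by simp
        leibniz' := fun f g => by simp [Derivation.leibniz] }
    have h2 : φ (pderiv i Q) = D (φ Q) := by
      change _ = φ (pderiv i (φ.symm (φ Q)))
      rw [φ.symm_apply_apply]
    have h3 : D (φ Q) = ∑ j, pderiv j (φ Q) * D (X j) := by
      have h4 : D = ∑ j, D (X j) • pderiv j := by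
        refine derivation_ext fun k => ?_
        fin_cases k <;> simp [Fin.sum_univ_three, pderiv_X]
      conv_lhs => rw [h4]
      simp [Fin.sum_univ_three, mul_comm]
    rw [h2, h3, map_sum]
    exact Finset.sum_eq_zero fun j _ => by rw [map_mul, hdQ, zero_mul]

/-- A nonunit common factor of `P_X` and `P_Y` vanishes at some `v ≠ 0`. Euler's identity with `2h ≠
0` gives `P (v) = 0`, so `(v, 0)` is a singular point of `z ^ 2 = P` other than the origin. -/
theorem isBranchPolynomial_of_isIsolatedSingularity (hab : h + 2 = a + b) (ha : 2 ≤ a)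
    (hb : 2 ≤ b) (h2h : (2 * h : F) ≠ 0) (hP : P ∈ planeGrading F a b (2 * h))
    {Q : MvPolynomial (Fin 3) F} (hQ : IsIsolatedSingularity Q)
    {φ : MvPolynomial (Fin 3) F ≃ₐ[F] MvPolynomial (Fin 3) F}
    (hφ : IsGradedUnimodular ![a, b, h] φ) {c : F}
    (hc : φ Q = C c * doublePlaneEquation P) : IsBranchPolynomial a b h P := by
  refine ⟨hab, ha, hb, hP, fun g hg0 hg1 => ?_⟩
  by_contra hg
  obtain ⟨v, hv, hgv⟩ := exists_zero_ne_zero (K := AlgebraicClosure F) hg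
  have hd0 : aeval v (pderiv 0 P) = 0 := by
    obtain ⟨q, hq⟩ := hg0
    rw [hq, map_mul, hgv, zero_mul]
  have hd1 : aeval v (pderiv 1 P) = 0 := by
    obtain ⟨q, hq⟩ := hg1
    rw [hq, map_mul, hgv, zero_mul]
  have hvP : aeval v P = 0 := by
    have h1 := congrArg (aeval v) (euler_planeGrading hP)
    simp only [map_add, map_mul, hd0, hd1, mul_zero, add_zero] at h1
    have h2 : (algebraMap F (AlgebraicClosure F)) (2 * h) ≠ 0 := (map_ne_zero _).2 h2h
    push_cast at h1 h2
    simp only [map_mul, map_ofNat, map_natCast] at h1 h2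
    exact ((mul_eq_zero.1 h1.symm).resolve_left h2)
  have hι : ∀ f, aeval ![v 0, v 1, 0] (planeInclusion F f) = aeval v f := by
    intro f
    rw [planeInclusion, aeval_rename]
    congr 2
    funext i
    fin_cases i <;> rfl
  have hw : ∀ i, 0 < ![a, b, h] i := by
    intro i
    fin_cases i <;> simp <;> omega
  obtain ⟨u, hu, h1⟩ := singular_of_isGradedUnimodular (K := AlgebraicClosure F) hw hφ (Q := Q)
    (v := ![v 0, v 1, 0])
    (by
      intro h0
      apply hv
      funext i
      have h1 := congrFun h0 i.castSucc
      fin_cases i <;> simpa using h1)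
    (by rw [hc, doublePlaneEquation, map_mul, map_sub, hι, hvP]; simp)
    (by
      intro i
      rw [hc, doublePlaneEquation, pderiv_C_mul]
      fin_cases i <;> simp [hι, hd0, hd1, pderiv_X])
  exact hu ((hQ u).1 h1)

/-- As `z` has half the weight of `Q`, it occurs at most to the second power, and the coefficient of
`z ^ 2` has weight zero. -/
theorem exists_eq_quadratic (h0 : 0 < h) (ha : 0 < a) (hb : 0 < b) {Q : MvPolynomial (Fin 3) F}
    (hQ : IsWeightedHomogeneous ![a, b, h] Q (2 * h)) :
    ∃ (c : F) (p₁ p₂ : MvPolynomial (Fin 2) F), p₁ ∈ planeGrading F a b h ∧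
      p₂ ∈ planeGrading F a b (2 * h) ∧
      Q = C c * X 2 ^ 2 + planeInclusion F p₁ * X 2 + planeInclusion F p₂ := by
  refine weightedHomogeneous_induction (motive := fun Q => ∃ (c : F)
      (p₁ p₂ : MvPolynomial (Fin 2) F), p₁ ∈ planeGrading F a b h ∧
      p₂ ∈ planeGrading F a b (2 * h) ∧
      Q = C c * X 2 ^ 2 + planeInclusion F p₁ * X 2 + planeInclusion F p₂) ?_ ?_ ?_ hQ
  · exact ⟨0, 0, 0, zero_mem _, zero_mem _, by simp⟩
  · rintro f g ⟨c, p, q, hp, hq, rfl⟩ ⟨c', p', q', hp', hq', rfl⟩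
    refine ⟨c + c', p + p', q + q', add_mem hp hp', add_mem hq hq', ?_⟩
    simp only [map_add]
    ring
  · intro k q hq
    match k with
    | 0 => exact ⟨0, 0, q, zero_mem _, by simpa using hq, by simp⟩
    | 1 =>
      refine ⟨0, q, 0, ?_, zero_mem _, by simp⟩
      rwa [show ((2 * h : ℕ) : ℤ) - h * (1 : ℕ) = h by push_cast; ring] at hq
    | 2 =>
      have h1 : q = C (coeff 0 q) := by
        refine eq_monomial_of_support_subset_singleton fun d hd => ?_
        have h2 := hq (mem_support_iff.1 hd)
        rw [weight_planeWeights] at h2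
        push_cast at h2
        have h3 : (0 : ℤ) ≤ a * d 0 := by positivity
        have h4 : (0 : ℤ) ≤ b * d 1 := by positivity
        have h5 : (a : ℤ) * d 0 = 0 := by linarith
        have h6 : (b : ℤ) * d 1 = 0 := by linarith
        ext i
        fin_cases i
        · simpa [ha.ne'] using h5
        · simpa [hb.ne'] using h6
      refine ⟨coeff 0 q, 0, 0, zero_mem _, zero_mem _, ?_⟩
      conv_lhs => rw [h1]
      simp [planeInclusion]
    | k + 3 =>
      refine ⟨0, 0, 0, zero_mem _, zero_mem _, ?_⟩
      have h1 : q = 0 := planeGrading_of_neg (by push_cast; nlinarith) hq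
      simp [h1]

/-- Completing the square. -/
theorem exists_isGradedUnimodular_eq_doublePlaneEquation (h2 : (2 : F) ≠ 0) {c : F} (hc : c ≠ 0)
    {p₁ p₂ : MvPolynomial (Fin 2) F} (hp₁ : p₁ ∈ planeGrading F a b h)
    (hp₂ : p₂ ∈ planeGrading F a b (2 * h)) :
    ∃ P ∈ planeGrading F a b (2 * h), ∃ φ : MvPolynomial (Fin 3) F ≃ₐ[F] MvPolynomial (Fin 3) F,
      IsGradedUnimodular ![a, b, h] φ ∧
      φ (C c * X 2 ^ 2 + planeInclusion F p₁ * X 2 + planeInclusion F p₂) =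
        C c * doublePlaneEquation P := by
  -- The substitution `z ↦ z - q` removes the linear term and leaves `c (z ^ 2 - (q ^ 2 - c⁻¹ p₂))`.
  set q : MvPolynomial (Fin 2) F := C (2 * c)⁻¹ * p₁ with hq
  have hqm : q ∈ planeGrading F a b h := by
    rw [hq, ← smul_eq_C_mul]
    exact Submodule.smul_mem _ _ hp₁
  have hι := planeInclusion_mem (h := h) hqm rfl
  have hX := fun i => isWeightedHomogeneous_X F ![a, b, h] i
  have hin : ∀ s : MvPolynomial (Fin 3) F, ∀ f : MvPolynomial (Fin 2) F,
      aeval ![X 0, X 1, s] (planeInclusion F f) = planeInclusion F f := by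
    intro s f
    have h1 : (aeval ![X 0, X 1, s]).comp (planeInclusion F) = planeInclusion F := by
      ext1 i
      rw [AlgHom.comp_apply, planeInclusion_X, aeval_X]
      fin_cases i <;> rfl
    exact DFunLike.congr_fun h1 f
  obtain ⟨φ, hφ, hφ'⟩ := exists_isGradedUnimodular (w := ![a, b, h])
    ![X 0, X 1, X 2 - planeInclusion F q] ![X 0, X 1, X 2 + planeInclusion F q]
    (by
      intro i
      fin_cases i
      · exact hX 0
      · exact hX 1
      · exact (hX 2).sub hι)
    (by
      intro i
      fin_cases i
      · exact hX 0
      · exact hX 1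
      · exact (hX 2).add hι)
    (by
      intro i
      fin_cases i
      · simp
      · simp
      · change aeval _ (X 2 + planeInclusion F q) = X 2
        rw [map_add, hin, aeval_X]
        simp)
    (by
      intro i
      fin_cases i
      · simp
      · simp
      · change aeval _ (X 2 - planeInclusion F q) = X 2
        rw [map_sub, hin, aeval_X]
        simp)
    (by simp [jacobianBracket, pderiv_X])
  refine ⟨q ^ 2 - C c⁻¹ * p₂, ?_, φ, hφ, ?_⟩
  · refine sub_mem ?_ ?_
    · have := mul_mem_planeGrading hqm hqm
      rwa [← pow_two, ← two_mul] at this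
    · rw [← smul_eq_C_mul]
      exact Submodule.smul_mem _ _ hp₂
  · rw [hφ']
    have e1 : planeInclusion F p₁ = C (2 * c) * planeInclusion F q := by
      have : planeInclusion F (C (2 * c)⁻¹) = C (2 * c)⁻¹ := rename_C _ _
      rw [hq, map_mul (planeInclusion F), ← mul_assoc, this, ← C_mul, mul_inv_cancel₀ (mul_ne_zero h2 hc), C_1, one_mul]
    have e2 : planeInclusion F (C c⁻¹) = C c⁻¹ := rename_C _ _
    have e3 : (C c * C c⁻¹ : MvPolynomial (Fin 3) F) = 1 := by
      rw [← C_mul, mul_inv_cancel₀ hc, C_1]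
    have e4 : (C (2 * c) : MvPolynomial (Fin 3) F) = 2 * C c := by
      rw [C_mul, map_ofNat]
    simp only [map_add, map_mul, map_pow, hin, aeval_X, doublePlaneEquation, map_sub, e1, e2, e4, map_ofNat,
      Matrix.cons_val, aeval_C, algebraMap_eq]
    linear_combination (-planeInclusion F p₂) * e3

theorem monomial_sum_induction {w : Fin 3 → ℕ} {m : ℕ} {motive : MvPolynomial (Fin 3) F → Prop}
    (zero : motive 0) (add : ∀ f g, motive f → motive g → motive (f + g))
    (mul : ∀ (c : F) (i j k : ℕ), w 0 * i + w 1 * j + w 2 * k = m →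
      motive (C c * (X 0 ^ i * X 1 ^ j * X 2 ^ k))) {f : MvPolynomial (Fin 3) F}
    (hf : IsWeightedHomogeneous w f m) : motive f := by
  rw [← support_sum_monomial_coeff f]
  refine Finset.sum_induction _ motive add zero fun d hd => ?_
  rw [monomial_eq, Finsupp.prod_fintype _ _ (by simp), Fin.prod_univ_three]
  refine mul _ _ _ _ ?_
  have h2 := hf (mem_support_iff.1 hd)
  rw [Finsupp.weight_apply, Finsupp.sum_fintype _ _ (by simp), Fin.sum_univ_three] at h2
  simpa [mul_comm] using h2

/-- Only monomials `x z ^ k` contribute at this point, and `a + h k = 2h` is impossible for `0 < a <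
h`. -/
theorem eval_pderiv_zero_eq_zero (h0 : 0 < a) (hah : a ≤ h) (hne : a ≠ h)
    {Q : MvPolynomial (Fin 3) F} (hQ : IsWeightedHomogeneous ![a, b, h] Q (2 * h)) :
    eval ![0, 0, 1] (pderiv 0 Q) = 0 := by
  refine monomial_sum_induction (motive := fun Q => eval ![0, 0, 1] (pderiv 0 Q) = 0)
    (by simp) (fun f g hf hg => by simp [hf, hg]) (fun c i j k hw => ?_) hQ
  simp only [Matrix.cons_val] at hw
  rcases Nat.eq_zero_or_pos j with rfl | hj
  · rcases eq_or_ne i 1 with rfl | hi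
    · exfalso
      have h1 : k < 2 := by
        by_contra! hk
        have := Nat.mul_le_mul_left h hk
        omega
      interval_cases k <;> omega
    · rcases Nat.eq_zero_or_pos i with rfl | hi'
      · simp [pderiv_X]
      · have : i - 1 ≠ 0 := by omega
        simp [pderiv_X, this]
  · simp [pderiv_X, hj.ne']

/-- For `y = 0` the polynomial is a quadratic form in `x, z`, and both sides are twice its
coefficient at `x z`. -/
theorem two_mul_eval_pderiv_zero (hh : 0 < h)
    {Q : MvPolynomial (Fin 3) F} (hQ : IsWeightedHomogeneous ![h, b, h] Q (2 * h)) :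
    2 * eval ![0, 0, 1] (pderiv 0 Q) = eval ![1, 0, 1] Q - eval ![-1, 0, 1] Q := by
  refine monomial_sum_induction (motive := fun Q =>
    2 * eval ![0, 0, 1] (pderiv 0 Q) = eval ![1, 0, 1] Q - eval ![-1, 0, 1] Q)
    (by simp) (fun f g hf hg => ?_) (fun c i j k hw => ?_) hQ
  · simp only [map_add]
    linear_combination hf + hg
  simp only [Matrix.cons_val] at hw
  rcases Nat.eq_zero_or_pos j with rfl | hj
  · have hi : i ≤ 2 := by
      by_contra! hi
      have := Nat.mul_le_mul_left h hi
      nlinarith [Nat.zero_le (h * k)]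
    interval_cases i <;> simp [pderiv_X]
    ring
  · simp [pderiv_X, hj.ne']

theorem eval_pderiv_one_eq_zero (h0 : 0 < b) (hah : b ≤ h) (hne : b ≠ h)
    {Q : MvPolynomial (Fin 3) F} (hQ : IsWeightedHomogeneous ![a, b, h] Q (2 * h)) :
    eval ![0, 0, 1] (pderiv 1 Q) = 0 := by
  refine monomial_sum_induction (motive := fun Q => eval ![0, 0, 1] (pderiv 1 Q) = 0)
    (by simp) (fun f g hf hg => by simp [hf, hg]) (fun c i j k hw => ?_) hQ
  simp only [Matrix.cons_val] at hw
  rcases Nat.eq_zero_or_pos i with rfl | hi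
  · rcases eq_or_ne j 1 with rfl | hj
    · exfalso
      have h1 : k < 2 := by
        by_contra! hk
        have := Nat.mul_le_mul_left h hk
        omega
      interval_cases k <;> omega
    · rcases Nat.eq_zero_or_pos j with rfl | hj'
      · simp [pderiv_X]
      · have : j - 1 ≠ 0 := by omega
        simp [pderiv_X, this]
  · simp [pderiv_X, hi.ne']

theorem two_mul_eval_pderiv_one (hh : 0 < h)
    {Q : MvPolynomial (Fin 3) F} (hQ : IsWeightedHomogeneous ![a, h, h] Q (2 * h)) :
    2 * eval ![0, 0, 1] (pderiv 1 Q) = eval ![0, 1, 1] Q - eval ![0, -1, 1] Q := by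
  refine monomial_sum_induction (motive := fun Q =>
    2 * eval ![0, 0, 1] (pderiv 1 Q) = eval ![0, 1, 1] Q - eval ![0, -1, 1] Q)
    (by simp) (fun f g hf hg => ?_) (fun c i j k hw => ?_) hQ
  · simp only [map_add]
    linear_combination hf + hg
  simp only [Matrix.cons_val] at hw
  rcases Nat.eq_zero_or_pos i with rfl | hi
  · have hj : j ≤ 2 := by
      by_contra! hj
      have := Nat.mul_le_mul_left h hj
      nlinarith [Nat.zero_le (h * k)]
    interval_cases j <;> simp [pderiv_X]
    ring
  · simp [pderiv_X, hi.ne']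

/-- The only pure power of `z` of weight `2h` is `z ^ 2`. -/
theorem eval_pderiv_two (hh : 0 < h)
    {Q : MvPolynomial (Fin 3) F} (hQ : IsWeightedHomogeneous ![a, b, h] Q (2 * h)) :
    eval ![0, 0, 1] (pderiv 2 Q) = 2 * eval ![0, 0, 1] Q := by
  refine monomial_sum_induction (motive := fun Q =>
    eval ![0, 0, 1] (pderiv 2 Q) = 2 * eval ![0, 0, 1] Q)
    (by simp) (fun f g hf hg => ?_) (fun c i j k hw => ?_) hQ
  · simp only [map_add]
    linear_combination hf + hg
  simp only [Matrix.cons_val] at hw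
  rcases Nat.eq_zero_or_pos i with rfl | hi
  · rcases Nat.eq_zero_or_pos j with rfl | hj
    · have hk : k = 2 := by
        have : h * k = h * 2 := by omega
        exact Nat.eq_of_mul_eq_mul_left hh this
      subst hk
      simp [pderiv_X]
      ring
    · simp [pderiv_X, hj.ne']
  · simp [pderiv_X, hi.ne']

/-- An isolated singularity has a point off the `(x, y)`-plane of the form `(c₀, c₁, 1)` where it
does not vanish, with `c₀`, `c₁` zero unless the variable has the weight of `z`. -/
theorem exists_eval_ne_zero (h2 : (2 : F) ≠ 0) (h0 : 0 < h) (ha : 0 < a) (hah : a ≤ h) (hb : 0 < b)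
    (hbh : b ≤ h) {Q : MvPolynomial (Fin 3) F} (hQ : IsWeightedHomogeneous ![a, b, h] Q (2 * h))
    (hs : IsIsolatedSingularity Q) :
    ∃ c₀ c₁ : F, (c₀ ≠ 0 → a = h) ∧ (c₁ ≠ 0 → b = h) ∧ eval ![c₀, c₁, 1] Q ≠ 0 := by
  by_contra! H
  -- If `Q` vanished at all these points, `(0, 0, 1)` would be singular. For a variable of weight
  -- `h` the derivative there is a difference of two of these values, and for other variables it
  -- vanishes by weight.
  have e3 := H 0 0 (by simp) (by simp)
  have hd : ∀ i, eval ![0, 0, 1] (pderiv i Q) = 0 := by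
    intro i
    fin_cases i
    · rcases eq_or_ne a h with rfl | hne
      · have h3 := two_mul_eval_pderiv_zero h0 hQ
        rw [H 1 0 (by simp) (by simp), H (-1) 0 (by simp) (by simp), sub_zero] at h3
        exact (mul_eq_zero.1 h3).resolve_left h2
      · exact eval_pderiv_zero_eq_zero ha hah hne hQ
    · rcases eq_or_ne b h with rfl | hne
      · have h3 := two_mul_eval_pderiv_one h0 hQ
        rw [H 0 1 (by simp) (by simp), H 0 (-1) (by simp) (by simp), sub_zero] at h3
        exact (mul_eq_zero.1 h3).resolve_left h2
      · exact eval_pderiv_one_eq_zero hb hbh hne hQ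
    · change eval ![0, 0, 1] (pderiv 2 Q) = 0
      rw [eval_pderiv_two h0 hQ, e3, mul_zero]
  have key : ∀ f : MvPolynomial (Fin 3) F, eval ![0, 0, 1] f = 0 →
      aeval (algebraMap F (AlgebraicClosure F) ∘ ![0, 0, 1]) f = 0 := by
    intro f hf
    rw [aeval_algebraMap_apply, aeval_eq_eval, hf, map_zero]
  have h4 := (hs _).1 ⟨key _ e3, fun i => key _ (hd i)⟩
  simpa using congrFun h4 2

/-- A quasihomogeneous isolated surface singularity of degree `2 h` with `deg z = h` is a double
plane. -/
theorem exists_isDoublePlane_surface (h2h : (2 * h : F) ≠ 0) (hab : h + 2 = a + b) (ha : 2 ≤ a)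
    (hah : a ≤ h) (hb : 2 ≤ b) (hbh : b ≤ h) {Q : MvPolynomial (Fin 3) F}
    (hQ : IsWeightedHomogeneous ![a, b, h] Q (2 * h)) (hs : IsIsolatedSingularity Q) :
    ∃ P e c, IsDoublePlane (surfaceBracket Q) (surfaceGrading Q ![a, b, h]) a b h P e (c : F) := by
  have h2 : (2 : F) ≠ 0 := left_ne_zero_of_mul h2h
  obtain ⟨c₀, c₁, hc₀, hc₁, hc⟩ := exists_eval_ne_zero h2 (by omega) (by omega) hah (by omega) hbh
    hQ hs
  have hX := fun i => isWeightedHomogeneous_X F ![a, b, h] i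
  have hCX : ∀ (c : F) (j : ℕ), (c ≠ 0 → j = h) →
      IsWeightedHomogeneous ![a, b, h] (C c * X 2 : MvPolynomial (Fin 3) F) j := by
    intro c j hj
    rcases eq_or_ne c 0 with rfl | hc
    · simpa using isWeightedHomogeneous_zero F _ j
    · rw [hj hc]
      exact (hX 2).C_mul c
  -- The shear `x ↦ x + c₀ z`, `y ↦ y + c₁ z` is graded because `c₀`, `c₁` are nonzero only for
  -- variables of weight `h`. Afterwards the coefficient of `z ^ 2` is `Q (c₀, c₁, 1)`.
  obtain ⟨φ, hφ, hφ'⟩ := exists_isGradedUnimodular (w := ![a, b, h])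
    ![X 0 + C c₀ * X 2, X 1 + C c₁ * X 2, X 2] ![X 0 - C c₀ * X 2, X 1 - C c₁ * X 2, X 2]
    (by
      intro i
      fin_cases i
      · exact (hX 0).add (hCX c₀ a hc₀)
      · exact (hX 1).add (hCX c₁ b hc₁)
      · exact hX 2)
    (by
      intro i
      fin_cases i
      · exact (hX 0).sub (hCX c₀ a hc₀)
      · exact (hX 1).sub (hCX c₁ b hc₁)
      · exact hX 2)
    (by
      intro i
      fin_cases i <;> simp [algebraMap_eq])
    (by
      intro i
      fin_cases i <;> simp [algebraMap_eq])
    (by simp [jacobianBracket, pderiv_X])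
  obtain ⟨c, p₁, p₂, hp₁, hp₂, hc'⟩ := exists_eq_quadratic (by omega) (by omega) (by omega)
    (hφ.map_mem hQ)
  have hp0 : ∀ {j : ℤ} {q : MvPolynomial (Fin 2) F}, q ∈ planeGrading F a b j → j ≠ 0 →
      eval ![0, 0, 1] (planeInclusion F q) = 0 := by
    intro j q hq hj
    have h1 : eval ![0, 0, 1] (planeInclusion F q) = constantCoeff q := by
      have h2 : (![0, 0, 1] ∘ Fin.castSucc : Fin 2 → F) = 0 := by
        funext i
        fin_cases i <;> rfl
      rw [planeInclusion, eval_rename, h2, eval_zero]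
    rw [h1, constantCoeff_eq]
    exact IsWeightedHomogeneous.coeff_eq_zero hq 0 (by simpa using hj.symm)
  have hcc : c ≠ 0 := by
    have h3 : eval ![0, 0, 1] (φ Q) = eval ![c₀, c₁, 1] Q := by
      rw [hφ', ← aeval_eq_eval, ← aeval_eq_eval]
      have : (aeval ![0, 0, 1]).comp (aeval ![X 0 + C c₀ * X 2, X 1 + C c₁ * X 2, X 2]) =
          (aeval ![c₀, c₁, 1] : MvPolynomial (Fin 3) F →ₐ[F] F) := by
        ext1 i
        fin_cases i <;> simp
      exact DFunLike.congr_fun this Q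
    have hh : (h : ℤ) ≠ 0 := by omega
    rw [hc', map_add, map_add, map_mul, map_mul, hp0 hp₁ hh, hp0 hp₂ (by omega)] at h3
    rintro rfl
    simp at h3
    exact hc h3.symm
  obtain ⟨P, hP, ψ, hψ, hψ'⟩ := exists_isGradedUnimodular_eq_doublePlaneEquation h2 hcc hp₁ hp₂
  have h3 : (φ.trans ψ) Q = C c * doublePlaneEquation P := by
    rw [AlgEquiv.trans_apply, hc', hψ']
  have hbr := isBranchPolynomial_of_isIsolatedSingularity hab ha hb h2h hP hs (hφ.trans hψ) h3
  obtain ⟨e, he⟩ := isDoublePlane_of_isGradedUnimodular hbr rfl (hφ.trans hψ) hcc h3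
  exact ⟨P, e, c, he⟩

end Singularities

/-! ### Rings of invariants with three generators are double planes. -/

section KleinGenerators

open MvPolynomial Matrix

variable {K : Type*} [Field K] {a b h : ℕ} {P x y z : MvPolynomial (Fin 2) K}

theorem pullback_X (γ : SpecialLinearGroup (Fin 2) K) (i : Fin 2) :
    pullback γ (X i) = ∑ j, C (γ.1 i j) * X j := by
  rw [pullback, aeval_X]

theorem pullback_C (γ : SpecialLinearGroup (Fin 2) K) (c : K) : pullback γ (C c) = C c :=
  (pullback γ).commutes c

theorem eval_pullback (γ : SpecialLinearGroup (Fin 2) K) (v : Fin 2 → K)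
    (f : MvPolynomial (Fin 2) K) : eval v (pullback γ f) = eval (γ.1 *ᵥ v) f := by
  have h1 : (aeval v).comp (pullback γ) = (aeval (γ.1 *ᵥ v) : MvPolynomial (Fin 2) K →ₐ[K] K) := by
    ext1 i
    fin_cases i <;> simp [pullback_X]
  exact DFunLike.congr_fun h1 f

theorem pullback_pullback (γ δ : SpecialLinearGroup (Fin 2) K) (f : MvPolynomial (Fin 2) K) :
    pullback γ (pullback δ f) = pullback (δ * γ) f := by
  have h1 : (pullback γ).comp (pullback δ) = pullback (δ * γ) := by
    ext1 i
    have h2 : ∀ j, (δ * γ).1 i j = δ.1 i 0 * γ.1 0 j + δ.1 i 1 * γ.1 1 j := fun j =>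
      (Matrix.mul_apply (M := δ.1) (N := γ.1)).trans (Fin.sum_univ_two _)
    simp only [AlgHom.comp_apply, pullback_X, Fin.sum_univ_two, map_add, map_mul, h2]
    simp only [← algebraMap_eq, AlgHom.commutes]
    ring
  exact DFunLike.congr_fun h1 f

theorem pullback_one (f : MvPolynomial (Fin 2) K) : pullback 1 f = f := by
  have h1 : pullback 1 = AlgHom.id K (MvPolynomial (Fin 2) K) := by
    ext1 i
    fin_cases i <;> simp [pullback_X]
  exact DFunLike.congr_fun h1 f

theorem pullback_isHomogeneous (γ : SpecialLinearGroup (Fin 2) K) {m : ℕ}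
    {f : MvPolynomial (Fin 2) K} (hf : f.IsHomogeneous m) : (pullback γ f).IsHomogeneous m := by
  have h1 := hf.aeval (fun i => ∑ j, C (γ.1 i j) * X j) (n := 1) (fun i =>
    IsHomogeneous.sum _ _ _ fun j _ => by
      have := (isHomogeneous_C (Fin 2) (γ.1 i j)).mul (isHomogeneous_X K j)
      simpa using this)
  simpa [pullback] using h1

theorem pullback_homogeneousComponent (γ : SpecialLinearGroup (Fin 2) K) (m : ℕ)
    (f : MvPolynomial (Fin 2) K) :
    pullback γ (homogeneousComponent m f) = homogeneousComponent m (pullback γ f) := by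
  conv_rhs => rw [← sum_homogeneousComponent f]
  rw [map_sum, map_sum]
  have h1 : ∀ i, homogeneousComponent m (pullback γ (homogeneousComponent i f)) =
      if m = i then pullback γ (homogeneousComponent i f) else 0 := fun i =>
    homogeneousComponent_of_mem (pullback_isHomogeneous γ (homogeneousComponent_isHomogeneous i f))
  simp only [h1]
  rw [Finset.sum_ite_eq _ m]
  split_ifs with hm
  · rfl
  · rw [homogeneousComponent_eq_zero, map_zero]
    simpa using hm

theorem homogeneousComponent_mem_invariants {Γ : Subgroup (SpecialLinearGroup (Fin 2) K)}
    {f : MvPolynomial (Fin 2) K} (hf : f ∈ invariants Γ) (m : ℕ) :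
    homogeneousComponent m f ∈ invariants Γ := fun γ hγ => by
  rw [pullback_homogeneousComponent, hf γ hγ]

theorem planeBracket_isHomogeneous {i j : ℕ} {f g : MvPolynomial (Fin 2) K}
    (hf : f.IsHomogeneous i) (hg : g.IsHomogeneous j) :
    (planeBracket f g).IsHomogeneous (i - 1 + (j - 1)) :=
  (hf.pderiv.mul hg.pderiv).sub (hf.pderiv.mul hg.pderiv)

/-- The map `(f, g) ↦ f (x, y) + g (x, y) z`. -/
noncomputable def kleinMap (x y z : MvPolynomial (Fin 2) K) :
    (MvPolynomial (Fin 2) K × MvPolynomial (Fin 2) K) →ₗ[K] MvPolynomial (Fin 2) K :=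
  (aeval ![x, y]).toLinearMap.coprod
    ((LinearMap.mulRight K z).comp (aeval ![x, y]).toLinearMap)

theorem kleinMap_apply (u : MvPolynomial (Fin 2) K × MvPolynomial (Fin 2) K) :
    kleinMap x y z u = aeval ![x, y] u.1 + aeval ![x, y] u.2 * z := rfl

/-- The polynomials of degree `m` in `K[x, y] + K[x, y] z`. -/
noncomputable def kleinSpan (a b h : ℕ) (x y z : MvPolynomial (Fin 2) K) (m : ℕ) :
    Submodule K (MvPolynomial (Fin 2) K) :=
  (doublePlaneGrading K a b h m).map (kleinMap x y z)

/-- The relation `z ^ 2 = P (x, y)` makes `K[x, y] + K[x, y] z` closed under products, compatibly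
with weights. -/
theorem mul_mem_kleinSpan (hP : P ∈ planeGrading K a b (2 * h)) (hz : z ^ 2 = aeval ![x, y] P)
    {i j : ℕ} {f g : MvPolynomial (Fin 2) K} (hf : f ∈ kleinSpan a b h x y z i)
    (hg : g ∈ kleinSpan a b h x y z j) : f * g ∈ kleinSpan a b h x y z (i + j) := by
  obtain ⟨u, hu, rfl⟩ := hf
  obtain ⟨v, hv, rfl⟩ := hg
  refine ⟨(u.1 * v.1 + u.2 * v.2 * P, u.1 * v.2 + u.2 * v.1), ⟨?_, ?_⟩, ?_⟩
  · push_cast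
    refine add_mem (mul_mem_planeGrading hu.1 hv.1) ?_
    have := mul_mem_planeGrading (mul_mem_planeGrading hu.2 hv.2) hP
    rwa [show (i : ℤ) - h + (j - h) + 2 * h = i + j by ring] at this
  · push_cast
    refine add_mem ?_ ?_
    · have := mul_mem_planeGrading hu.1 hv.2
      rwa [show (i : ℤ) + (j - h) = i + j - h by ring] at this
    · have := mul_mem_planeGrading hu.2 hv.1
      rwa [show (i : ℤ) - h + j = i + j - h by ring] at this
  · simp only [kleinMap_apply, map_add, map_mul, ← hz]
    ring

theorem left_mem_kleinSpan : x ∈ kleinSpan a b h x y z a :=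
  ⟨(X 0, 0), ⟨X_zero_mem, zero_mem _⟩, by simp [kleinMap_apply]⟩

theorem right_mem_kleinSpan : y ∈ kleinSpan a b h x y z b :=
  ⟨(X 1, 0), ⟨X_one_mem, zero_mem _⟩, by simp [kleinMap_apply]⟩

theorem C_mem_planeGrading (c : K) : (C c : MvPolynomial (Fin 2) K) ∈ planeGrading K a b 0 :=
  isWeightedHomogeneous_C _ _

theorem third_mem_kleinSpan : z ∈ kleinSpan a b h x y z h :=
  ⟨(0, C 1), ⟨zero_mem _, by rw [sub_self]; exact C_mem_planeGrading 1⟩, by simp [kleinMap_apply]⟩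

theorem C_mem_kleinSpan (c : K) : C c ∈ kleinSpan a b h x y z 0 :=
  ⟨(C c, 0), ⟨C_mem_planeGrading c, zero_mem _⟩, by simp [kleinMap_apply, algebraMap_eq]⟩

theorem pow_mem_kleinSpan (hP : P ∈ planeGrading K a b (2 * h)) (hz : z ^ 2 = aeval ![x, y] P)
    {i : ℕ} {f : MvPolynomial (Fin 2) K} (hf : f ∈ kleinSpan a b h x y z i) (n : ℕ) :
    f ^ n ∈ kleinSpan a b h x y z (i * n) := by
  induction n with
  | zero => simpa using C_mem_kleinSpan (x := x) (y := y) (z := z) 1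
  | succ n ih =>
    rw [pow_succ, mul_add, mul_one]
    exact mul_mem_kleinSpan hP hz ih hf

/-- Generators `x, y, z` of the ring of invariants of `Γ` satisfying `z ^ 2 = P (x, y)` and
`{x, y} = c z`. -/
structure KleinGenerators (Γ : Subgroup (SpecialLinearGroup (Fin 2) K)) (a b h : ℕ)
    (P x y z : MvPolynomial (Fin 2) K) (c : K) : Prop where
  branch : IsBranchPolynomial a b h P
  left_mem : x ∈ invariants Γ
  right_mem : y ∈ invariants Γ
  third_mem : z ∈ invariants Γ
  left_isHomogeneous : x.IsHomogeneous a
  right_isHomogeneous : y.IsHomogeneous b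
  third_isHomogeneous : z.IsHomogeneous h
  sq_eq : z ^ 2 = aeval ![x, y] P
  bracket_eq : planeBracket x y = C c * z
  ne_zero : c ≠ 0
  exists_eval : ∃ v : Fin 2 → K, eval v x = 0 ∧ eval v y ≠ 0
  mem_kleinSpan : ∀ {m f}, f ∈ invariants Γ → f.IsHomogeneous m → f ∈ kleinSpan a b h x y z m

theorem X_zero_dvd_of_aeval_eq_zero {f : MvPolynomial (Fin 2) K}
    (hf : aeval ![(0 : Polynomial K), Polynomial.X] f = 0) : X 0 ∣ f := by
  have h1 : ∀ g : MvPolynomial (Fin 2) K,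
      X 0 ∣ g - Polynomial.aeval (X 1) (aeval ![(0 : Polynomial K), Polynomial.X] g) := by
    intro g
    induction g using MvPolynomial.induction_on with
    | C a => simp [algebraMap_eq]
    | add f g hf hg =>
      rw [map_add, map_add, add_sub_add_comm]
      exact dvd_add hf hg
    | mul_X f k hf =>
      rw [map_mul, map_mul, aeval_X]
      fin_cases k
      · simp
      · simpa [← sub_mul] using Dvd.dvd.mul_right hf (X 1)
  simpa [hf] using h1 f

theorem eval_smul_of_isHomogeneous {m : ℕ} {f : MvPolynomial (Fin 2) K} (hf : f.IsHomogeneous m)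
    (s : K) (v : Fin 2 → K) : eval (s • v) f = s ^ m * eval v f := by
  rw [eval_eq', eval_eq', Finset.mul_sum]
  refine Finset.sum_congr rfl fun d hd => ?_
  have h1 : m = d 0 + d 1 := by
    rw [← hf (mem_support_iff.1 hd), Finsupp.weight_apply, Finsupp.sum_fintype _ _ (by simp)]
    simp
  rw [h1]
  simp only [Fin.prod_univ_two, Pi.smul_apply, smul_eq_mul, mul_pow, pow_add]
  ring

/-- Divide a relation `f (x, y) = 0` by the highest power of `X` in `f`. On the line through `v` the
form `x` vanishes, while `y` takes every value, since `y (s v) = s ^ b y (v)`. So `f (0, Y) = 0`,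
and `X` still divides `f`, a contradiction. -/
theorem aeval_injective [IsAlgClosed K] (hx : x.IsHomogeneous a) (hy : y.IsHomogeneous b) (hb : 0 < b)
    (hx0 : x ≠ 0) {v : Fin 2 → K} (hvx : eval v x = 0) (hvy : eval v y ≠ 0) :
    Function.Injective (aeval ![x, y] : MvPolynomial (Fin 2) K →ₐ[K] MvPolynomial (Fin 2) K) := by
  rw [injective_iff_map_eq_zero]
  intro f hf
  by_contra hf0
  have hfin : FiniteMultiplicity (X 0) f :=
    FiniteMultiplicity.of_not_isUnit (X_prime (i := (0 : Fin 2))).not_isUnit hf0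
  obtain ⟨g, hg, hg'⟩ := hfin.exists_eq_pow_mul_and_not_dvd
  refine hg' (X_zero_dvd_of_aeval_eq_zero ?_)
  have h1 : aeval ![x, y] g = 0 := by
    rw [hg, map_mul, map_pow, aeval_X] at hf
    exact (mul_eq_zero.1 hf).resolve_left (pow_ne_zero _ hx0)
  refine Polynomial.funext fun r => ?_
  obtain ⟨s, hs⟩ := IsAlgClosed.exists_pow_nat_eq (r / eval v y) hb
  have h3 := congrArg (eval (s • v)) h1
  rw [map_zero] at h3
  rw [Polynomial.eval_zero, ← h3]
  have h4 : (Polynomial.aeval r).comp (aeval ![(0 : Polynomial K), Polynomial.X]) =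
      ((aeval (s • v)).comp (aeval ![x, y]) : MvPolynomial (Fin 2) K →ₐ[K] K) := by
    ext1 i
    fin_cases i
    · simp [aeval_eq_eval, eval_smul_of_isHomogeneous hx, hvx]
    · simp [aeval_eq_eval, eval_smul_of_isHomogeneous hy, hs, hvy]
  exact DFunLike.congr_fun h4 g

/-- If `q ^ 2` divides `P`, then `q` divides both partial derivatives. -/
theorem IsBranchPolynomial.squarefree (hP : IsBranchPolynomial a b h P) : Squarefree P := by
  rintro q ⟨s, rfl⟩
  refine hP.isRelPrime ⟨pderiv 0 q * s * 2 + q * pderiv 0 s, ?_⟩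
    ⟨pderiv 1 q * s * 2 + q * pderiv 1 s, ?_⟩
  · simp only [pderiv_mul]
    ring
  · simp only [pderiv_mul]
    ring

theorem IsBranchPolynomial.not_isUnit (hP : IsBranchPolynomial a b h P) : ¬ IsUnit P := by
  intro hu
  have h1 : constantCoeff P = 0 := by
    rw [constantCoeff_eq]
    refine IsWeightedHomogeneous.coeff_eq_zero hP.mem 0 ?_
    have := hP.two_le_left
    have := hP.two_le_right
    have := hP.add_two
    rw [map_zero]
    omega
  exact not_isUnit_zero (h1 ▸ hu.map constantCoeff)

theorem aeval_mem_of_mem_planeGrading (hx : x.IsHomogeneous a) (hy : y.IsHomogeneous b) {m : ℕ}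
    {f : MvPolynomial (Fin 2) K} (hf : f ∈ planeGrading K a b m) :
    (aeval ![x, y] f).IsHomogeneous m := by
  rw [aeval_def, eval₂_eq', algebraMap_eq]
  refine IsHomogeneous.sum _ _ _ fun d hd => ?_
  have h1 := hf (mem_support_iff.1 hd)
  rw [weight_planeWeights] at h1
  have h2 : 0 + (a * d 0 + b * d 1) = m := by
    rw [zero_add]
    exact_mod_cast h1
  rw [← h2, Fin.prod_univ_two]
  exact (isHomogeneous_C _ _).mul ((hx.pow _).mul (hy.pow _))

theorem aeval_mem_invariants {Γ : Subgroup (SpecialLinearGroup (Fin 2) K)} (hx : x ∈ invariants Γ)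
    (hy : y ∈ invariants Γ) (f : MvPolynomial (Fin 2) K) : aeval ![x, y] f ∈ invariants Γ := by
  induction f using MvPolynomial.induction_on with
  | C a => 
    rw [aeval_C]
    exact Subalgebra.algebraMap_mem _ _
  | add f g hf hg =>
    rw [map_add]
    exact add_mem hf hg
  | mul_X f k hf =>
    rw [map_mul, aeval_X]
    refine mul_mem hf ?_
    fin_cases k
    · exact hx
    · exact hy

theorem pderiv_aeval_pair (i : Fin 2) (f : MvPolynomial (Fin 2) K) :
    pderiv i (aeval ![x, y] f) = aeval ![x, y] (pderiv 0 f) * pderiv i x +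
      aeval ![x, y] (pderiv 1 f) * pderiv i y := by
  induction f using MvPolynomial.induction_on with
  | C a => simp [algebraMap_eq]
  | add f g hf hg =>
    simp only [map_add, hf, hg]
    ring
  | mul_X f k hf =>
    simp only [map_mul, pderiv_mul, hf, map_add, aeval_X]
    fin_cases k <;> simp [pderiv_X] <;> ring

theorem planeBracket_aeval (f g : MvPolynomial (Fin 2) K) :
    planeBracket (aeval ![x, y] f) (aeval ![x, y] g) =
      aeval ![x, y] (planeBracket f g) * planeBracket x y := by
  simp only [planeBracket, pderiv_aeval_pair, map_sub, map_mul]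
  ring

namespace KleinGenerators

variable {Γ : Subgroup (SpecialLinearGroup (Fin 2) K)} {c : K}

theorem kleinMap_mem (hk : KleinGenerators Γ a b h P x y z c)
    (u : MvPolynomial (Fin 2) K × MvPolynomial (Fin 2) K) : kleinMap x y z u ∈ invariants Γ :=
  add_mem (aeval_mem_invariants hk.left_mem hk.right_mem _)
    (mul_mem (aeval_mem_invariants hk.left_mem hk.right_mem _) hk.third_mem)

theorem third_ne_zero [IsAlgClosed K] (hk : KleinGenerators Γ a b h P x y z c) (hx : x ≠ 0) :
    z ≠ 0 := by
  rintro rfl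
  obtain ⟨v, hvx, hvy⟩ := hk.exists_eval
  have h1 := hk.sq_eq
  rw [zero_pow two_ne_zero] at h1
  exact hk.branch.ne_zero ((injective_iff_map_eq_zero _).1 (aeval_injective hk.left_isHomogeneous
    hk.right_isHomogeneous hk.branch.right_pos hx hvx hvy) P h1.symm)

/-- Compute `{f, z ^ 2}` as `2z {f, z}` by the Leibniz rule, and as the plane bracket of `f` and `P`
at `(x, y)` times `{x, y} = c z` by the chain rule; then cancel `z`. -/
theorem planeBracket_third (hk : KleinGenerators Γ a b h P x y z c) (hz : z ≠ 0)
    (f : MvPolynomial (Fin 2) K) :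
    2 * planeBracket (aeval ![x, y] f) z = C c * aeval ![x, y] (planeBracket f P) := by
  have h1 := planeBracket_aeval (x := x) (y := y) f P
  rw [← hk.sq_eq, hk.bracket_eq] at h1
  refine mul_left_cancel₀ hz ?_
  have h2 : planeBracket (aeval ![x, y] f) (z ^ 2) =
      z * (2 * planeBracket (aeval ![x, y] f) z) := by
    simp only [planeBracket, pow_two, pderiv_mul]
    ring
  rw [← h2, h1]
  ring

/-- From `f + g z = 0` one gets `f ^ 2 = g ^ 2 P`. If `g ≠ 0`, then `g` divides `f` and `P` is a
square, which is impossible for a squarefree nonunit. -/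
theorem kleinMap_injective [IsAlgClosed K] (hk : KleinGenerators Γ a b h P x y z c) (hx : x ≠ 0) :
    Function.Injective (kleinMap x y z) := by
  obtain ⟨v, hvx, hvy⟩ := hk.exists_eval
  have hinj := aeval_injective hk.left_isHomogeneous
    hk.right_isHomogeneous hk.branch.right_pos hx hvx hvy
  rw [← LinearMap.ker_eq_bot, LinearMap.ker_eq_bot']
  rintro ⟨f, g⟩ hfg
  rw [kleinMap_apply] at hfg
  have h1 : f ^ 2 = g ^ 2 * P := by
    apply hinj
    rw [map_mul, map_pow, map_pow, ← hk.sq_eq]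
    linear_combination (aeval ![x, y] f - aeval ![x, y] g * z) * hfg
  have hg : g = 0 := by
    by_contra hg
    have h2 : g ∣ f := (UniqueFactorizationMonoid.pow_dvd_pow_iff_dvd two_ne_zero).1 ⟨P, h1⟩
    obtain ⟨k, rfl⟩ := h2
    have h3 : k * k = P := by
      refine mul_left_cancel₀ (pow_ne_zero 2 hg) ?_
      rw [← h1]
      ring
    have h4 := hk.branch.squarefree k (h3 ▸ dvd_rfl)
    exact hk.branch.not_isUnit (h3 ▸ h4.mul h4)
  subst hg
  rw [zero_pow two_ne_zero, zero_mul] at h1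
  rw [pow_eq_zero_iff two_ne_zero] at h1
  rw [h1]
  rfl

/-- The constant is `c / 2` because `{x, y}` is `c z` here and `2 z` in the double plane. -/
theorem exists_isDoublePlane [IsAlgClosed K] (h2 : (2 : K) ≠ 0)
    (hk : KleinGenerators Γ a b h P x y z c) (hx : x ≠ 0) :
    ∃ e, IsDoublePlane (invariantBracket Γ) (invariantGrading Γ) a b h P e (c / 2) := by
  have hz := hk.third_ne_zero hx
  let e₀ : (MvPolynomial (Fin 2) K × MvPolynomial (Fin 2) K) →ₗ[K] invariants Γ :=
    (kleinMap x y z).codRestrict (Subalgebra.toSubmodule (invariants Γ)) hk.kleinMap_mem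
  have he₀ : ∀ u, (e₀ u).1 = kleinMap x y z u := fun _ => rfl
  have hmem : ∀ m (f : invariants Γ), f.1.IsHomogeneous m →
      ∃ u ∈ doublePlaneGrading K a b h m, e₀ u = f := by
    intro m f hf
    obtain ⟨u, hu, h1⟩ := hk.mem_kleinSpan f.2 hf
    exact ⟨u, hu, Subtype.ext h1⟩
  have hbij : Function.Bijective e₀ := by
    constructor
    · intro u v huv
      exact hk.kleinMap_injective hx (congrArg Subtype.val huv)
    · intro f
      have h1 : f = ∑ i ∈ Finset.range (f.1.totalDegree + 1),
          (⟨homogeneousComponent i f.1, homogeneousComponent_mem_invariants f.2 i⟩ :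
            invariants Γ) := by
        apply Subtype.ext
        rw [AddSubmonoidClass.coe_finsetSum]
        exact (sum_homogeneousComponent f.1).symm
      change f ∈ LinearMap.range e₀
      rw [h1]
      refine Submodule.sum_mem _ fun i _ => ?_
      obtain ⟨u, -, hu⟩ := hmem i ⟨homogeneousComponent i f.1, homogeneousComponent_mem_invariants f.2 i⟩
        (homogeneousComponent_isHomogeneous i f.1)
      exact ⟨u, hu⟩
  refine ⟨LinearEquiv.ofBijective e₀ hbij, hk.branch, div_ne_zero hk.ne_zero h2, ?_, ?_⟩
  · intro u v
    apply Subtype.ext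
    change planeBracket (kleinMap x y z u) (kleinMap x y z v) =
      (c / 2) • kleinMap x y z (doublePlaneBracket P u v)
    have h3 : (2 : MvPolynomial (Fin 2) K) ≠ 0 := by
      rw [← map_ofNat (C (σ := Fin 2) (R := K)) 2]
      exact C_ne_zero.2 h2
    -- `planeBracket_third` computes `2 {f, z}`, so the identity is proved after multiplication by
    -- 2.
    refine mul_left_cancel₀ h3 ?_
    have h4 : (2 : MvPolynomial (Fin 2) K) * C (c / 2) = C c := by
      rw [← map_ofNat (C (σ := Fin 2) (R := K)) 2, ← C_mul, mul_div_cancel₀ _ h2]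
    rw [smul_eq_C_mul, ← mul_assoc, h4]
    have e11 := planeBracket_aeval (x := x) (y := y) u.1 v.1
    have e12 := planeBracket_aeval (x := x) (y := y) u.1 v.2
    have e21 := planeBracket_aeval (x := x) (y := y) v.1 u.2
    have e22 := planeBracket_aeval (x := x) (y := y) u.2 v.2
    have f1 := hk.planeBracket_third hz u.1
    have f2 := hk.planeBracket_third hz u.2
    have g1 := hk.planeBracket_third hz v.1
    have g2 := hk.planeBracket_third hz v.2
    have hq := hk.sq_eq
    rw [hk.bracket_eq] at e11 e12 e21 e22
    simp only [kleinMap_apply, doublePlaneBracket]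
    have hexp : ∀ f₁ f₂ g₁ g₂ : MvPolynomial (Fin 2) K,
        planeBracket (f₁ + f₂ * z) (g₁ + g₂ * z) = planeBracket f₁ g₁ + g₂ * planeBracket f₁ z +
          z * planeBracket f₁ g₂ - f₂ * planeBracket g₁ z - z * planeBracket g₁ f₂ +
          z ^ 2 * planeBracket f₂ g₂ + z * g₂ * planeBracket f₂ z -
          z * f₂ * planeBracket g₂ z := by
      intros
      simp only [planeBracket, map_add, pderiv_mul]
      ring
    have hB : planeBracket (P * u.2) v.2 + planeBracket u.2 (P * v.2) =
        2 * P * planeBracket u.2 v.2 - u.2 * planeBracket v.2 P + v.2 * planeBracket u.2 P := by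
      simp only [planeBracket, pderiv_mul]
      ring
    rw [add_assoc, hB, hexp]
    simp only [map_add, map_sub, map_mul, map_ofNat]
    linear_combination 2 * e11 + 2 * z * e12 - 2 * z * e21 + 2 * z ^ 2 * e22 +
      aeval ![x, y] v.2 * f1 - aeval ![x, y] u.2 * g1 + z * aeval ![x, y] v.2 * f2 -
      z * aeval ![x, y] u.2 * g2 + (2 * C c * aeval ![x, y] (planeBracket u.1 v.2) -
      2 * C c * aeval ![x, y] (planeBracket v.1 u.2) +
      2 * C c * z * aeval ![x, y] (planeBracket u.2 v.2)) * hq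
  · intro m
    apply le_antisymm
    · intro f hf
      obtain ⟨u, hu, h1⟩ := hmem m f hf
      exact ⟨u, hu, h1⟩
    · rintro _ ⟨u, hu, rfl⟩
      change (kleinMap x y z u).IsHomogeneous m
      rw [kleinMap_apply]
      refine (aeval_mem_of_mem_planeGrading hk.left_isHomogeneous hk.right_isHomogeneous hu.1).add ?_
      rcases lt_or_ge m h with hm | hm
      · rw [planeGrading_of_neg (by omega) hu.2]
        simpa using isHomogeneous_zero _ _ m
      · have h1 := (aeval_mem_of_mem_planeGrading (m := m - h) hk.left_isHomogeneous
          hk.right_isHomogeneous (f := u.2) (by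
            have := hu.2
            rwa [show (m : ℤ) - h = (m - h : ℕ) by omega] at this)).mul hk.third_isHomogeneous
        rwa [Nat.sub_add_cancel hm] at h1

/-- Generators for a conjugate subgroup. -/
theorem conj (g : SpecialLinearGroup (Fin 2) K) {Δ : Subgroup (SpecialLinearGroup (Fin 2) K)}
    (hΔ : ∀ γ, γ ∈ Δ ↔ g * γ * g⁻¹ ∈ Γ) (hk : KleinGenerators Γ a b h P x y z c) :
    KleinGenerators Δ a b h P (pullback g x) (pullback g y) (pullback g z) c := by
  have h1 : ∀ f ∈ invariants Γ, pullback g f ∈ invariants Δ := by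
    intro f hf γ hγ
    have h2 := hf _ ((hΔ γ).1 hγ)
    conv_rhs => rw [← h2]
    rw [pullback_pullback, pullback_pullback]
    congr 2
    group
  have h2 : ∀ f ∈ invariants Δ, pullback g⁻¹ f ∈ invariants Γ := by
    intro f hf γ hγ
    have h2 := hf (g⁻¹ * γ * g) ((hΔ _).2 (by
      convert hγ using 1
      group))
    conv_rhs => rw [← h2]
    rw [pullback_pullback, pullback_pullback]
    congr 2
    group
  have h3 : ∀ f : MvPolynomial (Fin 2) K, aeval ![pullback g x, pullback g y] f =
      pullback g (aeval ![x, y] f) := by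
    intro f
    have : (aeval ![pullback g x, pullback g y] :
        MvPolynomial (Fin 2) K →ₐ[K] MvPolynomial (Fin 2) K) =
        (pullback g).comp (aeval ![x, y]) := by
      ext1 i
      fin_cases i <;> simp
    exact DFunLike.congr_fun this f
  refine ⟨hk.branch, h1 _ hk.left_mem, h1 _ hk.right_mem, h1 _ hk.third_mem,
    pullback_isHomogeneous g hk.left_isHomogeneous, pullback_isHomogeneous g hk.right_isHomogeneous,
    pullback_isHomogeneous g hk.third_isHomogeneous, ?_, ?_, hk.ne_zero, ?_, ?_⟩
  · rw [h3, ← map_pow, hk.sq_eq]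
  · rw [planeBracket_pullback, hk.bracket_eq, map_mul, pullback_C]
  · obtain ⟨v, hv⟩ := hk.exists_eval
    refine ⟨g⁻¹.1 *ᵥ v, ?_⟩
    rw [← eval_pullback, ← eval_pullback, pullback_pullback, pullback_pullback, mul_inv_cancel,
      pullback_one, pullback_one]
    exact hv
  · intro m f hf hm
    obtain ⟨u, hu, h4⟩ := hk.mem_kleinSpan (h2 f hf) (pullback_isHomogeneous g⁻¹ hm)
    refine ⟨u, hu, ?_⟩
    rw [kleinMap_apply, h3, h3, ← map_mul, ← map_add, ← kleinMap_apply, h4, pullback_pullback,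
      inv_mul_cancel, pullback_one]

end KleinGenerators

end KleinGenerators

/-! ### Passing to the algebraic closure. -/

section BaseChange

open MvPolynomial Matrix

variable {F : Type*} [Field F] (K : Type*) [Field K] [Algebra F K]

theorem linearIndependent_map_algebraMap {ι σ : Type*} {v : ι → MvPolynomial σ F}
    (hv : LinearIndependent F v) :
    LinearIndependent K fun i => MvPolynomial.map (algebraMap F K) (v i) := by
  classical
  let b : Module.Basis _ F (MvPolynomial σ F) := .extend hv.linearIndepOn_id
  let b' := (b.baseChange K).map (algebraTensorAlgEquiv F K (σ := σ)).toLinearEquiv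
  let v' : ι → hv.linearIndepOn_id.extend (Set.subset_univ _) := fun i =>
    ⟨v i, hv.linearIndepOn_id.subset_extend _ (Set.mem_range_self i)⟩
  have hv' : b' ∘ v' = fun i => MvPolynomial.map (algebraMap F K) (v i) := by
    funext i
    simp [b', b, v', Module.Basis.extend]
  rw [← hv']
  exact b'.linearIndependent.comp _ fun i j hij => hv.injective (congrArg Subtype.val hij)

/-- The `K`-span of a space of polynomials over `F`. -/
noncomputable def extendScalars {σ : Type*} (V : Submodule F (MvPolynomial σ F)) :
    Submodule K (MvPolynomial σ K) :=
  Submodule.span K (MvPolynomial.map (algebraMap F K) '' V)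

theorem finrank_extendScalars {σ : Type*} (V : Submodule F (MvPolynomial σ F)) :
    Module.finrank K (extendScalars K V) = Module.finrank F V := by
  let b := Module.Basis.ofVectorSpace F V
  have h1 : LinearIndependent F fun i => (b i : MvPolynomial σ F) :=
    b.linearIndependent.map' V.subtype V.ker_subtype
  have h2 := linearIndependent_map_algebraMap K h1
  have h3 : extendScalars K V = Submodule.span K (Set.range fun i =>
      MvPolynomial.map (algebraMap F K) (b i : MvPolynomial σ F)) := by
    apply le_antisymm
    · refine Submodule.span_le.2 ?_
      rintro _ ⟨f, hf, rfl⟩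
      have h4 : (⟨f, hf⟩ : V) ∈ Submodule.span F (Set.range b) := by rw [b.span_eq]; trivial
      let φ : MvPolynomial σ F →ₗ[F] MvPolynomial σ K := (MvPolynomial.mapAlgHom (Algebra.ofId F K)).toLinearMap
      have h5 : Submodule.span F (Set.range b) ≤ ((Submodule.span K (Set.range fun i =>
        MvPolynomial.map (algebraMap F K) (b i : MvPolynomial σ F))).restrictScalars F).comap
          (φ ∘ₗ V.subtype) := by
        refine Submodule.span_le.2 ?_
        rintro _ ⟨i, rfl⟩
        exact Submodule.subset_span ⟨i, rfl⟩
      exact h5 h4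
    · refine Submodule.span_mono ?_
      rintro _ ⟨i, rfl⟩
      exact ⟨_, (b i).2, rfl⟩
  rw [h3, Module.finrank_eq_nat_card_basis (Module.Basis.span h2), Module.finrank_eq_nat_card_basis b]

/-- Used for `homogeneousComponent`, to compare degreewise dimensions over `F` and `K`. -/
theorem map_extendScalars {σ : Type*} (V : Submodule F (MvPolynomial σ F))
    (A : MvPolynomial σ F →ₗ[F] MvPolynomial σ F) (B : MvPolynomial σ K →ₗ[K] MvPolynomial σ K)
    (hAB : ∀ f, B (MvPolynomial.map (algebraMap F K) f) = MvPolynomial.map (algebraMap F K) (A f)) :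
    (extendScalars K V).map B = extendScalars K (V.map A) := by
  rw [extendScalars, extendScalars, Submodule.map_span]
  congr 1
  ext f
  constructor
  · rintro ⟨_, ⟨g, hg, rfl⟩, rfl⟩
    exact ⟨A g, ⟨g, hg, rfl⟩, (hAB g).symm⟩
  · rintro ⟨_, ⟨g, hg, rfl⟩, rfl⟩
    exact ⟨_, ⟨g, hg, rfl⟩, hAB g⟩

/-- The brackets of invariants, as polynomials. -/
noncomputable def invariantBracketSpan (Γ : Subgroup (SpecialLinearGroup (Fin 2) F)) :
    Submodule F (MvPolynomial (Fin 2) F) :=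
  Submodule.span F {q | ∃ f ∈ invariants Γ, ∃ g ∈ invariants Γ, q = planeBracket f g}

theorem map_bracketSpan (Γ : Subgroup (SpecialLinearGroup (Fin 2) F)) :
    (bracketSpan F (invariantBracket Γ)).map (invariants Γ).val.toLinearMap =
      invariantBracketSpan Γ := by
  rw [bracketSpan, invariantBracketSpan, Submodule.map_span]
  congr 1
  ext q
  constructor
  · rintro ⟨_, ⟨f, g, rfl⟩, rfl⟩
    exact ⟨f.1, f.2, g.1, g.2, rfl⟩
  · rintro ⟨f, hf, g, hg, rfl⟩
    exact ⟨_, ⟨⟨f, hf⟩, ⟨g, hg⟩, rfl⟩, rfl⟩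

theorem homogeneousComponent_mem_invariantBracketSpan
    (Γ : Subgroup (SpecialLinearGroup (Fin 2) F)) (m : ℕ) {q : MvPolynomial (Fin 2) F}
    (hq : q ∈ invariantBracketSpan Γ) : homogeneousComponent m q ∈ invariantBracketSpan Γ := by
  have h1 : invariantBracketSpan Γ ≤ (invariantBracketSpan Γ).comap (homogeneousComponent m) := by
    refine Submodule.span_le.2 ?_
    rintro _ ⟨f, hf, g, hg, rfl⟩
    have h2 : planeBracket f g = ∑ i ∈ Finset.range (f.totalDegree + 1),
        ∑ j ∈ Finset.range (g.totalDegree + 1),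
          planeBracket (homogeneousComponent i f) (homogeneousComponent j g) := by
      conv_lhs => rw [← sum_homogeneousComponent f, ← sum_homogeneousComponent g]
      simp only [planeBracket, map_sum, Finset.sum_mul_sum, Finset.sum_sub_distrib]
    rw [SetLike.mem_coe, Submodule.mem_comap, h2, map_sum]
    refine Submodule.sum_mem _ fun i _ => ?_
    rw [map_sum]
    refine Submodule.sum_mem _ fun j _ => ?_
    rw [homogeneousComponent_of_mem (planeBracket_isHomogeneous
      (homogeneousComponent_isHomogeneous i f) (homogeneousComponent_isHomogeneous j g))]
    split_ifs
    · exact Submodule.subset_span ⟨_, homogeneousComponent_mem_invariants hf i, _,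
        homogeneousComponent_mem_invariants hg j, rfl⟩
    · exact zero_mem _
  exact h1 hq

theorem inf_homogeneousSubmodule_eq_map {V : Submodule F (MvPolynomial (Fin 2) F)} {m : ℕ}
    (hV : ∀ f ∈ V, homogeneousComponent m f ∈ V) :
    homogeneousSubmodule (Fin 2) F m ⊓ V = V.map (homogeneousComponent m) := by
  apply le_antisymm
  · rintro f ⟨hf, hfV⟩
    exact ⟨f, hfV, by rw [homogeneousComponent_of_mem hf, if_pos rfl]⟩
  · rintro _ ⟨f, hf, rfl⟩
    exact ⟨homogeneousComponent_isHomogeneous m f, hV f hf⟩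

theorem map_invariantGrading (Γ : Subgroup (SpecialLinearGroup (Fin 2) F)) (m : ℕ) :
    (invariantGrading Γ m).map (invariants Γ).val.toLinearMap =
      (Subalgebra.toSubmodule (invariants Γ)).map (homogeneousComponent m) := by
  rw [← inf_homogeneousSubmodule_eq_map fun f hf => homogeneousComponent_mem_invariants hf m]
  ext f
  constructor
  · rintro ⟨g, hg, rfl⟩
    exact ⟨hg, g.2⟩
  · rintro ⟨hf, hf'⟩
    exact ⟨⟨f, hf'⟩, hf, rfl⟩

theorem finite_invariantGrading (Γ : Subgroup (SpecialLinearGroup (Fin 2) F)) (m : ℕ) :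
    Module.Finite F (invariantGrading Γ m) := by
  have h1 : Module.Finite F (homogeneousSubmodule (Fin 2) F m) :=
    Module.Finite.iff_fg.2 (weightedHomogeneousSubmodule_fg F 1 (by simp) m)
  refine Module.Finite.of_injective
    (((invariants Γ).val.toLinearMap.restrict (p := invariantGrading Γ m)
      (q := homogeneousSubmodule (Fin 2) F m)) fun f hf => hf) ?_
  intro f g hfg
  exact Subtype.ext (Subtype.ext (congrArg (fun q : homogeneousSubmodule (Fin 2) F m => q.1) hfg))

/-- The dimension of a component of `HP₀` in terms of spaces of polynomials. -/
theorem finrank_HP0Component_invariant (Γ : Subgroup (SpecialLinearGroup (Fin 2) F)) (m : ℕ) :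
    Module.finrank F (HP0Component F (invariantBracket Γ) (invariantGrading Γ) m) +
      Module.finrank F ((invariantBracketSpan Γ).map (homogeneousComponent m)) =
      Module.finrank F ((Subalgebra.toSubmodule (invariants Γ)).map (homogeneousComponent m)) := by
  have hinj : Function.Injective (invariants Γ).val.toLinearMap := Subtype.val_injective
  have := finite_invariantGrading Γ m
  have h1 := finrank_map_add_finrank_inf_ker (bracketSpan F (invariantBracket Γ)).mkQ
    (invariantGrading Γ m)
  rw [Submodule.ker_mkQ] at h1
  have h2 : Module.finrank F (invariantGrading Γ m) =
      Module.finrank F ((Subalgebra.toSubmodule (invariants Γ)).map (homogeneousComponent m)) := by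
    rw [← map_invariantGrading]
    exact (Submodule.equivMapOfInjective _ hinj _).finrank_eq
  have h3 : Module.finrank F (invariantGrading Γ m ⊓ bracketSpan F (invariantBracket Γ) :
      Submodule F (invariants Γ)) =
      Module.finrank F ((invariantBracketSpan Γ).map (homogeneousComponent m)) := by
    have h4 : (invariantGrading Γ m ⊓ bracketSpan F (invariantBracket Γ)).map
        (invariants Γ).val.toLinearMap = (invariantBracketSpan Γ).map (homogeneousComponent m) := by
      rw [Submodule.map_inf _ hinj, map_bracketSpan, map_invariantGrading,
        ← inf_homogeneousSubmodule_eq_map fun f hf => homogeneousComponent_mem_invariants hf m,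
        ← inf_homogeneousSubmodule_eq_map fun f hf =>
          homogeneousComponent_mem_invariantBracketSpan Γ m hf, inf_assoc]
      congr 1
      rw [inf_eq_right, ← map_bracketSpan]
      rintro _ ⟨f, -, rfl⟩
      exact f.2
    rw [← h4]
    exact (Submodule.equivMapOfInjective _ hinj _).finrank_eq
  rw [← h2, ← h3, ← h1, HP0Component]

variable (F) in
/-- The base change homomorphism `SL(2, F) → SL(2, K)`. -/
noncomputable def slMap : SpecialLinearGroup (Fin 2) F →* SpecialLinearGroup (Fin 2) K :=
  SpecialLinearGroup.map (algebraMap F K)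

theorem pullback_map (γ : SpecialLinearGroup (Fin 2) F) (f : MvPolynomial (Fin 2) F) :
    pullback (slMap F K γ) (MvPolynomial.map (algebraMap F K) f) =
      MvPolynomial.map (algebraMap F K) (pullback γ f) := by
  induction f using MvPolynomial.induction_on with
  | C a => rw [map_C, pullback_C, pullback_C, map_C]
  | add f g hf hg => rw [map_add, map_add, map_add, map_add, hf, hg]
  | mul_X f k hf =>
    rw [map_mul, map_mul, map_mul, map_mul, hf, map_X, pullback_X, pullback_X]
    congr 1
    simp [slMap]

theorem planeBracket_map (f g : MvPolynomial (Fin 2) F) :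
    planeBracket (MvPolynomial.map (algebraMap F K) f) (MvPolynomial.map (algebraMap F K) g) =
      MvPolynomial.map (algebraMap F K) (planeBracket f g) := by
  simp [planeBracket, pderiv_map]

theorem homogeneousComponent_map' (m : ℕ) (f : MvPolynomial (Fin 2) F) :
    homogeneousComponent m (MvPolynomial.map (algebraMap F K) f) =
      MvPolynomial.map (algebraMap F K) (homogeneousComponent m f) := by
  ext d
  rw [coeff_homogeneousComponent, coeff_map, coeff_map, coeff_homogeneousComponent]
  split_ifs <;> simp

/-- Averaging: the sum over `Γ` sends a monomial to an invariant with coefficients in `F`, and an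
invariant over `K` is its own sum over `Γ` divided by the order of `Γ`, hence a `K`-combination of
such invariants. -/
theorem invariants_map (Γ : Subgroup (SpecialLinearGroup (Fin 2) F)) [Finite Γ]
    (hΓ : (Nat.card Γ : F) ≠ 0) :
    Subalgebra.toSubmodule (invariants (Γ.map (slMap F K))) =
      extendScalars K (Subalgebra.toSubmodule (invariants Γ)) := by
  have := Fintype.ofFinite Γ
  apply le_antisymm
  · intro f hf
    let N : MvPolynomial (Fin 2) F →ₗ[F] MvPolynomial (Fin 2) F :=
      ∑ γ : Γ, (pullback γ.1).toLinearMap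
    let N' : MvPolynomial (Fin 2) K →ₗ[K] MvPolynomial (Fin 2) K :=
      ∑ γ : Γ, (pullback (slMap F K γ.1)).toLinearMap
    have hNf : ∀ f, N f = ∑ γ : Γ, pullback γ.1 f := fun f => by
      rw [LinearMap.sum_apply]
      rfl
    have hNf' : ∀ f, N' f = ∑ γ : Γ, pullback (slMap F K γ.1) f := fun f => by
      rw [LinearMap.sum_apply]
      rfl
    have hN : ∀ f, N f ∈ invariants Γ := by
      intro f γ hγ
      rw [hNf, map_sum]
      simp only [pullback_pullback]
      exact Fintype.sum_equiv (Equiv.mulRight (⟨γ, hγ⟩ : Γ)) (fun δ : Γ => pullback (δ.1 * γ) f)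
        (fun δ : Γ => pullback δ.1 f) fun _ => rfl
    have h1 : ∀ g, N' g ∈ extendScalars K (Subalgebra.toSubmodule (invariants Γ)) := by
      intro g
      rw [← support_sum_monomial_coeff g, map_sum]
      refine Submodule.sum_mem _ fun d _ => ?_
      have h2 : monomial d (coeff d g) = coeff d g •
          MvPolynomial.map (algebraMap F K) (monomial d 1) := by
        rw [map_monomial, map_one, smul_monomial, smul_eq_mul, mul_one]
      have h3 : N' (MvPolynomial.map (algebraMap F K) (monomial d 1)) =
          MvPolynomial.map (algebraMap F K) (N (monomial d 1)) := by
        rw [hNf, hNf', map_sum]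
        simp only [pullback_map]
      rw [h2, map_smul, h3]
      exact Submodule.smul_mem _ _ (Submodule.subset_span ⟨_, hN _, rfl⟩)
    have h2 : N' f = (Nat.card Γ : K) • f := by
      have h3 : ∀ γ : Γ, pullback (slMap F K γ.1) f = f := fun γ => hf _ ⟨γ.1, γ.2, rfl⟩
      rw [hNf']
      simp only [h3]
      simp [Nat.cast_smul_eq_nsmul]
    have h3 : (Nat.card Γ : K) ≠ 0 := by
      rw [← map_natCast (algebraMap F K)]
      exact (map_ne_zero _).2 hΓ
    have h4 : f = (Nat.card Γ : K)⁻¹ • N' f := by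
      rw [h2, smul_smul, inv_mul_cancel₀ h3, one_smul]
    rw [h4]
    exact Submodule.smul_mem _ _ (h1 f)
  · refine Submodule.span_le.2 ?_
    rintro _ ⟨f, hf, rfl⟩ _ ⟨γ, hγ, rfl⟩
    rw [pullback_map, hf γ hγ]

/-- By bilinearity of the bracket and `invariants_map`. -/
theorem invariantBracketSpan_map (Γ : Subgroup (SpecialLinearGroup (Fin 2) F)) [Finite Γ]
    (hΓ : (Nat.card Γ : F) ≠ 0) :
    invariantBracketSpan (Γ.map (slMap F K)) = extendScalars K (invariantBracketSpan Γ) := by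
  apply le_antisymm
  · refine Submodule.span_le.2 ?_
    rintro _ ⟨f, hf, g, hg, rfl⟩
    replace hf : f ∈ Subalgebra.toSubmodule (invariants (Γ.map (slMap F K))) := hf
    replace hg : g ∈ Subalgebra.toSubmodule (invariants (Γ.map (slMap F K))) := hg
    rw [invariants_map K Γ hΓ] at hf hg
    have hadd : ∀ f₁ f₂ g : MvPolynomial (Fin 2) K, planeBracket (f₁ + f₂) g =
        planeBracket f₁ g + planeBracket f₂ g := by
      intros
      simp only [planeBracket, map_add]
      ring
    have hadd' : ∀ f g₁ g₂ : MvPolynomial (Fin 2) K, planeBracket f (g₁ + g₂) =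
        planeBracket f g₁ + planeBracket f g₂ := by
      intros
      simp only [planeBracket, map_add]
      ring
    have hsmul : ∀ (c : K) (f g : MvPolynomial (Fin 2) K), planeBracket (c • f) g =
        c • planeBracket f g := by
      intros
      simp only [planeBracket, smul_eq_C_mul, pderiv_C_mul]
      ring
    have hsmul' : ∀ (c : K) (f g : MvPolynomial (Fin 2) K), planeBracket f (c • g) =
        c • planeBracket f g := by
      intros
      simp only [planeBracket, smul_eq_C_mul, pderiv_C_mul]
      ring
    refine Submodule.span_induction₂ (R := K)
      (p := fun f g _ _ => planeBracket f g ∈ extendScalars K (invariantBracketSpan Γ))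
      ?_ ?_ ?_ ?_ ?_ ?_ ?_ hf hg
    · rintro _ _ ⟨f, hf, rfl⟩ ⟨g, hg, rfl⟩
      rw [planeBracket_map]
      exact Submodule.subset_span ⟨_, Submodule.subset_span ⟨f, hf, g, hg, rfl⟩, rfl⟩
    · intro g _
      simp [planeBracket]
    · intro g _
      simp [planeBracket]
    · intro f₁ f₂ g _ _ _ h1 h2
      rw [hadd]
      exact add_mem h1 h2
    · intro f₁ f₂ g _ _ _ h1 h2
      rw [hadd']
      exact add_mem h1 h2
    · intro c f g _ _ h1
      rw [hsmul]
      exact Submodule.smul_mem _ _ h1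
    · intro c f g _ _ h1
      rw [hsmul']
      exact Submodule.smul_mem _ _ h1
  · refine Submodule.span_le.2 ?_
    rintro _ ⟨q, hq, rfl⟩
    let φ : MvPolynomial (Fin 2) F →ₗ[F] MvPolynomial (Fin 2) K :=
      (MvPolynomial.mapAlgHom (Algebra.ofId F K)).toLinearMap
    have h1 : invariantBracketSpan Γ ≤
        ((invariantBracketSpan (Γ.map (slMap F K))).restrictScalars F).comap φ := by
      refine Submodule.span_le.2 ?_
      rintro _ ⟨f, hf, g, hg, rfl⟩
      have h2 : ∀ f ∈ invariants Γ, MvPolynomial.map (algebraMap F K) f ∈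
          invariants (Γ.map (slMap F K)) := by
        rintro f hf _ ⟨γ, hγ, rfl⟩
        rw [pullback_map, hf γ hγ]
      exact Submodule.subset_span ⟨_, h2 f hf, _, h2 g hg, (planeBracket_map K f g).symm⟩
    exact h1 hq

/-- The Hilbert series of `HP₀` of a ring of invariants may be computed after base change. -/
theorem hasKleinianHilbertSeries_of_map (Γ : Subgroup (SpecialLinearGroup (Fin 2) F)) [Finite Γ]
    (hΓ : (Nat.card Γ : F) ≠ 0) {T : ADEType} {p : ℕ} {hp : p ≠ 0}
    (h : HasKleinianHilbertSeries K (HP0Component K (invariantBracket (Γ.map (slMap F K)))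
      (invariantGrading (Γ.map (slMap F K)))) T p hp) :
    HasKleinianHilbertSeries F (HP0Component F (invariantBracket Γ) (invariantGrading Γ)) T p hp := by
  refine hasKleinianHilbertSeries_of_coeff T hp _ (fun m => ?_) fun m => ?_
  · have := finite_invariantGrading Γ m
    exact Module.Finite.map _ _
  · rw [← h.2.2, hilbertSeries, PowerSeries.coeff_mk]
    have h1 := finrank_HP0Component_invariant Γ m
    have h2 := finrank_HP0Component_invariant (Γ.map (slMap F K)) m
    rw [invariants_map K Γ hΓ, invariantBracketSpan_map K Γ hΓ,
      map_extendScalars K _ (homogeneousComponent m) _ (homogeneousComponent_map' K m),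
      map_extendScalars K _ (homogeneousComponent m) _ (homogeneousComponent_map' K m),
      finrank_extendScalars, finrank_extendScalars] at h2
    congr 1
    omega

end BaseChange

/-! ### Diagonalization in `SL(2, K)`. -/

section Diagonal

open Matrix

variable {K : Type*} [Field K]

theorem val_mul_apply (g k : SpecialLinearGroup (Fin 2) K) (i j : Fin 2) :
    (g * k).1 i j = g.1 i 0 * k.1 0 j + g.1 i 1 * k.1 1 j :=
  (Matrix.mul_apply (M := g.1) (N := k.1)).trans (Fin.sum_univ_two _)

/-- The matrix with the rows `(a, b)` and `(c, d)`. -/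
def mkSL (a b c d : K) (h : a * d - b * c = 1) : SpecialLinearGroup (Fin 2) K :=
  ⟨!![a, b; c, d], by rw [det_fin_two_of, h]⟩

theorem mkSL_val {a b c d : K} (h : a * d - b * c = 1) : (mkSL a b c d h).1 = !![a, b; c, d] := rfl

theorem sl_ext {g k : SpecialLinearGroup (Fin 2) K} (h00 : g.1 0 0 = k.1 0 0)
    (h01 : g.1 0 1 = k.1 0 1) (h10 : g.1 1 0 = k.1 1 0) (h11 : g.1 1 1 = k.1 1 1) : g = k := by
  apply Subtype.ext
  ext i j
  fin_cases i <;> fin_cases j <;> assumption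

theorem inv_val (g : SpecialLinearGroup (Fin 2) K) :
    (g⁻¹).1 = !![g.1 1 1, -g.1 0 1; -g.1 1 0, g.1 0 0] :=
  (Matrix.SpecialLinearGroup.coe_inv g).trans (adjugate_fin_two _)

/-- The diagonal matrices in `SL(2, K)`. -/
noncomputable def diagonalSL : Kˣ →* SpecialLinearGroup (Fin 2) K where
  toFun ζ := mkSL (ζ : K) 0 0 ((ζ⁻¹ : Kˣ) : K) (by simp)
  map_one' := sl_ext (by simp [mkSL_val]) (by simp [mkSL_val])
    (by simp [mkSL_val]) (by simp [mkSL_val])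
  map_mul' ζ ξ := by
    apply sl_ext <;> rw [val_mul_apply] <;> simp [mkSL_val, mul_comm]

theorem diagonalSL_val (ζ : Kˣ) : (diagonalSL ζ).1 = !![(ζ : K), 0; 0, ((ζ⁻¹ : Kˣ) : K)] := rfl

theorem diagonalSL_injective : Function.Injective (diagonalSL (K := K)) := by
  intro ζ ξ h
  have h1 := congrFun (congrFun (congrArg Subtype.val h) 0) 0
  exact Units.ext (by simpa [diagonalSL_val] using h1)

theorem val_det (g : SpecialLinearGroup (Fin 2) K) :
    g.1 0 0 * g.1 1 1 - g.1 0 1 * g.1 1 0 = 1 := by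
  rw [← det_fin_two, g.2]

theorem exists_eigenvector [IsAlgClosed K] (g : SpecialLinearGroup (Fin 2) K) :
    ∃ (v : Fin 2 → K) (ε : K), v ≠ 0 ∧ g.1 *ᵥ v = ε • v := by
  obtain ⟨ε, hε⟩ := Module.End.exists_eigenvalue (K := K) (Matrix.toLin' g.1)
  obtain ⟨v, hv⟩ := hε.exists_hasEigenvector
  exact ⟨v, ε, hv.2, by simpa using hv.apply_eq_smul⟩

/-- Take for `k` a matrix whose first column spans an eigenline of `g`. -/
theorem exists_conj_upper [IsAlgClosed K] (g : SpecialLinearGroup (Fin 2) K) :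
    ∃ k : SpecialLinearGroup (Fin 2) K, (k⁻¹ * g * k).1 1 0 = 0 := by
  obtain ⟨v, ε, hv, hg⟩ := exists_eigenvector g
  have h0 := congrFun hg 0
  have h1 := congrFun hg 1
  simp only [mulVec, dotProduct, Fin.sum_univ_two, Pi.smul_apply, smul_eq_mul] at h0 h1
  rcases eq_or_ne (v 0) 0 with hv0 | hv0
  · have hv1 : v 1 ≠ 0 := by
      intro hv1
      apply hv
      funext i
      fin_cases i <;> simpa
    refine ⟨mkSL 0 (-1) 1 0 (by simp), ?_⟩
    rw [hv0] at h0
    have h2 : g.1 0 1 = 0 := by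
      simpa [hv1] using h0
    simp only [val_mul_apply, inv_val]
    simp [mkSL_val, h2]
  · refine ⟨mkSL (v 0) 0 (v 1) (v 0)⁻¹ (by simp [hv0]), ?_⟩
    have h2 : v 0 * (g.1 1 0 * v 0 + g.1 1 1 * v 1) - v 1 * (g.1 0 0 * v 0 + g.1 0 1 * v 1) = 0 := by
      rw [h0, h1]
      ring
    simp only [val_mul_apply, inv_val]
    simp [mkSL_val]
    linear_combination h2

/-- Start from a triangular conjugate. If its diagonal entries agree, the off-diagonal entry of the
`N`-th power is `N` times a unit times that of the matrix, so the latter is zero. If they differ, a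
unipotent conjugation removes it. -/
theorem exists_conj_diagonal [IsAlgClosed K] {N : ℕ} (hN : (N : K) ≠ 0)
    {g : SpecialLinearGroup (Fin 2) K} (hg : g ^ N = 1) :
    ∃ (k : SpecialLinearGroup (Fin 2) K) (ζ : Kˣ), k⁻¹ * g * k = diagonalSL ζ := by
  obtain ⟨k, hk⟩ := exists_conj_upper g
  set u := k⁻¹ * g * k with hu
  have hdet := val_det u
  rw [hk, mul_zero, sub_zero] at hdet
  have hpow : u ^ N = 1 := by
    have : u = MulAut.conj k⁻¹ g := by simp [hu]
    rw [this, ← map_pow, hg, map_one]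
  let ζ : Kˣ := ⟨u.1 0 0, u.1 1 1, hdet, by rw [mul_comm]; exact hdet⟩
  rcases eq_or_ne (u.1 0 0) (u.1 1 1) with heq | hne
  · refine ⟨k, ζ, ?_⟩
    -- The third formula carries an extra factor `u.1 0 0`, which avoids the exponent `n - 1`.
    have h1 : ∀ n : ℕ, (u ^ n).1 1 0 = 0 ∧ (u ^ n).1 0 0 = u.1 0 0 ^ n ∧
        u.1 0 0 * (u ^ n).1 0 1 = n * u.1 0 0 ^ n * u.1 0 1 ∧ (u ^ n).1 1 1 = u.1 0 0 ^ n := by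
      intro n
      induction n with
      | zero => simp
      | succ n ih =>
        obtain ⟨i1, i2, i3, i4⟩ := ih
        rw [pow_succ]
        simp only [val_mul_apply]
        rw [i1, i2, i4, hk, ← heq]
        refine ⟨by ring, by ring, ?_, by ring⟩
        push_cast
        linear_combination u.1 0 0 * i3
    obtain ⟨-, h2, h3, -⟩ := h1 N
    rw [hpow] at h2 h3
    have h4 : u.1 0 1 = 0 := by
      have h5 : (1 : SpecialLinearGroup (Fin 2) K).1 0 0 = 1 := by simp
      have h6 : (1 : SpecialLinearGroup (Fin 2) K).1 0 1 = 0 := by simp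
      rw [h5] at h2
      rw [← h2, h6] at h3
      simpa [hN] using h3
    exact sl_ext rfl h4 hk rfl
  · set s : K := u.1 0 1 / (u.1 1 1 - u.1 0 0) with hs
    have hs' : s * (u.1 1 1 - u.1 0 0) = u.1 0 1 := div_mul_cancel₀ _ (sub_ne_zero.2 hne.symm)
    refine ⟨k * mkSL 1 s 0 1 (by simp), ζ, ?_⟩
    have h1 : (k * mkSL 1 s 0 1 (by simp))⁻¹ * g *
        (k * mkSL 1 s 0 1 (by simp)) =
        (mkSL 1 s 0 1 (by simp))⁻¹ * u *
          mkSL 1 s 0 1 (by simp) := by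
      rw [hu]
      group
    rw [h1]
    apply sl_ext <;> simp only [val_mul_apply, inv_val] <;>
      simp [mkSL_val, hk, diagonalSL_val, ζ]
    linear_combination -hs'

theorem closure_val_image {G : Type*} [Group G] {Γ : Subgroup G} {S : Set Γ}
    (hS : Subgroup.closure S = ⊤) : Subgroup.closure (Subtype.val '' S) = Γ := by
  have h1 := Γ.subtype.map_closure S
  rw [hS, ← MonoidHom.range_eq_map, Subgroup.range_subtype] at h1
  exact h1.symm

end Diagonal

/-! ### Invariants of diagonal matrices, and monomials. -/

section Monomials

open MvPolynomial Matrix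

variable {K : Type*} [Field K] {a b h : ℕ} {P x y z : MvPolynomial (Fin 2) K}

theorem mem_invariants_closure {S : Set (SpecialLinearGroup (Fin 2) K)} {f : MvPolynomial (Fin 2) K}
    (hf : ∀ γ ∈ S, pullback γ f = f) : f ∈ invariants (Subgroup.closure S) := by
  intro γ hγ
  induction hγ using Subgroup.closure_induction with
  | mem γ hγ => exact hf γ hγ
  | one => exact pullback_one f
  | mul γ δ _ _ h1 h2 => rw [← pullback_pullback, h1, h2]
  | inv γ _ h1 => rw [← h1, pullback_pullback, mul_inv_cancel, pullback_one, h1]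

theorem pullback_diagonalSL_X_zero (ζ : Kˣ) : pullback (diagonalSL ζ) (X 0) = C (ζ : K) * X 0 := by
  simp [pullback_X, diagonalSL_val]

theorem pullback_diagonalSL_X_one (ζ : Kˣ) :
    pullback (diagonalSL ζ) (X 1) = C ((ζ⁻¹ : Kˣ) : K) * X 1 := by
  simp [pullback_X, diagonalSL_val]

theorem coeff_pullback_diagonalSL (ζ : Kˣ) (f : MvPolynomial (Fin 2) K) (d : Fin 2 →₀ ℕ) :
    coeff d (pullback (diagonalSL ζ) f) = ((ζ ^ d 0 * ζ⁻¹ ^ d 1 : Kˣ) : K) * coeff d f := by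
  induction f using MvPolynomial.induction_on' with
  | monomial e c =>
    have h1 : pullback (diagonalSL ζ) (monomial e c) =
        monomial e (((ζ ^ e 0 * ζ⁻¹ ^ e 1 : Kˣ) : K) * c) := by
      rw [monomial_eq, monomial_eq, Finsupp.prod_fintype _ _ (by simp), Fin.prod_univ_two]
      simp only [map_mul, map_pow, pullback_C, pullback_diagonalSL_X_zero,
        pullback_diagonalSL_X_one, Units.val_mul, Units.val_pow_eq_pow_val]
      ring
    rw [h1, coeff_monomial, coeff_monomial]
    split_ifs with h
    · rw [h]
    · simp
  | add f g hf hg =>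
    rw [map_add, coeff_add, coeff_add, hf, hg]
    ring

/-- An invariant of a diagonal matrix of order `n` only involves monomials `u ^ i v ^ j` with
`i ≡ j` modulo `n`. -/
theorem modEq_of_pullback_diagonalSL {ζ : Kˣ} {f : MvPolynomial (Fin 2) K}
    (hf : pullback (diagonalSL ζ) f = f) {d : Fin 2 →₀ ℕ} (hd : coeff d f ≠ 0) :
    d 0 ≡ d 1 [MOD orderOf ζ] := by
  have h1 := coeff_pullback_diagonalSL ζ f d
  rw [hf] at h1
  have h2 : ((ζ ^ d 0 * ζ⁻¹ ^ d 1 : Kˣ) : K) = 1 := by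
    refine mul_right_cancel₀ hd ?_
    rw [← h1, one_mul]
  have h3 : ζ ^ d 0 * ζ⁻¹ ^ d 1 = 1 := Units.ext h2
  rw [inv_pow, mul_inv_eq_one] at h3
  exact pow_eq_pow_iff_modEq.1 h3

theorem monomial_eq_C_mul (d : Fin 2 →₀ ℕ) (c : K) :
    monomial d c = C c * (X 0 ^ d 0 * X 1 ^ d 1) := by
  rw [monomial_eq, Finsupp.prod_fintype _ _ (by simp), Fin.prod_univ_two]

theorem mem_kleinSpan_of_conj {Γ : Subgroup (SpecialLinearGroup (Fin 2) K)} {c : K}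
    (k : SpecialLinearGroup (Fin 2) K)
    (hk : KleinGenerators (Γ.map (MulAut.conj k).toMonoidHom) a b h P x y z c) :
    KleinGenerators Γ a b h P (pullback k x) (pullback k y) (pullback k z) c := by
  refine hk.conj k fun γ => ?_
  constructor
  · intro hγ
    exact ⟨γ, hγ, rfl⟩
  · rintro ⟨δ, hδ, h1⟩
    have h2 : γ = δ := (MulAut.conj k).injective h1.symm
    rwa [h2]

theorem pullback_ne_zero {f : MvPolynomial (Fin 2) K} (hf : f ≠ 0)
    (k : SpecialLinearGroup (Fin 2) K) : pullback k f ≠ 0 := by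
  intro h0
  apply hf
  rw [← pullback_one f, ← mul_inv_cancel k, ← pullback_pullback, h0, map_zero]

theorem degree_eq_of_isHomogeneous {m : ℕ} {f : MvPolynomial (Fin 2) K} (hf : f.IsHomogeneous m)
    {d : Fin 2 →₀ ℕ} (hd : coeff d f ≠ 0) : d 0 + d 1 = m := by
  rw [← hf hd, Finsupp.weight_apply, Finsupp.sum_fintype _ _ (by simp)]
  simp

theorem isRelPrime_X_pow_mul {m n : ℕ} {c d : K} (hc : c ≠ 0) (hd : d ≠ 0) :
    IsRelPrime (C c * X 0 ^ m : MvPolynomial (Fin 2) K) (C d * X 1 ^ n) := by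
  have h2 : IsRelPrime (X 0 : MvPolynomial (Fin 2) K) (X 1) :=
    ((X_prime (i := 0)).irreducible.isRelPrime_iff_not_dvd).2 (by simp [X_dvd_X])
  have h3 : IsRelPrime (X 0 ^ m : MvPolynomial (Fin 2) K) (X 1 ^ n) := h2.pow
  have hu : ∀ {c : K}, c ≠ 0 → IsUnit (C c : MvPolynomial (Fin 2) K) := fun hc =>
    (isUnit_iff_ne_zero.2 hc).map C
  exact (isRelPrime_mul_unit_left_left (hu hc)).2 ((isRelPrime_mul_unit_left_right (hu hd)).2 h3)

theorem monomial_mem_planeGrading {j : ℤ} {m n : ℕ} (c : K) (hj : (a : ℤ) * m + b * n = j) :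
    C c * (X 0 ^ m * X 1 ^ n) ∈ planeGrading K a b j := by
  have h3 : (X 0 ^ m * X 1 ^ n : MvPolynomial (Fin 2) K) =
      monomial (Finsupp.single 0 m + Finsupp.single 1 n) 1 := by
    rw [X_pow_eq_monomial, X_pow_eq_monomial, monomial_mul, one_mul]
  rw [h3, C_mul_monomial]
  refine isWeightedHomogeneous_monomial _ _ _ ?_
  rw [weight_planeWeights, ← hj]
  simp

end Monomials

/-! ### Type `A`: cyclic groups. -/

section Cyclic

open MvPolynomial Matrix

variable {K : Type*} [Field K]

/-- Generators of the ring of invariants of a diagonal cyclic group of order `n`. -/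
theorem kleinGenerators_zpowers {n : ℕ} (hn : 2 ≤ n) (hnK : (n : K) ≠ 0) (h2 : (2 : K) ≠ 0) {ζ : Kˣ}
    (hζ : orderOf ζ = n) {P x y z : MvPolynomial (Fin 2) K} (hx : x = X 0 * X 1)
    (hy : y = X 0 ^ n + X 1 ^ n) (hz : z = X 0 ^ n - X 1 ^ n)
    (hP : P = C 1 * (X 0 ^ 0 * X 1 ^ 2) + C (-4) * (X 0 ^ n * X 1 ^ 0)) :
    KleinGenerators (Subgroup.closure {diagonalSL ζ}) 2 n n P x y z (-n : K) := by
  have h4 : (4 : K) ≠ 0 := by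
    rw [show (4 : K) = 2 * 2 by norm_num]
    exact mul_ne_zero h2 h2
  have hmem : P ∈ planeGrading K 2 n (2 * n) := by
    rw [hP]
    exact add_mem (monomial_mem_planeGrading _ (by push_cast; ring))
      (monomial_mem_planeGrading _ (by push_cast; ring))
  have hζn : ζ ^ n = 1 := hζ ▸ pow_orderOf_eq_one ζ
  have hζK : (C (ζ : K) : MvPolynomial (Fin 2) K) ^ n = 1 := by
    rw [← C_pow, ← Units.val_pow_eq_pow_val, hζn, Units.val_one, C_1]
  have hζK' : (C ((ζ⁻¹ : Kˣ) : K) : MvPolynomial (Fin 2) K) ^ n = 1 := by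
    rw [← C_pow, ← Units.val_pow_eq_pow_val, inv_pow, hζn, inv_one, Units.val_one, C_1]
  -- This is `(uⁿ - vⁿ)² = (uⁿ + vⁿ)² - 4 (uv)ⁿ`.
  have hsq : z ^ 2 = aeval ![x, y] P := by
    have e4 : (C 4 : MvPolynomial (Fin 2) K) = 4 := map_ofNat C 4
    rw [hP]
    simp [hx, hy, hz]
    rw [e4]
    ring
  have hpow : ∀ i : Fin 2, (X i ^ n : MvPolynomial (Fin 2) K) ∈
      kleinSpan 2 n n x y z n := by
    have e1 : (C (2 : K)⁻¹ : MvPolynomial (Fin 2) K) * 2 = 1 := by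
      rw [← map_ofNat (C (σ := Fin 2) (R := K)) 2, ← C_mul, inv_mul_cancel₀ h2, C_1]
    intro i
    have h0 : (X i ^ n : MvPolynomial (Fin 2) K) = (2 : K)⁻¹ • y +
        (if i = 0 then (1 : K) else -1) • (2 : K)⁻¹ • z := by
      fin_cases i <;> simp [smul_eq_C_mul, hy, hz]
      · linear_combination (-X 0 ^ n) * e1
      · linear_combination (-X 1 ^ n) * e1
    rw [h0]
    exact add_mem (Submodule.smul_mem _ _ right_mem_kleinSpan)
      (Submodule.smul_mem _ _ (Submodule.smul_mem _ _ third_mem_kleinSpan))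
  refine ⟨⟨rfl.trans (add_comm _ _), le_rfl, hn, hmem, ?_⟩, mem_invariants_closure ?_,
    mem_invariants_closure ?_, mem_invariants_closure ?_, ?_, ?_, ?_, hsq, ?_, ?_, ?_, ?_⟩
  · have e0 : pderiv 0 P = C (-4 * (n : K)) * X 0 ^ (n - 1) := by
      rw [hP]
      simp [pderiv_X]
      ring
    have e1 : pderiv 1 P = C 2 * X 1 ^ 1 := by
      rw [hP, map_ofNat]
      simp [pderiv_X]
    rw [e0, e1]
    exact isRelPrime_X_pow_mul (mul_ne_zero (neg_ne_zero.2 h4) hnK) h2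
  · rintro γ rfl
    rw [hx, map_mul, pullback_diagonalSL_X_zero, pullback_diagonalSL_X_one]
    have : (C (ζ : K) * C ((ζ⁻¹ : Kˣ) : K) : MvPolynomial (Fin 2) K) = 1 := by
      rw [← C_mul, Units.mul_inv, C_1]
    linear_combination (X 0 * X 1) * this
  · rintro γ rfl
    rw [hy, map_add, map_pow, map_pow, pullback_diagonalSL_X_zero, pullback_diagonalSL_X_one, mul_pow,
      mul_pow, hζK, hζK', one_mul, one_mul]
  · rintro γ rfl
    rw [hz, map_sub, map_pow, map_pow, pullback_diagonalSL_X_zero, pullback_diagonalSL_X_one, mul_pow,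
      mul_pow, hζK, hζK', one_mul, one_mul]
  · rw [hx]
    exact (isHomogeneous_X K 0).mul (isHomogeneous_X K 1)
  · rw [hy]
    exact (isHomogeneous_X_pow 0 n).add (isHomogeneous_X_pow 1 n)
  · rw [hz]
    exact (isHomogeneous_X_pow 0 n).sub (isHomogeneous_X_pow 1 n)
  · obtain ⟨k, rfl⟩ : ∃ k, n = k + 1 := ⟨n - 1, by omega⟩
    simp [hx, hy, hz, planeBracket, pderiv_X]
    ring
  · exact neg_ne_zero.2 hnK
  · exact ⟨![1, 0], by simp [hx], by simp [hy, show n ≠ 0 by omega]⟩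
  · intro m f hf hm
    have hf' := hf _ (Subgroup.subset_closure rfl)
    rw [← support_sum_monomial_coeff f]
    refine Submodule.sum_mem _ fun d hd => ?_
    have hd' := mem_support_iff.1 hd
    have h3 := modEq_of_pullback_diagonalSL hf' hd'
    rw [hζ] at h3
    have h4 := degree_eq_of_isHomogeneous hm hd'
    rw [monomial_eq_C_mul, ← smul_eq_C_mul]
    refine Submodule.smul_mem _ _ ?_
    -- A monomial `u ^ i v ^ j` with `i ≡ j` modulo `n` is a power of `uv` times a power of `uⁿ` or
    -- of `vⁿ`, and these are `(y + z) / 2` and `(y - z) / 2`.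
    have key : ∀ (i : Fin 2) (j k : ℕ), 2 * j + n * k = m →
        x ^ j * (X i ^ n) ^ k ∈
        kleinSpan 2 n n x y z m := by
      rintro i j k rfl
      exact mul_mem_kleinSpan hmem hsq (pow_mem_kleinSpan hmem hsq left_mem_kleinSpan j)
        (pow_mem_kleinSpan hmem hsq (hpow i) k)
    rcases le_total (d 0) (d 1) with hle | hle
    · obtain ⟨k, hk⟩ := (Nat.modEq_iff_dvd' hle).1 h3
      have h5 : d 1 = d 0 + n * k := by omega
      convert key 1 (d 0) k (by omega) using 1
      rw [h5, hx]
      ring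
    · obtain ⟨k, hk⟩ := (Nat.modEq_iff_dvd' hle).1 h3.symm
      have h5 : d 0 = d 1 + n * k := by omega
      convert key 0 (d 1) k (by omega) using 1
      rw [h5, hx]
      ring

theorem exists_kleinGenerators_cyclic [IsAlgClosed K]
    {Γ : Subgroup (SpecialLinearGroup (Fin 2) K)} (hΓ : IsCyclic Γ) {n : ℕ} (hcard : Nat.card Γ = n)
    (hn : 2 ≤ n) (hnK : (n : K) ≠ 0) (h2 : (2 : K) ≠ 0) :
    ∃ P x y z c, KleinGenerators Γ 2 n n P x y z c ∧ x ≠ 0 := by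
  obtain ⟨g, hg⟩ := hΓ.exists_generator
  have hord : orderOf g.1 = n := by
    rw [Subgroup.orderOf_coe, ← hcard]
    exact orderOf_eq_card_of_forall_mem_zpowers hg
  have hcl : Subgroup.closure {g.1} = Γ := by
    have h1 : Subgroup.closure {g} = ⊤ := by
      rw [← Subgroup.zpowers_eq_closure, Subgroup.eq_top_iff']
      exact hg
    have := closure_val_image h1
    rwa [Set.image_singleton] at this
  obtain ⟨k, ζ, hk⟩ := exists_conj_diagonal hnK (hord ▸ pow_orderOf_eq_one g.1)
  have hconj : MulAut.conj k⁻¹ g.1 = diagonalSL ζ := by simpa using hk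
  have hζ : orderOf ζ = n := by
    rw [← orderOf_injective diagonalSL diagonalSL_injective ζ, ← hconj, ← hord]
    exact orderOf_injective (MulAut.conj k⁻¹).toMonoidHom (MulAut.conj k⁻¹).injective g.1
  have hmap : Γ.map (MulAut.conj k⁻¹).toMonoidHom = Subgroup.closure {diagonalSL ζ} := by
    rw [← hcl, MonoidHom.map_closure, Set.image_singleton, ← hconj]
    rfl
  have hK := kleinGenerators_zpowers hn hnK h2 hζ rfl rfl rfl rfl
  rw [← hmap] at hK
  exact ⟨_, _, _, _, _, mem_kleinSpan_of_conj k⁻¹ hK, pullback_ne_zero (mul_ne_zero (X_ne_zero 0) (X_ne_zero 1)) _⟩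

end Cyclic

/-! ### Type `D`: binary dihedral groups. -/

section Dihedral

open MvPolynomial Matrix

/-- In a binary dihedral group of order `4 n` generated by `s` and `t`, the element `t` has order
`2 n`. -/
theorem orderOf_eq_of_card_eq {G : Type*} [Group G] {n : ℕ} (hn : 0 < n) {s t : G}
    (hcl : Subgroup.closure {s, t} = ⊤) (hst : s * t * s⁻¹ = t⁻¹) (hs : s ^ 2 = t ^ n)
    (hcard : Nat.card G = 4 * n) : orderOf t = 2 * n := by
  -- Conjugation by `s` inverts `t` but fixes `t ^ n = s ^ 2`.
  have h1 : t ^ n = t⁻¹ ^ n := by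
    rw [← hst, conj_pow, ← hs]
    group
  have h2 : t ^ (2 * n) = 1 := by
    rw [two_mul, pow_add]
    nth_rewrite 1 [h1]
    rw [inv_pow, inv_mul_cancel]
  have hconj : ∀ g ∈ Subgroup.zpowers t, s * g * s⁻¹ ∈ Subgroup.zpowers t := by
    rintro _ ⟨k, rfl⟩
    refine ⟨-k, ?_⟩
    simp only
    rw [← conj_zpow, hst, _root_.inv_zpow, _root_.zpow_neg]
  have hs2 : s ^ 2 ∈ Subgroup.zpowers t := hs ▸ Subgroup.npow_mem_zpowers t n
  -- The powers of `t` have at most two cosets, so `4n ≤ 2 · orderOf t`, while `t ^ (2n) = 1`.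
  have hall : ∀ g : G, g ∈ Subgroup.zpowers t ∨ s * g ∈ Subgroup.zpowers t := by
    intro g
    have hg : g ∈ Subgroup.closure {s, t} := hcl ▸ Subgroup.mem_top g
    induction hg using Subgroup.closure_induction_left with
    | one => exact Or.inl (one_mem _)
    | mul_left x hx y _ ih =>
      rcases hx with rfl | rfl
      · rcases ih with ih | ih
        · refine Or.inr ?_
          rw [← mul_assoc, ← pow_two]
          exact mul_mem hs2 ih
        · exact Or.inl ih
      · rcases ih with ih | ih
        · exact Or.inl (mul_mem (Subgroup.mem_zpowers _) ih)
        · refine Or.inr ?_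
          have := mul_mem (hconj x (Subgroup.mem_zpowers _)) ih
          rwa [show s * x * s⁻¹ * (s * y) = s * (x * y) by group] at this
    | inv_mul_cancel x hx y _ ih =>
      rcases hx with rfl | rfl
      · rcases ih with ih | ih
        · refine Or.inr ?_
          rwa [mul_inv_cancel_left]
        · refine Or.inl ?_
          have := mul_mem (inv_mem hs2) ih
          rwa [show (x ^ 2)⁻¹ * (x * y) = x⁻¹ * y by group] at this
      · rcases ih with ih | ih
        · exact Or.inl (mul_mem (inv_mem (Subgroup.mem_zpowers _)) ih)
        · refine Or.inr ?_
          have := mul_mem (hconj x⁻¹ (inv_mem (Subgroup.mem_zpowers _))) ih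
          rwa [show s * x⁻¹ * s⁻¹ * (s * y) = s * (x⁻¹ * y) by group] at this
  have hfin : Finite (Subgroup.zpowers t) := by
    rw [← Nat.card_pos_iff.trans (and_iff_right ⟨1, one_mem _⟩), Nat.card_zpowers]
    exact orderOf_pos_iff.2 (isOfFinOrder_iff_pow_eq_one.2 ⟨2 * n, by omega, h2⟩)
  have hsurj : Function.Surjective fun q : Bool × Subgroup.zpowers t =>
      if q.1 then q.2.1 else s⁻¹ * q.2.1 := by
    intro g
    rcases hall g with hg | hg
    · exact ⟨(true, ⟨g, hg⟩), rfl⟩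
    · exact ⟨(false, ⟨s * g, hg⟩), by simp⟩
  have h3 := Nat.card_le_card_of_surjective _ hsurj
  rw [Nat.card_prod, Nat.card_zpowers, hcard] at h3
  simp only [Nat.card_eq_fintype_card, Fintype.card_bool] at h3
  have h4 := Nat.le_of_dvd (by omega) (orderOf_dvd_of_pow_eq_one h2)
  omega

variable {K : Type*} [Field K]

/-- Generators of the ring of invariants of a binary dihedral group of order `4 n`. -/
theorem kleinGenerators_dihedral {n : ℕ} (hn : 2 ≤ n) (hnK : (n : K) ≠ 0)
    (hnK' : ((n + 1 : ℕ) : K) ≠ 0) (h2 : (2 : K) ≠ 0) {ζ : Kˣ} (hζ : orderOf ζ = 2 * n)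
    {w : SpecialLinearGroup (Fin 2) K} (hw : w = mkSL 0 1 (-1) 0 (by simp))
    {P x y z : MvPolynomial (Fin 2) K} (hx : x = (X 0 * X 1) ^ 2)
    (hy : y = X 0 ^ (2 * n) + X 1 ^ (2 * n)) (hz : z = X 0 * X 1 * (X 0 ^ (2 * n) - X 1 ^ (2 * n)))
    (hP : P = C 1 * (X 0 ^ 1 * X 1 ^ 2) + C (-4) * (X 0 ^ (n + 1) * X 1 ^ 0)) :
    KleinGenerators (Subgroup.closure {w, diagonalSL ζ}) 4 (2 * n) (2 * (n + 1)) P x y z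
      (-(4 * n) : K) := by
  have h4 : (4 : K) ≠ 0 := by
    rw [show (4 : K) = 2 * 2 by norm_num]
    exact mul_ne_zero h2 h2
  have hmem : P ∈ planeGrading K 4 (2 * n) (2 * (2 * (n + 1) : ℕ)) := by
    rw [hP]
    exact add_mem (monomial_mem_planeGrading _ (by push_cast; ring))
      (monomial_mem_planeGrading _ (by push_cast; ring))
  have hζn : ζ ^ (2 * n) = 1 := hζ ▸ pow_orderOf_eq_one ζ
  have hζK : (C (ζ : K) : MvPolynomial (Fin 2) K) ^ (2 * n) = 1 := by
    rw [← C_pow, ← Units.val_pow_eq_pow_val, hζn, Units.val_one, C_1]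
  have hζK' : (C ((ζ⁻¹ : Kˣ) : K) : MvPolynomial (Fin 2) K) ^ (2 * n) = 1 := by
    rw [← C_pow, ← Units.val_pow_eq_pow_val, inv_pow, hζn, inv_one, Units.val_one, C_1]
  have hζi : (C (ζ : K) * C ((ζ⁻¹ : Kˣ) : K) : MvPolynomial (Fin 2) K) = 1 := by
    rw [← C_mul, Units.mul_inv, C_1]
  have hw0 : pullback w (X 0) = X 1 := by simp [pullback_X, hw, mkSL_val]
  have hw1 : pullback w (X 1) = -X 0 := by simp [pullback_X, hw, mkSL_val]
  have hsq : z ^ 2 = aeval ![x, y] P := by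
    have e4 : (C 4 : MvPolynomial (Fin 2) K) = 4 := map_ofNat C 4
    rw [hP]
    simp [hx, hy, hz]
    rw [e4]
    ring
  have hxS : x ∈ kleinSpan 4 (2 * n) (2 * (n + 1)) x y z 4 := left_mem_kleinSpan
  have hyS : y ∈ kleinSpan 4 (2 * n) (2 * (n + 1)) x y z (2 * n) := right_mem_kleinSpan
  have hzS : z ∈ kleinSpan 4 (2 * n) (2 * (n + 1)) x y z (2 * (n + 1)) := third_mem_kleinSpan
  have hxn := pow_mem_kleinSpan hmem hsq hxS n
  -- With `S k = u ^ (2nk) + v ^ (2nk)` and `x ^ n = (uv) ^ (2n)` one has `S (k + 2) = y S (k + 1) -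
  -- x ^ n S k`. Two consecutive values are carried through the induction, and the differences below
  -- satisfy the same recursion.
  have hsum : ∀ k, (X 0 ^ (2 * n * k) + X 1 ^ (2 * n * k)) ∈
      kleinSpan 4 (2 * n) (2 * (n + 1)) x y z (2 * n * k) ∧
      (X 0 ^ (2 * n * (k + 1)) + X 1 ^ (2 * n * (k + 1))) ∈
      kleinSpan 4 (2 * n) (2 * (n + 1)) x y z (2 * n * (k + 1)) := by
    intro k
    induction k with
    | zero =>
      constructor
      · have := C_mem_kleinSpan (a := 4) (b := 2 * n) (h := 2 * (n + 1)) (x := x) (y := y) (z := z) 2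
        rw [map_ofNat] at this
        simpa [one_add_one_eq_two] using this
      · simpa [hy] using hyS
    | succ k ih =>
      refine ⟨ih.2, ?_⟩
      have h5 := sub_mem (mul_mem_kleinSpan hmem hsq hyS ih.2) (by
        have := mul_mem_kleinSpan hmem hsq hxn ih.1
        rwa [show 4 * n + 2 * n * k = 2 * n + 2 * n * (k + 1) by ring] at this)
      rw [show 2 * n * (k + 1 + 1) = 2 * n + 2 * n * (k + 1) by ring]
      convert h5 using 1
      rw [hx, hy]
      ring
  have hdiff : ∀ k, X 0 * X 1 * (X 0 ^ (2 * n * k) - X 1 ^ (2 * n * k)) ∈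
      kleinSpan 4 (2 * n) (2 * (n + 1)) x y z (2 * n * k + 2) ∧
      X 0 * X 1 * (X 0 ^ (2 * n * (k + 1)) - X 1 ^ (2 * n * (k + 1))) ∈
      kleinSpan 4 (2 * n) (2 * (n + 1)) x y z (2 * n * (k + 1) + 2) := by
    intro k
    induction k with
    | zero =>
      constructor
      · simp
      · rw [zero_add, mul_one, show 2 * n + 2 = 2 * (n + 1) by ring, ← hz]
        exact hzS
    | succ k ih =>
      refine ⟨ih.2, ?_⟩
      have h5 := sub_mem (mul_mem_kleinSpan hmem hsq hyS ih.2) (by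
        have := mul_mem_kleinSpan hmem hsq hxn ih.1
        rwa [show 4 * n + (2 * n * k + 2) = 2 * n + (2 * n * (k + 1) + 2) by ring] at this)
      rw [show 2 * n * (k + 1 + 1) + 2 = 2 * n + (2 * n * (k + 1) + 2) by ring]
      convert h5 using 1
      rw [hx, hy]
      ring
  have hgen : ∀ j k : ℕ, (X 0 * X 1) ^ j * (X 0 ^ (2 * n * k) + (-1) ^ j * X 1 ^ (2 * n * k)) ∈
      kleinSpan 4 (2 * n) (2 * (n + 1)) x y z (2 * j + 2 * n * k) := by
    intro j k
    rcases Nat.even_or_odd' j with ⟨i, rfl | rfl⟩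
    · have := mul_mem_kleinSpan hmem hsq (pow_mem_kleinSpan hmem hsq hxS i) (hsum k).1
      rw [show 4 * i + 2 * n * k = 2 * (2 * i) + 2 * n * k by ring] at this
      convert this using 1
      rw [pow_mul, pow_mul (-1)]
      simp [hx]
    · have := mul_mem_kleinSpan hmem hsq (pow_mem_kleinSpan hmem hsq hxS i) (hdiff k).1
      rw [show 4 * i + (2 * n * k + 2) = 2 * (2 * i + 1) + 2 * n * k by ring] at this
      convert this using 1
      rw [pow_succ, pow_mul, pow_succ (-1), pow_mul (-1)]
      simp [hx]
      ring
  have hpw : ∀ γ ∈ ({w, diagonalSL ζ} : Set (SpecialLinearGroup (Fin 2) K)),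
      pullback γ x = x ∧ pullback γ y = y ∧ pullback γ z = z := by
    rintro γ (rfl | rfl)
    · simp only [hx, hy, hz, map_mul, map_pow, map_add, map_sub, hw0, hw1]
      rw [pow_mul (-X 0), neg_sq, ← pow_mul]
      refine ⟨by ring, by ring, by ring⟩
    · simp only [hx, hy, hz, map_mul, map_pow, map_add, map_sub, pullback_diagonalSL_X_zero,
        pullback_diagonalSL_X_one]
      have e1 : (C (ζ : K) * X 0 * (C ((ζ⁻¹ : Kˣ) : K) * X 1) : MvPolynomial (Fin 2) K) =
          X 0 * X 1 := by
        linear_combination (X 0 * X 1) * hζi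
      rw [e1, mul_pow (C (ζ : K)), mul_pow (C ((ζ⁻¹ : Kˣ) : K)), hζK, hζK', one_mul, one_mul]
      exact ⟨rfl, rfl, rfl⟩
  refine ⟨⟨by ring, by norm_num, by omega, hmem, ?_⟩, mem_invariants_closure fun γ hγ => (hpw γ hγ).1,
    mem_invariants_closure fun γ hγ => (hpw γ hγ).2.1,
    mem_invariants_closure fun γ hγ => (hpw γ hγ).2.2, ?_, ?_, ?_, hsq, ?_, ?_, ?_, ?_⟩
  · have e0 : pderiv 0 P = X 1 ^ 2 - C (4 * (n + 1 : ℕ) : K) * X 0 ^ n := by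
      rw [hP]
      simp [pderiv_X]
      ring
    have e1 : pderiv 1 P = C 2 * (X 0 * X 1) := by
      rw [hP, map_ofNat C 2]
      simp [pderiv_X]
      ring
    rw [e0, e1]
    have hc : C (4 * (n + 1 : ℕ) : K) ≠ (0 : MvPolynomial (Fin 2) K) :=
      C_ne_zero.2 (mul_ne_zero h4 hnK')
    have hu : IsUnit (C (4 * (n + 1 : ℕ) : K) : MvPolynomial (Fin 2) K) :=
      (isUnit_iff_ne_zero.2 (mul_ne_zero h4 hnK')).map C
    refine (isRelPrime_mul_unit_left_right ((isUnit_iff_ne_zero.2 h2).map C)).2 (IsRelPrime.mul_right ?_ ?_)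
    · refine (((X_prime (i := 0)).irreducible.isRelPrime_iff_not_dvd).2 fun hd => ?_).symm
      have h5 : X 0 ∣ (X 1 ^ 2 : MvPolynomial (Fin 2) K) :=
        (dvd_sub_left (Dvd.dvd.mul_left (dvd_pow_self _ (by omega)) _)).1 hd
      have h6 := (X_prime (i := 0)).dvd_of_dvd_pow h5
      simp [X_dvd_X] at h6
    · refine (((X_prime (i := 1)).irreducible.isRelPrime_iff_not_dvd).2 fun hd => ?_).symm
      have h5 : X 1 ∣ (C (4 * (n + 1 : ℕ) : K) * X 0 ^ n : MvPolynomial (Fin 2) K) :=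
        (dvd_sub_right (dvd_pow_self _ two_ne_zero)).1 hd
      have h6 := (X_prime (i := 1)).dvd_of_dvd_pow (hu.dvd_mul_left.1 h5)
      simp [X_dvd_X] at h6
  · rw [hx]
    exact ((isHomogeneous_X K 0).mul (isHomogeneous_X K 1)).pow 2
  · rw [hy]
    exact (isHomogeneous_X_pow 0 _).add (isHomogeneous_X_pow 1 _)
  · have := ((isHomogeneous_X K (0 : Fin 2)).mul (isHomogeneous_X K 1)).mul
      ((isHomogeneous_X_pow (R := K) (0 : Fin 2) (2 * n)).sub (isHomogeneous_X_pow 1 (2 * n)))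
    rwa [show 1 + 1 + 2 * n = 2 * (n + 1) by ring, ← hz] at this
  · obtain ⟨k, hk⟩ : ∃ k, 2 * n = k + 1 := ⟨2 * n - 1, by omega⟩
    have hk' : (C (4 * n : K) : MvPolynomial (Fin 2) K) = 2 * (k + 1) := by
      have h5 : ((2 * n : ℕ) : MvPolynomial (Fin 2) K) = (k + 1 : ℕ) := by rw [hk]
      push_cast at h5
      rw [← h5, C_mul, map_ofNat, map_natCast]
      ring
    rw [C_neg, hk', hx, hy, hz, hk]
    simp [planeBracket, pderiv_X]
    ring
  · exact neg_ne_zero.2 (mul_ne_zero h4 hnK)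
  · exact ⟨![1, 0], by simp [hx], by simp [hy, show n ≠ 0 by omega]⟩
  · intro m f hf hm
    have hf' := hf (diagonalSL ζ) (Subgroup.subset_closure (by simp))
    have hfw := hf w (Subgroup.subset_closure (by simp))
    -- An invariant is half the sum of its monomials, each symmetrized by `w`; the symmetrized
    -- monomials are covered by `hgen`.
    have h5 : f = (2 : K)⁻¹ • ∑ d ∈ f.support,
        (monomial d (coeff d f) + pullback w (monomial d (coeff d f))) := by
      rw [Finset.sum_add_distrib, ← map_sum, support_sum_monomial_coeff, hfw, ← two_smul K f,
        smul_smul, inv_mul_cancel₀ h2, one_smul]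
    rw [h5]
    refine Submodule.smul_mem _ _ (Submodule.sum_mem _ fun d hd => ?_)
    have hd' := mem_support_iff.1 hd
    have h3 := modEq_of_pullback_diagonalSL hf' hd'
    rw [hζ] at h3
    have h4 := degree_eq_of_isHomogeneous hm hd'
    rw [monomial_eq_C_mul, map_mul, pullback_C, ← mul_add, ← smul_eq_C_mul]
    refine Submodule.smul_mem _ _ ?_
    simp only [map_mul, map_pow, hw0, hw1]
    rcases le_total (d 0) (d 1) with hle | hle
    · obtain ⟨k, hk⟩ := (Nat.modEq_iff_dvd' hle).1 h3
      have h6 : d 1 = d 0 + 2 * n * k := by omega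
      have h7 := Submodule.smul_mem _ ((-1 : K) ^ d 0) (hgen (d 0) k)
      rw [show 2 * d 0 + 2 * n * k = m by omega] at h7
      convert h7 using 1
      rw [h6, neg_pow (X 0 : MvPolynomial (Fin 2) K), pow_add (-1), show 2 * n * k = 2 * (n * k) by ring, pow_mul (-1) 2,
        neg_one_sq, one_pow, mul_one, smul_eq_C_mul, C_pow, C_neg, C_1]
      have h8 : ((-1) ^ d 0 * (-1) ^ d 0 : MvPolynomial (Fin 2) K) = 1 := by
        rw [← mul_pow]
        simp
      linear_combination (-(X 0 * X 1) ^ d 0 * X 1 ^ (2 * (n * k))) * h8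
    · obtain ⟨k, hk⟩ := (Nat.modEq_iff_dvd' hle).1 h3.symm
      have h6 : d 0 = d 1 + 2 * n * k := by omega
      have h7 := hgen (d 1) k
      rw [show 2 * d 1 + 2 * n * k = m by omega] at h7
      convert h7 using 1
      rw [h6, neg_pow (X 0 : MvPolynomial (Fin 2) K)]
      ring

theorem exists_kleinGenerators_dihedral [IsAlgClosed K]
    {Γ : Subgroup (SpecialLinearGroup (Fin 2) K)} {n : ℕ} (hn : 2 ≤ n) (hnK : (n : K) ≠ 0)
    (hnK' : ((n + 1 : ℕ) : K) ≠ 0) (h2 : (2 : K) ≠ 0)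
    (hΓ : IsBinaryPolyhedral Γ 2 2 n (4 * n)) :
    ∃ P x y z c, KleinGenerators Γ 4 (2 * n) (2 * (n + 1)) P x y z c ∧ x ≠ 0 := by
  obtain ⟨hcard, r, s, t, hcl, hr, hs, ht⟩ := hΓ
  have hr' : r = s * t := by
    rw [pow_two, mul_assoc] at hr
    exact mul_left_cancel hr
  -- With `r = s t` the relation for `s` reads `s ^ 2 = (s t) ^ 2`, that is, `s = t s t`.
  have hst : s * t * s⁻¹ = t⁻¹ := by
    rw [hr', pow_two, mul_assoc (s * t)] at hs
    have h3 : s = t * (s * t) := by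
      have h4 : s * s = s * (t * (s * t)) := by rw [hs]; group
      exact mul_left_cancel h4
    nth_rewrite 2 [h3]
    group
  have hcl' : Subgroup.closure {s, t} = ⊤ := by
    rw [eq_top_iff, ← hcl, Subgroup.closure_le]
    rintro g (rfl | rfl | rfl)
    · rw [hr']
      exact mul_mem (Subgroup.subset_closure (by simp)) (Subgroup.subset_closure (by simp))
    · exact Subgroup.subset_closure (by simp)
    · exact Subgroup.subset_closure (by simp)
  have hord := orderOf_eq_of_card_eq (by omega) hcl' hst (hs.trans ht.symm) hcard
  have hord' : orderOf t.1 = 2 * n := by rw [Subgroup.orderOf_coe, hord]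
  have hclv : Subgroup.closure {s.1, t.1} = Γ := by
    have := closure_val_image hcl'
    rwa [Set.image_pair] at this
  have h2n : ((2 * n : ℕ) : K) ≠ 0 := by
    push_cast
    exact mul_ne_zero h2 hnK
  obtain ⟨k, ζ, hk⟩ := exists_conj_diagonal h2n (hord' ▸ pow_orderOf_eq_one t.1)
  have hconj : MulAut.conj k⁻¹ t.1 = diagonalSL ζ := by simpa using hk
  have hζ : orderOf ζ = 2 * n := by
    rw [← orderOf_injective diagonalSL diagonalSL_injective ζ, ← hconj, ← hord']
    exact orderOf_injective (MulAut.conj k⁻¹).toMonoidHom (MulAut.conj k⁻¹).injective t.1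
  set σ := MulAut.conj k⁻¹ s.1 with hσ
  have hσt : σ * diagonalSL ζ = (diagonalSL ζ)⁻¹ * σ := by
    rw [← hconj, hσ, ← map_inv, ← map_mul, ← map_mul]
    congr 1
    have := congrArg Subtype.val (mul_inv_eq_iff_eq_mul.1 hst)
    exact this
  have hζ2 : (ζ : K) ≠ ((ζ⁻¹ : Kˣ) : K) := by
    intro h3
    have h4 : ζ * ζ = 1 := by
      nth_rewrite 2 [Units.ext h3]
      exact mul_inv_cancel ζ
    have := Nat.le_of_dvd (by norm_num) (orderOf_dvd_of_pow_eq_one ((pow_two ζ).trans h4))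
    omega
  -- The conjugate of `s` exchanges the eigenlines of `diag (ζ, ζ⁻¹)`, which are distinct as `ζ` has
  -- order `2n > 2`. So both its diagonal entries vanish.
  have h00 : σ.1 0 0 = 0 := by
    have h3 := congrArg (fun g : SpecialLinearGroup (Fin 2) K => g.1 0 0) hσt
    simp only [val_mul_apply, inv_val, diagonalSL_val] at h3
    simp only [of_apply, cons_val', cons_val_zero, cons_val_one, cons_val_fin_one] at h3
    have h4 : σ.1 0 0 * ((ζ : K) - ((ζ⁻¹ : Kˣ) : K)) = 0 := by linear_combination h3
    exact (mul_eq_zero.1 h4).resolve_right (sub_ne_zero.2 hζ2)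
  have h11 : σ.1 1 1 = 0 := by
    have h3 := congrArg (fun g : SpecialLinearGroup (Fin 2) K => g.1 1 1) hσt
    simp only [val_mul_apply, inv_val, diagonalSL_val] at h3
    simp only [of_apply, cons_val', cons_val_zero, cons_val_one, cons_val_fin_one] at h3
    have h4 : σ.1 1 1 * ((ζ : K) - ((ζ⁻¹ : Kˣ) : K)) = 0 := by linear_combination -h3
    exact (mul_eq_zero.1 h4).resolve_right (sub_ne_zero.2 hζ2)
  have hdet := val_det σ
  rw [h00, zero_mul, zero_sub] at hdet
  have h01 : σ.1 0 1 ≠ 0 := by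
    intro h0
    rw [h0] at hdet
    simp at hdet
  -- Conjugation by `diag (δ, δ⁻¹)` multiplies the upper right entry by `δ ^ 2`, which normalizes it
  -- to 1 and fixes `diag (ζ, ζ⁻¹)`.
  obtain ⟨δ, hδ⟩ := IsAlgClosed.exists_pow_nat_eq (σ.1 0 1)⁻¹ two_pos
  have hδ0 : δ ≠ 0 := by
    rintro rfl
    rw [zero_pow two_ne_zero] at hδ
    exact inv_ne_zero h01 hδ.symm
  set D := diagonalSL (Units.mk0 δ hδ0) with hD
  have hDt : MulAut.conj D (diagonalSL ζ) = diagonalSL ζ := by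
    rw [MulAut.conj_apply, hD, ← map_inv, ← map_mul, ← map_mul, mul_inv_cancel_comm]
  have hDs : MulAut.conj D σ = mkSL 0 1 (-1) 0 (by simp) := by
    have e1 : δ ^ 2 * σ.1 0 1 = 1 := by rw [hδ, inv_mul_cancel₀ h01]
    rw [MulAut.conj_apply]
    apply sl_ext <;> simp only [val_mul_apply, inv_val, hD, diagonalSL_val, mkSL_val, h00, h11] <;>
      simp
    · linear_combination e1
    · field_simp
      linear_combination -hdet * δ ^ 2 - σ.1 1 0 * e1
  have hmap : Γ.map (MulAut.conj (D * k⁻¹)).toMonoidHom =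
      Subgroup.closure {mkSL 0 1 (-1) 0 (by simp), diagonalSL ζ} := by
    rw [← hclv, MonoidHom.map_closure, Set.image_pair]
    congr 2
    · rw [← hDs, hσ, map_mul]
      rfl
    · rw [← hDt, ← hconj, map_mul]
      rfl
  have hK := kleinGenerators_dihedral hn hnK hnK' h2 hζ rfl rfl rfl rfl rfl
  rw [← hmap] at hK
  exact ⟨_, _, _, _, _, mem_kleinSpan_of_conj _ hK, pullback_ne_zero (pow_ne_zero 2
    (mul_ne_zero (X_ne_zero 0) (X_ne_zero 1))) _⟩

end Dihedral

/-! ### Linear forms attached to lines in the plane. -/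

section LineForms

open MvPolynomial Matrix

variable {K : Type*} [Field K]

theorem isHomogeneous_iff_mem_planeGrading {m : ℕ} {f : MvPolynomial (Fin 2) K} :
    f.IsHomogeneous m ↔ f ∈ planeGrading K 1 1 m := by
  constructor
  · intro h d hd
    rw [weight_planeWeights, ← degree_eq_of_isHomogeneous h hd]
    push_cast
    ring
  · intro h d hd
    have h1 := h hd
    rw [weight_planeWeights] at h1
    rw [Finsupp.weight_apply, Finsupp.sum_fintype _ _ (by simp)]
    simp
    push_cast at h1
    omega

theorem isHomogeneous_of_mul {k m : ℕ} {f g : MvPolynomial (Fin 2) K} (hg : g.IsHomogeneous k)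
    (h : (g * f).IsHomogeneous m) (h0 : g * f ≠ 0) : k ≤ m ∧ f.IsHomogeneous (m - k) := by
  rw [mul_comm] at h h0
  have h1 := mem_planeGrading_of_mul_mem (isHomogeneous_iff_mem_planeGrading.1 hg)
    (right_ne_zero_of_mul h0) (isHomogeneous_iff_mem_planeGrading.1 h)
  have h2 : k ≤ m := by
    by_contra hlt
    exact left_ne_zero_of_mul h0 (planeGrading_of_neg (by omega) h1)
  refine ⟨h2, isHomogeneous_iff_mem_planeGrading.2 ?_⟩
  push_cast [h2]
  exact h1

/-- The linear form vanishing on the line through `v`. -/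
noncomputable def lineForm (v : Fin 2 → K) : MvPolynomial (Fin 2) K := C (v 0) * X 1 - C (v 1) * X 0

theorem eval_lineForm (u v : Fin 2 → K) : eval u (lineForm v) = v 0 * u 1 - v 1 * u 0 := by
  simp [lineForm]

theorem lineForm_smul (c : K) (v : Fin 2 → K) : lineForm (c • v) = C c * lineForm v := by
  simp [lineForm]
  ring

theorem mulVec_apply (g : SpecialLinearGroup (Fin 2) K) (v : Fin 2 → K) (i : Fin 2) :
    (g.1 *ᵥ v) i = g.1 i 0 * v 0 + g.1 i 1 * v 1 := by
  simp [mulVec, dotProduct]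

theorem mul_mulVec (g k : SpecialLinearGroup (Fin 2) K) (v : Fin 2 → K) :
    (g * k).1 *ᵥ v = g.1 *ᵥ (k.1 *ᵥ v) := by
  rw [mulVec_mulVec, Matrix.SpecialLinearGroup.coe_mul]

theorem one_mulVec' (v : Fin 2 → K) : (1 : SpecialLinearGroup (Fin 2) K).1 *ᵥ v = v := by
  rw [Matrix.SpecialLinearGroup.coe_one, one_mulVec]

theorem mulVec_ne_zero (g : SpecialLinearGroup (Fin 2) K) {v : Fin 2 → K} (hv : v ≠ 0) :
    g.1 *ᵥ v ≠ 0 := by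
  intro h0
  apply hv
  rw [← one_mulVec' v, ← inv_mul_cancel g, mul_mulVec, h0, mulVec_zero]

theorem pullback_lineForm (g : SpecialLinearGroup (Fin 2) K) (v : Fin 2 → K) :
    pullback g (lineForm v) = lineForm (g⁻¹.1 *ᵥ v) := by
  rw [lineForm, lineForm, mulVec_apply, mulVec_apply, inv_val]
  simp [pullback_X]
  ring

theorem lineForm_isHomogeneous (v : Fin 2 → K) : (lineForm v).IsHomogeneous 1 := by
  have h1 := (isHomogeneous_C (Fin 2) (v 0)).mul (isHomogeneous_X K 1)
  have h2 := (isHomogeneous_C (Fin 2) (v 1)).mul (isHomogeneous_X K 0)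
  rw [zero_add] at h1 h2
  exact h1.sub h2

theorem lineForm_self (v : Fin 2 → K) : eval v (lineForm v) = 0 := by
  rw [eval_lineForm]
  ring

theorem exists_mulVec_eq {v : Fin 2 → K} (hv : v ≠ 0) :
    ∃ g : SpecialLinearGroup (Fin 2) K, g.1 *ᵥ ![1, 0] = v := by
  rcases eq_or_ne (v 0) 0 with h0 | h0
  · have h1 : v 1 ≠ 0 := by
      intro h1
      apply hv
      funext i
      fin_cases i <;> simpa
    refine ⟨mkSL 0 (-(v 1)⁻¹) (v 1) 0 (by simp [h1]), ?_⟩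
    funext i
    fin_cases i <;> simp [mkSL_val, h0]
  · refine ⟨mkSL (v 0) 0 (v 1) (v 0)⁻¹ (by simp [h0]), ?_⟩
    funext i
    fin_cases i <;> simp [mkSL_val]

theorem pullback_dvd_pullback {f g : MvPolynomial (Fin 2) K} (k : SpecialLinearGroup (Fin 2) K)
    (h : pullback k f ∣ pullback k g) : f ∣ g := by
  have h1 := map_dvd (pullback k⁻¹) h
  rwa [pullback_pullback, pullback_pullback, mul_inv_cancel, pullback_one, pullback_one] at h1

/-- Move `v` to `(1, 0)`. The form becomes the second variable, and a homogeneous polynomial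
vanishing at `(1, 0)` contains no pure power of the first. -/
theorem lineForm_dvd {v : Fin 2 → K} (hv : v ≠ 0) {m : ℕ} {f : MvPolynomial (Fin 2) K}
    (hf : f.IsHomogeneous m) (h0 : eval v f = 0) : lineForm v ∣ f := by
  obtain ⟨g, rfl⟩ := exists_mulVec_eq hv
  refine pullback_dvd_pullback g ?_
  rw [pullback_lineForm, ← mul_mulVec, inv_mul_cancel, one_mulVec']
  rw [← eval_pullback] at h0
  have hf' := pullback_isHomogeneous g hf
  generalize pullback g f = u at h0 hf'
  have h1 : lineForm ![1, 0] = (X 1 : MvPolynomial (Fin 2) K) := by simp [lineForm]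
  rw [h1, ← support_sum_monomial_coeff u]
  refine Finset.dvd_sum fun d hd => ?_
  rw [monomial_eq_C_mul]
  by_cases hd1 : d 1 = 0
  · exfalso
    refine mem_support_iff.1 hd ?_
    rw [← h0, eval_eq', Finset.sum_eq_single_of_mem d hd]
    · simp [hd1]
    · intro e he hne
      have h2 := degree_eq_of_isHomogeneous hf' (mem_support_iff.1 hd)
      have h3 := degree_eq_of_isHomogeneous hf' (mem_support_iff.1 he)
      have h4 : e 1 ≠ 0 := by
        intro h4
        apply hne
        ext i
        fin_cases i
        · show e 0 = d 0
          omega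
        · show e 1 = d 1
          omega
      simp [h4]
  · exact Dvd.dvd.mul_left (Dvd.dvd.mul_left (dvd_pow_self _ hd1) _) _

theorem lineForm_irreducible {v : Fin 2 → K} (hv : v ≠ 0) : Irreducible (lineForm v) := by
  obtain ⟨g, rfl⟩ := exists_mulVec_eq hv
  have h1 : lineForm (g.1 *ᵥ ![1, 0]) = pullback g⁻¹ (X 1) := by
    have h2 : (X 1 : MvPolynomial (Fin 2) K) = lineForm ![1, 0] := by simp [lineForm]
    rw [h2, pullback_lineForm, inv_inv]
  let e : MvPolynomial (Fin 2) K ≃ₐ[K] MvPolynomial (Fin 2) K :=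
    AlgEquiv.ofAlgHom (pullback g⁻¹) (pullback g)
      (AlgHom.ext fun f => by
        simp only [AlgHom.comp_apply, pullback_pullback, mul_inv_cancel, pullback_one,
          AlgHom.id_apply])
      (AlgHom.ext fun f => by
        simp only [AlgHom.comp_apply, pullback_pullback, inv_mul_cancel, pullback_one,
          AlgHom.id_apply])
  rw [h1]
  exact (MulEquiv.irreducible_iff e.toMulEquiv).2 (X_prime (i := (1 : Fin 2))).irreducible

theorem isRelPrime_lineForm {u v : Fin 2 → K} (hu : u ≠ 0) (h : eval u (lineForm v) ≠ 0) :
    IsRelPrime (lineForm u) (lineForm v) := by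
  rw [(lineForm_irreducible hu).isRelPrime_iff_not_dvd]
  rintro ⟨f, hf⟩
  apply h
  rw [hf, map_mul, lineForm_self, zero_mul]

theorem exists_eq_smul {u v : Fin 2 → K} (hv : v ≠ 0) (h : eval u (lineForm v) = 0) :
    ∃ c : K, u = c • v := by
  rw [eval_lineForm] at h
  rcases eq_or_ne (v 0) 0 with h0 | h0
  · have h1 : v 1 ≠ 0 := by
      intro h1
      apply hv
      funext i
      fin_cases i <;> simpa
    rw [h0, zero_mul, zero_sub, neg_eq_zero] at h
    refine ⟨u 1 / v 1, ?_⟩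
    funext i
    fin_cases i
    · simpa [h0, h1] using h
    · simp [h1]
  · refine ⟨u 0 / v 0, ?_⟩
    funext i
    fin_cases i
    · simp [h0]
    · show u 1 = u 0 / v 0 * v 1
      field_simp
      linear_combination h

end LineForms

/-! ### Homogeneous semi-invariants and their characters. -/

section Semiinvariants

open MvPolynomial Matrix

variable {K : Type*} [Field K] {Γ : Subgroup (SpecialLinearGroup (Fin 2) K)} {χ ψ : Γ →* Kˣ}
  {k m : ℕ} {f g : MvPolynomial (Fin 2) K}

/-- `f` is a homogeneous semi-invariant of degree `m` with character `χ`. -/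
structure IsSemiinvariant (χ : Γ →* Kˣ) (m : ℕ) (f : MvPolynomial (Fin 2) K) : Prop where
  isHomogeneous : f.IsHomogeneous m
  pullback_eq : ∀ γ : Γ, pullback γ.1 f = C (χ γ : K) * f

theorem IsSemiinvariant.mul (hf : IsSemiinvariant χ k f) (hg : IsSemiinvariant ψ m g) :
    IsSemiinvariant (χ * ψ) (k + m) (f * g) := by
  refine ⟨hf.isHomogeneous.mul hg.isHomogeneous, fun γ => ?_⟩
  rw [map_mul, hf.pullback_eq, hg.pullback_eq, MonoidHom.mul_apply, Units.val_mul, C_mul]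
  ring

theorem IsSemiinvariant.pow (hf : IsSemiinvariant χ k f) (n : ℕ) :
    IsSemiinvariant (χ ^ n) (k * n) (f ^ n) := by
  refine ⟨hf.isHomogeneous.pow n, fun γ => ?_⟩
  rw [map_pow, hf.pullback_eq, MonoidHom.pow_apply, Units.val_pow_eq_pow_val, C_pow, mul_pow]

theorem IsSemiinvariant.add (hf : IsSemiinvariant χ k f) (hg : IsSemiinvariant χ k g) :
    IsSemiinvariant χ k (f + g) := by
  refine ⟨hf.isHomogeneous.add hg.isHomogeneous, fun γ => ?_⟩
  rw [map_add, hf.pullback_eq, hg.pullback_eq, mul_add]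

theorem IsSemiinvariant.C_mul (hf : IsSemiinvariant χ k f) (c : K) :
    IsSemiinvariant χ k (C c * f) := by
  refine ⟨by simpa using (isHomogeneous_C (Fin 2) c).mul hf.isHomogeneous, fun γ => ?_⟩
  rw [map_mul, pullback_C, hf.pullback_eq]
  ring

theorem IsSemiinvariant.sub (hf : IsSemiinvariant χ k f) (hg : IsSemiinvariant χ k g) :
    IsSemiinvariant χ k (f - g) := by
  have h1 := hf.add (hg.C_mul (-1))
  rwa [C_neg, C_1, neg_one_mul, ← sub_eq_add_neg] at h1

theorem planeBracket_C_mul (c d : K) (f g : MvPolynomial (Fin 2) K) :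
    planeBracket (C c * f) (C d * g) = C (c * d) * planeBracket f g := by
  simp only [planeBracket, pderiv_C_mul, MvPolynomial.C_mul]
  ring

theorem planeBracket_mul (f g h : MvPolynomial (Fin 2) K) :
    planeBracket f (g * h) = planeBracket f g * h + g * planeBracket f h := by
  simp only [planeBracket, pderiv_mul]
  ring

theorem IsSemiinvariant.planeBracket (hf : IsSemiinvariant χ k f) (hg : IsSemiinvariant ψ m g) :
    IsSemiinvariant (χ * ψ) (k - 1 + (m - 1)) (planeBracket f g) := by
  refine ⟨planeBracket_isHomogeneous hf.isHomogeneous hg.isHomogeneous, fun γ => ?_⟩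
  rw [← planeBracket_pullback, hf.pullback_eq, hg.pullback_eq, planeBracket_C_mul,
    MonoidHom.mul_apply, Units.val_mul]

theorem isSemiinvariant_one (hf : f ∈ invariants Γ) (hm : f.IsHomogeneous m) :
    IsSemiinvariant (1 : Γ →* Kˣ) m f :=
  ⟨hm, fun γ => by rw [hf γ.1 γ.2]; simp⟩

theorem IsSemiinvariant.mem_invariants (hf : IsSemiinvariant (1 : Γ →* Kˣ) m f) :
    f ∈ invariants Γ := fun γ hγ => by
  have h1 := hf.pullback_eq ⟨γ, hγ⟩
  simpa using h1

theorem IsSemiinvariant.eval_mulVec (hf : IsSemiinvariant χ m f) (γ : Γ) (v : Fin 2 → K) :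
    eval (γ.1.1 *ᵥ v) f = χ γ * eval v f := by
  rw [← eval_pullback, hf.pullback_eq, map_mul, eval_C]

/-- Compare `f (γ v)` with `f (ε v) = ε ^ m f (v)`. Read contrapositively, a mismatch between degree
and character forces `f` to vanish on the eigenline. -/
theorem IsSemiinvariant.character_eq (hf : IsSemiinvariant χ m f) {γ : Γ} {v : Fin 2 → K} {ε : Kˣ}
    (hv : γ.1.1 *ᵥ v = (ε : K) • v) (h0 : eval v f ≠ 0) : χ γ = ε ^ m := by
  have h1 := hf.eval_mulVec γ v
  rw [hv, eval_smul_of_isHomogeneous hf.isHomogeneous] at h1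
  exact Units.ext (by simpa using (mul_right_cancel₀ h0 h1).symm)

theorem IsSemiinvariant.exists_mul (hf : IsSemiinvariant χ k f) (hfg : IsSemiinvariant ψ m g)
    (hg0 : g ≠ 0) (hdvd : f ∣ g) :
    ∃ u, g = f * u ∧ k ≤ m ∧ IsSemiinvariant (ψ / χ) (m - k) u := by
  obtain ⟨u, rfl⟩ := hdvd
  obtain ⟨h1, h2⟩ := isHomogeneous_of_mul hf.isHomogeneous hfg.isHomogeneous hg0
  refine ⟨u, rfl, h1, h2, fun γ => ?_⟩
  have h3 := hfg.pullback_eq γ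
  rw [map_mul, hf.pullback_eq] at h3
  have h4 : (C (χ γ : K) : MvPolynomial (Fin 2) K) ≠ 0 := by simp
  refine mul_left_cancel₀ (mul_ne_zero h4 (left_ne_zero_of_mul hg0)) ?_
  rw [h3, MonoidHom.div_apply, Units.val_div_eq_div_val]
  have h5 : (C (χ γ : K) * C ((ψ γ : K) / χ γ) : MvPolynomial (Fin 2) K) = C (ψ γ : K) := by
    rw [← MvPolynomial.C_mul, mul_div_cancel₀ _ (Units.ne_zero _)]
  linear_combination (-(f * u)) * h5

theorem IsSemiinvariant.eq_C (hf : IsSemiinvariant χ 0 f) : ∃ c, f = C c :=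
  ⟨_, totalDegree_eq_zero_iff_eq_C.1 (Nat.le_zero.1 hf.isHomogeneous.totalDegree_le)⟩

theorem IsSemiinvariant.character_eq_one (hf : IsSemiinvariant χ 0 f) (h0 : f ≠ 0) : χ = 1 := by
  obtain ⟨c, rfl⟩ := hf.eq_C
  ext γ
  have h1 := hf.pullback_eq γ
  rw [pullback_C, ← MvPolynomial.C_mul] at h1
  have h2 := C_injective _ _ h1
  have hc : c ≠ 0 := by
    rintro rfl
    simp at h0
  simpa [hc] using h2

/-- Two semi-invariants of the same degree and character agree up to a scalar if one divides the
other. -/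
theorem IsSemiinvariant.eq_C_mul (hf : IsSemiinvariant χ m f) (hg : IsSemiinvariant ψ m g)
    (hdvd : f ∣ g) : ∃ c, g = C c * f := by
  rcases eq_or_ne g 0 with rfl | hg0
  · exact ⟨0, by simp⟩
  obtain ⟨u, rfl, -, hu⟩ := hf.exists_mul hg hg0 hdvd
  rw [Nat.sub_self] at hu
  obtain ⟨c, rfl⟩ := hu.eq_C
  exact ⟨c, mul_comm _ _⟩

theorem exists_character (h0 : f ≠ 0) (hm : f.IsHomogeneous m)
    (h : ∀ γ : Γ, ∃ c, pullback γ.1 f = C c * f) : ∃ χ : Γ →* Kˣ, IsSemiinvariant χ m f := by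
  choose c hc using h
  have hmul : ∀ γ δ, c (γ * δ) = c γ * c δ := by
    intro γ δ
    have h1 := hc (γ * δ)
    rw [Subgroup.coe_mul, ← pullback_pullback, hc γ, map_mul, pullback_C, hc δ, ← mul_assoc,
      ← MvPolynomial.C_mul] at h1
    exact (C_injective _ _ (mul_right_cancel₀ h0 h1)).symm
  have hone : c 1 = 1 := by
    have h1 := hc 1
    rw [Subgroup.coe_one, pullback_one] at h1
    refine (C_injective (Fin 2) K (mul_right_cancel₀ h0 ?_)).symm
    rw [C_1, one_mul, ← h1]
  exact ⟨MonoidHom.toHomUnits ⟨⟨c, hone⟩, hmul⟩, hm, fun γ => by rw [hc γ]; rfl⟩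

end Semiinvariants

/-! ### Forms vanishing on an orbit of lines. -/

section OrbitForms

open MvPolynomial Matrix

variable {K : Type*} [Field K] {Γ : Subgroup (SpecialLinearGroup (Fin 2) K)}

/-- Such an element is diagonalizable with eigenvalues `ζ, ζ⁻¹`, so one eigenvalue 1 makes both
equal to 1. -/
theorem eq_one_of_mulVec_eq [IsAlgClosed K] {N : ℕ} (hN : (N : K) ≠ 0)
    {g : SpecialLinearGroup (Fin 2) K} (hg : g ^ N = 1) {v : Fin 2 → K} (hv : v ≠ 0)
    (h : g.1 *ᵥ v = v) : g = 1 := by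
  obtain ⟨k, ζ, hk⟩ := exists_conj_diagonal hN hg
  have h1 : (diagonalSL ζ).1 *ᵥ (k⁻¹.1 *ᵥ v) = k⁻¹.1 *ᵥ v := by
    rw [← hk, ← mul_mulVec, mul_inv_cancel_right, mul_mulVec, h]
  have h2 := mulVec_ne_zero k⁻¹ hv
  generalize k⁻¹.1 *ᵥ v = w at h1 h2
  have hζ : ζ = 1 := by
    have e0 : (ζ : K) * w 0 = w 0 := by
      have h3 := congrFun h1 0
      rw [mulVec_apply] at h3
      simpa [diagonalSL_val] using h3
    have e1 : ((ζ⁻¹ : Kˣ) : K) * w 1 = w 1 := by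
      have h3 := congrFun h1 1
      rw [mulVec_apply] at h3
      simpa [diagonalSL_val] using h3
    by_cases h0 : w 0 = 0
    · have h4 : w 1 ≠ 0 := by
        intro h4
        apply h2
        funext i
        fin_cases i <;> simpa
      exact inv_eq_one.1 (Units.ext (mul_right_cancel₀ h4 (e1.trans (one_mul _).symm)))
    · exact Units.ext (mul_right_cancel₀ h0 (e0.trans (one_mul _).symm))
  rw [hζ, map_one] at hk
  simpa [mul_assoc] using congrArg (k * · * k⁻¹) hk

/-- The subgroup of the elements of `Γ` having `v` as an eigenvector. -/
def lineStabilizer (Γ : Subgroup (SpecialLinearGroup (Fin 2) K)) (v : Fin 2 → K) :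
    Subgroup Γ where
  carrier := {γ | ∃ c : Kˣ, γ.1.1 *ᵥ v = (c : K) • v}
  one_mem' := ⟨1, by rw [Subgroup.coe_one, one_mulVec', Units.val_one, one_smul]⟩
  mul_mem' := by
    rintro γ δ ⟨c, hc⟩ ⟨d, hd⟩
    exact ⟨d * c, by rw [Subgroup.coe_mul, mul_mulVec, hd, mulVec_smul, hc, smul_smul, Units.val_mul]⟩
  inv_mem' := by
    rintro γ ⟨c, hc⟩
    refine ⟨c⁻¹, ?_⟩
    have h1 : γ.1⁻¹.1 *ᵥ (γ.1.1 *ᵥ v) = v := by rw [← mul_mulVec, inv_mul_cancel, one_mulVec']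
    rw [hc, mulVec_smul] at h1
    rw [Subgroup.coe_inv]
    nth_rewrite 2 [← h1]
    rw [smul_smul, Units.inv_mul, one_smul]

theorem mem_lineStabilizer {v : Fin 2 → K} (hv : v ≠ 0) {γ : Γ} {c : K}
    (h : γ.1.1 *ᵥ v = c • v) : γ ∈ lineStabilizer Γ v := by
  have hc : c ≠ 0 := by
    rintro rfl
    rw [zero_smul] at h
    exact mulVec_ne_zero _ hv h
  exact ⟨Units.mk0 c hc, h⟩

theorem exists_lineCharacter {v : Fin 2 → K} (hv : v ≠ 0) :
    ∃ ε : lineStabilizer Γ v →* Kˣ, ∀ γ, γ.1.1.1 *ᵥ v = (ε γ : K) • v := by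
  have h : ∀ γ : lineStabilizer Γ v, ∃ c : Kˣ, γ.1.1.1 *ᵥ v = (c : K) • v := fun γ => γ.2
  choose ε hε using h
  refine ⟨⟨⟨ε, ?_⟩, ?_⟩, hε⟩
  · have h1 := hε 1
    rw [Subgroup.coe_one, Subgroup.coe_one, one_mulVec'] at h1
    refine Units.ext (smul_left_injective K hv ?_)
    simp only
    rw [← h1, Units.val_one, one_smul]
  · intro γ δ
    have h1 := hε (γ * δ)
    rw [Subgroup.coe_mul, Subgroup.coe_mul, mul_mulVec, hε δ, mulVec_smul, hε γ, smul_smul] at h1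
    refine Units.ext (smul_left_injective K hv ?_)
    simp only
    rw [← h1, Units.val_mul, mul_comm]

theorem pow_card_eq_one_val (γ : Γ) : γ.1 ^ Nat.card Γ = 1 := by
  rw [← Subgroup.coe_pow, pow_card_eq_one', Subgroup.coe_one]

/-- Only the identity of `Γ` fixes a nonzero vector. Consequently line stabilizers embed in `Kˣ`,
which later makes them cyclic. -/
theorem injective_of_mulVec_eq_smul [IsAlgClosed K] (hΓ : (Nat.card Γ : K) ≠ 0) {v : Fin 2 → K}
    (hv : v ≠ 0) {ε : lineStabilizer Γ v →* Kˣ} (hε : ∀ γ, γ.1.1.1 *ᵥ v = (ε γ : K) • v) :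
    Function.Injective ε := by
  rw [injective_iff_map_eq_one]
  intro γ hγ
  have h1 := hε γ
  rw [hγ, Units.val_one, one_smul] at h1
  exact Subtype.ext (Subtype.ext (eq_one_of_mulVec_eq hΓ (pow_card_eq_one_val γ.1) hv h1))

theorem orderOf_eq_of_mulVec_eq_smul [IsAlgClosed K] (hΓ : (Nat.card Γ : K) ≠ 0) {v : Fin 2 → K}
    (hv : v ≠ 0) {γ : Γ} {c : Kˣ} (h : γ.1.1 *ᵥ v = (c : K) • v) : orderOf c = orderOf γ := by
  obtain ⟨ε, hε⟩ := exists_lineCharacter (Γ := Γ) hv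
  have h1 : (c : K) • v = (ε ⟨γ, c, h⟩ : K) • v := h.symm.trans (hε ⟨γ, c, h⟩)
  have h2 : c = ε ⟨γ, c, h⟩ := Units.ext (smul_left_injective K hv h1)
  rw [h2, orderOf_injective ε (injective_of_mulVec_eq_smul hΓ hv hε), ← Subgroup.orderOf_coe]

/-- `Φ` is, up to a scalar, the product of the linear forms vanishing on the `k` lines in the orbit
of the line through `v`. -/
structure IsOrbitForm (v : Fin 2 → K) (k : ℕ) (χ : Γ →* Kˣ) (Φ : MvPolynomial (Fin 2) K) :
    Prop where
  vector_ne_zero : v ≠ 0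
  semi : IsSemiinvariant χ k Φ
  ne_zero : Φ ≠ 0
  exists_eq_mul : ∃ G, Φ = lineForm v * G ∧ eval v G ≠ 0
  exists_of_eval_eq_zero : ∀ u, u ≠ 0 → eval u Φ = 0 →
    ∃ (γ : Γ) (c : K), c ≠ 0 ∧ u = c • γ.1.1 *ᵥ v
  dvd : ∀ {ψ : Γ →* Kˣ} {m f}, IsSemiinvariant ψ m f → eval v f = 0 → Φ ∣ f

/-- The form is a product of linear forms over the cosets of the stabilizer. `Γ` permutes the
factors up to scalars. They are pairwise coprime, so a semi-invariant vanishing at `v`, and hence on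
the whole orbit, is divisible by their product. -/
theorem exists_isOrbitForm [Finite Γ] {v : Fin 2 → K} (hv : v ≠ 0) :
    ∃ χ Φ, IsOrbitForm (Γ := Γ) v (lineStabilizer Γ v).index χ Φ := by
  classical
  let S := lineStabilizer Γ v
  have : Fintype (Γ ⧸ S) := Fintype.ofFinite _
  let u : Γ ⧸ S → Fin 2 → K := fun q => q.out.1.1 *ᵥ v
  have hu : ∀ q, u q ≠ 0 := fun q => mulVec_ne_zero _ hv
  have hmk : ∀ γ : Γ, ∃ c : K, c ≠ 0 ∧ γ.1.1 *ᵥ v = c • u (γ : Γ ⧸ S) := by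
    intro γ
    obtain ⟨δ, hδ⟩ := QuotientGroup.mk_out_eq_mul S γ
    obtain ⟨c, hc⟩ : ∃ c : Kˣ, δ.1.1.1 *ᵥ v = (c : K) • v := δ.2
    refine ⟨((c⁻¹ : Kˣ) : K), Units.ne_zero _, ?_⟩
    simp only [u]
    rw [hδ, Subgroup.coe_mul, mul_mulVec, hc, mulVec_smul, smul_smul, Units.inv_mul, one_smul]
  have hne : ∀ {q q'}, q ≠ q' → eval (u q) (lineForm (u q')) ≠ 0 := by
    intro q q' hqq h0
    obtain ⟨c, hc⟩ := exists_eq_smul (hu q') h0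
    apply hqq
    rw [← QuotientGroup.out_eq' q, ← QuotientGroup.out_eq' q']
    refine Eq.symm (QuotientGroup.eq.2 (mem_lineStabilizer hv (c := c) ?_))
    rw [Subgroup.coe_mul, mul_mulVec, Subgroup.coe_inv]
    change (q'.out.1)⁻¹.1 *ᵥ u q = _
    rw [hc, mulVec_smul, ← mul_mulVec, inv_mul_cancel, one_mulVec']
  obtain ⟨c, hc0, hc⟩ := hmk 1
  rw [Subgroup.coe_one, one_mulVec'] at hc
  have h0 : ∏ q, lineForm (u q) ≠ 0 :=
    Finset.prod_ne_zero_iff.2 fun q _ => (lineForm_irreducible (hu q)).ne_zero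
  have hm : (∏ q, lineForm (u q)).IsHomogeneous S.index := by
    have h1 := IsHomogeneous.prod Finset.univ (fun q => lineForm (u q)) (fun _ => 1)
      fun q _ => lineForm_isHomogeneous (u q)
    rwa [Finset.sum_const, smul_eq_mul, mul_one, Finset.card_univ, ← Nat.card_eq_fintype_card,
      ← Subgroup.index_eq_card] at h1
  obtain ⟨χ, hχ⟩ := exists_character (Γ := Γ) h0 hm (by
    intro γ
    have h1 : ∀ q, ∃ c : K, γ⁻¹.1.1 *ᵥ u q = c • u (γ⁻¹ • q) := by
      intro q
      obtain ⟨c, -, hc⟩ := hmk (γ⁻¹ * q.out)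
      refine ⟨c, ?_⟩
      rw [Subgroup.coe_mul, mul_mulVec] at hc
      have h2 : ((γ⁻¹ * q.out : Γ) : Γ ⧸ S) = γ⁻¹ • q := by
        conv_rhs => rw [← QuotientGroup.out_eq' q]
        rfl
      rw [h2] at hc
      exact hc
    choose c hc using h1
    refine ⟨∏ q, c q, ?_⟩
    rw [map_prod, map_prod]
    simp_rw [pullback_lineForm]
    have h2 : ∀ q, lineForm (γ.1⁻¹.1 *ᵥ u q) = C (c q) * lineForm (u (γ⁻¹ • q)) := by
      intro q
      rw [← lineForm_smul, ← hc q, Subgroup.coe_inv]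
    simp_rw [h2]
    rw [Finset.prod_mul_distrib]
    congr 1
    exact Equiv.prod_comp (MulAction.toPerm γ⁻¹) fun q => lineForm (u q))
  refine ⟨χ, _, hv, hχ, h0, ?_, ?_, ?_⟩
  · refine ⟨C c⁻¹ * ∏ q ∈ Finset.univ.erase ((1 : Γ) : Γ ⧸ S), lineForm (u q), ?_, ?_⟩
    · rw [← Finset.mul_prod_erase Finset.univ _ (Finset.mem_univ ((1 : Γ) : Γ ⧸ S))]
      rw [show lineForm v = C c * lineForm (u ((1 : Γ) : Γ ⧸ S)) by rw [← lineForm_smul, ← hc]]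
      have h1 : (C c * C c⁻¹ : MvPolynomial (Fin 2) K) = 1 := by
        rw [← MvPolynomial.C_mul, mul_inv_cancel₀ hc0, C_1]
      linear_combination (-lineForm (u ((1 : Γ) : Γ ⧸ S)) *
        ∏ q ∈ Finset.univ.erase ((1 : Γ) : Γ ⧸ S), lineForm (u q)) * h1
    · rw [map_mul, eval_C, map_prod]
      refine mul_ne_zero (inv_ne_zero hc0) (Finset.prod_ne_zero_iff.2 fun q hq => ?_)
      have h1 := hne (Finset.ne_of_mem_erase hq).symm
      rw [hc, eval_smul_of_isHomogeneous (lineForm_isHomogeneous _)]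
      exact mul_ne_zero (pow_ne_zero _ hc0) h1
  · intro w hw hw0
    rw [map_prod] at hw0
    obtain ⟨q, -, hq⟩ := Finset.prod_eq_zero_iff.1 hw0
    obtain ⟨d, hd⟩ := exists_eq_smul (hu q) hq
    refine ⟨q.out, d, ?_, hd⟩
    rintro rfl
    rw [zero_smul] at hd
    exact hw hd
  · intro ψ m f hf hv0
    refine Fintype.prod_dvd_of_isRelPrime (fun q q' hqq => isRelPrime_lineForm (hu q) (hne hqq))
      fun q => lineForm_dvd (hu q) hf.isHomogeneous ?_
    rw [hf.eval_mulVec, hv0, mul_zero]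

variable {v w : Fin 2 → K} {k l m : ℕ} {χ ψ : Γ →* Kˣ} {Φ Ψ f g : MvPolynomial (Fin 2) K}

theorem IsOrbitForm.eval_self (h : IsOrbitForm v k χ Φ) : eval v Φ = 0 := by
  obtain ⟨G, rfl, -⟩ := h.exists_eq_mul
  rw [map_mul, lineForm_self, zero_mul]

/-- Write `Φ = lineForm v * G` with `G (v) ≠ 0`. Pulling back by `γ` multiplies the linear form by
`ε⁻¹` and the value `G (v)` by `ε ^ (k - 1)`, so `χ γ = ε ^ (k - 2)`; the factor `ε ^ 2` avoids the
subtraction. -/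
theorem IsOrbitForm.character_mul (h : IsOrbitForm v k χ Φ) {γ : Γ} {ε : Kˣ}
    (hv : γ.1.1 *ᵥ v = (ε : K) • v) : χ γ * ε ^ 2 = ε ^ k := by
  obtain ⟨G, hG, hG0⟩ := h.exists_eq_mul
  have h1 := h.semi.pullback_eq γ
  have h0 : lineForm v * G ≠ 0 := hG ▸ h.ne_zero
  obtain ⟨hk, hGm⟩ := isHomogeneous_of_mul (lineForm_isHomogeneous v) (hG ▸ h.semi.isHomogeneous) h0
  have h2 : γ.1⁻¹.1 *ᵥ v = ((ε⁻¹ : Kˣ) : K) • v := by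
    have h3 : γ.1⁻¹.1 *ᵥ (γ.1.1 *ᵥ v) = v := by rw [← mul_mulVec, inv_mul_cancel, one_mulVec']
    rw [hv, mulVec_smul] at h3
    nth_rewrite 2 [← h3]
    rw [smul_smul, Units.inv_mul, one_smul]
  rw [hG, map_mul, pullback_lineForm, h2, lineForm_smul] at h1
  have h4 : C ((ε⁻¹ : Kˣ) : K) * pullback γ.1 G = C (χ γ : K) * G := by
    refine mul_left_cancel₀ (left_ne_zero_of_mul h0) ?_
    linear_combination h1
  have h5 := congrArg (eval v) h4
  rw [map_mul, map_mul, eval_C, eval_C, eval_pullback, hv, eval_smul_of_isHomogeneous hGm,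
    ← mul_assoc] at h5
  have h6 : ε⁻¹ * ε ^ (k - 1) = χ γ := Units.ext (by simpa using mul_right_cancel₀ hG0 h5)
  rw [← h6, mul_assoc, ← pow_add, inv_mul_eq_iff_eq_mul, ← pow_succ']
  congr 1
  omega

theorem IsOrbitForm.degree_le (h : IsOrbitForm v k χ Φ) (hf : IsSemiinvariant ψ m f) (hf0 : f ≠ 0)
    (hv : eval v f = 0) : k ≤ m := by
  obtain ⟨u, -, hle, -⟩ := h.semi.exists_mul hf hf0 (h.dvd hf hv)
  exact hle

theorem IsOrbitForm.eval_comm (hΦ : IsOrbitForm v k χ Φ) (hΨ : IsOrbitForm w l ψ Ψ)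
    (h : eval w Φ = 0) : eval v Ψ = 0 := by
  obtain ⟨γ, c, hc, rfl⟩ := hΦ.exists_of_eval_eq_zero w hΨ.vector_ne_zero h
  have h1 := hΨ.eval_self
  rw [eval_smul_of_isHomogeneous hΨ.semi.isHomogeneous, hΨ.semi.eval_mulVec] at h1
  simpa [hc] using h1

/-- If `Φ` vanished at `w`, the two orbits would coincide, each form would divide the other, and
degrees and characters would agree. -/
theorem IsOrbitForm.eval_ne_zero (hΦ : IsOrbitForm v k χ Φ) (hΨ : IsOrbitForm w l ψ Ψ)
    (h : k ≠ l ∨ χ ≠ ψ) : eval w Φ ≠ 0 := by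
  intro h0
  have h1 := hΦ.degree_le hΨ.semi hΨ.ne_zero (hΦ.eval_comm hΨ h0)
  have h2 := hΨ.degree_le hΦ.semi hΦ.ne_zero h0
  obtain rfl : k = l := le_antisymm h1 h2
  obtain ⟨u, hu, -, hs⟩ := hΨ.semi.exists_mul hΦ.semi hΦ.ne_zero (hΨ.dvd hΦ.semi h0)
  rw [Nat.sub_self] at hs
  have hu0 : u ≠ 0 := by
    rintro rfl
    exact hΦ.ne_zero (by rw [hu, mul_zero])
  have h3 := hs.character_eq_one hu0
  have h4 : χ = ψ := by
    ext γ
    have h5 := DFunLike.congr_fun h3 γ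
    rw [MonoidHom.div_apply, MonoidHom.one_apply, div_eq_one] at h5
    rw [h5]
  simp [h4] at h

/-- A semi-invariant vanishing at `v` vanishes to the second order if its character does not have
the value imposed by a zero of the first order. -/
theorem IsOrbitForm.sq_dvd (h : IsOrbitForm v k χ Φ) (hf : IsSemiinvariant ψ m f)
    (hf0 : eval v f = 0) {γ : Γ} {ε : Kˣ} (hv : γ.1.1 *ᵥ v = (ε : K) • v)
    (hne : ψ γ * ε ^ 2 ≠ ε ^ m) : Φ ^ 2 ∣ f := by
  rcases eq_or_ne f 0 with rfl | hfne
  · exact dvd_zero _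
  obtain ⟨u, rfl, hle, hu⟩ := h.semi.exists_mul hf hfne (h.dvd hf hf0)
  rw [pow_two]
  refine mul_dvd_mul_left _ (h.dvd hu ?_)
  -- If the quotient `f / Φ` did not vanish at `v`, its degree and character would match there, and
  -- with `character_mul` this contradicts `hne`.
  by_contra h0
  apply hne
  have h1 := hu.character_eq hv h0
  rw [MonoidHom.div_apply, div_eq_iff_eq_mul] at h1
  rw [h1, mul_assoc, h.character_mul hv, ← pow_add]
  congr 1
  omega

/-- At `v` the differential of `Φ` is `G (v)` times that of the linear form, and the bracket of that
form with `g` at `v` is minus the Euler derivative, `-m g (v)`. -/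
theorem IsOrbitForm.planeBracket_ne_zero (h : IsOrbitForm v k χ Φ) (hg : g.IsHomogeneous m)
    (hm : (m : K) ≠ 0) (hg0 : eval v g ≠ 0) : eval v (planeBracket Φ g) ≠ 0 := by
  obtain ⟨G, hG, hG0⟩ := h.exists_eq_mul
  have h1 := congrArg (eval v) hg.sum_X_mul_pderiv
  rw [Fin.sum_univ_two, map_add, map_mul, map_mul, eval_X, eval_X, map_nsmul, nsmul_eq_mul] at h1
  have h2 : eval v (planeBracket Φ g) = -(eval v G * (m * eval v g)) := by
    rw [← h1, hG, planeBracket]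
    simp only [lineForm, pderiv_mul, map_add, map_sub, map_mul, pderiv_X, eval_C, eval_X]
    simp
    ring
  rw [h2]
  exact neg_ne_zero.2 (mul_ne_zero hG0 (mul_ne_zero hm hg0))

end OrbitForms

/-! ### Involutions and centralizers in `SL(2, K)`. -/

section Center

open Matrix

variable {K : Type*} [Field K]

theorem mul_diagonalSL_neg_one (g : SpecialLinearGroup (Fin 2) K) :
    g * diagonalSL (-1) = diagonalSL (-1) * g := by
  apply sl_ext <;> simp only [val_mul_apply] <;> simp [diagonalSL_val]

theorem diagonalSL_neg_one_ne_one (h2 : (2 : K) ≠ 0) : diagonalSL (-1 : Kˣ) ≠ 1 := by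
  intro h
  rw [← map_one diagonalSL] at h
  have h1 := congrArg Units.val (diagonalSL_injective h)
  apply h2
  rw [Units.val_neg, Units.val_one] at h1
  linear_combination -h1

theorem eq_of_conj_eq {k g : SpecialLinearGroup (Fin 2) K} {ζ : Kˣ} (hζ : ζ ^ 2 = 1)
    (hk : k⁻¹ * g * k = diagonalSL ζ) : g = 1 ∨ g = diagonalSL (-1) := by
  have h1 : g = k * diagonalSL ζ * k⁻¹ := by
    rw [← hk]
    group
  have h2 : ζ = 1 ∨ ζ = -1 := by
    have h3 : (ζ : K) * ζ = 1 := by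
      rw [← Units.val_mul, ← pow_two, hζ, Units.val_one]
    rcases mul_self_eq_one_iff.1 h3 with h | h
    · exact Or.inl (Units.ext h)
    · exact Or.inr (Units.ext (by simpa using h))
  rcases h2 with rfl | rfl
  · left
    rw [h1, map_one, mul_one, mul_inv_cancel]
  · right
    rw [h1, mul_diagonalSL_neg_one, mul_inv_cancel_right]

variable [IsAlgClosed K]

theorem eq_one_or_of_sq_eq_one (h2 : (2 : K) ≠ 0) {g : SpecialLinearGroup (Fin 2) K}
    (hg : g ^ 2 = 1) : g = 1 ∨ g = diagonalSL (-1) := by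
  obtain ⟨k, ζ, hk⟩ := exists_conj_diagonal (N := 2) (by exact_mod_cast h2) hg
  refine eq_of_conj_eq ?_ hk
  apply diagonalSL_injective
  have h1 : diagonalSL ζ = MulAut.conj k⁻¹ g := by simpa using hk.symm
  rw [map_pow, h1, ← map_pow, hg, map_one, map_one]

theorem commute_of_sq_eq_one (h2 : (2 : K) ≠ 0) {g h : SpecialLinearGroup (Fin 2) K}
    (hg : g ^ 2 = 1) : h * g = g * h := by
  rcases eq_one_or_of_sq_eq_one h2 hg with rfl | rfl
  · rw [one_mul, mul_one]
  · exact mul_diagonalSL_neg_one h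

/-- Diagonalize `c`. If its eigenvalues differ, its centralizer consists of diagonal matrices and is
commutative, contrary to `hgh`. -/
theorem eq_one_or_of_commute {N : ℕ} (hN : (N : K) ≠ 0) {c g h : SpecialLinearGroup (Fin 2) K}
    (hc : c ^ N = 1) (hg : g * c = c * g) (hh : h * c = c * h) (hgh : g * h ≠ h * g) :
    c = 1 ∨ c = diagonalSL (-1) := by
  obtain ⟨k, ζ, hk⟩ := exists_conj_diagonal hN hc
  by_cases hζ : ζ ^ 2 = 1
  · exact eq_of_conj_eq hζ hk
  exfalso
  apply hgh
  have hd : (ζ : K) - ((ζ⁻¹ : Kˣ) : K) ≠ 0 := by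
    intro h0
    apply hζ
    have h1 : ζ = ζ⁻¹ := Units.ext (sub_eq_zero.1 h0)
    rw [pow_two]
    nth_rewrite 2 [h1]
    exact mul_inv_cancel ζ
  have key : ∀ g : SpecialLinearGroup (Fin 2) K, g * c = c * g →
      (k⁻¹ * g * k).1 0 1 = 0 ∧ (k⁻¹ * g * k).1 1 0 = 0 := by
    intro g hg
    have h1 : k⁻¹ * g * k * diagonalSL ζ = diagonalSL ζ * (k⁻¹ * g * k) := by
      rw [← hk]
      calc k⁻¹ * g * k * (k⁻¹ * c * k) = k⁻¹ * (g * c) * k := by group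
        _ = _ := by rw [hg]; group
    generalize k⁻¹ * g * k = u at h1
    have e0 : u.1 0 1 * ((ζ⁻¹ : Kˣ) : K) = ζ * u.1 0 1 := by
      have := congrFun (congrFun (congrArg Subtype.val h1) 0) 1
      rw [val_mul_apply, val_mul_apply] at this
      simpa [diagonalSL_val] using this
    have e1 : u.1 1 0 * ζ = ((ζ⁻¹ : Kˣ) : K) * u.1 1 0 := by
      have := congrFun (congrFun (congrArg Subtype.val h1) 1) 0
      rw [val_mul_apply, val_mul_apply] at this
      simpa [diagonalSL_val] using this
    constructor
    · refine (mul_eq_zero.1 ?_).resolve_left hd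
      linear_combination -e0
    · refine (mul_eq_zero.1 ?_).resolve_left hd
      linear_combination e1
  obtain ⟨g1, g2⟩ := key g hg
  obtain ⟨h1, h2⟩ := key h hh
  have h3 : (k⁻¹ * g * k) * (k⁻¹ * h * k) = (k⁻¹ * h * k) * (k⁻¹ * g * k) := by
    generalize k⁻¹ * g * k = u at g1 g2 ⊢
    generalize k⁻¹ * h * k = w at h1 h2 ⊢
    apply sl_ext <;> simp only [val_mul_apply] <;> simp [g1, g2, h1, h2, mul_comm]
  calc g * h = k * ((k⁻¹ * g * k) * (k⁻¹ * h * k)) * k⁻¹ := by group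
    _ = h * g := by rw [h3]; group

end Center

/-! ### Binary polyhedral groups: orders, characters and line stabilizers. -/

section BinaryTriples

open Matrix

variable {K : Type*} [Field K] {Γ : Subgroup (SpecialLinearGroup (Fin 2) K)} {n : ℕ} {s t : Γ}

/-- `Γ` is nonabelian and generated by `s` and `t` with `(s t) ^ 2 = s ^ 3 = t ^ n = -1`. -/
structure IsBinaryPair (n : ℕ) (s t : Γ) : Prop where
  closure_eq : Subgroup.closure {s, t} = ⊤
  sq_eq : (s * t) ^ 2 = s ^ 3
  pow_eq : t ^ n = s ^ 3
  cube_eq : (s ^ 3).1 = diagonalSL (-1)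
  ne : s * t ≠ t * s

theorem exists_isBinaryPair [IsAlgClosed K] (h2 : (2 : K) ≠ 0) (hΓ : (Nat.card Γ : K) ≠ 0)
    {N : ℕ} (hn : 3 ≤ n) (hn' : n ≤ 5) (hN : 3 < N) (h : IsBinaryPolyhedral Γ 2 3 n N) :
    ∃ s t : Γ, IsBinaryPair n s t := by
  obtain ⟨hcard, r, s, t, hcl, hr, hs, ht⟩ := h
  have hrst : r = s * t := by
    rw [pow_two, mul_assoc] at hr
    exact mul_left_cancel hr
  have hsq : (s * t) ^ 2 = s ^ 3 := by rw [← hrst, hr, hs]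
  have hpow : t ^ n = s ^ 3 := by rw [ht, hs]
  have hcl' : Subgroup.closure {s, t} = ⊤ := by
    rw [eq_top_iff, ← hcl, Subgroup.closure_le]
    have h1 : s ∈ Subgroup.closure {s, t} := Subgroup.subset_closure (by simp)
    have h2 : t ∈ Subgroup.closure {s, t} := Subgroup.subset_closure (by simp)
    rintro x (rfl | rfl | rfl)
    · rw [SetLike.mem_coe, hrst]
      exact mul_mem h1 h2
    · exact h1
    · exact h2
  -- If `s` and `t` commute, `(s t) ^ 2 = s ^ 3` gives `s = t ^ 2`. Then `Γ` is generated by `t`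
  -- with `t ^ (6 - n) = 1`, too small for its order `N`.
  have hne : s * t ≠ t * s := by
    intro hcomm
    have h1 : s = t ^ 2 := by
      have h3 : s ^ 2 * t ^ 2 = s ^ 2 * s := by
        rw [← pow_succ, ← hsq]
        exact ((show Commute s t from hcomm).mul_pow 2).symm
      exact (mul_left_cancel h3).symm
    have h3 : Subgroup.closure {s, t} ≤ Subgroup.zpowers t := by
      rw [Subgroup.closure_le]
      rintro x (rfl | rfl)
      · rw [SetLike.mem_coe, h1]
        exact Subgroup.npow_mem_zpowers t 2
      · exact Subgroup.mem_zpowers _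
    rw [hcl', top_le_iff] at h3
    have h4 : orderOf t = N := by rw [← Nat.card_zpowers, h3, ← hcard, Subgroup.card_top]
    have h5 : t ^ (6 - n) = 1 := by
      have h6 : t ^ (6 - n) * t ^ n = t ^ n := by
        rw [← pow_add, Nat.sub_add_cancel (by omega), hpow, h1, ← pow_mul]
      exact mul_eq_right.1 h6
    have := Nat.le_of_dvd (by omega) (orderOf_dvd_of_pow_eq_one h5)
    omega
  refine ⟨s, t, hcl', hsq, hpow, ?_, hne⟩
  have hne' : s.1 * t.1 ≠ t.1 * s.1 := fun h => hne (Subtype.ext h)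
  refine (eq_one_or_of_commute hΓ (pow_card_eq_one_val (s ^ 3)) (g := s.1) (h := t.1) ?_ ?_
    hne').resolve_left ?_
  · rw [← Subgroup.coe_mul, ← Subgroup.coe_mul, ← pow_succ', ← pow_succ]
  · rw [← Subgroup.coe_mul, ← Subgroup.coe_mul, ← hpow, ← pow_succ', ← pow_succ]
  -- If `s ^ 3 = 1`, then `s t` squares to 1 and is therefore central, so `s` and `t` commute.
  · intro h1
    have h3 : (s.1 * t.1) ^ 2 = 1 := by
      rw [← Subgroup.coe_mul, ← Subgroup.coe_pow, hsq, h1]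
    have h4 := commute_of_sq_eq_one h2 (h := s.1) h3
    rw [mul_assoc] at h4
    exact hne' (mul_left_cancel h4)

theorem IsBinaryPair.character_left (h : IsBinaryPair n s t) {M : Type*} [CommGroup M]
    (χ : Γ →* M) : χ s = χ t ^ 2 := by
  have h1 := congrArg χ h.sq_eq
  rw [map_pow, map_pow, map_mul, mul_pow, pow_succ (χ s) 2] at h1
  exact (mul_left_cancel h1).symm

theorem IsBinaryPair.character_mul (h : IsBinaryPair n s t) {M : Type*} [CommGroup M]
    (χ : Γ →* M) : χ (s * t) = χ t ^ 3 := by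
  rw [map_mul, h.character_left, ← pow_succ]

/-- On abelian quotients `s = t ^ 2`, so `t ^ n = s ^ 3` becomes `t ^ n = t ^ 6`. Characters are
thus determined by their value at `t` and have order dividing `6 - n`. -/
theorem IsBinaryPair.character_pow (h : IsBinaryPair n s t) (hn : n ≤ 6) {M : Type*} [CommGroup M]
    (χ : Γ →* M) : χ t ^ (6 - n) = 1 := by
  have h1 := congrArg χ h.pow_eq
  rw [map_pow, map_pow, h.character_left, ← pow_mul] at h1
  have h2 : χ t ^ (6 - n) * χ t ^ n = χ t ^ n := by
    rw [← pow_add, Nat.sub_add_cancel hn, h1]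
  exact mul_eq_right.1 h2

theorem IsBinaryPair.character_ext (h : IsBinaryPair n s t) {M : Type*} [CommGroup M]
    {χ ψ : Γ →* M} (ht : χ t = ψ t) : χ = ψ := by
  refine MonoidHom.eq_of_eqOn_dense h.closure_eq ?_
  rintro x (rfl | rfl)
  · rw [h.character_left, h.character_left, ht]
  · exact ht

theorem IsBinaryPair.pow_eq_one (h : IsBinaryPair n s t) (hn : n ≤ 6) (χ : Γ →* Kˣ) :
    χ ^ (6 - n) = 1 :=
  h.character_ext (by rw [MonoidHom.pow_apply, h.character_pow hn, MonoidHom.one_apply])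

theorem orderOf_eq_two_mul_prime {G : Type*} [Group G] {q : ℕ} (hq : q.Prime) {x : G}
    (h1 : x ^ q ≠ 1) (h2 : x ^ 2 ≠ 1) (h : x ^ (2 * q) = 1) : orderOf x = 2 * q := by
  refine orderOf_eq_of_pow_and_pow_div_prime (by have := hq.pos; omega) h fun p hp hdvd => ?_
  rcases (Nat.Prime.dvd_mul hp).1 hdvd with h3 | h3
  · obtain rfl := (Nat.prime_dvd_prime_iff_eq hp Nat.prime_two).1 h3
    rwa [Nat.mul_div_cancel_left _ two_pos]
  · obtain rfl := (Nat.prime_dvd_prime_iff_eq hp hq).1 h3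
    rwa [Nat.mul_div_cancel _ hq.pos]

theorem IsBinaryPair.cube_ne_one (h : IsBinaryPair n s t) (h2 : (2 : K) ≠ 0) : s ^ 3 ≠ 1 := by
  intro h1
  have h3 := h.cube_eq
  rw [h1] at h3
  exact diagonalSL_neg_one_ne_one h2 h3.symm

theorem IsBinaryPair.cube_sq (h : IsBinaryPair n s t) : (s ^ 3) ^ 2 = 1 := by
  apply Subtype.ext
  rw [Subgroup.coe_pow, h.cube_eq, ← map_pow, neg_one_sq, map_one, Subgroup.coe_one]

theorem IsBinaryPair.left_sq_ne_one [IsAlgClosed K] (h : IsBinaryPair n s t) (h2 : (2 : K) ≠ 0) :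
    s ^ 2 ≠ 1 := fun h1 => h.ne (Subtype.ext
  (commute_of_sq_eq_one h2 (g := s.1) (h := t.1) (congrArg Subtype.val h1)).symm)

theorem IsBinaryPair.right_sq_ne_one [IsAlgClosed K] (h : IsBinaryPair n s t) (h2 : (2 : K) ≠ 0) :
    t ^ 2 ≠ 1 := fun h1 => h.ne (Subtype.ext
  (commute_of_sq_eq_one h2 (g := t.1) (h := s.1) (congrArg Subtype.val h1)))

theorem IsBinaryPair.orderOf_left [IsAlgClosed K] (h : IsBinaryPair n s t) (h2 : (2 : K) ≠ 0) :
    orderOf s = 6 :=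
  orderOf_eq_two_mul_prime Nat.prime_three (h.cube_ne_one h2) (h.left_sq_ne_one h2)
    (by rw [mul_comm, pow_mul, h.cube_sq])

theorem IsBinaryPair.orderOf_right [IsAlgClosed K] (h : IsBinaryPair n s t) (h2 : (2 : K) ≠ 0)
    (hn : n.Prime) : orderOf t = 2 * n :=
  orderOf_eq_two_mul_prime hn (by rw [h.pow_eq]; exact h.cube_ne_one h2) (h.right_sq_ne_one h2)
    (by rw [mul_comm, pow_mul, h.pow_eq, h.cube_sq])

theorem IsBinaryPair.orderOf_right_four (h : IsBinaryPair 4 s t) (h2 : (2 : K) ≠ 0) :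
    orderOf t = 8 :=
  orderOf_eq_prime_pow (p := 2) (n := 2) (by
    rw [show 2 ^ 2 = 4 by norm_num, h.pow_eq]
    exact h.cube_ne_one h2) (by
    rw [show 2 ^ (2 + 1) = 4 * 2 by norm_num, pow_mul, h.pow_eq, h.cube_sq])

theorem IsBinaryPair.orderOf_mul (h : IsBinaryPair n s t) (h2 : (2 : K) ≠ 0) :
    orderOf (s * t) = 4 :=
  orderOf_eq_prime_pow (p := 2) (n := 1) (by
    rw [pow_one, h.sq_eq]
    exact h.cube_ne_one h2) (by
    rw [show 2 ^ (1 + 1) = 2 * 2 by norm_num, pow_mul, h.sq_eq, h.cube_sq])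

theorem IsBinaryPair.cube_mem_lineStabilizer (h : IsBinaryPair n s t) (v : Fin 2 → K) :
    s ^ 3 ∈ lineStabilizer Γ v := by
  refine ⟨-1, ?_⟩
  rw [h.cube_eq]
  funext i
  rw [mulVec_apply]
  fin_cases i <;> simp [diagonalSL_val]

/-- Removes the solution `k = 2` of the congruence for orbit lengths. A subgroup of index 2 contains
all squares, and the stabilizer contains `s ^ 3 = t ^ n`, hence `s`. For odd `n` it contains `t` too
and is everything. For `n = 4` it is abelian, so `s` commutes with `t ^ 2`; cubing `t s t⁻¹ = s ^ 2
t⁻²` gives `t ^ 4 = t ^ 2`, which is excluded. -/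
theorem IsBinaryPair.index_ne_two [IsAlgClosed K] (h : IsBinaryPair n s t) (h2 : (2 : K) ≠ 0)
    (hΓ : (Nat.card Γ : K) ≠ 0) (hn : n = 3 ∨ n = 4 ∨ n = 5) {v : Fin 2 → K} (hv : v ≠ 0) :
    (lineStabilizer Γ v).index ≠ 2 := by
  intro hi
  have h3 := h.cube_mem_lineStabilizer v
  have hs : s ∈ lineStabilizer Γ v := by
    have h4 := mul_mem h3 (inv_mem (Subgroup.sq_mem_of_index_two hi s))
    rwa [show s ^ 3 * (s ^ 2)⁻¹ = s by group] at h4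
  have ht2 := Subgroup.sq_mem_of_index_two hi t
  have htop : t ∉ lineStabilizer Γ v := by
    intro ht
    have h4 : lineStabilizer Γ v = ⊤ := by
      rw [eq_top_iff, ← h.closure_eq, Subgroup.closure_le]
      rintro x (rfl | rfl)
      · exact hs
      · exact ht
    rw [h4, Subgroup.index_top] at hi
    omega
  rw [← h.pow_eq] at h3
  rcases hn with rfl | rfl | rfl
  · apply htop
    have h4 := mul_mem h3 (inv_mem ht2)
    rwa [show t ^ 3 * (t ^ 2)⁻¹ = t by group] at h4
  · obtain ⟨ε, hε⟩ := exists_lineCharacter (Γ := Γ) hv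
    have hcomm : s * t ^ 2 = t ^ 2 * s := by
      have h4 : (⟨s, hs⟩ * ⟨t ^ 2, ht2⟩ : lineStabilizer Γ v) = ⟨t ^ 2, ht2⟩ * ⟨s, hs⟩ :=
        injective_of_mulVec_eq_smul hΓ hv hε (by rw [map_mul, map_mul, mul_comm])
      exact congrArg Subtype.val h4
    have h5 : t * s * t⁻¹ = s ^ 2 * (t ^ 2)⁻¹ := by
      have h6 : s * (t * s * t) = s * s ^ 2 := by
        rw [← pow_succ', ← h.sq_eq, pow_two]
        group
      rw [← mul_left_cancel h6]
      group
    have h7 : t ^ 4 = t ^ 2 := by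
      have h8 : (s ^ 2 * (t ^ 2)⁻¹) ^ 3 = (s ^ 3) ^ 2 * ((t ^ 2)⁻¹) ^ 3 := by
        have h9 : Commute (s ^ 2) (t ^ 2)⁻¹ :=
          ((show Commute s (t ^ 2) from hcomm).pow_left 2).inv_right
        rw [h9.mul_pow, ← pow_mul, ← pow_mul]
      rw [← h5, conj_pow, ← h.pow_eq] at h8
      calc t ^ 4 = t * t ^ 4 * t⁻¹ := by group
        _ = t ^ 2 := by rw [h8]; group
    apply h.right_sq_ne_one h2
    rw [show t ^ 4 = t ^ 2 * t ^ 2 by group] at h7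
    exact mul_eq_right.1 h7
  · apply htop
    have h4 := mul_mem h3 (inv_mem (mul_mem ht2 ht2))
    rwa [show t ^ 5 * (t ^ 2 * t ^ 2)⁻¹ = t by group] at h4

theorem exists_eigenvector_units [IsAlgClosed K] (γ : Γ) :
    ∃ (v : Fin 2 → K) (ε : Kˣ), v ≠ 0 ∧ γ.1.1 *ᵥ v = (ε : K) • v := by
  obtain ⟨v, ε, hv, hg⟩ := exists_eigenvector γ.1
  have hε : ε ≠ 0 := by
    rintro rfl
    rw [zero_smul] at hg
    exact mulVec_ne_zero _ hv hg
  exact ⟨v, Units.mk0 ε hε, hv, hg⟩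

/-- The other eigenvector of an element of finite order. -/
theorem exists_eigenvectors [IsAlgClosed K] (hΓ : (Nat.card Γ : K) ≠ 0) (γ : Γ) :
    ∃ (v w : Fin 2 → K) (ε : Kˣ), v ≠ 0 ∧ w ≠ 0 ∧ γ.1.1 *ᵥ v = (ε : K) • v ∧
      γ.1.1 *ᵥ w = ((ε⁻¹ : Kˣ) : K) • w := by
  obtain ⟨k, ζ, hk⟩ := exists_conj_diagonal hΓ (pow_card_eq_one_val γ)
  have h1 : γ.1 * k = k * diagonalSL ζ := by
    rw [← hk]
    group
  refine ⟨k.1 *ᵥ ![1, 0], k.1 *ᵥ ![0, 1], ζ, mulVec_ne_zero _ (by simp), mulVec_ne_zero _ (by simp),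
    ?_, ?_⟩
  · rw [← mul_mulVec, h1, mul_mulVec, ← mulVec_smul]
    congr 1
    funext i
    rw [mulVec_apply]
    fin_cases i <;> simp [diagonalSL_val]
  · rw [← mul_mulVec, h1, mul_mulVec, ← mulVec_smul]
    congr 1
    funext i
    rw [mulVec_apply]
    fin_cases i <;> simp [diagonalSL_val]

/-- The restrictions on the length `k` of the orbit of the line spanned by an eigenvector. -/
theorem exists_isOrbitForm_of_mulVec_eq_smul [IsAlgClosed K] (hΓ : (Nat.card Γ : K) ≠ 0) {e N : ℕ}
    (hN : Nat.card Γ = N) (he : ∀ χ : Γ →* Kˣ, χ ^ e = 1) {γ : Γ} {v : Fin 2 → K} {ε : Kˣ}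
    (hv : v ≠ 0) (h : γ.1.1 *ᵥ v = (ε : K) • v) :
    ∃ k χ Φ, IsOrbitForm (Γ := Γ) v k χ Φ ∧ k = (lineStabilizer Γ v).index ∧ k ∈ N.divisors ∧
      orderOf γ ∣ N / k ∧ k * e ≡ 2 * e [MOD N / k] ∧
      ∃ (q : Γ) (j : ℕ), γ = q ^ j ∧ orderOf q = N / k := by
  have hN0 : N ≠ 0 := by
    rintro rfl
    rw [hN] at hΓ
    exact hΓ Nat.cast_zero
  have : Finite Γ := Nat.finite_of_card_ne_zero (hN ▸ hN0)
  obtain ⟨χ, Φ, hΦ⟩ := exists_isOrbitForm (Γ := Γ) hv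
  obtain ⟨η, hη⟩ := exists_lineCharacter (Γ := Γ) hv
  have hinj := injective_of_mulVec_eq_smul hΓ hv hη
  have hcyc : IsCyclic (lineStabilizer Γ v) :=
    isCyclic_of_injective_ringHom ((Units.coeHom K).comp η) (Units.val_injective.comp hinj)
  obtain ⟨q, hq⟩ := hcyc.exists_generator
  have hmul := (lineStabilizer Γ v).card_mul_index
  rw [hN] at hmul
  have hk0 : 0 < (lineStabilizer Γ v).index := Nat.pos_of_ne_zero fun h0 => hN0 (by
    rw [← hmul, h0, mul_zero])
  have hdiv : N / (lineStabilizer Γ v).index = Nat.card (lineStabilizer Γ v) := by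
    rw [← hmul, Nat.mul_div_cancel _ hk0]
  have hqord : orderOf q = Nat.card (lineStabilizer Γ v) := orderOf_eq_card_of_forall_mem_zpowers hq
  have hγ : γ ∈ lineStabilizer Γ v := ⟨ε, h⟩
  refine ⟨_, χ, Φ, hΦ, rfl, Nat.mem_divisors.2 ⟨⟨_, by rw [mul_comm, hmul]⟩, hN0⟩, ?_, ?_, q.1, ?_⟩
  · rw [hdiv]
    have h1 := orderOf_dvd_natCard (⟨γ, hγ⟩ : lineStabilizer Γ v)
    rwa [← Subgroup.orderOf_coe] at h1
  · rw [hdiv, ← hqord, ← orderOf_injective η hinj]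
    -- For a generator `q` of the cyclic stabilizer with eigenvalue `η`, of order `N / k`, one has
    -- `χ q * η ^ 2 = η ^ k`. The `e`-th power eliminates the character.
    have h1 := congrArg (· ^ e) (hΦ.character_mul (hη q))
    simp only [mul_pow] at h1
    rw [← MonoidHom.pow_apply, he, MonoidHom.one_apply, one_mul, ← pow_mul, ← pow_mul] at h1
    exact (pow_eq_pow_iff_modEq.1 h1).symm
  · obtain ⟨j, hj⟩ := (Submonoid.mem_powers_iff _ _).1 ((mem_powers_iff_mem_zpowers (y := (⟨γ, hγ⟩ : lineStabilizer Γ v))).2 (hq ⟨γ, hγ⟩))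
    refine ⟨j, ?_, ?_⟩
    · exact (congrArg Subtype.val hj).symm
    · rw [Subgroup.orderOf_coe, hqord, hdiv]

end BinaryTriples

/-! ### Type `E₈`: generation by divisibility, and the binary icosahedral group. -/

section Polyhedral

open MvPolynomial Matrix

variable {K : Type*} [Field K] {Γ : Subgroup (SpecialLinearGroup (Fin 2) K)} {n : ℕ} {s t : Γ}

theorem one_pow_character (j : ℕ) : (1 : Γ →* Kˣ) ^ j = 1 := by
  ext γ
  simp

theorem one_div_one_character : (1 : Γ →* Kˣ) / 1 = 1 := by
  ext γ
  simp

/-- Invariants are generated by `x, y, z` if every invariant is divisible by one of them, up to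
an invariant generated by them. -/
theorem mem_kleinSpan_of_step {a b h : ℕ} {P x y z : MvPolynomial (Fin 2) K} (ha : 0 < a)
    (hb : 0 < b) (hh : 0 < h) (hP : P ∈ planeGrading K a b (2 * h)) (hz : z ^ 2 = aeval ![x, y] P)
    (hxs : IsSemiinvariant (1 : Γ →* Kˣ) a x) (hys : IsSemiinvariant (1 : Γ →* Kˣ) b y)
    (hzs : IsSemiinvariant (1 : Γ →* Kˣ) h z)
    (step : ∀ m f, IsSemiinvariant (1 : Γ →* Kˣ) m f → x ∣ f ∨ y ∣ f ∨ z ∣ f ∨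
      ∃ g ∈ kleinSpan a b h x y z m, IsSemiinvariant (1 : Γ →* Kˣ) m g ∧ x ∣ f - g) :
    ∀ {m f}, f ∈ invariants Γ → f.IsHomogeneous m → f ∈ kleinSpan a b h x y z m := by
  suffices key : ∀ m f, IsSemiinvariant (1 : Γ →* Kˣ) m f → f ∈ kleinSpan a b h x y z m from
    fun {_ _} hf hm => key _ _ (isSemiinvariant_one hf hm)
  intro m
  induction m using Nat.strong_induction_on with
  | _ m ih =>
    have key : ∀ {d f u}, 0 < d → IsSemiinvariant (1 : Γ →* Kˣ) d u → u ∈ kleinSpan a b h x y z d →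
        IsSemiinvariant (1 : Γ →* Kˣ) m f → u ∣ f → f ∈ kleinSpan a b h x y z m := by
      intro d f u hd hu hmem hf hdvd
      rcases eq_or_ne f 0 with rfl | hf0
      · exact zero_mem _
      obtain ⟨w, rfl, hle, hw⟩ := hu.exists_mul hf hf0 hdvd
      rw [one_div_one_character] at hw
      have h1 := mul_mem_kleinSpan hP hz hmem (ih (m - d) (by omega) w hw)
      rwa [Nat.add_sub_cancel' hle] at h1
    intro f hf
    rcases step m f hf with h1 | h1 | h1 | ⟨g, hg, hgs, h1⟩
    · exact key ha hxs left_mem_kleinSpan hf h1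
    · exact key hb hys right_mem_kleinSpan hf h1
    · exact key hh hzs third_mem_kleinSpan hf h1
    · have h2 := key ha hxs left_mem_kleinSpan (hf.sub hgs) h1
      have h3 := add_mem h2 hg
      rwa [sub_add_cancel] at h3

/-- An invariant is congruent to a multiple of `g ^ j` modulo the form vanishing at `v`. -/
theorem exists_dvd_sub {v : Fin 2 → K} {k l j m : ℕ} {χ : Γ →* Kˣ} {Φ f g : MvPolynomial (Fin 2) K}
    (hΦ : IsOrbitForm v k χ Φ) (hf : IsSemiinvariant (1 : Γ →* Kˣ) m f)
    (hg : IsSemiinvariant (1 : Γ →* Kˣ) l g) (hg0 : eval v g ≠ 0) (hm : m = l * j) :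
    ∃ c : K, IsSemiinvariant (1 : Γ →* Kˣ) m (c • g ^ j) ∧ Φ ∣ f - c • g ^ j := by
  have h1 : IsSemiinvariant (1 : Γ →* Kˣ) m (C (eval v f / eval v g ^ j) * g ^ j) := by
    have h2 := (hg.pow j).C_mul (eval v f / eval v g ^ j)
    rwa [one_pow_character, ← hm] at h2
  refine ⟨eval v f / eval v g ^ j, ?_, ?_⟩
  · rwa [smul_eq_C_mul]
  · rw [smul_eq_C_mul]
    refine hΦ.dvd (hf.sub h1) ?_
    rw [map_sub, map_mul, eval_C, map_pow, div_mul_cancel₀ _ (pow_ne_zero _ hg0), sub_self]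

theorem isRelPrime_pderiv {α β : K} {i j : ℕ} (hi : ((i + 1 : ℕ) : K) * α ≠ 0)
    (hj : ((j + 1 : ℕ) : K) * β ≠ 0) :
    IsRelPrime
      (pderiv 0 (C α * (X 0 ^ (i + 1) * X 1 ^ 0) + C β * (X 0 ^ 0 * X 1 ^ (j + 1)) :
        MvPolynomial (Fin 2) K))
      (pderiv 1 (C α * (X 0 ^ (i + 1) * X 1 ^ 0) + C β * (X 0 ^ 0 * X 1 ^ (j + 1)))) := by
  have e0 : pderiv 0 (C α * (X 0 ^ (i + 1) * X 1 ^ 0) + C β * (X 0 ^ 0 * X 1 ^ (j + 1)) :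
      MvPolynomial (Fin 2) K) = C ((i + 1 : ℕ) * α) * X 0 ^ i := by
    rw [MvPolynomial.C_mul, map_natCast]
    simp [pderiv_X]
    ring
  have e1 : pderiv 1 (C α * (X 0 ^ (i + 1) * X 1 ^ 0) + C β * (X 0 ^ 0 * X 1 ^ (j + 1)) :
      MvPolynomial (Fin 2) K) = C ((j + 1 : ℕ) * β) * X 1 ^ j := by
    rw [MvPolynomial.C_mul, map_natCast]
    simp [pderiv_X]
    ring
  rw [e0, e1]
  exact isRelPrime_X_pow_mul hi hj

theorem natCast_ne_zero_of_dvd {N d : ℕ} (hN : (N : K) ≠ 0) (hd : d ∣ N) : (d : K) ≠ 0 := by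
  obtain ⟨e, rfl⟩ := hd
  intro h0
  apply hN
  rw [Nat.cast_mul, h0, zero_mul]

variable [IsAlgClosed K]

theorem IsBinaryPair.exists_isOrbitForm (hst : IsBinaryPair n s t) (hn : n = 3 ∨ n = 4 ∨ n = 5)
    (h2 : (2 : K) ≠ 0) {N : ℕ} (hcard : Nat.card Γ = N) (hN : (N : K) ≠ 0) {γ : Γ} {v : Fin 2 → K} {ε : Kˣ}
    (hv : v ≠ 0) (h : γ.1.1 *ᵥ v = (ε : K) • v) :
    ∃ k χ Φ, IsOrbitForm (Γ := Γ) v k χ Φ ∧ k ≠ 2 ∧ k ∈ N.divisors ∧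
      orderOf γ ∣ N / k ∧ k * (6 - n) ≡ 2 * (6 - n) [MOD N / k] ∧
      ∃ (q : Γ) (j : ℕ), γ = q ^ j ∧ orderOf q = N / k := by
  have hΓ : (Nat.card Γ : K) ≠ 0 := by rwa [hcard]
  obtain ⟨k, χ, Φ, h1, h3, h4⟩ :=
    exists_isOrbitForm_of_mulVec_eq_smul hΓ hcard (hst.pow_eq_one (by omega)) hv h
  exact ⟨k, χ, Φ, h1, h3 ▸ hst.index_ne_two h2 hΓ hn hv, h4⟩

/-- Generators of the ring of invariants of a binary icosahedral group. -/
theorem exists_kleinGenerators_icosahedral (hN : ((120 : ℕ) : K) ≠ 0)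
    (hΓ : IsBinaryPolyhedral Γ 2 3 5 120) :
    ∃ P x y z c, KleinGenerators Γ 12 20 30 P x y z c ∧ x ≠ 0 := by
  have hcard := hΓ.1
  have hΓ0 : (Nat.card Γ : K) ≠ 0 := by rwa [hcard]
  have h2 : (2 : K) ≠ 0 := by exact_mod_cast natCast_ne_zero_of_dvd (d := 2) hN (by norm_num)
  obtain ⟨s, t, hst⟩ := exists_isBinaryPair h2 hΓ0 (by norm_num) (by norm_num) (by norm_num) hΓ
  have hall : ∀ χ : Γ →* Kˣ, χ = 1 := fun χ => by
    ext γ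
    simpa using congrArg Units.val (DFunLike.congr_fun (hst.pow_eq_one (by norm_num) χ) γ)
  obtain ⟨u, ε, hu, hut⟩ := exists_eigenvector_units t
  obtain ⟨v, η, hv, hvs⟩ := exists_eigenvector_units s
  obtain ⟨w, ζ, hw, hwr⟩ := exists_eigenvector_units (s * t)
  have hε := orderOf_eq_of_mulVec_eq_smul hΓ0 hu hut
  have hη := orderOf_eq_of_mulVec_eq_smul hΓ0 hv hvs
  have hζ := orderOf_eq_of_mulVec_eq_smul hΓ0 hw hwr
  obtain ⟨k, χ, x, hx, hk1, hk2, hk3, hk4, -⟩ :=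
    hst.exists_isOrbitForm (by norm_num) h2 hcard hN hu hut
  obtain ⟨k', χ', y, hy, hk1', hk2', hk3', hk4', -⟩ :=
    hst.exists_isOrbitForm (by norm_num) h2 hcard hN hv hvs
  obtain ⟨k'', χ'', z, hz, hk1'', hk2'', hk3'', hk4'', -⟩ :=
    hst.exists_isOrbitForm (by norm_num) h2 hcard hN hw hwr
  rw [hst.orderOf_right h2 Nat.prime_five] at hε hk3
  rw [hst.orderOf_left h2] at hη hk3'
  rw [hst.orderOf_mul h2] at hζ hk3''
  -- All characters are trivial here, and the arithmetic of orbit lengths leaves a single value for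
  -- each of the three eigenlines.
  obtain rfl : k = 12 := (by decide +kernel : ∀ k ∈ Nat.divisors 120, k ≠ 2 → 10 ∣ 120 / k →
    k * 1 ≡ 2 * 1 [MOD 120 / k] → k = 12) k hk2 hk1 hk3 hk4
  obtain rfl : k' = 20 := (by decide +kernel : ∀ k ∈ Nat.divisors 120, k ≠ 2 → 6 ∣ 120 / k →
    k * 1 ≡ 2 * 1 [MOD 120 / k] → k = 20) k' hk2' hk1' hk3' hk4'
  obtain rfl : k'' = 30 := (by decide +kernel : ∀ k ∈ Nat.divisors 120, k ≠ 2 → 4 ∣ 120 / k →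
    k * 1 ≡ 2 * 1 [MOD 120 / k] → k = 30) k'' hk2'' hk1'' hk3'' hk4''
  obtain rfl := hall χ
  obtain rfl := hall χ'
  obtain rfl := hall χ''
  have hxv := hx.eval_ne_zero hy (Or.inl (by norm_num))
  have hxw := hx.eval_ne_zero hz (Or.inl (by norm_num))
  have hyu := hy.eval_ne_zero hx (Or.inl (by norm_num))
  have hyw := hy.eval_ne_zero hz (Or.inl (by norm_num))
  have hζ2 : ζ ^ 2 ≠ 1 := fun h0 => by
    have := orderOf_dvd_of_pow_eq_one h0
    rw [hζ] at this
    omega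
  have hζ4 : ζ ^ 4 = 1 := hζ ▸ pow_orderOf_eq_one ζ
  -- A combination of `x ^ 5` and `y ^ 3` vanishes at `w`. A simple zero would require `ζ ^ 2 = ζ ^
  -- 60 = 1`, so `z ^ 2` divides it, and the degrees agree. Evaluation at `u` shows that it is not
  -- zero.
  obtain ⟨α, β, hα, hβ, hrel⟩ : ∃ α β : K, α ≠ 0 ∧ β ≠ 0 ∧ z ^ 2 = C α * x ^ 5 + C β * y ^ 3 := by
    have hF : IsSemiinvariant (1 : Γ →* Kˣ) 60
        (C (eval w y ^ 3) * x ^ 5 - C (eval w x ^ 5) * y ^ 3) := by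
      have h5 := (hx.semi.pow 5).C_mul (eval w y ^ 3)
      have h3 := (hy.semi.pow 3).C_mul (eval w x ^ 5)
      rw [one_pow_character] at h5 h3
      exact h5.sub h3
    have hFw : eval w (C (eval w y ^ 3) * x ^ 5 - C (eval w x ^ 5) * y ^ 3) = 0 := by
      simp only [map_sub, map_mul, eval_C, map_pow]
      ring
    have hdvd := hz.sq_dvd hF hFw hwr (by
      rw [MonoidHom.one_apply, one_mul, show 60 = 4 * 15 by norm_num, pow_mul, hζ4, one_pow]
      exact hζ2)
    have hz2 := hz.semi.pow 2
    obtain ⟨c, hc⟩ := hz2.eq_C_mul hF hdvd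
    have hc0 : c ≠ 0 := by
      rintro rfl
      have h1 := congrArg (eval u) hc
      simp [hx.eval_self, hxw, hyu] at h1
    have hcc : (C c⁻¹ * C c : MvPolynomial (Fin 2) K) = 1 := by
      rw [← MvPolynomial.C_mul, inv_mul_cancel₀ hc0, C_1]
    refine ⟨c⁻¹ * eval w y ^ 3, -(c⁻¹ * eval w x ^ 5),
      mul_ne_zero (inv_ne_zero hc0) (pow_ne_zero _ hyw),
      neg_ne_zero.2 (mul_ne_zero (inv_ne_zero hc0) (pow_ne_zero _ hxw)), ?_⟩
    rw [C_neg, MvPolynomial.C_mul, MvPolynomial.C_mul]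
    linear_combination C c⁻¹ * (-hc) - z ^ 2 * hcc
  obtain ⟨c, hc0, hc⟩ : ∃ c : K, c ≠ 0 ∧ planeBracket x y = C c * z := by
    have hB := hx.semi.planeBracket hy.semi
    have hBu := hx.planeBracket_ne_zero hy.semi.isHomogeneous
      (natCast_ne_zero_of_dvd hN (by norm_num)) hyu
    -- The bracket is an invariant of degree 30, and `ζ ^ 30 = ζ ^ 2 ≠ 1` forces it to vanish at
    -- `w`.
    obtain ⟨c, hc⟩ := hz.semi.eq_C_mul hB (hz.dvd hB (by
      by_contra h0
      have h1 := hB.character_eq hwr h0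
      apply hζ2
      rw [hall (1 * 1), MonoidHom.one_apply, show 12 - 1 + (20 - 1) = 4 * 7 + 2 by norm_num, pow_add,
        pow_mul, hζ4, one_pow, one_mul] at h1
      exact h1.symm))
    refine ⟨c, ?_, hc⟩
    rintro rfl
    rw [hc] at hBu
    simp at hBu
  have hmem : C α * (X 0 ^ 5 * X 1 ^ 0) + C β * (X 0 ^ 0 * X 1 ^ 3) ∈
      planeGrading K 12 20 (2 * (30 : ℕ)) :=
    add_mem (monomial_mem_planeGrading _ (by norm_num)) (monomial_mem_planeGrading _ (by norm_num))
  have hsq : z ^ 2 = aeval ![x, y] (C α * (X 0 ^ 5 * X 1 ^ 0) + C β * (X 0 ^ 0 * X 1 ^ 3)) := by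
    rw [hrel]
    simp
  refine ⟨_, x, y, z, c, ⟨⟨by norm_num, by norm_num, by norm_num, hmem, ?_⟩,
    hx.semi.mem_invariants, hy.semi.mem_invariants, hz.semi.mem_invariants,
    hx.semi.isHomogeneous, hy.semi.isHomogeneous, hz.semi.isHomogeneous, hsq, hc, hc0,
    ⟨u, hx.eval_self, hyu⟩, ?_⟩, hx.ne_zero⟩
  · exact isRelPrime_pderiv (mul_ne_zero (natCast_ne_zero_of_dvd hN (by norm_num)) hα)
      (mul_ne_zero (natCast_ne_zero_of_dvd hN (by norm_num)) hβ)
  · refine mem_kleinSpan_of_step (by norm_num) (by norm_num) (by norm_num) hmem hsq hx.semi hy.semi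
      hz.semi fun m f hf => ?_
    by_cases hfu : eval u f = 0
    · exact Or.inl (hx.dvd hf hfu)
    by_cases hfv : eval v f = 0
    · exact Or.inr (Or.inl (hy.dvd hf hfv))
    by_cases hfw : eval w f = 0
    · exact Or.inr (Or.inr (Or.inl (hz.dvd hf hfw)))
    refine Or.inr (Or.inr (Or.inr ?_))
    -- An invariant vanishing on none of the three orbits has degree divisible by 10, 6 and 4, hence
    -- by 60, so a power of `y` has the same degree.
    have h10 := orderOf_dvd_of_pow_eq_one (hf.character_eq hut hfu).symm
    have h6 := orderOf_dvd_of_pow_eq_one (hf.character_eq hvs hfv).symm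
    have h4 := orderOf_dvd_of_pow_eq_one (hf.character_eq hwr hfw).symm
    rw [hε] at h10
    rw [hη] at h6
    rw [hζ] at h4
    obtain ⟨d, hd, hd'⟩ := exists_dvd_sub (j := 3 * (m / 60)) hx hf hy.semi hyu (by omega)
    refine ⟨_, Submodule.smul_mem _ d ?_, hd, hd'⟩
    have h1 := pow_mem_kleinSpan hmem hsq right_mem_kleinSpan (3 * (m / 60))
    rwa [show 20 * (3 * (m / 60)) = m by omega] at h1

end Polyhedral

/-! ### Types `E₇` and `E₆`: the binary octahedral and tetrahedral groups. -/

section Polyhedral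

open MvPolynomial Matrix

variable {K : Type*} [Field K] {Γ : Subgroup (SpecialLinearGroup (Fin 2) K)}

theorem IsOrbitForm.mul_dvd {v w : Fin 2 → K} {k l m : ℕ} {χ ψ φ : Γ →* Kˣ}
    {Φ Ψ f : MvPolynomial (Fin 2) K} (hΦ : IsOrbitForm v k χ Φ) (hΨ : IsOrbitForm w l ψ Ψ)
    (hne : eval w Φ ≠ 0) (hf : IsSemiinvariant φ m f) (hv : eval v f = 0) (hw : eval w f = 0) :
    Φ * Ψ ∣ f := by
  rcases eq_or_ne f 0 with rfl | hf0
  · exact dvd_zero _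
  obtain ⟨u, rfl, -, hu⟩ := hΦ.semi.exists_mul hf hf0 (hΦ.dvd hf hv)
  rw [map_mul] at hw
  exact mul_dvd_mul_left _ (hΨ.dvd hu ((mul_eq_zero.1 hw).resolve_left hne))

theorem isRelPrime_pderiv_cubic {α β : K} (h3 : (3 : K) ≠ 0) (hα : α ≠ 0) (hβ : β ≠ 0) :
    IsRelPrime
      (pderiv 0 (C α * (X 0 ^ 0 * X 1 ^ 3) + C β * (X 0 ^ 3 * X 1 ^ 1) : MvPolynomial (Fin 2) K))
      (pderiv 1 (C α * (X 0 ^ 0 * X 1 ^ 3) + C β * (X 0 ^ 3 * X 1 ^ 1))) := by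
  have e3 : (C 3 : MvPolynomial (Fin 2) K) = 3 := map_ofNat C 3
  have e0 : pderiv 0 (C α * (X 0 ^ 0 * X 1 ^ 3) + C β * (X 0 ^ 3 * X 1 ^ 1) :
      MvPolynomial (Fin 2) K) = C (3 * β) * (X 0 ^ 2 * X 1) := by
    rw [MvPolynomial.C_mul, e3]
    simp [pderiv_X]
    ring
  have e1 : pderiv 1 (C α * (X 0 ^ 0 * X 1 ^ 3) + C β * (X 0 ^ 3 * X 1 ^ 1) :
      MvPolynomial (Fin 2) K) = C (3 * α) * X 1 ^ 2 + C β * X 0 ^ 3 := by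
    rw [MvPolynomial.C_mul, e3]
    simp [pderiv_X]
    ring
  have hu : ∀ {c : K}, c ≠ 0 → IsUnit (C c : MvPolynomial (Fin 2) K) := fun hc =>
    (isUnit_iff_ne_zero.2 hc).map C
  rw [e0, e1]
  refine (isRelPrime_mul_unit_left_left (hu (mul_ne_zero h3 hβ))).2
    (IsRelPrime.mul_left (IsRelPrime.pow_left ?_) ?_)
  · refine ((X_prime (i := 0)).irreducible.isRelPrime_iff_not_dvd).2 fun hd => ?_
    have h5 : X 0 ∣ (C (3 * α) * X 1 ^ 2 : MvPolynomial (Fin 2) K) :=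
      (dvd_add_left (Dvd.dvd.mul_left (dvd_pow_self _ (by omega)) _)).1 hd
    have h6 := (X_prime (i := 0)).dvd_of_dvd_pow ((hu (mul_ne_zero h3 hα)).dvd_mul_left.1 h5)
    simp [X_dvd_X] at h6
  · refine ((X_prime (i := 1)).irreducible.isRelPrime_iff_not_dvd).2 fun hd => ?_
    have h5 : X 1 ∣ (C β * X 0 ^ 3 : MvPolynomial (Fin 2) K) :=
      (dvd_add_right (Dvd.dvd.mul_left (dvd_pow_self _ (by omega)) _)).1 hd
    have h6 := (X_prime (i := 1)).dvd_of_dvd_pow ((hu hβ).dvd_mul_left.1 h5)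
    simp [X_dvd_X] at h6

variable [IsAlgClosed K]

/-- Generators of the ring of invariants of a binary octahedral group. -/
theorem exists_kleinGenerators_octahedral (hN : ((48 : ℕ) : K) ≠ 0)
    (hΓ : IsBinaryPolyhedral Γ 2 3 4 48) :
    ∃ P x y z c, KleinGenerators Γ 8 12 18 P x y z c ∧ x ≠ 0 := by
  have hcard := hΓ.1
  have hΓ0 : (Nat.card Γ : K) ≠ 0 := by rwa [hcard]
  have h2 : (2 : K) ≠ 0 := by exact_mod_cast natCast_ne_zero_of_dvd (d := 2) hN (by norm_num)
  have h3 : (3 : K) ≠ 0 := by exact_mod_cast natCast_ne_zero_of_dvd (d := 3) hN (by norm_num)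
  obtain ⟨s, t, hst⟩ := exists_isBinaryPair h2 hΓ0 (by norm_num) (by norm_num) (by norm_num) hΓ
  have hall : ∀ (χ : Γ →* Kˣ) γ, χ γ ^ 2 = 1 := fun χ =>
    DFunLike.congr_fun (hst.pow_eq_one (by norm_num) χ)
  obtain ⟨u, ε, hu, hut⟩ := exists_eigenvector_units t
  obtain ⟨v, η, hv, hvs⟩ := exists_eigenvector_units s
  obtain ⟨w, ζ, hw, hwr⟩ := exists_eigenvector_units (s * t)
  have hε := orderOf_eq_of_mulVec_eq_smul hΓ0 hu hut
  have hη := orderOf_eq_of_mulVec_eq_smul hΓ0 hv hvs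
  have hζ := orderOf_eq_of_mulVec_eq_smul hΓ0 hw hwr
  obtain ⟨k, χ, φ, hφ, hk1, hk2, hk3, hk4, -⟩ :=
    hst.exists_isOrbitForm (by norm_num) h2 hcard hN hu hut
  obtain ⟨k', χ', x, hx, hk1', hk2', hk3', hk4', -⟩ :=
    hst.exists_isOrbitForm (by norm_num) h2 hcard hN hv hvs
  obtain ⟨k'', χ'', ψ, hψ, hk1'', hk2'', hk3'', hk4'', q, j, hqj, hq⟩ :=
    hst.exists_isOrbitForm (by norm_num) h2 hcard hN hw hwr
  have hr := hst.orderOf_mul h2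
  rw [hst.orderOf_right_four h2] at hε hk3
  rw [hst.orderOf_left h2] at hη hk3'
  rw [hr] at hζ hk3''
  obtain rfl : k = 6 := (by decide +kernel : ∀ k ∈ Nat.divisors 48, k ≠ 2 → 8 ∣ 48 / k →
    k * 2 ≡ 2 * 2 [MOD 48 / k] → k = 6) k hk2 hk1 hk3 hk4
  obtain rfl : k' = 8 := (by decide +kernel : ∀ k ∈ Nat.divisors 48, k ≠ 2 → 6 ∣ 48 / k →
    k * 2 ≡ 2 * 2 [MOD 48 / k] → k = 8) k' hk2' hk1' hk3' hk4'
  have hε4 : ε ^ 4 ≠ 1 := fun h0 => by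
    have := orderOf_dvd_of_pow_eq_one h0
    rw [hε] at this
    omega
  have hε8 : ε ^ 8 = 1 := hε ▸ pow_orderOf_eq_one ε
  have hζ2 : ζ ^ 2 ≠ 1 := fun h0 => by
    have := orderOf_dvd_of_pow_eq_one h0
    rw [hζ] at this
    omega
  have hζ4 : ζ ^ 4 = 1 := hζ ▸ pow_orderOf_eq_one ζ
  have hχt : χ t = ε ^ 4 := by
    have h1 := hφ.character_mul hut
    rw [show 6 = 4 + 2 by norm_num, pow_add] at h1
    exact mul_right_cancel h1
  have hχr : χ (s * t) ≠ 1 := by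
    rw [hst.character_mul, pow_succ, hall, one_mul, hχt]
    exact hε4
  -- The congruence also allows an orbit of length 6, with stabilizer generated by `q` of order 8.
  -- Then `s t = q ^ j` of order 4 has even `j`, so the quadratic character `χ` is trivial on it;
  -- but `χ (s t) = χ t = ε ^ 4 ≠ 1`.
  obtain rfl : k'' = 12 := by
    rcases (by decide +kernel : ∀ k ∈ Nat.divisors 48, k ≠ 2 → 4 ∣ 48 / k →
      k * 2 ≡ 2 * 2 [MOD 48 / k] → k = 12 ∨ k = 6) k'' hk2'' hk1'' hk3'' hk4'' with rfl | rfl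
    · rfl
    · exfalso
      have h1 := pow_orderOf_eq_one (s * t)
      rw [hr, hqj, ← pow_mul] at h1
      have h4 := orderOf_dvd_of_pow_eq_one h1
      rw [hq] at h4
      obtain ⟨i, hi⟩ : 2 ∣ j := by omega
      apply hχr
      rw [hqj, hi, mul_comm, pow_mul, map_pow, hall]
  have hφv := hφ.eval_ne_zero hx (Or.inl (by norm_num))
  have hφw := hφ.eval_ne_zero hψ (Or.inl (by norm_num))
  have hxu := hx.eval_ne_zero hφ (Or.inl (by norm_num))
  have hxw := hx.eval_ne_zero hψ (Or.inl (by norm_num))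
  have hψu := hψ.eval_ne_zero hφ (Or.inl (by norm_num))
  obtain rfl : χ' = 1 := hst.character_ext (by
    rw [hx.semi.character_eq hut hxu, hε8, MonoidHom.one_apply])
  obtain rfl : χ = χ'' := hst.character_ext (by
    rw [hψ.semi.character_eq hut hψu, hχt, show 12 = 8 + 4 by norm_num, pow_add, hε8, one_mul])
  have hχ2 : χ ^ 2 = 1 := by
    ext γ
    rw [MonoidHom.pow_apply, hall, MonoidHom.one_apply]
  have hχχ : χ * χ = 1 := by
    ext γ
    rw [MonoidHom.mul_apply, ← pow_two, hall, MonoidHom.one_apply]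
  obtain ⟨y, hy⟩ : ∃ y, y = φ ^ 2 := ⟨_, rfl⟩
  -- The forms `φ` and `ψ` share a quadratic character, so only `φ ^ 2` and `φ ψ` are invariant.
  obtain ⟨z, hz⟩ : ∃ z, z = φ * ψ := ⟨_, rfl⟩
  have hys : IsSemiinvariant (1 : Γ →* Kˣ) 12 y := by
    have h1 := hφ.semi.pow 2
    rwa [hχ2, ← hy] at h1
  have hzs : IsSemiinvariant (1 : Γ →* Kˣ) 18 z := by
    have h1 := hφ.semi.mul hψ.semi
    rwa [hχχ, ← hz] at h1
  have hyv : eval v y ≠ 0 := by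
    rw [hy, map_pow]
    exact pow_ne_zero _ hφv
  have hyw : eval w y ≠ 0 := by
    rw [hy, map_pow]
    exact pow_ne_zero _ hφw
  obtain ⟨α, β, hα, hβ, hrel⟩ : ∃ α β : K, α ≠ 0 ∧ β ≠ 0 ∧ ψ ^ 2 = C α * y ^ 2 + C β * x ^ 3 := by
    have hF : IsSemiinvariant (1 : Γ →* Kˣ) 24
        (C (eval w x ^ 3) * y ^ 2 - C (eval w y ^ 2) * x ^ 3) := by
      have h5 := (hys.pow 2).C_mul (eval w x ^ 3)
      have h3 := (hx.semi.pow 3).C_mul (eval w y ^ 2)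
      rw [one_pow_character] at h5 h3
      exact h5.sub h3
    have hFw : eval w (C (eval w x ^ 3) * y ^ 2 - C (eval w y ^ 2) * x ^ 3) = 0 := by
      simp only [map_sub, map_mul, eval_C, map_pow]
      ring
    have hdvd := hψ.sq_dvd hF hFw hwr (by
      rw [MonoidHom.one_apply, one_mul, show 24 = 4 * 6 by norm_num, pow_mul, hζ4, one_pow]
      exact hζ2)
    obtain ⟨c, hc⟩ := (hψ.semi.pow 2).eq_C_mul hF hdvd
    have hc0 : c ≠ 0 := by
      rintro rfl
      have h1 := congrArg (eval v) hc
      simp [hx.eval_self, hxw, hyv] at h1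
    have hcc : (C c⁻¹ * C c : MvPolynomial (Fin 2) K) = 1 := by
      rw [← MvPolynomial.C_mul, inv_mul_cancel₀ hc0, C_1]
    refine ⟨c⁻¹ * eval w x ^ 3, -(c⁻¹ * eval w y ^ 2),
      mul_ne_zero (inv_ne_zero hc0) (pow_ne_zero _ hxw),
      neg_ne_zero.2 (mul_ne_zero (inv_ne_zero hc0) (pow_ne_zero _ hyw)), ?_⟩
    rw [C_neg, MvPolynomial.C_mul, MvPolynomial.C_mul]
    linear_combination C c⁻¹ * (-hc) - ψ ^ 2 * hcc
  obtain ⟨c, hc0, hc⟩ : ∃ c : K, c ≠ 0 ∧ planeBracket x φ = C c * ψ := by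
    have hB := hx.semi.planeBracket hφ.semi
    have hBv := hx.planeBracket_ne_zero hφ.semi.isHomogeneous
      (natCast_ne_zero_of_dvd hN (by norm_num)) hφv
    -- The bracket of `x` and `φ` has the degree 12 and the character of `ψ`. Not vanishing at `w`
    -- would give `χ (s t) = ζ ^ 12 = 1`.
    obtain ⟨c, hc⟩ := hψ.semi.eq_C_mul hB (hψ.dvd hB (by
      by_contra h0
      have h1 := hB.character_eq hwr h0
      rw [MonoidHom.mul_apply, MonoidHom.one_apply, one_mul,
        show 8 - 1 + (6 - 1) = 4 * 3 by norm_num, pow_mul, hζ4, one_pow] at h1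
      exact hχr h1))
    refine ⟨c, ?_, hc⟩
    rintro rfl
    rw [hc] at hBv
    simp at hBv
  have hc' : planeBracket x y = C (2 * c) * z := by
    rw [hy, pow_two, planeBracket_mul, hc, hz, MvPolynomial.C_mul, map_ofNat]
    ring
  have hmem : C α * (X 0 ^ 0 * X 1 ^ 3) + C β * (X 0 ^ 3 * X 1 ^ 1) ∈
      planeGrading K 8 12 (2 * (18 : ℕ)) :=
    add_mem (monomial_mem_planeGrading _ (by norm_num)) (monomial_mem_planeGrading _ (by norm_num))
  have hsq : z ^ 2 = aeval ![x, y] (C α * (X 0 ^ 0 * X 1 ^ 3) + C β * (X 0 ^ 3 * X 1 ^ 1)) := by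
    rw [hz, mul_pow, ← hy, hrel]
    simp
    ring
  refine ⟨_, x, y, z, _, ⟨⟨by norm_num, by norm_num, by norm_num, hmem,
    isRelPrime_pderiv_cubic h3 hα hβ⟩,
    hx.semi.mem_invariants, hys.mem_invariants, hzs.mem_invariants,
    hx.semi.isHomogeneous, hys.isHomogeneous, hzs.isHomogeneous, hsq, hc', mul_ne_zero h2 hc0,
    ⟨v, hx.eval_self, hyv⟩, ?_⟩, hx.ne_zero⟩
  refine mem_kleinSpan_of_step (by norm_num) (by norm_num) (by norm_num) hmem hsq hx.semi hys
    hzs fun m f hf => ?_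
  by_cases hfv : eval v f = 0
  · exact Or.inl (hx.dvd hf hfv)
  by_cases hfu : eval u f = 0
  · by_cases hfw : eval w f = 0
    · refine Or.inr (Or.inr (Or.inl ?_))
      rw [hz]
      exact hφ.mul_dvd hψ hφw hf hfu hfw
    · refine Or.inr (Or.inl ?_)
      rw [hy]
      -- A simple zero at `u` would require `m ≡ 2` modulo 8, while `f (w) ≠ 0` gives `4 ∣ m`.
      refine hφ.sq_dvd hf hfu hut fun h0 => ?_
      have h4 := orderOf_dvd_of_pow_eq_one (hf.character_eq hwr hfw).symm
      rw [hζ] at h4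
      rw [MonoidHom.one_apply, one_mul] at h0
      have h5 := pow_eq_pow_iff_modEq.1 h0
      rw [hε, Nat.ModEq] at h5
      omega
  refine Or.inr (Or.inr (Or.inr ?_))
  have h8 := orderOf_dvd_of_pow_eq_one (hf.character_eq hut hfu).symm
  have h6 := orderOf_dvd_of_pow_eq_one (hf.character_eq hvs hfv).symm
  rw [hε] at h8
  rw [hη] at h6
  obtain ⟨d, hd, hd'⟩ := exists_dvd_sub (j := 2 * (m / 24)) hx hf hys hyv (by omega)
  refine ⟨_, Submodule.smul_mem _ d ?_, hd, hd'⟩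
  have h1 := pow_mem_kleinSpan hmem hsq right_mem_kleinSpan (2 * (m / 24))
  rwa [show 12 * (2 * (m / 24)) = m by omega] at h1

/-- Generators of the ring of invariants of a binary tetrahedral group. -/
theorem exists_kleinGenerators_tetrahedral (hN : ((24 : ℕ) : K) ≠ 0)
    (hΓ : IsBinaryPolyhedral Γ 2 3 3 24) :
    ∃ P x y z c, KleinGenerators Γ 6 8 12 P x y z c ∧ x ≠ 0 := by
  have hcard := hΓ.1
  have hΓ0 : (Nat.card Γ : K) ≠ 0 := by rwa [hcard]
  have h2 : (2 : K) ≠ 0 := by exact_mod_cast natCast_ne_zero_of_dvd (d := 2) hN (by norm_num)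
  have h3 : (3 : K) ≠ 0 := by exact_mod_cast natCast_ne_zero_of_dvd (d := 3) hN (by norm_num)
  obtain ⟨s, t, hst⟩ := exists_isBinaryPair h2 hΓ0 (by norm_num) (by norm_num) (by norm_num) hΓ
  have hall : ∀ (χ : Γ →* Kˣ) γ, χ γ ^ 3 = 1 := fun χ =>
    DFunLike.congr_fun (hst.pow_eq_one (by norm_num) χ)
  -- The two eigenlines of `t` lie in different orbits: their forms have characters with the values
  -- `ε ^ 2` and `ε ^ (-2)` at `t`.
  obtain ⟨u, u', ε, hu, hu', hut, hut'⟩ := exists_eigenvectors hΓ0 t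
  obtain ⟨w, ζ, hw, hwr⟩ := exists_eigenvector_units (s * t)
  have hε := orderOf_eq_of_mulVec_eq_smul hΓ0 hu hut
  have hζ := orderOf_eq_of_mulVec_eq_smul hΓ0 hw hwr
  obtain ⟨k, χ, φ, hφ, hk1, hk2, hk3, hk4, -⟩ :=
    hst.exists_isOrbitForm (by norm_num) h2 hcard hN hu hut
  obtain ⟨k', χ', φ', hφ', hk1', hk2', hk3', hk4', -⟩ :=
    hst.exists_isOrbitForm (by norm_num) h2 hcard hN hu' hut'
  obtain ⟨k'', χ'', x, hx, hk1'', hk2'', hk3'', hk4'', -⟩ :=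
    hst.exists_isOrbitForm (by norm_num) h2 hcard hN hw hwr
  rw [hst.orderOf_right h2 Nat.prime_three] at hε hk3 hk3'
  rw [hst.orderOf_mul h2] at hζ hk3''
  have hdec : ∀ k ∈ Nat.divisors 24, k ≠ 2 → 2 * 3 ∣ 24 / k →
    k * 3 ≡ 2 * 3 [MOD 24 / k] → k = 4 := by decide +kernel
  obtain rfl := hdec k hk2 hk1 hk3 hk4
  obtain rfl := hdec k' hk2' hk1' hk3' hk4'
  obtain rfl : k'' = 6 := (by decide +kernel : ∀ k ∈ Nat.divisors 24, k ≠ 2 → 4 ∣ 24 / k →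
    k * 3 ≡ 2 * 3 [MOD 24 / k] → k = 6) k'' hk2'' hk1'' hk3'' hk4''
  have hεne : ∀ {j}, ¬ 6 ∣ j → ε ^ j ≠ 1 := fun hj h0 => by
    have := orderOf_dvd_of_pow_eq_one h0
    rw [hε] at this
    exact hj this
  have hε6 : ε ^ 6 = 1 := orderOf_dvd_iff_pow_eq_one.1 (by rw [hε])
  have hζ2 : ζ ^ 2 ≠ 1 := fun h0 => by
    have := orderOf_dvd_of_pow_eq_one h0
    rw [hζ] at this
    omega
  have hζ4 : ζ ^ 4 = 1 := hζ ▸ pow_orderOf_eq_one ζ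
  have hχt : χ t = ε ^ 2 := by
    have h1 := hφ.character_mul hut
    rw [show 4 = 2 + 2 by norm_num, pow_add] at h1
    exact mul_right_cancel h1
  have hχt' : χ' t = ε⁻¹ ^ 2 := by
    have h1 := hφ'.character_mul hut'
    rw [show 4 = 2 + 2 by norm_num, pow_add] at h1
    exact mul_right_cancel h1
  have hχχ' : χ ≠ χ' := by
    rintro rfl
    rw [hχt, inv_pow, eq_inv_iff_mul_eq_one, ← pow_add] at hχt'
    exact hεne (by norm_num) hχt'
  have hφu' := hφ.eval_ne_zero hφ' (Or.inr hχχ')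
  have hφu := hφ'.eval_ne_zero hφ (Or.inr hχχ'.symm)
  have hφw := hφ.eval_ne_zero hx (Or.inl (by norm_num))
  have hφw' := hφ'.eval_ne_zero hx (Or.inl (by norm_num))
  have hxu := hx.eval_ne_zero hφ (Or.inl (by norm_num))
  obtain rfl : χ'' = 1 := hst.character_ext (by
    rw [hx.semi.character_eq hut hxu, hε6, MonoidHom.one_apply])
  have hmul : χ * χ' = 1 := hst.character_ext (by
    rw [MonoidHom.mul_apply, hχt, hχt', inv_pow, mul_inv_cancel, MonoidHom.one_apply])
  have hcube : ∀ χ : Γ →* Kˣ, χ ^ 3 = 1 := fun χ => by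
    ext γ
    rw [MonoidHom.pow_apply, hall, MonoidHom.one_apply]
  obtain ⟨y, hy⟩ : ∃ y, y = φ * φ' := ⟨_, rfl⟩
  have hys : IsSemiinvariant (1 : Γ →* Kˣ) 8 y := by
    have h1 := hφ.semi.mul hφ'.semi
    rwa [hmul, ← hy] at h1
  have hWs : IsSemiinvariant (1 : Γ →* Kˣ) 12 (φ ^ 3) := by
    have h1 := hφ.semi.pow 3
    rwa [hcube] at h1
  have hWs' : IsSemiinvariant (1 : Γ →* Kˣ) 12 (φ' ^ 3) := by
    have h1 := hφ'.semi.pow 3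
    rwa [hcube] at h1
  have hxs : IsSemiinvariant (1 : Γ →* Kˣ) 12 (x ^ 2) := by
    have h1 := hx.semi.pow 2
    rwa [one_pow_character] at h1
  obtain ⟨c₁, c₂, hc₁, hc₂, hrel⟩ : ∃ c₁ c₂ : K, c₁ ≠ 0 ∧ c₂ ≠ 0 ∧
      φ' ^ 3 = C c₁ * φ ^ 3 + C c₂ * x ^ 2 := by
    have hF := hWs'.sub (hWs.C_mul ((eval w φ' / eval w φ) ^ 3))
    have hFw : eval w (φ' ^ 3 - C ((eval w φ' / eval w φ) ^ 3) * φ ^ 3) = 0 := by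
      rw [map_sub, map_mul, eval_C, map_pow, map_pow, ← mul_pow, div_mul_cancel₀ _ hφw, sub_self]
    have hdvd := hx.sq_dvd hF hFw hwr (by
      rw [MonoidHom.one_apply, one_mul, show 12 = 4 * 3 by norm_num, pow_mul, hζ4, one_pow]
      exact hζ2)
    obtain ⟨c, hc⟩ := hxs.eq_C_mul hF hdvd
    refine ⟨_, c, pow_ne_zero 3 (div_ne_zero hφw' hφw), ?_, by linear_combination hc⟩
    rintro rfl
    have h1 := congrArg (eval u) hc
    simp [hφ.eval_self, hφu] at h1
  -- With `y = φ φ'` the relation gives `y ^ 3 = c₁ φ ^ 6 + c₂ φ ^ 3 x ^ 2`. Completing the square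
  -- in `φ ^ 3` yields `z = φ ^ 3 + κ x ^ 2` and `z ^ 2 = κ ^ 2 x ^ 4 + c₁⁻¹ y ^ 3`.
  obtain ⟨κ, hκ⟩ : ∃ κ, κ = c₂ / (2 * c₁) := ⟨_, rfl⟩
  have hκ0 : κ ≠ 0 := by
    rw [hκ]
    exact div_ne_zero hc₂ (mul_ne_zero h2 hc₁)
  have hκc : (2 * C c₁ * C κ : MvPolynomial (Fin 2) K) = C c₂ := by
    rw [← map_ofNat (C (σ := Fin 2) (R := K)) 2, ← MvPolynomial.C_mul, ← MvPolynomial.C_mul, hκ,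
      mul_div_cancel₀ _ (mul_ne_zero h2 hc₁)]
  obtain ⟨z, hz⟩ : ∃ z, z = φ ^ 3 + C κ * x ^ 2 := ⟨_, rfl⟩
  have hzs : IsSemiinvariant (1 : Γ →* Kˣ) 12 z := hz ▸ hWs.add (hxs.C_mul κ)
  -- The bracket has degree 8 and the value `ε ^ 2` of its character at `t`. On the other eigenline,
  -- with eigenvalue `ε⁻¹`, this excludes a nonzero value and a simple zero, so `φ' ^ 2` divides it.
  obtain ⟨e, he0, he⟩ : ∃ e : K, e ≠ 0 ∧ planeBracket x φ = C e * φ' ^ 2 := by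
    have hB := hx.semi.planeBracket hφ.semi
    have hBw := hx.planeBracket_ne_zero hφ.semi.isHomogeneous
      (natCast_ne_zero_of_dvd hN (by norm_num)) hφw
    have hBt : ((1 : Γ →* Kˣ) * χ) t = ε ^ 2 := by
      rw [MonoidHom.mul_apply, MonoidHom.one_apply, one_mul, hχt]
    have hB0 : eval u' (planeBracket x φ) = 0 := by
      by_contra h0
      have h1 := hB.character_eq hut' h0
      rw [hBt, inv_pow, eq_inv_iff_mul_eq_one, ← pow_add] at h1
      exact hεne (by norm_num) h1
    obtain ⟨e, he⟩ := (hφ'.semi.pow 2).eq_C_mul hB (hφ'.sq_dvd hB hB0 hut' (by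
      rw [hBt, inv_pow, mul_inv_cancel, inv_pow]
      exact fun h0 => hεne (by norm_num) (inv_eq_one.1 h0.symm)))
    refine ⟨e, ?_, he⟩
    rintro rfl
    rw [he] at hBw
    simp at hBw
  obtain ⟨e', he'⟩ : ∃ e' : K, planeBracket x φ' = C e' * φ ^ 2 := by
    have hB := hx.semi.planeBracket hφ'.semi
    have hBt : ((1 : Γ →* Kˣ) * χ') t = ε⁻¹ ^ 2 := by
      rw [MonoidHom.mul_apply, MonoidHom.one_apply, one_mul, hχt']
    have hB0 : eval u (planeBracket x φ') = 0 := by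
      by_contra h0
      have h1 := hB.character_eq hut h0
      rw [hBt, inv_pow, inv_eq_iff_mul_eq_one, ← pow_add] at h1
      exact hεne (by norm_num) h1
    exact (hφ.semi.pow 2).eq_C_mul hB (hφ.sq_dvd hB hB0 hut (by
      rw [hBt, inv_pow, inv_mul_cancel]
      exact (hεne (by norm_num)).symm))
  -- Take the bracket of `x` with the relation between `φ' ^ 3`, `φ ^ 3` and `x ^ 2`.
  have hee : C e' = (C c₁ * C e : MvPolynomial (Fin 2) K) := by
    have h1 := congrArg (planeBracket x) hrel
    have h4 : planeBracket x (φ' ^ 3) = 3 * φ' ^ 2 * planeBracket x φ' := by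
      rw [pow_succ, pow_two, planeBracket_mul, planeBracket_mul]
      ring
    have h5 : planeBracket x (C c₁ * φ ^ 3 + C c₂ * x ^ 2) = C c₁ * (3 * φ ^ 2 * planeBracket x φ) := by
      simp only [planeBracket, map_add, pderiv_C_mul, pderiv_pow]
      push_cast
      ring
    rw [h4, h5, he, he'] at h1
    have h6 : (3 : MvPolynomial (Fin 2) K) ≠ 0 := by
      rw [← map_ofNat (C (σ := Fin 2) (R := K)) 3]
      exact C_ne_zero.2 h3
    refine mul_left_cancel₀ (mul_ne_zero h6 (pow_ne_zero 2
      (mul_ne_zero hφ.ne_zero hφ'.ne_zero))) ?_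
    linear_combination h1
  have hc' : planeBracket x y = C (2 * (c₁ * e)) * z := by
    rw [hy, planeBracket_mul, he, he', hz, hee]
    simp only [MvPolynomial.C_mul, map_ofNat]
    linear_combination C e * hrel - C e * x ^ 2 * hκc
  have hcc : (C c₁⁻¹ * C c₁ : MvPolynomial (Fin 2) K) = 1 := by
    rw [← MvPolynomial.C_mul, inv_mul_cancel₀ hc₁, C_1]
  have hmem : C (κ ^ 2) * (X 0 ^ 4 * X 1 ^ 0) + C c₁⁻¹ * (X 0 ^ 0 * X 1 ^ 3) ∈
      planeGrading K 6 8 (2 * (12 : ℕ)) :=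
    add_mem (monomial_mem_planeGrading _ (by norm_num)) (monomial_mem_planeGrading _ (by norm_num))
  have hsq : z ^ 2 =
      aeval ![x, y] (C (κ ^ 2) * (X 0 ^ 4 * X 1 ^ 0) + C c₁⁻¹ * (X 0 ^ 0 * X 1 ^ 3)) := by
    rw [hz, hy]
    simp only [map_add, map_mul, map_pow, aeval_X, algHom_C, algebraMap_eq]
    simp
    rw [mul_pow, hrel]
    linear_combination (-φ ^ 6 - 2 * C κ * φ ^ 3 * x ^ 2) * hcc + C c₁⁻¹ * φ ^ 3 * x ^ 2 * hκc
  refine ⟨_, x, y, z, _, ⟨⟨by norm_num, by norm_num, by norm_num, hmem,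
    isRelPrime_pderiv (mul_ne_zero (natCast_ne_zero_of_dvd hN (by norm_num)) (pow_ne_zero 2 hκ0))
      (mul_ne_zero (natCast_ne_zero_of_dvd hN (by norm_num)) (inv_ne_zero hc₁))⟩,
    hx.semi.mem_invariants, hys.mem_invariants, hzs.mem_invariants,
    hx.semi.isHomogeneous, hys.isHomogeneous, hzs.isHomogeneous, hsq, hc',
    mul_ne_zero h2 (mul_ne_zero hc₁ he0), ⟨w, hx.eval_self, ?_⟩, ?_⟩, hx.ne_zero⟩
  · rw [hy, map_mul]
    exact mul_ne_zero hφw hφw'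
  refine mem_kleinSpan_of_step (by norm_num) (by norm_num) (by norm_num) hmem hsq hx.semi hys
    hzs fun m f hf => ?_
  by_cases hfw : eval w f = 0
  · exact Or.inl (hx.dvd hf hfw)
  by_cases hfu : eval u f = 0 ∧ eval u' f = 0
  · refine Or.inr (Or.inl ?_)
    rw [hy]
    exact hφ.mul_dvd hφ' hφu' hf hfu.1 hfu.2
  refine Or.inr (Or.inr (Or.inr ?_))
  -- Not vanishing at one of `u`, `u'` gives `6 ∣ m`, and not vanishing at `w` gives `4 ∣ m`. So `12
  -- ∣ m`, and a power of `φ ^ 3 = z - κ x ^ 2` has the same degree as `f`.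
  have h6 : 6 ∣ m := by
    rw [not_and_or] at hfu
    rw [show 6 = 2 * 3 by norm_num, ← hε]
    refine orderOf_dvd_of_pow_eq_one ?_
    rcases hfu with h0 | h0
    · exact (hf.character_eq hut h0).symm
    · have h1 := hf.character_eq hut' h0
      rw [MonoidHom.one_apply, inv_pow] at h1
      exact inv_eq_one.1 h1.symm
  have h4 := orderOf_dvd_of_pow_eq_one (hf.character_eq hwr hfw).symm
  rw [hζ] at h4
  obtain ⟨d, hd, hd'⟩ := exists_dvd_sub (j := m / 12) hx hf hWs (by
    rw [map_pow]
    exact pow_ne_zero _ hφw) (by omega)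
  refine ⟨_, Submodule.smul_mem _ d ?_, hd, hd'⟩
  have hW : φ ^ 3 ∈ kleinSpan 6 8 12 x y z 12 := by
    have h1 := sub_mem (third_mem_kleinSpan (a := 6) (b := 8) (h := 12) (x := x) (y := y) (z := z))
      (Submodule.smul_mem _ κ (pow_mem_kleinSpan hmem hsq left_mem_kleinSpan 2))
    rwa [smul_eq_C_mul, show z - C κ * x ^ 2 = φ ^ 3 by rw [hz]; ring] at h1
  have h1 := pow_mem_kleinSpan hmem hsq hW (m / 12)
  rwa [show 12 * (m / 12) = m by omega] at h1

end Polyhedral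

/-! ### All types together. -/

section McKay

open Matrix

theorem IsBinaryPolyhedral.congr {G H : Type*} [Group G] [Group H] (e : G ≃* H) {l m n N : ℕ}
    (h : IsBinaryPolyhedral G l m n N) : IsBinaryPolyhedral H l m n N := by
  obtain ⟨hcard, r, s, t, hcl, hr, hs, ht⟩ := h
  refine ⟨by rw [← hcard, Nat.card_congr e.toEquiv], e r, e s, e t, ?_, ?_, ?_, ?_⟩
  · have h1 := (e : G →* H).map_closure {r, s, t}
    rw [hcl, Subgroup.map_top_of_surjective _ e.surjective] at h1
    rw [h1]
    congr 1
    simp [Set.image_insert_eq]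
  all_goals simp only [← map_mul, ← map_pow, hr, hs, ht]

theorem IsMcKayGroup.congr {G H : Type*} [Group G] [Group H] (e : G ≃* H) {T : ADEType}
    (h : IsMcKayGroup G T) : IsMcKayGroup H T := by
  cases T with
  | A r hr =>
    obtain ⟨h1, h2⟩ := h
    exact ⟨(MulEquiv.isCyclic e).1 h1, by rw [← h2, Nat.card_congr e.toEquiv]⟩
  | D r hr => exact IsBinaryPolyhedral.congr e h
  | E6 => exact IsBinaryPolyhedral.congr e h
  | E7 => exact IsBinaryPolyhedral.congr e h
  | E8 => exact IsBinaryPolyhedral.congr e h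

theorem slMap_injective (F K : Type*) [Field F] [Field K] [Algebra F K] :
    Function.Injective (slMap F K) := by
  intro g k h
  have h1 : ∀ i j, g.1 i j = k.1 i j := fun i j =>
    (algebraMap F K).injective (congrFun (congrFun (congrArg Subtype.val h) i) j)
  exact sl_ext (h1 0 0) (h1 0 1) (h1 1 0) (h1 1 1)

theorem natCast_ne_zero_of_lt {K : Type*} [Field K] {p : ℕ} [CharP K p] {m : ℕ} (h0 : 0 < m)
    (hm : m < p) : (m : K) ≠ 0 := by
  rw [Ne, CharP.cast_eq_zero_iff K p]
  exact Nat.not_dvd_of_pos_of_lt h0 hm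

/-- Generators of the ring of invariants of a finite group corresponding to the type `T`. -/
theorem IsMcKayGroup.exists_kleinGenerators {K : Type*} [Field K] [IsAlgClosed K] {p : ℕ}
    [CharP K p] {T : ADEType} (hT : T.coxeterNumber < p)
    {Γ : Subgroup (SpecialLinearGroup (Fin 2) K)} (hΓ : IsMcKayGroup Γ T) :
    (Nat.card Γ : K) ≠ 0 ∧ (2 : K) ≠ 0 ∧ ∃ P x y z c,
      KleinGenerators Γ T.degA T.degB T.coxeterNumber P x y z c ∧ x ≠ 0 := by
  have hlt : ∀ m : ℕ, 0 < m → m < p → (m : K) ≠ 0 := fun m => natCast_ne_zero_of_lt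
  have hmul : ∀ {i j : ℕ}, (i : K) ≠ 0 → (j : K) ≠ 0 → ((i * j : ℕ) : K) ≠ 0 := fun hi hj => by
    rw [Nat.cast_mul]
    exact mul_ne_zero hi hj
  have h2 : ((2 : ℕ) : K) ≠ 0 := by
    refine hlt 2 two_pos (lt_of_le_of_lt ?_ hT)
    have := T.coxeterNumber_add_two
    have := T.two_le_degA
    have := T.two_le_degB
    omega
  have h2' : (2 : K) ≠ 0 := by exact_mod_cast h2
  have h4 : ((4 : ℕ) : K) ≠ 0 := hmul (i := 2) (j := 2) h2 h2
  cases T with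
  | A r hr =>
    have hn : ((r + 1 : ℕ) : K) ≠ 0 := hlt _ (by omega) hT
    exact ⟨by rw [hΓ.2]; exact hn, h2',
      exists_kleinGenerators_cyclic hΓ.1 hΓ.2 (show 2 ≤ r + 1 by omega) hn h2'⟩
  | D r hr =>
    change 2 * (r - 1) < p at hT
    have hn : ((r - 2 : ℕ) : K) ≠ 0 := hlt _ (by omega) (by omega)
    refine ⟨by rw [hΓ.1]; exact hmul h4 hn, h2', ?_⟩
    have h1 := exists_kleinGenerators_dihedral (by omega) hn (hlt (r - 2 + 1) (by omega) (by omega))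
      h2' hΓ
    rwa [show r - 2 + 1 = r - 1 by omega] at h1
  | E6 =>
    change 12 < p at hT
    -- The order of the group may exceed `p`, but it is a product of factors below `p`.
    have hN : ((24 : ℕ) : K) ≠ 0 := hmul (i := 2) (j := 12) h2 (hlt 12 (by norm_num) hT)
    exact ⟨by rw [hΓ.1]; exact hN, h2', exists_kleinGenerators_tetrahedral hN hΓ⟩
  | E7 =>
    change 18 < p at hT
    have hN : ((48 : ℕ) : K) ≠ 0 := hmul (i := 4) (j := 12) h4 (hlt 12 (by norm_num) (by omega))
    exact ⟨by rw [hΓ.1]; exact hN, h2', exists_kleinGenerators_octahedral hN hΓ⟩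
  | E8 =>
    change 30 < p at hT
    have hN : ((120 : ℕ) : K) ≠ 0 := hmul (i := 4) (j := 30) h4 (hlt 30 (by norm_num) hT)
    exact ⟨by rw [hΓ.1]; exact hN, h2', exists_kleinGenerators_icosahedral hN hΓ⟩

end McKay

end KleinianHP

/-! ### The theorem. -/

open KleinianHP in
theorem theorem5p5 (p : ℕ) (hp : p.Prime) (F : Type*) [Field F] [CharP F p]
    (T : ADEType) (hT : T.coxeterNumber < p) :
    (∀ Q : MvPolynomial (Fin 3) F,
      MvPolynomial.IsWeightedHomogeneous T.weights Q (2 * T.coxeterNumber) →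
      IsIsolatedSingularity Q →
        HasKleinianHilbertSeries F
          (HP0Component F (surfaceBracket Q) (surfaceGrading Q T.weights)) T p hp.ne_zero) ∧
    (∀ Γ : Subgroup (Matrix.SpecialLinearGroup (Fin 2) F),
      IsMcKayGroup Γ T →
        HasKleinianHilbertSeries F
          (HP0Component F (invariantBracket Γ) (invariantGrading Γ)) T p hp.ne_zero) := by
  constructor
  · intro Q hQ hs
    have hh : 2 ≤ T.coxeterNumber := T.two_le_degA.trans T.degA_le
    have h2h : ((2 * T.coxeterNumber : ℕ) : F) ≠ 0 := by
      rw [Nat.cast_mul]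
      exact mul_ne_zero (natCast_ne_zero_of_lt (p := p) two_pos (lt_of_le_of_lt hh hT))
        (natCast_ne_zero_of_lt (p := p) (by omega) hT)
    obtain ⟨P, e, c, h⟩ := exists_isDoublePlane_surface (by exact_mod_cast h2h) T.coxeterNumber_add_two
      T.two_le_degA T.degA_le T.two_le_degB T.degB_le hQ hs
    exact h.hasKleinianHilbertSeries hp hT
  · intro Γ hΓ
    -- Eigenvectors and roots are available only over the algebraic closure. The type of the group
    -- is abstract and survives base change.
    have hK : CharP (AlgebraicClosure F) p := charP_of_injective_algebraMap
      (algebraMap F (AlgebraicClosure F)).injective p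
    have hΓ' : IsMcKayGroup (Γ.map (slMap F (AlgebraicClosure F))) T :=
      hΓ.congr (Γ.equivMapOfInjective _ (slMap_injective F (AlgebraicClosure F)))
    obtain ⟨hcard, h2, P, x, y, z, c, hk, hx⟩ := hΓ'.exists_kleinGenerators hT
    rw [← Nat.card_congr (Γ.equivMapOfInjective _
      (slMap_injective F (AlgebraicClosure F))).toEquiv] at hcard
    have hcard' : (Nat.card Γ : F) ≠ 0 := by
      intro h0
      apply hcard
      rw [← map_natCast (algebraMap F (AlgebraicClosure F)), h0, map_zero]
    have : Finite Γ := Nat.finite_of_card_ne_zero fun h0 => hcard' (by rw [h0, Nat.cast_zero])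
    obtain ⟨e, h⟩ := hk.exists_isDoublePlane h2 hx
    exact hasKleinianHilbertSeries_of_map (AlgebraicClosure F) Γ hcard'
      (h.hasKleinianHilbertSeries hp hT)
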